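/- Let $F$ be a non-archimedean local field with ring of integers $\mathcal O_F$, maximal ideal $\mathfrak p_F$ and residue field of odd order $q$. Let $E/F$ be a quadratic extension, with normalised valuation $v_E$, residue field $k_E$ and residue degree $f$; let $A=M_2(F)$, let $B$ be the quaternion division algebra over $F$ with reduced trace and norm $\mathrm{Trd},\mathrm{Nrd}$, and fix embeddings $j_A:E\to A$, $j_B:E\to B$ of $F$-algebras. Put $j=(j_A,j_B)$ and regard $E^\times$ as a subgroup of $\mathrm{GL}_2(F)\times B^\times$ via $j$. Let $\Omega$ be an algebraically closed field of characteristic $0$ (all representations and characters have coefficients in $\Omega$, characters of $E^\times$, $F^\times$ are smooth), and let $\psi:F\to\Omega^\times$ be a character that is trivial on $\mathfrak p_F$ but not on $\mathcal O_F$; put $\psi_E=\psi\circ\mathrm{tr}_{E/F}$. $\mathrm{Ind}$ denotes full smooth induction and $\check{\ }$ the contragredient. *Filtrations.* Let $\mathfrak P_A^n$ be the set of matrices mapping $\Lambda_i$ into $\Lambda_{i+n}$ for all $i$, where $\Lambda_i=\mathfrak p_E^i v$ ($0\ne v\in F^2$) is the $E^\times$-stable lattice chain in $F^2$; let $\mathfrak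 P_B^n=\{b: v_F(\mathrm{Nrd}\,b)\ge n\}$; let $U_A^n=1+\mathfrak P_A^n$, $U_B^n=1+\mathfrak P_B^n$, $U_E^n=1+\mathfrak p_E^n$ $(n\ge1)$. Let $s_A:A\to E$, $s_B:B\to E$ be the projections along the orthogonal complements of $E$ for the (reduced) trace pairings. For $m\ge1$ let $V^m=V^m_A\times V^m_B$, $W^m=W^m_A\times W^m_B$ with $V_A^m=s_A^{-1}(\mathfrak p_E^m)\cap\mathfrak P_A^{\lfloor (m+1)/2\rfloor}$, $W_A^m=s_A^{-1}(\mathfrak p_E^m)\cap\mathfrak P_A^{\lfloor m/2\rfloor+1}$, $V_B^m=s_B^{-1}(\mathfrak p_E^m)\cap\mathfrak P_B^{r}$, $W_B^m=s_B^{-1}(\mathfrak p_E^m)\cap\mathfrak P_B^{r'}$, where $(r,r')=(2\lfloor m/2\rfloor,m+1)$ if $E/F$ is unramified and $(r,r')=(\lfloor (m+1)/2\rfloor,\lfloor m/2\rfloor+1)$ if $E/F$ is ramified. Let $\mathcal K=E^\times(1+V^m)\subset \mathrm{GL}_2(F)\times B^\times$ and $\mathcal K^1=\{(g,b)\in\mathcal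 K:\det g=\mathrm{Nrd}\,b\}$. *Minimal elements.* $\alpha\in E^\times$ with $v_E(\alpha)=-m$ is minimal if $m$ is odd when $E/F$ is ramified, and if, when $E/F$ is unramified, for a uniformizer $\varpi$ of $F$ the element $\varpi^m\alpha$ generates $E/F$ and its minimal polynomial over $F$ is irreducible modulo $\mathfrak p_F$. Let $\mu_E\subset E^\times$, $\mu_F\subset F^\times$ be the groups of roots of unity of order prime to $q$. *The representation $\tau_\alpha$.* For $\alpha$ minimal of valuation $-m$, let $\tau_\alpha$ be the irreducible representation of $\mathcal K$ on which $F^\times U_E^1$ acts trivially, $1+w$ acts by the scalar $\psi_E(\alpha(s_A(w_A)-s_B(w_B)))$ for $w=(w_A,w_B)\in W^m$, and such that: if $E/F$ is ramified, $\beta\in E^\times$ acts by $(-1)^{v_E(\beta)}$; if $E/F$ is unramified, $\mathrm{tr}\,\tau_\alpha(\zeta)=-1$ for all $\zeta\in\mu_E\setminus\mu_F$. (These conditions characterise $\tau_\alpha$ up to isomorphism.) Let $\tau_\alpha^1=\tau_\alpha|_{\mathcal K^1}$. *The set $Y_\alpha$.* $Y_\alpha$ is the set of characters of $E^\times$ of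 the form $\chi'\cdot(\omega\circ N_{E/F})$, where $\omega$ is a character of $F^\times$ and $\chi'(1+x)=\psi_E(\alpha x)$ for all $x\in\mathfrak p_E^m$. *The representations $\pi_\chi$, $\pi'_\chi$.* First let $\chi_0$ be a character of $E^\times$ with $\chi_0(1+x)=\psi_E(\beta x)$ for $x\in\mathfrak p_E^{\lfloor m/2\rfloor+1}$, where $\beta$ is minimal of valuation $-m$, $m\ge 1$. Let $J_A=E^\times U_A^{\lfloor (m+1)/2\rfloor}$ and let $\Lambda_{\chi_0}$ be the representation of $J_A$ on which $1+x$ acts by the scalar $\psi(\mathrm{tr}(\beta x))$ for $x\in\mathfrak P_A^{\lfloor m/2\rfloor+1}$ and such that: for $m$ odd, it is a character that agrees with $\chi_0$ on $E^\times$; for $m$ even, it has dimension $q$, $F^\times U_E^1$ acts by $\chi_0$, and $\mathrm{tr}\,\Lambda_{\chi_0}(\zeta)=-\chi_0(\zeta)$ for $\zeta\in\mu_E\setminus\mu_F$. Let $J_B=E^\times U_B^{m}$ and $n=m+1$ if $E/F$ is unramified, $J_B=E^\times U_B^{(m+1)/2}$ and $n=(m+1)/2$ if $E/F$ is ramified,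 and let $\Lambda'_{\chi_0}$ be the representation of $J_B$ on which $1+x$ acts by the scalar $\psi(\mathrm{Trd}(\beta x))$ for $x\in\mathfrak P_B^{n}$ and such that: if $E/F$ is ramified or $m$ is even, it is a character that agrees with $e\mapsto(-1)^{f v_E(e)}\chi_0(e)$ on $E^\times$; if $E/F$ is unramified and $m$ is odd, it has dimension $q$, $F^\times U_E^1$ acts by $\chi_0$, and $\mathrm{tr}\,\Lambda'_{\chi_0}(\zeta)=-\chi_0(\zeta)$ for $\zeta\in\mu_E\setminus\mu_F$. For $\chi=\chi_0\cdot(\omega\circ N_{E/F})$ put $\pi_\chi=(\omega\circ\det)\otimes\mathrm{Ind}_{J_A}^{\mathrm{GL}_2(F)}\Lambda_{\chi_0}$ and $\pi'_\chi=(\omega\circ\mathrm{Nrd})\otimes\mathrm{Ind}_{J_B}^{B^\times}\Lambda'_{\chi_0}$. These depend, up to isomorphism, only on $\chi$, and they are defined for every $\chi\in Y_\alpha$. **Proposition.** Let $m\ge1$, let $\alpha\in E^\times$ be minimal of valuation $-m$, and let $\pi$ and $\pi'$ be smooth irreducible representations of $\mathrm{GL}_2(F)$ and $B^\times$. If there is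 $\chi\in Y_\alpha$ with $\pi\cong\pi_\chi$ and $\pi'\cong\check{\pi}'_\chi$, then $$\dim_\Omega\mathrm{Hom}_{\mathrm{GL}_2(F)\times B^\times}\bigl(\pi\otimes\pi',\ \mathrm{Ind}_{\mathcal K^1}^{\mathrm{GL}_2(F)\times B^\times}\tau^1_\alpha\bigr)=1 .$$ Otherwise this space of homomorphisms is zero. -/

import Mathlib

open Polynomial ValuativeRel
open scoped Topology WithZero TensorProduct

namespace TameTypes

/-! ### Quaternion division algebras, reduced trace and reduced norm -/

section Quaternion

variable (F B : Type*) [Field F] [DivisionRing B] [Algebra F B]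

/-- `B` is a (nonsplit) quaternion algebra over `F`: a central division algebra of dimension `4`. -/
class IsQuaternionDivision : Prop extends Algebra.IsCentral F B where
  finrank_eq : Module.finrank F B = 4

variable {B} in
/-- The reduced characteristic polynomial of an element `b` of a quaternion division algebra:
the minimal polynomial if it is quadratic, and `(X - a) ^ 2` if `b = a` lies in `F`. -/
noncomputable def redCharpoly (b : B) : F[X] :=
  minpoly F b ^ (2 / (minpoly F b).natDegree)

variable {B} in
/-- The reduced trace `Trd b`, where `X ^ 2 - Trd b * X + Nrd b` is the reduced characteristic
polynomial. -/
noncomputable def redTrace (b : B) : F := -(redCharpoly F b).coeff 1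

variable {B} in
/-- The reduced norm `Nrd b` as a function; see `redNorm` for the multiplicative map. -/
noncomputable def redNormFun (b : B) : F := (redCharpoly F b).coeff 0

variable {F B}

lemma mulLeft_trace_comm (x y : B) :
    LinearMap.trace F B (LinearMap.mulLeft F (x * y)) =
      LinearMap.trace F B (LinearMap.mulLeft F (y * x)) := by
  rw [LinearMap.mulLeft_mul, LinearMap.mulLeft_mul, ← Module.End.mul_eq_comp,
    LinearMap.trace_mul_comm, Module.End.mul_eq_comp]

lemma mulLeft_trace_add (x y : B) :
    LinearMap.trace F B (LinearMap.mulLeft F (x + y)) =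
      LinearMap.trace F B (LinearMap.mulLeft F x) +
        LinearMap.trace F B (LinearMap.mulLeft F y) := by
  rw [← map_add]; congr 1; ext z; simp [add_mul]

lemma mulLeft_trace_neg (x : B) :
    LinearMap.trace F B (LinearMap.mulLeft F (-x)) =
      -LinearMap.trace F B (LinearMap.mulLeft F x) := by
  rw [← map_neg]; congr 1; ext z; simp

lemma redCharpoly_algebraMap (a : F) : redCharpoly F (algebraMap F B a) = (X - C a) ^ 2 := by
  simp [redCharpoly, minpoly.eq_X_sub_C]

lemma redNorm_algebraMap (a : F) : redNormFun F (algebraMap F B a) = a ^ 2 := by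
  simp [redNormFun, redCharpoly_algebraMap, coeff_zero_eq_eval_zero]

lemma redTrace_algebraMap (a : F) : redTrace F (algebraMap F B a) = 2 * a := by
  have : ((X : F[X]) - C a) ^ 2 = X ^ 2 - C (2 * a) * X + C (a ^ 2) := by
    simp only [map_mul, map_pow, map_ofNat]; ring
  rw [redTrace, redCharpoly_algebraMap, this]
  rw [coeff_add, coeff_sub, coeff_C_mul, coeff_X_one, coeff_C_of_ne_zero one_ne_zero, coeff_X_pow]
  simp

variable [IsQuaternionDivision F B]

lemma finiteDimensional_of_isQuaternionDivision : FiniteDimensional F B :=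
  Module.finite_of_finrank_pos (by rw [IsQuaternionDivision.finrank_eq]; norm_num)

lemma natDegree_minpoly_eq_two (b : B) (hb : b ∉ Set.range (algebraMap F B)) :
    (minpoly F b).natDegree = 2 := by
  have : FiniteDimensional F B := finiteDimensional_of_isQuaternionDivision
  have hint : IsIntegral F b := IsIntegral.of_finite F b
  have : Fact (Irreducible (minpoly F b)) := ⟨minpoly.irreducible hint⟩
  let φ : AdjoinRoot (minpoly F b) →+* B :=
    Ideal.Quotient.lift _ (aeval b : F[X] →ₐ[F] B).toRingHom (by
      intro a ha
      obtain ⟨c, rfl⟩ := Ideal.mem_span_singleton.1 ha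
      simp [minpoly.aeval])
  let : Module (AdjoinRoot (minpoly F b)) B := Module.compHom B φ
  have hsm : ∀ (x : AdjoinRoot (minpoly F b)) (y : B), x • y = φ x * y := fun _ _ => rfl
  have hφF : ∀ a : F, φ (algebraMap F _ a) = algebraMap F B a := by
    intro a
    change φ (AdjoinRoot.mk _ (C a)) = _
    change Ideal.Quotient.lift _ _ _ (Ideal.Quotient.mk _ (C a)) = _
    rw [Ideal.Quotient.lift_mk]; simp
  have : IsScalarTower F (AdjoinRoot (minpoly F b)) B := ⟨fun a x y => by
    rw [hsm, hsm, Algebra.smul_def, map_mul, hφF, Algebra.smul_def, mul_assoc]⟩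
  have h1 := Module.finrank_mul_finrank F (AdjoinRoot (minpoly F b)) B
  have h2 : Module.finrank F (AdjoinRoot (minpoly F b)) = (minpoly F b).natDegree := by
    have := (AdjoinRoot.powerBasis (minpoly.ne_zero hint)).finrank
    simpa using this
  rw [h2, IsQuaternionDivision.finrank_eq (F := F) (B := B)] at h1
  have hd : (minpoly F b).natDegree ∣ 4 := ⟨_, h1.symm⟩
  have hne1 : (minpoly F b).natDegree ≠ 1 := fun h => hb (minpoly.natDegree_eq_one_iff.1 h)
  have hne4 : (minpoly F b).natDegree ≠ 4 := by
    intro h4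
    rw [h4] at h2
    let φl : AdjoinRoot (minpoly F b) →ₗ[F] B :=
      { toFun := φ, map_add' := map_add φ,
        map_smul' := fun a x => by
          simp only [Algebra.smul_def, map_mul, hφF, RingHom.id_apply] }
    have hinj : Function.Injective φl := φ.injective
    have : FiniteDimensional F (AdjoinRoot (minpoly F b)) :=
      Module.finite_of_finrank_pos (by rw [h2]; norm_num)
    have hsurj : Function.Surjective φl :=
      (LinearMap.injective_iff_surjective_of_finrank_eq_finrank
        (by rw [h2, IsQuaternionDivision.finrank_eq (F := F) (B := B)])).1 hinj
    have hcen : b ∈ Subalgebra.center F B := by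
      rw [Subalgebra.mem_center_iff]
      intro y
      obtain ⟨x, rfl⟩ := hsurj y
      obtain ⟨z, hz⟩ := hsurj b
      have hz' : φ z = b := hz
      change φ x * b = b * φ x
      have hcomm : φ x * φ z = φ z * φ x := by rw [← map_mul, mul_comm, map_mul]
      rw [hz'] at hcomm
      exact hcomm
    obtain ⟨a, ha⟩ := Algebra.IsCentral.out (K := F) (D := B) hcen
    exact hb ⟨a, ha⟩
  have hle := Nat.le_of_dvd (by norm_num) hd
  have : (minpoly F b).natDegree ≠ 0 := fun h => by simp [h] at hd
  have : (minpoly F b).natDegree ≠ 3 := fun h => by rw [h] at hd; norm_num at hd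
  omega

lemma mul_self_eq_redTrace_redNorm (b : B) :
    b * b = redTrace F b • b - algebraMap F B (redNormFun F b) := by
  have : FiniteDimensional F B := finiteDimensional_of_isQuaternionDivision
  by_cases hb : b ∈ Set.range (algebraMap F B)
  · obtain ⟨a, rfl⟩ := hb
    rw [redTrace_algebraMap, redNorm_algebraMap, Algebra.smul_def, ← map_mul, ← map_mul, ← map_sub]
    congr 1; ring
  · have h2 := natDegree_minpoly_eq_two b hb
    have hint : IsIntegral F b := IsIntegral.of_finite F b
    have h := minpoly.aeval F b
    have hm := (minpoly.monic hint).coeff_natDegree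
    rw [h2] at hm
    rw [aeval_eq_sum_range, h2, Finset.sum_range_succ, Finset.sum_range_succ,
      Finset.sum_range_one, hm] at h
    have : redCharpoly F b = minpoly F b := by simp [redCharpoly, h2]
    rw [redTrace, redNormFun, this]
    simp only [pow_zero, pow_one, one_smul, pow_two, ← Algebra.algebraMap_eq_smul_one] at h
    rw [neg_smul]
    rw [eq_neg_of_add_eq_zero_right h]
    abel

lemma mulLeft_trace_algebraMap (a : F) :
    LinearMap.trace F B (LinearMap.mulLeft F (algebraMap F B a)) = 4 * a := by
  have : FiniteDimensional F B := finiteDimensional_of_isQuaternionDivision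
  have h : LinearMap.mulLeft F (algebraMap F B a) = a • (LinearMap.id : B →ₗ[F] B) := by
    ext x; simp [Algebra.smul_def]
  rw [h, map_smul, LinearMap.trace_id, IsQuaternionDivision.finrank_eq (F := F) (B := B)]
  simp [mul_comm]

lemma mulLeft_trace_eq [NeZero (2 : F)] (b : B) :
    LinearMap.trace F B (LinearMap.mulLeft F b) = 2 * redTrace F b := by
  have : FiniteDimensional F B := finiteDimensional_of_isQuaternionDivision
  have h2 : (2 : F) ≠ 0 := NeZero.ne 2
  by_cases hb : b ∈ Set.range (algebraMap F B)
  · obtain ⟨a, rfl⟩ := hb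
    rw [redTrace_algebraMap, mulLeft_trace_algebraMap]; ring
  · set s := redTrace F b with hs
    obtain ⟨b0, hb0⟩ : ∃ b0 : B, b0 = b - algebraMap F B (s / 2) := ⟨_, rfl⟩
    have hsq : ∃ d : F, b0 * b0 = algebraMap F B d := by
      refine ⟨s / 2 * (s / 2) - redNormFun F b, ?_⟩
      have h := mul_self_eq_redTrace_redNorm (F := F) b
      have hc : b * algebraMap F B (s / 2) = algebraMap F B (s / 2) * b :=
        (Algebra.commutes _ _).symm
      have e1 : algebraMap F B (s / 2) * b + algebraMap F B (s / 2) * b = s • b := by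
        rw [← add_mul, ← map_add, add_halves, Algebra.smul_def]
      rw [hb0, sub_mul, mul_sub, mul_sub, h, hc, map_sub, map_mul, ← hs, ← e1]
      abel
    obtain ⟨d, hd⟩ := hsq
    have hnc : ∃ y : B, b0 * y ≠ y * b0 := by
      by_contra! hcon
      have hcen : b0 ∈ Subalgebra.center F B :=
        Subalgebra.mem_center_iff.2 fun y => (hcon y).symm
      obtain ⟨a, ha⟩ := Algebra.IsCentral.out (K := F) (D := B) hcen
      refine hb ⟨a + s / 2, ?_⟩
      have ha' : algebraMap F B a = b0 := ha
      rw [map_add, ha', hb0]; abel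
    obtain ⟨y, hy⟩ := hnc
    obtain ⟨z, hz⟩ : ∃ z : B, z = b0 * y - y * b0 := ⟨_, rfl⟩
    have hz0 : z ≠ 0 := hz ▸ sub_ne_zero.2 hy
    have hanti : b0 * z = -(z * b0) := by
      rw [hz, mul_sub, sub_mul, ← mul_assoc, hd, mul_assoc y, hd, ← Algebra.commutes d y, mul_assoc]
      abel
    have ht0 : LinearMap.trace F B (LinearMap.mulLeft F b0) = 0 := by
      have h1 := mulLeft_trace_comm (F := F) z⁻¹ (b0 * z)
      rw [mul_assoc b0, mul_inv_cancel₀ hz0, mul_one, hanti, mul_neg, ← mul_assoc,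
        inv_mul_cancel₀ hz0, one_mul, mulLeft_trace_neg] at h1
      have : 2 * LinearMap.trace F B (LinearMap.mulLeft F b0) = 0 := by linear_combination -h1
      exact (mul_eq_zero.1 this).resolve_left h2
    have hb1 : b = b0 + algebraMap F B (s / 2) := by rw [hb0]; abel
    rw [hb1, mulLeft_trace_add, ht0, mulLeft_trace_algebraMap]
    linear_combination 2 * add_halves s

lemma redTrace_add [NeZero (2 : F)] (x y : B) :
    redTrace F (x + y) = redTrace F x + redTrace F y := by
  have h2 : (2 : F) ≠ 0 := NeZero.ne 2
  have h := mulLeft_trace_add (F := F) x y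
  rw [mulLeft_trace_eq, mulLeft_trace_eq, mulLeft_trace_eq, ← mul_add] at h
  exact mul_left_cancel₀ h2 h

lemma redTrace_mul_comm [NeZero (2 : F)] (x y : B) :
    redTrace F (x * y) = redTrace F (y * x) := by
  have h2 : (2 : F) ≠ 0 := NeZero.ne 2
  have h := mulLeft_trace_comm (F := F) x y
  rw [mulLeft_trace_eq, mulLeft_trace_eq] at h
  exact mul_left_cancel₀ h2 h

lemma redTrace_smul [NeZero (2 : F)] (a : F) (x : B) :
    redTrace F (a • x) = a * redTrace F x := by
  have h2 : (2 : F) ≠ 0 := NeZero.ne 2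
  have h : LinearMap.trace F B (LinearMap.mulLeft F (a • x)) =
      a * LinearMap.trace F B (LinearMap.mulLeft F x) := by
    rw [← smul_eq_mul, ← map_smul]; congr 1; ext z; simp
  rw [mulLeft_trace_eq, mulLeft_trace_eq] at h
  exact mul_left_cancel₀ h2 (by linear_combination h)

lemma polar_eq [NeZero (2 : F)] (x y : B) :
    x * y + y * x = redTrace F x • y + redTrace F y • x +
      algebraMap F B (redTrace F (x * y) - redTrace F x * redTrace F y) := by
  have h2 : (2 : F) ≠ 0 := NeZero.ne 2
  have hxy := mul_self_eq_redTrace_redNorm (F := F) (x + y)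
  have hx := mul_self_eq_redTrace_redNorm (F := F) x
  have hy := mul_self_eq_redTrace_redNorm (F := F) y
  set c : F := redNormFun F x + redNormFun F y - redNormFun F (x + y) with hc
  have h1 : x * y + y * x = redTrace F x • y + redTrace F y • x + algebraMap F B c := by
    have e : x * y + y * x = (x + y) * (x + y) - x * x - y * y := by noncomm_ring
    rw [e, hxy, hx, hy, redTrace_add, hc]
    simp only [map_add, map_sub, smul_add, add_smul]
    abel
  have h3 := congrArg (redTrace F) h1
  rw [redTrace_add, redTrace_add, redTrace_add, redTrace_smul, redTrace_smul,
    redTrace_algebraMap, redTrace_mul_comm y x] at h3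
  have hcc : c = redTrace F (x * y) - redTrace F x * redTrace F y :=
    mul_left_cancel₀ h2 (by linear_combination -h3)
  rw [h1, hcc]

lemma redNormFun_mul [NeZero (2 : F)] (x y : B) :
    redNormFun F (x * y) = redNormFun F x * redNormFun F y := by
  apply (algebraMap F B).injective
  have N : ∀ b : B, algebraMap F B (redNormFun F b) =
      b * (algebraMap F B (redTrace F b) - b) := by
    intro b
    rw [mul_sub, mul_self_eq_redTrace_redNorm (F := F) b, ← Algebra.commutes, Algebra.smul_def]
    abel
  have h := polar_eq (F := F) x y
  have hconj : algebraMap F B (redTrace F (x * y)) - x * y =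
      (algebraMap F B (redTrace F y) - y) * (algebraMap F B (redTrace F x) - x) := by
    have e : x * y = redTrace F x • y + redTrace F y • x +
      algebraMap F B (redTrace F (x * y) - redTrace F x * redTrace F y) - y * x := by
      rw [← h]; abel
    nth_rewrite 2 [e]
    rw [Algebra.smul_def, Algebra.smul_def, Algebra.commutes (redTrace F x) y, map_sub, map_mul,
      ← map_mul, mul_comm (redTrace F x), map_mul]
    noncomm_ring
  rw [N (x * y), hconj, map_mul, N x, mul_assoc, ← mul_assoc y, ← N y,
    Algebra.commutes (redNormFun F y), ← mul_assoc, ← N x]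

/-- The reduced norm `Nrd : B → F`, bundled as a multiplicative map. -/
noncomputable def redNorm (F B : Type*) [Field F] [DivisionRing B] [Algebra F B]
    [IsQuaternionDivision F B] [NeZero (2 : F)] : B →* F where
  toFun := redNormFun F
  map_one' := by simpa using redNorm_algebraMap (B := B) (1 : F)
  map_mul' := redNormFun_mul

end Quaternion

/-! ### Smooth representations -/

section Smooth

variable {Ω G : Type*} [Field Ω] [Group G] [TopologicalSpace G]

/-- A representation is smooth if the stabiliser of every vector is open (equivalently, is a
neighbourhood of `1`). -/
def IsSmooth {V : Type*} [AddCommGroup V] [Module Ω V] (π : Representation Ω G V) : Prop :=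
  ∀ v : V, ∀ᶠ g in 𝓝 (1 : G), π g v = v

/-- A character with values in `Ωˣ` is smooth if its kernel is open. -/
def IsSmoothChar (χ : G →* Ωˣ) : Prop := IsOpen (χ.ker : Set G)

/-- The twist `π ⊗ c` of a representation by a character. -/
noncomputable def twist {V : Type*} [AddCommGroup V] [Module Ω V] (c : G →* Ωˣ)
    (π : Representation Ω G V) : Representation Ω G V where
  toFun g := (c g : Ω) • π g
  map_one' := by simp
  map_mul' x y := by
    ext v
    simp [smul_smul, mul_comm]

variable [IsTopologicalGroup G]

lemma tendsto_conj_one (x : G) : Filter.Tendsto (fun u : G => x⁻¹ * u * x) (𝓝 1) (𝓝 1) := by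
  have h : Continuous fun u : G => x⁻¹ * u * x := by fun_prop
  simpa using h.tendsto 1

/-- The space of the (full) smoothly induced representation: functions `f : G → W` with
`f (h g) = σ h (f g)` for `h ∈ H`, invariant under right translation by an open neighbourhood
of `1`. -/
def indSpace {W : Type*} [AddCommGroup W] [Module Ω W] {H : Subgroup G}
    (σ : Representation Ω H W) : Submodule Ω (G → W) where
  carrier := {f | (∀ (h : H) (g : G), f (h * g) = σ h (f g)) ∧
    ∀ᶠ u in 𝓝 (1 : G), ∀ g : G, f (g * u) = f g}
  add_mem' := by
    rintro a b ⟨ha, ha'⟩ ⟨hb, hb'⟩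
    refine ⟨fun h g => by simp [ha, hb], ?_⟩
    filter_upwards [ha', hb'] with u h1 h2 g
    simp [h1, h2]
  zero_mem' := ⟨fun h g => by simp, by simp⟩
  smul_mem' := by
    rintro c a ⟨ha, ha'⟩
    refine ⟨fun h g => by simp [ha], ?_⟩
    filter_upwards [ha'] with u h1 g
    simp [h1]

/-- The smoothly induced representation `Ind_H^G σ`; the group acts by right translation. -/
def ind {W : Type*} [AddCommGroup W] [Module Ω W] {H : Subgroup G}
    (σ : Representation Ω H W) : Representation Ω G (indSpace σ) where
  toFun x :=
    { toFun := fun f => ⟨fun g => f.1 (g * x), fun h g => by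
        change f.1 (h * g * x) = σ h (f.1 (g * x))
        rw [mul_assoc, f.2.1], by
        filter_upwards [(tendsto_conj_one x).eventually f.2.2] with u hu g
        have := hu (g * x)
        rwa [← mul_assoc, ← mul_assoc, mul_inv_cancel_right] at this⟩
      map_add' := fun _ _ => rfl
      map_smul' := fun _ _ => rfl }
  map_one' := by
    ext f g
    simp
  map_mul' x y := by
    ext f g
    simp [mul_assoc]

/-- The space of smooth vectors in the linear dual of `π`. -/
def smoothDualSpace {V : Type*} [AddCommGroup V] [Module Ω V] (π : Representation Ω G V) :
    Submodule Ω (Module.Dual Ω V) where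
  carrier := {l | ∀ᶠ u in 𝓝 (1 : G), π.dual u l = l}
  add_mem' := by
    intro a b ha hb
    filter_upwards [ha, hb] with u h1 h2
    rw [map_add, h1, h2]
  zero_mem' := by simp
  smul_mem' := by
    intro c a ha
    filter_upwards [ha] with u h1
    rw [map_smul, h1]

/-- The contragredient (smooth dual) of a representation. -/
def contragredient {V : Type*} [AddCommGroup V] [Module Ω V] (π : Representation Ω G V) :
    Representation Ω G (smoothDualSpace π) where
  toFun x := (π.dual x).restrict (p := smoothDualSpace π) (q := smoothDualSpace π) (by
    intro l hl
    filter_upwards [(tendsto_conj_one x).eventually hl] with u hu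
    have h2 := congrArg (π.dual x) hu
    rwa [← Module.End.mul_apply, ← map_mul, ← mul_assoc, ← mul_assoc, mul_inv_cancel, one_mul,
      map_mul, Module.End.mul_apply] at h2)
  map_one' := by
    ext l : 2
    change π.dual 1 l.1 = l.1
    rw [map_one, Module.End.one_apply]
  map_mul' x y := by
    ext l : 2
    change π.dual (x * y) l.1 = π.dual x (π.dual y l.1)
    rw [map_mul, Module.End.mul_apply]

/-- The external tensor product of representations of `G` and `G'`. -/
noncomputable def extTensor {G' V V' : Type*} [Group G'] [AddCommGroup V] [Module Ω V]
    [AddCommGroup V'] [Module Ω V'] (π : Representation Ω G V) (π' : Representation Ω G' V') :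
    Representation Ω (G × G') (V ⊗[Ω] V') :=
  Representation.tprod (π.comp (MonoidHom.fst G G')) (π'.comp (MonoidHom.snd G G'))

end Smooth

/-! ### Valuations on local fields -/

section LocalField

variable (K : Type*) [Field K] [ValuativeRel K] [TopologicalSpace K] [IsNonarchimedeanLocalField K]

/-- The normalised multiplicative valuation of a local field, with values in `ℤᵐ⁰`; a uniformizer
has value `exp (-1)`. -/
noncomputable def val (x : K) : ℤᵐ⁰ :=
  IsNonarchimedeanLocalField.valueGroupWithZeroIsoInt K (valuation K x)

variable {K} in
/-- The normalised additive valuation `v_K : K → ℤ` (with the junk value `0` at `0`). -/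
noncomputable def ord (x : K) : ℤ := -(val K x).log

/-- The fractional ideal `𝔭_K ^ n`, for `n : ℤ`. -/
def pPow (n : ℤ) : Set K := {x | val K x ≤ WithZero.exp (-n)}

/-- The additive character `ψ` has level zero: trivial on `𝔭_K`, nontrivial on `𝒪_K`. -/
def IsLevelZero {Ω : Type*} [Field Ω] (ψ : AddChar K Ω) : Prop :=
  (∀ x ∈ pPow K 1, ψ x = 1) ∧ ∃ x ∈ pPow K 0, ψ x ≠ 1

/-- A local field of odd residual characteristic has characteristic different from `2`. -/
instance neZero_two [Fact (ringChar 𝓀[K] ≠ 2)] : NeZero (2 : K) where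
  out h := by
    have hc : ringChar 𝓀[K] ≠ 2 := Fact.out
    have h1 : (2 : 𝒪[K]) = 0 := Subtype.ext h
    have h2 : ((2 : ℕ) : 𝓀[K]) = 0 := by
      have h3 := congrArg (IsLocalRing.residue 𝒪[K]) h1
      rw [map_ofNat, map_zero] at h3
      exact_mod_cast h3
    exact hc (CharP.ringChar_of_prime_eq_zero Nat.prime_two h2)

end LocalField

/-! ### Quadratic extensions, minimal elements and characters -/

section Quadratic

variable (F : Type*) [Field F] [ValuativeRel F] [TopologicalSpace F] [IsNonarchimedeanLocalField F]
variable (E : Type*) [Field E] [ValuativeRel E] [TopologicalSpace E] [IsNonarchimedeanLocalField E]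
variable [Algebra F E]
variable {Ω : Type*} [Field Ω]

/-- `E / F` is unramified: uniformizers of `F` are uniformizers of `E`. -/
def Unramified : Prop := ∀ ϖ : F, ord ϖ = 1 → ord (algebraMap F E ϖ) = 1

variable {E} in
/-- `α` is a minimal element of valuation `-m`: if `E / F` is ramified then `m` is odd; if `E / F`
is unramified then `ϖ ^ m * α` generates `E / F` and its minimal polynomial over `F`, which has
coefficients in `𝒪_F`, is irreducible modulo `𝔭_F`. -/
structure IsMinimalElt (m : ℕ) (α : E) : Prop where
  val_eq : val E α = WithZero.exp (m : ℤ)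
  odd_of_ramified : ¬ Unramified F E → Odd m
  irreducible_of_unramified : Unramified F E → ∀ ϖ : F, ord ϖ = 1 →
    α ∉ Set.range (algebraMap F E) ∧
      Irreducible ((minpoly 𝒪[F] (ϖ ^ m • α)).map (IsLocalRing.residue 𝒪[F]))

/-- The norm `N_{E/F} : Eˣ → Fˣ`. -/
noncomputable def normUnits : Eˣ →* Fˣ := Units.map (Algebra.norm F)

variable {F E} in
/-- `χ (1 + x) = ψ_E (α x)` for all `x ∈ 𝔭_E ^ n`, where `ψ_E = ψ ∘ tr_{E/F}` and `n ≥ 1`. -/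
def GivenByOn (ψ : AddChar F Ω) (α : E) (n : ℕ) (χ : Eˣ →* Ωˣ) : Prop :=
  ∀ u : Eˣ, (u : E) - 1 ∈ pPow E n → (χ u : Ω) = ψ (Algebra.trace F E (α * ((u : E) - 1)))

variable {F E} in
/-- The set `Y_α` of characters of `Eˣ` of the form `χ' * (ω ∘ N_{E/F})` with
`χ' (1 + x) = ψ_E (α x)` for `x ∈ 𝔭_E ^ m`; here `m = - v_E(α)`. -/
def charsY (ψ : AddChar F Ω) (m : ℕ) (α : E) : Set (Eˣ →* Ωˣ) :=
  {χ | ∃ (χ' : Eˣ →* Ωˣ) (ω : Fˣ →* Ωˣ), IsSmoothChar χ' ∧ IsSmoothChar ω ∧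
    GivenByOn ψ α m χ' ∧ χ = χ' * ω.comp (normUnits F E)}

end Quadratic

/-! ### Orders, filtrations and the groups `𝒦`, `J_A`, `J_B` -/

section Groups

variable {F : Type*} [Field F] [ValuativeRel F] [TopologicalSpace F] [IsNonarchimedeanLocalField F]
variable {E : Type*} [Field E] [ValuativeRel E] [TopologicalSpace E] [IsNonarchimedeanLocalField E]
variable [Algebra F E]
variable {B : Type*} [DivisionRing B] [Algebra F B]

/-- For an embedding `j : E → R` and a trace form `T` on `R`, write `R = j(E) ⊕ C` with `C` the
orthogonal complement of `j(E)` under `(x, y) ↦ T (x y)`. This is the projection of `R` onto `E`: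
the unique `e` with `a - j e ∈ C`. -/
noncomputable def corestriction {R : Type*} [Ring R] [Algebra F R] (T : R → F) (j : E →ₐ[F] R)
    (a : R) : E :=
  Classical.epsilon fun e : E => ∀ x : E, T (j x * (a - j e)) = 0

/-- The tame corestriction `s_A : M₂(F) → E`. -/
noncomputable def sA (jA : E →ₐ[F] Matrix (Fin 2) (Fin 2) F) : Matrix (Fin 2) (Fin 2) F → E :=
  corestriction Matrix.trace jA

/-- The tame corestriction `s_B : B → E`. -/
noncomputable def sB (jB : E →ₐ[F] B) : B → E := corestriction (redTrace F) jB

/-- The lattice `𝔭_E ^ i · v` in `F²`. For `v ≠ 0` these form the lattice chain attached to the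
embedding of `E`; another choice of `v ≠ 0` only shifts the numbering. -/
def lattice (jA : E →ₐ[F] Matrix (Fin 2) (Fin 2) F) (v : Fin 2 → F) (i : ℤ) : Set (Fin 2 → F) :=
  {w | ∃ y ∈ pPow E i, w = (jA y).mulVec v}

/-- `𝔓_𝔄 ^ n`: the matrices that map `Λ_i` into `Λ_{i+n}` for all `i`; `𝔄` is the case `n = 0`. -/
def radA (jA : E →ₐ[F] Matrix (Fin 2) (Fin 2) F) (n : ℕ) : Set (Matrix (Fin 2) (Fin 2) F) :=
  {a | ∀ (v : Fin 2 → F) (i : ℤ), ∀ w ∈ lattice jA v i, a.mulVec w ∈ lattice jA v (i + n)}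

variable (F B) in
/-- `𝔓_B ^ n`: the elements `b` with `v_F (Nrd b) ≥ n`; `𝒪_B` is the case `n = 0`. -/
def radB (n : ℕ) : Set B := {b | redNormFun F b ∈ pPow F n}

/-- `V_A^m = s_A⁻¹(𝔭_E ^ m) ∩ 𝔓_𝔄 ^ ⌊(m+1)/2⌋`. -/
def VA (jA : E →ₐ[F] Matrix (Fin 2) (Fin 2) F) (m : ℕ) : Set (Matrix (Fin 2) (Fin 2) F) :=
  {a | sA jA a ∈ pPow E m ∧ a ∈ radA jA ((m + 1) / 2)}

/-- `W_A^m = s_A⁻¹(𝔭_E ^ m) ∩ 𝔓_𝔄 ^ (⌊m/2⌋ + 1)`. -/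
def WA (jA : E →ₐ[F] Matrix (Fin 2) (Fin 2) F) (m : ℕ) : Set (Matrix (Fin 2) (Fin 2) F) :=
  {a | sA jA a ∈ pPow E m ∧ a ∈ radA jA (m / 2 + 1)}

open Classical in
/-- `V_B^m = s_B⁻¹(𝔭_E ^ m) ∩ 𝔓_B ^ r` with `r = 2⌊m/2⌋` if `E / F` is unramified and
`r = ⌊(m+1)/2⌋` otherwise. -/
def VB (jB : E →ₐ[F] B) (m : ℕ) : Set B :=
  {b | sB jB b ∈ pPow E m ∧ b ∈ radB F B (if Unramified F E then 2 * (m / 2) else (m + 1) / 2)}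

open Classical in
/-- `W_B^m = s_B⁻¹(𝔭_E ^ m) ∩ 𝔓_B ^ r'` with `r' = m + 1` if `E / F` is unramified and
`r' = ⌊m/2⌋ + 1` otherwise. -/
def WB (jB : E →ₐ[F] B) (m : ℕ) : Set B :=
  {b | sB jB b ∈ pPow E m ∧ b ∈ radB F B (if Unramified F E then m + 1 else m / 2 + 1)}

/-- The diagonal embedding `j = (j_A, j_B)` of `Eˣ` in `GL₂(F) × Bˣ`. -/
def diag (jA : E →ₐ[F] Matrix (Fin 2) (Fin 2) F) (jB : E →ₐ[F] B) :
    Eˣ →* GL (Fin 2) F × Bˣ :=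
  (Units.map (jA : E →* Matrix (Fin 2) (Fin 2) F)).prod (Units.map (jB : E →* B))

/-- `𝒦 = Eˣ (1 + V^m)` with `V^m = V_A^m × V_B^m`, the subgroup of `GL₂(F) × Bˣ` generated by
the diagonal `Eˣ` and by `1 + V^m`. -/
def groupK (jA : E →ₐ[F] Matrix (Fin 2) (Fin 2) F) (jB : E →ₐ[F] B) (m : ℕ) :
    Subgroup (GL (Fin 2) F × Bˣ) :=
  (diag jA jB).range ⊔ Subgroup.closure
    {g | (g.1 : Matrix (Fin 2) (Fin 2) F) - 1 ∈ VA jA m ∧ (g.2 : B) - 1 ∈ VB jB m}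

variable (F B) in
/-- `δ (g, b) = det(g)⁻¹ Nrd(b)`. -/
noncomputable def delta [IsQuaternionDivision F B] [NeZero (2 : F)] :
    GL (Fin 2) F × Bˣ →* Fˣ where
  toFun g := (Matrix.GeneralLinearGroup.det g.1)⁻¹ * Units.map (redNorm F B) g.2
  map_one' := by simp
  map_mul' x y := by
    simp only [Prod.fst_mul, Prod.snd_mul, map_mul, mul_inv]
    exact mul_mul_mul_comm _ _ _ _

/-- `𝒦¹`, the kernel of `δ` on `𝒦`. -/
noncomputable def groupK1 [IsQuaternionDivision F B] [NeZero (2 : F)]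
    (jA : E →ₐ[F] Matrix (Fin 2) (Fin 2) F) (jB : E →ₐ[F] B) (m : ℕ) :
    Subgroup (GL (Fin 2) F × Bˣ) :=
  groupK jA jB m ⊓ (delta F B).ker

/-- `J_A = Eˣ U_𝔄 ^ ⌊(m+1)/2⌋`, where `U_𝔄 ^ n = 1 + 𝔓_𝔄 ^ n`. -/
def groupJA (jA : E →ₐ[F] Matrix (Fin 2) (Fin 2) F) (m : ℕ) : Subgroup (GL (Fin 2) F) :=
  (Units.map (jA : E →* Matrix (Fin 2) (Fin 2) F)).range ⊔ Subgroup.closure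
    {g : GL (Fin 2) F | (g : Matrix (Fin 2) (Fin 2) F) - 1 ∈ radA jA ((m + 1) / 2)}

open Classical in
/-- `J_B = Eˣ U_B ^ m` if `E / F` is unramified, `J_B = Eˣ U_B ^ ⌊(m+1)/2⌋` otherwise, where
`U_B ^ n = 1 + 𝔓_B ^ n`. -/
def groupJB (jB : E →ₐ[F] B) (m : ℕ) : Subgroup Bˣ :=
  (Units.map (jB : E →* B)).range ⊔ Subgroup.closure
    {b : Bˣ | (b : B) - 1 ∈ radB F B (if Unramified F E then m else (m + 1) / 2)}

end Groups

/-! ### The representations `τ_α`, `Λ_χ`, `Λ'_χ`, `π_χ` and `π'_χ` -/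

section Types

variable {F : Type*} [Field F] [ValuativeRel F] [TopologicalSpace F] [IsNonarchimedeanLocalField F]
variable {E : Type*} [Field E] [ValuativeRel E] [TopologicalSpace E] [IsNonarchimedeanLocalField E]
variable [Algebra F E]
variable {B : Type*} [DivisionRing B] [Algebra F B]
variable {Ω : Type*} [Field Ω]

variable (F E) in
/-- `ζ ∈ μ_E ∖ μ_F`, where `μ_E` is the group of roots of unity in `E` of order prime to the
residue characteristic, that is, of order dividing `|k_E| - 1`. -/
def IsRootOutside (ζ : Eˣ) : Prop :=
  ζ ^ (Nat.card 𝓀[E] - 1) = 1 ∧ (ζ : E) ∉ Set.range (algebraMap F E)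

/-- `τ` is the representation `τ_α` of `𝒦`: it is irreducible, it lies over the character `ψ_α` of
`Fˣ U_E^1 (1 + W^m)` (which is trivial on `Fˣ U_E^1` and is `1 + w ↦ ψ_E (α s(w))` on `1 + W^m`,
where `s (a, b) = s_A a - s_B b`), and
* if `E / F` is ramified, `β ∈ Eˣ` acts by `(-1) ^ v_E(β)`;
* if `E / F` is unramified, `ζ ∈ μ_E ∖ μ_F` has trace `-1`. -/
structure IsTau (jA : E →ₐ[F] Matrix (Fin 2) (Fin 2) F) (jB : E →ₐ[F] B) (ψ : AddChar F Ω)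
    (m : ℕ) (α : E) {W : Type*} [AddCommGroup W] [Module Ω W]
    (τ : Representation Ω (groupK jA jB m) W) : Prop where
  irreducible : τ.IsIrreducible
  scalar : ∀ (k : groupK jA jB m) (a : Fˣ),
    (k : GL (Fin 2) F × Bˣ) = diag jA jB (Units.map (algebraMap F E : F →* E) a) → τ k = 1
  oneUnit : ∀ (k : groupK jA jB m) (u : Eˣ), (u : E) - 1 ∈ pPow E 1 →
    (k : GL (Fin 2) F × Bˣ) = diag jA jB u → τ k = 1
  one_add : ∀ (k : groupK jA jB m) (a : Matrix (Fin 2) (Fin 2) F) (b : B),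
    a ∈ WA jA m → b ∈ WB jB m → (k.1.1 : Matrix (Fin 2) (Fin 2) F) = 1 + a →
    (k.1.2 : B) = 1 + b →
    τ k = ψ (Algebra.trace F E (α * (sA jA a - sB jB b))) • (1 : W →ₗ[Ω] W)
  ramified : ¬ Unramified F E → ∀ (k : groupK jA jB m) (β : Eˣ),
    (k : GL (Fin 2) F × Bˣ) = diag jA jB β →
    τ k = ((-1 : Ω) ^ ord (β : E)) • (1 : W →ₗ[Ω] W)
  unramified : Unramified F E → ∀ (k : groupK jA jB m) (ζ : Eˣ), IsRootOutside F E ζ →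
    (k : GL (Fin 2) F × Bˣ) = diag jA jB ζ → LinearMap.trace Ω W (τ k) = -1

/-- `Λ` is the representation `Λ_χ` of `J_A`, where `χ` has level `m` and
`χ (1 + x) = ψ_E (β x)` on `𝔭_E ^ (⌊m/2⌋ + 1)` with `β` minimal. It is given by
`1 + x ↦ ψ (tr (β x))` on `U_𝔄 ^ (⌊m/2⌋ + 1)`.
* If `m` is odd, it is a character that agrees with `χ` on `Eˣ`.
* If `m` is even, it has dimension `q`, agrees with `χ` on `Fˣ U_E^1`, and
  `tr Λ(ζ) = - χ(ζ)` for `ζ ∈ μ_E ∖ μ_F`. -/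
structure IsLambdaA (jA : E →ₐ[F] Matrix (Fin 2) (Fin 2) F) (ψ : AddChar F Ω) (m : ℕ) (β : E)
    (χ : Eˣ →* Ωˣ) {d : ℕ} (Λ : Representation Ω (groupJA jA m) (Fin d → Ω)) : Prop where
  one_add : ∀ (g : groupJA jA m) (x : Matrix (Fin 2) (Fin 2) F), x ∈ radA jA (m / 2 + 1) →
    (g.1 : Matrix (Fin 2) (Fin 2) F) = 1 + x → Λ g = ψ (Matrix.trace (jA β * x)) • 1
  odd : Odd m → d = 1 ∧ ∀ (g : groupJA jA m) (e : Eˣ),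
    (g.1 : Matrix (Fin 2) (Fin 2) F) = jA e → Λ g = (χ e : Ω) • 1
  even : Even m → d = Nat.card 𝓀[F] ∧
    (∀ (g : groupJA jA m) (e : Eˣ), (g.1 : Matrix (Fin 2) (Fin 2) F) = jA e →
      ((e : E) ∈ Set.range (algebraMap F E) ∨ (e : E) - 1 ∈ pPow E 1) →
      Λ g = (χ e : Ω) • 1) ∧
    ∀ (g : groupJA jA m) (ζ : Eˣ), IsRootOutside F E ζ →
      (g.1 : Matrix (Fin 2) (Fin 2) F) = jA ζ →
      LinearMap.trace Ω (Fin d → Ω) (Λ g) = -(χ ζ : Ω)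

open Classical in
/-- `Λ'` is the representation `Λ'_χ` of `J_B`, where `χ` has level `m` and
`χ (1 + x) = ψ_E (β x)` on `𝔭_E ^ (⌊m/2⌋ + 1)` with `β` minimal. It is given by
`1 + x ↦ ψ (Trd (β x))` on `U_B ^ (m + 1)` if `E / F` is unramified and on
`U_B ^ ((m + 1) / 2)` if `E / F` is ramified (and then `m` is odd).
* If `E / F` is ramified or `m` is even, it is a character that agrees with
  `e ↦ (-1) ^ (f v_E(e)) χ(e)` on `Eˣ`, with `f` the residue degree of `E / F`.
* If `E / F` is unramified and `m` is odd, it has dimension `q`, agrees with `χ` on `Fˣ U_E^1`,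
  and `tr Λ'(ζ) = - χ(ζ)` for `ζ ∈ μ_E ∖ μ_F`. -/
structure IsLambdaB (jB : E →ₐ[F] B) (ψ : AddChar F Ω) (m : ℕ) (β : E)
    (χ : Eˣ →* Ωˣ) {d : ℕ} (Λ : Representation Ω (groupJB jB m) (Fin d → Ω)) : Prop where
  one_add : ∀ (g : groupJB jB m) (x : B),
    x ∈ radB F B (if Unramified F E then m + 1 else (m + 1) / 2) →
    (g.1 : B) = 1 + x → Λ g = ψ (redTrace F (jB β * x)) • 1
  character : ¬ Unramified F E ∨ Even m → d = 1 ∧ ∀ (g : groupJB jB m) (e : Eˣ),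
    (g.1 : B) = jB e →
    Λ g = ((-1 : Ω) ^ ((if Unramified F E then 2 else 1) * ord (e : E)) * (χ e : Ω)) • 1
  odd : Unramified F E → Odd m → d = Nat.card 𝓀[F] ∧
    (∀ (g : groupJB jB m) (e : Eˣ), (g.1 : B) = jB e →
      ((e : E) ∈ Set.range (algebraMap F E) ∨ (e : E) - 1 ∈ pPow E 1) →
      Λ g = (χ e : Ω) • 1) ∧
    ∀ (g : groupJB jB m) (ζ : Eˣ), IsRootOutside F E ζ → (g.1 : B) = jB ζ →
      LinearMap.trace Ω (Fin d → Ω) (Λ g) = -(χ ζ : Ω)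

/-- `χ = χ₀ * (ω ∘ N_{E/F})`, where `χ₀` is a character of level `m` which is given by the minimal
element `β` of valuation `-m` on `U_E ^ (⌊m/2⌋ + 1)`. Every admissible character of essential level
`m ≥ 1` has such a presentation. -/
structure IsPresentation (ψ : AddChar F Ω) (m : ℕ) (β : E) (χ χ₀ : Eˣ →* Ωˣ) (ω : Fˣ →* Ωˣ) :
    Prop where
  smooth : IsSmoothChar χ₀
  smooth_twist : IsSmoothChar ω
  minimal : IsMinimalElt F m β
  given : GivenByOn ψ β (m / 2 + 1) χ₀
  eq : χ = χ₀ * ω.comp (normUnits F E)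

/-- `π ≅ π_χ`, where `π_χ` is the twist by `ω ∘ det` of `Ind_{J_A}^{GL₂(F)} Λ_{χ₀}` for
`χ = χ₀ * (ω ∘ N_{E/F})` (`χ` admissible of positive essential level). -/
def IsPi (jA : E →ₐ[F] Matrix (Fin 2) (Fin 2) F) (ψ : AddChar F Ω) (χ : Eˣ →* Ωˣ)
    {V : Type*} [AddCommGroup V] [Module Ω V] (π : Representation Ω (GL (Fin 2) F) V) : Prop :=
  ∃ (m : ℕ) (β : E) (χ₀ : Eˣ →* Ωˣ) (ω : Fˣ →* Ωˣ) (d : ℕ)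
    (Λ : Representation Ω (groupJA jA m) (Fin d → Ω)),
    1 ≤ m ∧ IsPresentation ψ m β χ χ₀ ω ∧ IsLambdaA jA ψ m β χ₀ Λ ∧
    Nonempty (π.Equiv (twist (ω.comp Matrix.GeneralLinearGroup.det) (ind Λ)))

/-- `π' ≅ π̌'_χ`, the contragredient of `π'_χ`, where `π'_χ` is the twist by `ω ∘ Nrd` of
`Ind_{J_B}^{Bˣ} Λ'_{χ₀}` for `χ = χ₀ * (ω ∘ N_{E/F})` (`χ` admissible of positive essential
level). -/
def IsPiPrimeDual [IsQuaternionDivision F B] [NeZero (2 : F)] [TopologicalSpace B]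
    [IsTopologicalRing B] (jB : E →ₐ[F] B) (ψ : AddChar F Ω) (χ : Eˣ →* Ωˣ)
    {V' : Type*} [AddCommGroup V'] [Module Ω V'] (π' : Representation Ω Bˣ V') : Prop :=
  ∃ (m : ℕ) (β : E) (χ₀ : Eˣ →* Ωˣ) (ω : Fˣ →* Ωˣ) (d : ℕ)
    (Λ : Representation Ω (groupJB jB m) (Fin d → Ω)),
    1 ≤ m ∧ IsPresentation ψ m β χ χ₀ ω ∧ IsLambdaB jB ψ m β χ₀ Λ ∧
    Nonempty (π'.Equiv (contragredient
      (twist (ω.comp (Units.map (redNorm F B))) (ind Λ))))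

/-- The restriction `τ¹` of a representation `τ` of `𝒦` to `𝒦¹`. -/
noncomputable def restrictK1 [IsQuaternionDivision F B] [NeZero (2 : F)]
    {jA : E →ₐ[F] Matrix (Fin 2) (Fin 2) F} {jB : E →ₐ[F] B} {m : ℕ}
    {W : Type*} [AddCommGroup W] [Module Ω W] (τ : Representation Ω (groupK jA jB m) W) :
    Representation Ω (groupK1 jA jB m) W :=
  τ.comp (Subgroup.inclusion inf_le_left)

end Types

end TameTypes

open TameTypes

/-!
Both algebras have the form `E ⊕ E c` with `c x = σ(x) c` for `x ∈ E` and `c ^ 2 = d ∈ F`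
(`QuatModel`, `exists_modelA`, `exists_modelB`), so `GL₂(F)` and `Bˣ` are treated by the same
arguments. On each side there is a pair of groups `H ◁ J`, where `H = U_E^1 (1 + W)`, `J = Eˣ U`, and `U`
is the congruence subgroup that has the depth of `V` along `E c`. The element `α` singles out the pure
characters of `H`: those that are `1 + w ↦ ψ_E (α s(w))` on `1 + W`.

*Types.* If `g` intertwines two pure characters for `α`, then by duality of lattices
(`exists_conj_of_tr`) it conjugates one element of the dual coset of `α` into another. Each element of
that coset is conjugate in `J` to an element of `E` near `α` (`exists_conj_into`), so `g` lies in `J`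
(`intertwine`). The same computation bounds the supports of functions in induced representations
(`exists_finite_support`). So pure characters, and their twists by characters `ω ∘ nrm`, are types
(`IsPure.isType`, `IsTwistedPure.isType`). For a type `Θ`, the smooth irreducible representations of `G`
in which `Θ` occurs are induced from their `Θ`-eigenspaces (`nonempty_equiv_ind`). An irreducible
representation contains at most one twist of a pure character for `α` (`IsTwistedPure.eq`).

*Reduction to eigenspaces.* By Frobenius reciprocity the homomorphisms in question are the linear maps
`φ : V ⊗ V' → W` that are equivariant for `𝒦¹` (`rank_eq_one_of_frobenius`,
`rank_eq_zero_of_frobenius`). Commutators in `H` have norm `1` and act trivially on `τ_α`. So a nonzero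
`φ` is nonzero on a tensor product of eigenvectors of the two groups `H`
(`IsSetting.exists_eigen_pair`). Comparing the action of pairs in `1 + W` that have equal norms, one sees
that the eigencharacters are `Ξ` and `Ξ'⁻¹`, where `Ξ` and `Ξ'` are twists of pure characters for `α` by
the same `ω` (`exists_isTwistedPure`). Hence `φ` is determined by its restriction to the two
eigenspaces. After twists by `ω⁻¹` and `ω` this restriction is equivariant for all of `𝒦`, because `𝒦` is
generated by `𝒦¹` and elements of `1 + W`, which act by the same scalars on both sides
(`IsTypePair.resEigen_map`). By Schur's lemma the tensor product of the twisted eigenspaces is then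
isomorphic to `τ_α`, and `φ` is unique up to scalars (`IsTypePair.of_ne_zero`). Conversely such an
isomorphism extends by zero to an equivariant `φ` (`IsTypePair.exists_ne_zero`).

*Comparison with `τ_α`.* At least one of the two groups `J` acts by scalars, because `H` and `U` agree up
to elements of `E` on that side (`bH_eq_or`). It follows that the tensor product has the properties of
`τ_α` exactly if the factors are given on `Eˣ` in the way prescribed for `Λ_χ` and for the
contragredient of `Λ'_χ`, with the same `χ` (`isTauModel_tensorK`, `exists_isLambda`). The properties
determine `τ_α`: in the unramified case it restricts to a Heisenberg representation of `1 + V`, and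
the traces of roots of unity fix the extension to `𝒦` (`exists_hom_of_isHeisenberg`).

*Presentations of `χ`.* A decomposition `χ = χ₀ (ω ∘ N)` is not unique. The values of `χ` on elements of
norm one determine the level of `χ₀` (`le_of_mul_comp_norm_eq`), and two decompositions lead to the same
twisted pure character (`IsPure.isTwistedPure`).
-/

namespace TameTypes

set_option linter.unusedSectionVars false

/-! ### Local fields -/

lemma hom_ne_zero {M K L : Type*} [GroupWithZero K] [MonoidWithZero L] [Nontrivial L] [FunLike M K L]
    [MonoidWithZeroHomClass M K L] {f : M} {x : K} (hx : x ≠ 0) : f x ≠ 0 :=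
  (_root_.map_ne_zero f).2 hx

section Local

variable {K : Type*} [Field K] [ValuativeRel K] [TopologicalSpace K] [IsNonarchimedeanLocalField K]

lemma val_mul (x y : K) : val K (x * y) = val K x * val K y := by simp [val]

lemma val_one : val K 1 = 1 := by simp [val]

lemma val_eq_zero {x : K} : val K x = 0 ↔ x = 0 := by simp [val]

lemma val_add_le (x y : K) : val K (x + y) ≤ max (val K x) (val K y) := by
  have h := (valuation K).map_add x y
  have hm := (IsNonarchimedeanLocalField.valueGroupWithZeroIsoInt K).strictMono.monotone
  have := hm h
  rwa [hm.map_max] at this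

lemma val_neg (x : K) : val K (-x) = val K x := by simp [val]

lemma val_le_one_iff {x : K} : val K x ≤ 1 ↔ x ∈ 𝒪[K] := by
  rw [Valuation.mem_integer_iff, val,
    ← map_one (IsNonarchimedeanLocalField.valueGroupWithZeroIsoInt K), OrderIsoClass.map_le_map_iff]

lemma val_eq_exp {x : K} (hx : x ≠ 0) : val K x = WithZero.exp (-ord x) := by
  rw [ord, neg_neg, WithZero.exp_log]
  exact fun h => hx (val_eq_zero.1 h)

lemma ord_eq_of_val {x : K} {n : ℤ} (h : val K x = WithZero.exp (-n)) : ord x = n := by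
  rw [ord, h, WithZero.log_exp, neg_neg]

lemma ne_zero_of_val_exp {x : K} {n : ℤ} (h : val K x = WithZero.exp n) : x ≠ 0 := by
  rintro rfl
  rw [val_eq_zero.2 rfl] at h
  exact WithZero.exp_ne_zero h.symm

lemma mem_pPow {x : K} (hx : x ≠ 0) {n : ℤ} : x ∈ pPow K n ↔ n ≤ ord x := by
  rw [pPow, Set.mem_ofPred_eq, val_eq_exp hx, WithZero.exp_le_exp]
  omega

lemma zero_mem_pPow (n : ℤ) : (0 : K) ∈ pPow K n := by
  rw [pPow, Set.mem_ofPred_eq, val_eq_zero.2 rfl]; exact zero_le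

lemma add_mem_pPow {x y : K} {n : ℤ} (hx : x ∈ pPow K n) (hy : y ∈ pPow K n) :
    x + y ∈ pPow K n := (val_add_le x y).trans (max_le hx hy)

lemma neg_mem_pPow {x : K} {n : ℤ} (hx : x ∈ pPow K n) : -x ∈ pPow K n := by
  rw [pPow, Set.mem_ofPred_eq, val_neg]; exact hx

lemma sub_mem_pPow {x y : K} {n : ℤ} (hx : x ∈ pPow K n) (hy : y ∈ pPow K n) :
    x - y ∈ pPow K n := by rw [sub_eq_add_neg]; exact add_mem_pPow hx (neg_mem_pPow hy)

lemma pPow_anti {a b : ℤ} (h : a ≤ b) {x : K} (hx : x ∈ pPow K b) : x ∈ pPow K a :=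
  le_trans (α := ℤᵐ⁰) hx (WithZero.exp_le_exp.2 (by omega))

lemma mul_mem_pPow {x y : K} {a b : ℤ} (hx : x ∈ pPow K a) (hy : y ∈ pPow K b) :
    x * y ∈ pPow K (a + b) := by
  rw [pPow, Set.mem_ofPred_eq, val_mul, neg_add, WithZero.exp_add]
  exact mul_le_mul' hx hy

lemma mem_pPow_of_eq {x : K} {a b : ℤ} (hx : x ∈ pPow K a) (h : a = b) : x ∈ pPow K b := h ▸ hx

lemma ord_mul {x y : K} (hx : x ≠ 0) (hy : y ≠ 0) : ord (x * y) = ord x + ord y := by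
  apply ord_eq_of_val
  rw [val_mul, val_eq_exp hx, val_eq_exp hy, ← WithZero.exp_add, neg_add]

lemma ord_one : ord (1 : K) = 0 := by simp [ord, val_one]

lemma ord_inv {x : K} (hx : x ≠ 0) : ord x⁻¹ = -ord x := by
  have := ord_mul hx (inv_ne_zero hx)
  rw [mul_inv_cancel₀ hx, ord_one] at this
  omega

lemma ord_div {x y : K} (hx : x ≠ 0) (hy : y ≠ 0) : ord (x / y) = ord x - ord y := by
  rw [div_eq_mul_inv, ord_mul hx (inv_ne_zero hy), ord_inv hy, sub_eq_add_neg]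

lemma ord_pow {x : K} (hx : x ≠ 0) (n : ℕ) : ord (x ^ n) = n * ord x := by
  induction n with
  | zero => simp [ord_one]
  | succ n ih => rw [pow_succ, ord_mul (pow_ne_zero n hx) hx, ih]; push_cast; ring

lemma ord_zpow {x : K} (hx : x ≠ 0) (n : ℤ) : ord (x ^ n) = n * ord x := by
  cases n with
  | ofNat n => simpa using ord_pow hx n
  | negSucc n =>
    rw [zpow_negSucc, ord_inv (pow_ne_zero _ hx), ord_pow hx, Int.negSucc_eq]; push_cast; ring

lemma exists_ord_eq (n : ℤ) : ∃ x : K, x ≠ 0 ∧ ord x = n := by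
  obtain ⟨g, hg⟩ := (IsNonarchimedeanLocalField.valueGroupWithZeroIsoInt K).surjective
    (WithZero.exp (-n))
  obtain ⟨x, rfl⟩ := valuation_surjective g
  exact ⟨x, ne_zero_of_val_exp (n := -n) hg, ord_eq_of_val hg⟩

lemma one_mem_pPow_zero : (1 : K) ∈ pPow K 0 := by simp [mem_pPow, ord_one]

lemma mem_pPow_self {x : K} : x ∈ pPow K (ord x) := by
  by_cases hx : x = 0
  · rw [hx]; exact zero_mem_pPow _
  · exact (mem_pPow hx).2 le_rfl

lemma inv_mem_pPow {x : K} (hx : x ≠ 0) : x⁻¹ ∈ pPow K (-ord x) := by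
  rw [← ord_inv hx]; exact mem_pPow_self

lemma eq_zero_of_forall_mem_pPow {x : K} (h : ∀ n, x ∈ pPow K n) : x = 0 := by
  by_contra hx
  have := (mem_pPow hx).1 (h (ord x + 1))
  omega

lemma ne_zero_and_ord_eq_zero {u : K} (h : u - 1 ∈ pPow K 1) : u ≠ 0 ∧ ord u = 0 := by
  have h0 : u ≠ 0 := by
    rintro rfl
    have := neg_mem_pPow h
    rw [zero_sub, neg_neg, mem_pPow one_ne_zero, ord_one] at this
    omega
  refine ⟨h0, le_antisymm ?_ ?_⟩
  · by_contra! hlt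
    have h1 : (1 : K) ∈ pPow K 1 := by
      have := sub_mem_pPow ((mem_pPow h0).2 (show (1 : ℤ) ≤ ord u by omega)) h
      rwa [sub_sub_cancel] at this
    rw [mem_pPow one_ne_zero, ord_one] at h1
    omega
  · rw [← mem_pPow h0]
    have := add_mem_pPow (pPow_anti (a := 0) (by omega) h) one_mem_pPow_zero
    rwa [sub_add_cancel] at this

lemma inv_sub_one_mem {u : K} {i : ℤ} (hi : 1 ≤ i) (h : u - 1 ∈ pPow K i) :
    u⁻¹ - 1 ∈ pPow K i := by
  obtain ⟨h0, ho⟩ := ne_zero_and_ord_eq_zero (pPow_anti hi h)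
  have : u⁻¹ - 1 = -(u⁻¹ * (u - 1)) := by field_simp; ring
  rw [this]
  refine neg_mem_pPow (mem_pPow_of_eq (mul_mem_pPow (inv_mem_pPow h0) h) (by omega))

lemma mul_sub_one_mem {u v : K} {i : ℤ} (hi : 0 ≤ i) (hu : u - 1 ∈ pPow K i)
    (hv : v - 1 ∈ pPow K i) : u * v - 1 ∈ pPow K i := by
  have : u * v - 1 = (u - 1) * (v - 1) + (u - 1) + (v - 1) := by ring
  rw [this]
  exact add_mem_pPow (add_mem_pPow (pPow_anti (by omega) (mul_mem_pPow hu hv)) hu) hv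

variable (K) in
lemma pPow_mem_nhds (n : ℤ) : pPow K n ∈ 𝓝 (0 : K) := by
  obtain ⟨x, hx, hn⟩ := exists_ord_eq (K := K) (n - 1)
  rw [(IsValuativeTopology.hasBasis_nhds_zero' K).mem_iff]
  refine ⟨valuation K x, by simpa [zero_lt_iff] using hx, fun y hy => ?_⟩
  by_cases hy0 : y = 0
  · rw [hy0]; exact zero_mem_pPow _
  have h1 : val K y < val K x :=
    (IsNonarchimedeanLocalField.valueGroupWithZeroIsoInt K).strictMono hy
  rw [val_eq_exp hx, val_eq_exp hy0, WithZero.exp_lt_exp] at h1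
  rw [mem_pPow hy0]; omega

lemma exists_pPow_subset {U : Set K} (hU : U ∈ 𝓝 (0 : K)) : ∃ n : ℤ, pPow K n ⊆ U := by
  obtain ⟨g, hg, hgU⟩ := (IsValuativeTopology.hasBasis_nhds_zero' K).mem_iff.1 hU
  obtain ⟨x, rfl⟩ := valuation_surjective g
  have hx : x ≠ 0 := by simpa using hg
  refine ⟨ord x + 1, fun y hy => hgU ?_⟩
  by_cases hy0 : y = 0
  · rw [hy0]; simpa [zero_lt_iff] using hx
  rw [mem_pPow hy0] at hy
  rw [Set.mem_ofPred_eq,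
    ← (IsNonarchimedeanLocalField.valueGroupWithZeroIsoInt K).strictMono.lt_iff_lt]
  change val K y < val K x
  rw [val_eq_exp hx, val_eq_exp hy0, WithZero.exp_lt_exp]; omega

variable (K) in
lemma isCompact_pPow (n : ℤ) : IsCompact (pPow K n) := by
  obtain ⟨x, hx, hn⟩ := exists_ord_eq (K := K) n
  convert IsNonarchimedeanLocalField.isCompact_closedBall K (valuation K x) using 1
  ext y
  simp only [Set.mem_ofPred_eq]
  rw [← (IsNonarchimedeanLocalField.valueGroupWithZeroIsoInt K).strictMono.le_iff_le]
  change _ ↔ val K y ≤ val K x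
  rw [val_eq_exp hx, hn]; rfl

/-- By compactness `𝔭 ^ a / 𝔭 ^ b` is finite. -/
lemma exists_finset_pPow (a b : ℤ) :
    ∃ S : Finset K, ∀ x ∈ pPow K a, ∃ s ∈ S, x - s ∈ pPow K b := by
  obtain ⟨S, -, hS⟩ := (isCompact_pPow K a).elim_nhds_subcover
    (fun s => (fun x => x - s) ⁻¹' pPow K b) (fun s _ => by
      apply (continuous_id.sub continuous_const).continuousAt.preimage_mem_nhds
      simpa using pPow_mem_nhds K b)
  refine ⟨S, fun x hx => ?_⟩
  obtain ⟨s, hs, hxs⟩ := Set.mem_iUnion₂.1 (hS hx)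
  exact ⟨s, hs, hxs⟩

lemma residue_eq_iff {x y : 𝒪[K]} : IsLocalRing.residue 𝒪[K] x = IsLocalRing.residue 𝒪[K] y ↔
    (x : K) - y ∈ pPow K 1 := by
  rw [← sub_eq_zero, ← map_sub, IsLocalRing.residue_eq_zero_iff, IsLocalRing.mem_maximalIdeal,
    mem_nonunits_iff, Valuation.Integer.not_isUnit_iff_valuation_lt_one]
  rw [← (IsNonarchimedeanLocalField.valueGroupWithZeroIsoInt K).strictMono.lt_iff_lt, map_one]
  change val K ((x : K) - y) < 1 ↔ _
  by_cases h : (x : K) - y = 0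
  · rw [h, val_eq_zero.2 rfl]; simp [zero_mem_pPow]
  · rw [mem_pPow h, val_eq_exp h, ← WithZero.exp_zero, WithZero.exp_lt_exp]; omega

lemma mem_integer_iff {x : K} : x ∈ 𝒪[K] ↔ x ∈ pPow K 0 := by
  rw [← val_le_one_iff]; simp [pPow]

/-- Hensel's lemma: a simple root modulo `𝔭` lifts. -/
lemma hensel (f : 𝒪[K][X]) (hf : f.Monic) (a : 𝒪[K]) (h0 : ((f.eval a : 𝒪[K]) : K) ∈ pPow K 1)
    (h1 : ((f.derivative.eval a : 𝒪[K]) : K) ∉ pPow K 1) :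
    ∃ b : 𝒪[K], f.eval b = 0 ∧ (b : K) - a ∈ pPow K 1 := by
  let := IsTopologicalAddGroup.rightUniformSpace K
  have := isUniformAddGroup_of_addCommGroup (G := K)
  have key : ∀ x : 𝒪[K], x ∈ 𝓂[K] ↔ (x : K) ∈ pPow K 1 := fun x => by
    rw [← IsLocalRing.residue_eq_zero_iff, ← map_zero (IsLocalRing.residue 𝒪[K]), residue_eq_iff]
    simp
  obtain ⟨b, hb, hba⟩ := HenselianRing.is_henselian (I := 𝓂[K]) f hf a ((key _).2 h0) (by
    have : IsUnit (f.derivative.eval a) := by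
      by_contra hn
      exact h1 ((key _).1 ((IsLocalRing.mem_maximalIdeal _).2 hn))
    exact this.map _)
  exact ⟨b, hb, by simpa using (key _).1 hba⟩

variable (K) in
/-- The residue characteristic is odd, so `2` is a unit. -/
lemma two_not_mem_pPow [Fact (ringChar 𝓀[K] ≠ 2)] : (2 : K) ∉ pPow K 1 := by
  intro h
  have h1 := (residue_eq_iff (x := (2 : 𝒪[K])) (y := 0)).2 (by
    change (2 : K) - 0 ∈ _
    rwa [sub_zero])
  rw [map_zero, map_ofNat] at h1
  exact (Fact.out : ringChar 𝓀[K] ≠ 2)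
    (CharP.ringChar_of_prime_eq_zero Nat.prime_two (by exact_mod_cast h1))

lemma natCast_mem_pPow (n : ℕ) : (n : K) ∈ pPow K 0 :=
  mem_integer_iff.1 (natCast_mem 𝒪[K] n)

lemma ord_two [Fact (ringChar 𝓀[K] ≠ 2)] : ord (2 : K) = 0 := by
  have h2 : (2 : K) ≠ 0 := NeZero.ne 2
  have h := two_not_mem_pPow K
  have h' := natCast_mem_pPow (K := K) 2
  rw [Nat.cast_ofNat] at h'
  rw [mem_pPow h2] at h h'
  omega

/-- Every `1`-unit has a square root of the same level. -/
lemma exists_sqrt [Fact (ringChar 𝓀[K] ≠ 2)] {u : K} {i : ℤ} (hi : 1 ≤ i)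
    (hu : u - 1 ∈ pPow K i) : ∃ v : K, v * v = u ∧ v - 1 ∈ pPow K i := by
  obtain ⟨hu0, huo⟩ := ne_zero_and_ord_eq_zero (pPow_anti hi hu)
  have huO : u ∈ 𝒪[K] := by rw [mem_integer_iff, mem_pPow hu0]; omega
  let f : 𝒪[K][X] := X ^ 2 - C ⟨u, huO⟩
  obtain ⟨b, hb, hb1⟩ := hensel f (monic_X_pow_sub_C _ two_ne_zero) 1 (by
    have := neg_mem_pPow (pPow_anti hi hu)
    simpa [f] using this) (by
    have := two_not_mem_pPow K
    simp only [f, derivative_X_pow, derivative_sub, derivative_C, eval_mul, eval_C,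
      eval_pow, eval_X, one_pow, mul_one, sub_zero]
    exact this)
  have hbb : (b : K) * b = u := by
    have := congrArg (Subtype.val : 𝒪[K] → K) hb
    simp only [f, eval_sub, eval_pow, eval_X, eval_C] at this
    have h2 : (b : K) ^ 2 - u = 0 := this
    linear_combination h2
  refine ⟨b, hbb, ?_⟩
  have hb1' : (b : K) - 1 ∈ pPow K 1 := by simpa using hb1
  by_cases hbe : (b : K) - 1 = 0
  · rw [hbe]; exact zero_mem_pPow _
  have h2 : ((b : K) + 1) ∉ pPow K 1 := fun h => by
    have := sub_mem_pPow h hb1'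
    apply two_not_mem_pPow K
    convert this using 1; ring
  have hb10 : (b : K) + 1 ≠ 0 := fun h => h2 (h ▸ zero_mem_pPow _)
  have hprod : ((b : K) - 1) * (b + 1) = u - 1 := by linear_combination hbb
  rw [← hprod, mem_pPow (mul_ne_zero hbe hb10), ord_mul hbe hb10] at hu
  rw [mem_pPow hb10] at h2
  rw [mem_pPow hbe]
  omega

lemma residue_unit_pow {x : K} (hx : x ≠ 0) (hx0 : ord x = 0) :
    x ^ (Nat.card 𝓀[K] - 1) - 1 ∈ pPow K 1 := by
  have : Fintype 𝓀[K] := Fintype.ofFinite _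
  have hxO : x ∈ 𝒪[K] := by rw [mem_integer_iff, mem_pPow hx]; omega
  have hne : IsLocalRing.residue 𝒪[K] ⟨x, hxO⟩ ≠ 0 := by
    intro h
    rw [← map_zero (IsLocalRing.residue 𝒪[K]), residue_eq_iff] at h
    have h' : x ∈ pPow K 1 := by simpa using h
    rw [mem_pPow hx] at h'; omega
  have h := FiniteField.pow_card_sub_one_eq_one _ hne
  rw [← map_pow, ← map_one (IsLocalRing.residue 𝒪[K]), residue_eq_iff] at h
  simpa [Nat.card_eq_fintype_card] using h

lemma natCard_sub_one_not_mem : ((Nat.card 𝓀[K] - 1 : ℕ) : K) ∉ pPow K 1 := by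
  have : Fintype 𝓀[K] := Fintype.ofFinite _
  intro h
  have h1 := (residue_eq_iff (x := ((Nat.card 𝓀[K] - 1 : ℕ) : 𝒪[K])) (y := 0)).2 (by simpa using h)
  rw [map_zero, map_natCast, Nat.cast_sub Nat.card_pos] at h1
  simp [Nat.card_eq_fintype_card] at h1

/-- Teichmüller lifts: a unit is congruent to a root of unity of order prime to `p`. -/
lemma exists_teichmuller {x : K} (hx : x ≠ 0) (hx0 : ord x = 0) :
    ∃ z : K, z ^ (Nat.card 𝓀[K] - 1) = 1 ∧ z - x ∈ pPow K 1 := by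
  have hxO : x ∈ 𝒪[K] := by rw [mem_integer_iff, mem_pPow hx]; omega
  have hN : Nat.card 𝓀[K] - 1 ≠ 0 := by
    have := Finite.one_lt_card (α := 𝓀[K]); omega
  let f : 𝒪[K][X] := X ^ (Nat.card 𝓀[K] - 1) - C 1
  obtain ⟨b, hb, hb1⟩ := hensel f (monic_X_pow_sub_C _ hN) ⟨x, hxO⟩ (by
    simpa [f] using residue_unit_pow hx hx0) (by
    have h := natCard_sub_one_not_mem (K := K)
    have hn0 : ((Nat.card 𝓀[K] - 1 : ℕ) : K) ≠ 0 := fun h' => h (h' ▸ zero_mem_pPow _)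
    have hp := pow_ne_zero (Nat.card 𝓀[K] - 1 - 1) hx
    have : ((Nat.card 𝓀[K] - 1 : ℕ) : K) * x ^ (Nat.card 𝓀[K] - 1 - 1) ∉ pPow K 1 := by
      rw [mem_pPow (mul_ne_zero hn0 hp), ord_mul hn0 hp, ord_pow hx, hx0]
      rw [mem_pPow hn0] at h
      simpa using h
    simpa [f, derivative_X_pow] using this)
  refine ⟨b, ?_, hb1⟩
  have := congrArg (Subtype.val : 𝒪[K] → K) hb
  simp only [f, eval_sub, eval_pow, eval_X, eval_C] at this
  exact sub_eq_zero.1 this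

/-- There are no nontrivial roots of unity of order prime to `p` among the `1`-units. -/
lemma eq_one_of_pow_eq_one {u : K} (hu : u - 1 ∈ pPow K 1) (h : u ^ (Nat.card 𝓀[K] - 1) = 1) :
    u = 1 := by
  by_contra hne
  have hne' : u - 1 ≠ 0 := sub_ne_zero.2 hne
  set N := Nat.card 𝓀[K] - 1
  have hgeom := Commute.geom_sum₂_mul (Commute.all u 1) N
  simp only [one_pow, mul_one] at hgeom
  rw [h, sub_self] at hgeom
  have hz := (mul_eq_zero.1 hgeom).resolve_right hne'
  apply natCard_sub_one_not_mem (K := K)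
  have hpow : ∀ i : ℕ, u ^ i - 1 ∈ pPow K 1 := fun i => by
    induction i with
    | zero => simpa using zero_mem_pPow 1
    | succ i ih => rw [pow_succ]; exact mul_sub_one_mem (by omega) ih hu
  have hsum : ∀ n : ℕ, ∑ i ∈ Finset.range n, u ^ i - n ∈ pPow K 1 := fun n => by
    induction n with
    | zero => simpa using zero_mem_pPow 1
    | succ n ih =>
      rw [Finset.sum_range_succ]
      convert add_mem_pPow ih (hpow n) using 1
      push_cast; ring
  have := neg_mem_pPow (hsum N)
  rwa [hz, zero_sub, neg_neg] at this

lemma vle_iff_ord_le {a b : K} (ha : a ≠ 0) (hb : b ≠ 0) : b ≤ᵥ a ↔ ord a ≤ ord b := by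
  rw [Valuation.Compatible.vle_iff_le (v := valuation K),
    ← (IsNonarchimedeanLocalField.valueGroupWithZeroIsoInt K).strictMono.le_iff_le]
  change val K b ≤ val K a ↔ _
  rw [val_eq_exp ha, val_eq_exp hb, WithZero.exp_le_exp]; omega

end Local

/-! ### Eigenspaces of smooth representations -/

section Abstract

variable {Ω G : Type*} [Field Ω] [Group G]

lemma isIrreducible_iff {V : Type*} [AddCommGroup V] [Module Ω V] (ρ : Representation Ω G V) :
    ρ.IsIrreducible ↔ Nontrivial V ∧
      ∀ p : Submodule Ω V, (∀ g, ∀ v ∈ p, ρ g v ∈ p) → p = ⊥ ∨ p = ⊤ := by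
  have hinj := Subrepresentation.toSubmodule_injective (ρ := ρ)
  refine ⟨fun h => ⟨not_subsingleton_iff_nontrivial.1 fun hn => ?_, fun p hp => ?_⟩, fun h => ?_⟩
  · exact h.exists_pair_ne.elim fun a ⟨b, hab⟩ => hab (hinj (Subsingleton.elim _ _))
  · exact (h.eq_bot_or_eq_top ⟨p, fun g v => hp g v⟩).imp
      (congrArg Subrepresentation.toSubmodule) (congrArg Subrepresentation.toSubmodule)
  · have := h.1
    exact { exists_pair_ne := ⟨⊥, ⊤, fun h0 => bot_ne_top (α := Submodule Ω V)
              (congrArg Subrepresentation.toSubmodule h0)⟩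
            eq_bot_or_eq_top := fun a => (h.2 a.toSubmodule fun g v hv =>
              a.apply_mem_toSubmodule g hv).imp (fun h => hinj h) fun h => hinj h }

/-- A function on a finite group that is invariant under the commutator subgroup and does not vanish
at `1` has a nonzero coefficient for some character. -/
lemma exists_char_sum_ne_zero [IsAlgClosed Ω] [CharZero Ω] {Q U : Type*} [Group Q] [Fintype Q]
    [AddCommGroup U] [Module Ω U] (f : Q → U)
    (hf : ∀ x ∈ commutator Q, ∀ y, f (x * y) = f y) (h1 : f 1 ≠ 0) :
    ∃ χ : Q →* Ωˣ, ∑ q, ((χ q)⁻¹ : Ωˣ) • f q ≠ 0 := by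
  classical
  by_contra! hcon
  let A := Abelianization Q
  have : Finite A := Quotient.finite _
  have : HasEnoughRootsOfUnity Ω (Monoid.exponent A) := by
    have : NeZero (Monoid.exponent A : Ω) :=
      ⟨Nat.cast_ne_zero.2 (Monoid.exponent_ne_zero_of_finite)⟩
    infer_instance
  have hfin : Finite (A →* Ωˣ) := inferInstance
  let _ := Fintype.ofFinite (A →* Ωˣ)
  -- orthogonality of characters, for the characters `χ ↦ χ a⁻¹` of the dual of `A`
  let ev (a : A) : (A →* Ωˣ) →* Ω := (Units.coeHom Ω).comp (MonoidHom.eval a⁻¹)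
  have hev (q : Q) : ev (.of q) = 1 ↔ q ∈ commutator Q := by
    rw [← Abelianization.ker_of, MonoidHom.mem_ker, ← inv_eq_one (a := Abelianization.of q),
      ← CommGroup.forall_apply_eq_apply_iff A (M := Ω), DFunLike.ext_iff]
    exact forall_congr' fun χ => by simp [ev]
  -- sum the vanishing coefficients over all characters; orthogonality leaves a multiple of `f 1`
  have h0 : ∑ χ : A →* Ωˣ, ∑ q : Q, ev (.of q) χ • f q = 0 := Finset.sum_eq_zero fun χ _ => by
    simpa [ev, Units.smul_def] using hcon (χ.comp Abelianization.of)
  have h2 (q : Q) : ∑ χ : A →* Ωˣ, ev (.of q) χ • f q =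
      (if q ∈ commutator Q then (Fintype.card (A →* Ωˣ) : Ω) else 0) • f 1 := by
    rw [← Finset.sum_smul, sum_hom_units]
    by_cases hq : q ∈ commutator Q
    · simp [hev, hq, ← hf q hq 1]
    · simp [hev, hq]
  rw [Finset.sum_comm, Finset.sum_congr rfl fun q _ => h2 q, ← Finset.sum_smul, Finset.sum_ite,
    Finset.sum_const_zero, add_zero, Finset.sum_const, nsmul_eq_mul] at h0
  refine h1 ((smul_eq_zero.1 h0).resolve_left (mul_ne_zero (Nat.cast_ne_zero.2 ?_)
    (Nat.cast_ne_zero.2 Fintype.card_ne_zero)))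
  exact Finset.card_ne_zero.2 ⟨1, by simp [one_mem]⟩

/-- A group `G` with subgroups `H ◁ J`, where `H` has a neighbourhood basis of `1` that consists of normal
subgroups `U N` of finite index, and where `J` is finite modulo `H` and the powers of a central
element. -/
structure OpenPair (G : Type*) [Group G] [TopologicalSpace G] where
  H : Subgroup G
  J : Subgroup G
  U : ℕ → Subgroup G
  H_le_J : H ≤ J
  conj_mem_H : ∀ g ∈ J, ∀ h ∈ H, g * h * g⁻¹ ∈ H
  U_anti : Antitone U
  U_le_H : ∀ N, U N ≤ H
  U_mem_nhds : ∀ N, (U N : Set G) ∈ 𝓝 1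
  exists_U : ∀ S ∈ 𝓝 (1 : G), ∃ N, (U N : Set G) ⊆ S
  conj_mem_U : ∀ N, ∀ g ∈ H, ∀ u ∈ U N, g * u * g⁻¹ ∈ U N
  exists_cover : ∀ N, ∃ S : Set G, S.Finite ∧ S ⊆ H ∧ ∀ h ∈ H, ∃ s ∈ S, s⁻¹ * h ∈ U N
  exists_cover_J : ∃ (z : G) (S : Set G), S.Finite ∧ S ⊆ J ∧ z ∈ J ∧ (∀ g, z * g = g * z) ∧
    ∀ g ∈ J, ∃ k : ℤ, ∃ s ∈ S, ∃ h ∈ H, g = z ^ k * s * h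

namespace OpenPair

variable [TopologicalSpace G] (P : OpenPair G)

/-- A type for `J`: a smooth character of `H` that is normalised by `J`, is not intertwined by
elements outside `J`, and occurs in the translates of `U N` on finitely many cosets of `J` only. -/
structure IsType (Θ : P.H →* Ωˣ) : Prop where
  smooth : ∃ N, ∀ u : P.H, (u : G) ∈ P.U N → Θ u = 1
  conj : ∀ g ∈ P.J, ∀ (h : G) (hh : h ∈ P.H) (hh' : g * h * g⁻¹ ∈ P.H),
    Θ ⟨g * h * g⁻¹, hh'⟩ = Θ ⟨h, hh⟩
  mem_J : ∀ g, (∀ (h : G) (hh : h ∈ P.H) (hh' : g⁻¹ * h * g ∈ P.H),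
    Θ ⟨h, hh⟩ = Θ ⟨g⁻¹ * h * g, hh'⟩) → g ∈ P.J
  support : ∀ N, ∃ S : Set G, S.Finite ∧ ∀ g,
    (∀ h : P.H, g⁻¹ * (h : G) * g ∈ P.U N → Θ h = 1) → ∃ s ∈ S, ∃ j ∈ P.J, g = j * s

/-- The finite quotient of `H` by `U N`. -/
abbrev Quot (N : ℕ) := P.H ⧸ (P.U N).subgroupOf P.H

instance (N : ℕ) : ((P.U N).subgroupOf P.H).Normal :=
  ⟨fun u hu g => P.conj_mem_U N (g : G) g.2 (u : G) hu⟩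

instance (N : ℕ) : Finite (P.Quot N) := by
  obtain ⟨S, hS, hSH, hc⟩ := P.exists_cover N
  have : Finite S := hS
  refine Finite.of_surjective (fun s : S => (QuotientGroup.mk ⟨s, hSH s.2⟩ : P.Quot N)) fun q => ?_
  obtain ⟨h, rfl⟩ := QuotientGroup.mk_surjective q
  obtain ⟨s, hs, hs'⟩ := hc h h.2
  exact ⟨⟨s, hs⟩, QuotientGroup.eq.2 hs'⟩

noncomputable instance (N : ℕ) : Fintype (P.Quot N) := Fintype.ofFinite _

variable {P}
variable {V : Type*} [AddCommGroup V] [Module Ω V] {π : Representation Ω G V}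

variable (π) in
/-- The `Θ`-eigenspace of `H`. -/
def eigen (Θ : P.H →* Ωˣ) : Submodule Ω V where
  carrier := {v | ∀ h : P.H, π h v = (Θ h : Ω) • v}
  add_mem' ha hb h := by rw [map_add, ha h, hb h, smul_add]
  zero_mem' h := by simp
  smul_mem' c v hv h := by rw [map_smul, hv h, smul_comm]

variable (π) in
/-- The kernel of the projection to `Θ`-coinvariants of `H`. -/
def defect (Θ : P.H →* Ωˣ) : Submodule Ω V :=
  Submodule.span Ω {u | ∃ (h : P.H) (v : V), u = π h v - (Θ h : Ω) • v}

lemma exists_level (hπ : IsSmooth π) (v : V) : ∃ N, ∀ N' ≥ N, ∀ u ∈ P.U N', π u v = v := by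
  obtain ⟨N, hN⟩ := P.exists_U _ (hπ v)
  exact ⟨N, fun N' h u hu => hN (P.U_anti h hu)⟩

/-- The `Θ⁻¹`-translates of a vector that is fixed by `U N` are indexed by `H / U N`. -/
lemma translate_congr {Θ : P.H →* Ωˣ} {N : ℕ} (hΘ : ∀ u : P.H, (u : G) ∈ P.U N → Θ u = 1) {v : V}
    (hv : ∀ u ∈ P.U N, π u v = v) {h h' : P.H} (e : (h : P.Quot N) = h') :
    ((Θ h)⁻¹ : Ωˣ) • π h v = ((Θ h')⁻¹ : Ωˣ) • π h' v := by
  obtain ⟨u, hu, rfl⟩ : ∃ u : P.H, (u : G) ∈ P.U N ∧ h * u = h' :=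
    ⟨h⁻¹ * h', (QuotientGroup.eq (s := (P.U N).subgroupOf P.H)).1 e, mul_inv_cancel_left _ _⟩
  rw [map_mul, hΘ u hu, mul_one, Subgroup.coe_mul, map_mul, Module.End.mul_apply, hv _ hu]

variable (π) in
/-- The projection to the `Θ`-eigenspace, on vectors fixed by `U N`. -/
noncomputable def avg (Θ : P.H →* Ωˣ) (N : ℕ) : V →ₗ[Ω] V :=
  (Fintype.card (P.Quot N) : Ω)⁻¹ • ∑ q : P.Quot N, (((Θ q.out)⁻¹ : Ωˣ) : Ω) • π (q.out : P.H)

section avg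

variable {Θ : P.H →* Ωˣ} {N : ℕ} {v : V}

lemma avg_apply (v : V) : avg π Θ N v = (Fintype.card (P.Quot N) : Ω)⁻¹ •
    ∑ q : P.Quot N, ((Θ q.out)⁻¹ : Ωˣ) • π (q.out : P.H) v := by
  simp [avg, Units.smul_def]

lemma avg_mem_eigen (hΘ : ∀ u : P.H, (u : G) ∈ P.U N → Θ u = 1)
    (hv : ∀ u ∈ P.U N, π u v = v) : avg π Θ N v ∈ eigen π Θ := by
  intro h
  rw [avg_apply (π := π), map_smul, smul_comm (Θ h : Ω), map_sum]
  congr 1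
  rw [Finset.smul_sum]
  refine Fintype.sum_equiv (Equiv.mulLeft (h : P.Quot N)) _ _ fun q => ?_
  have e : (((h * q : P.Quot N).out : P.H) : P.Quot N) = (h * q.out : P.H) := by
    rw [QuotientGroup.out_eq', QuotientGroup.mk_mul, QuotientGroup.out_eq']
  rw [Equiv.coe_mulLeft, translate_congr hΘ hv e, map_mul, mul_inv, Subgroup.coe_mul, map_mul,
    Module.End.mul_apply, mul_smul, ← Units.smul_def, smul_inv_smul]
  simp only [Units.smul_def, map_smul]

lemma avg_of_mem_eigen [CharZero Ω] (hv : v ∈ eigen π Θ) : avg π Θ N v = v := by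
  have (q : P.Quot N) : ((Θ q.out)⁻¹ : Ωˣ) • π (q.out : P.H) v = v := by
    rw [hv, ← Units.smul_def, inv_smul_smul]
  rw [avg_apply, Finset.sum_congr rfl fun q _ => this q, Finset.sum_const, Finset.card_univ,
    ← Nat.cast_smul_eq_nsmul Ω, inv_smul_smul₀ (Nat.cast_ne_zero.2 Fintype.card_ne_zero)]

lemma sub_avg_mem_defect [CharZero Ω] : v - avg π Θ N v ∈ defect π Θ := by
  have e : v - avg π Θ N v = (Fintype.card (P.Quot N) : Ω)⁻¹ •
      ∑ q : P.Quot N, (v - ((Θ q.out)⁻¹ : Ωˣ) • π (q.out : P.H) v) := by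
    rw [Finset.sum_sub_distrib, smul_sub, Finset.sum_const, Finset.card_univ, avg_apply,
      ← Nat.cast_smul_eq_nsmul Ω, inv_smul_smul₀ (Nat.cast_ne_zero.2 Fintype.card_ne_zero)]
  rw [e]
  refine Submodule.smul_mem _ _ (Submodule.sum_mem _ fun q _ => ?_)
  have e1 : v - ((Θ q.out)⁻¹ : Ωˣ) • π (q.out : P.H) v =
      (-((Θ q.out)⁻¹ : Ωˣ) : Ω) • (π (q.out : P.H) v - (Θ q.out : Ω) • v) := by
    simp [Units.smul_def, smul_smul, sub_eq_add_neg, add_comm]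
  rw [e1]
  exact Submodule.smul_mem _ _ (Submodule.subset_span ⟨_, _, rfl⟩)

lemma avg_sub_smul (hΘ : ∀ u : P.H, (u : G) ∈ P.U N → Θ u = 1)
    (hv : ∀ u ∈ P.U N, π u v = v) (h : P.H) : avg π Θ N (π h v - (Θ h : Ω) • v) = 0 := by
  rw [map_sub, sub_eq_zero, map_smul, avg_apply (π := π), avg_apply (π := π), smul_comm]
  congr 1
  rw [Finset.smul_sum]
  refine Fintype.sum_equiv (Equiv.mulRight (h : P.Quot N)) _ _ fun q => ?_
  have e : (((q * h : P.Quot N).out : P.H) : P.Quot N) = (q.out * h : P.H) := by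
    rw [QuotientGroup.out_eq', QuotientGroup.mk_mul, QuotientGroup.out_eq']
  rw [Equiv.coe_mulRight, translate_congr hΘ hv e, map_mul, mul_inv, mul_comm, Subgroup.coe_mul,
    map_mul, Module.End.mul_apply, mul_smul, ← Units.smul_def, smul_inv_smul]

end avg

/-- A smooth representation is the direct sum of the `Θ`-eigenspace and the defect space. -/
lemma isCompl_eigen_defect [CharZero Ω] (hπ : IsSmooth π) {Θ : P.H →* Ωˣ}
    (hΘ : ∃ N, ∀ u : P.H, (u : G) ∈ P.U N → Θ u = 1) : IsCompl (eigen π Θ) (defect π Θ) := by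
  obtain ⟨N₀, hN₀⟩ := hΘ
  refine IsCompl.of_eq ((Submodule.eq_bot_iff _).2 ?_) (eq_top_iff.2 fun v _ => ?_)
  · rintro v ⟨hv, hv'⟩
    obtain ⟨N, hN⟩ : ∃ N, ∀ N' ≥ N, avg π Θ N' v = 0 := by
      refine Submodule.span_induction (p := fun v _ => ∃ N, ∀ N' ≥ N, avg π Θ N' v = 0)
        ?_ ⟨0, fun N' _ => map_zero _⟩ ?_ ?_ hv'
      · rintro _ ⟨h, w, rfl⟩
        obtain ⟨N, hN⟩ := exists_level (P := P) hπ w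
        exact ⟨max N₀ N, fun N' hN' => avg_sub_smul
          (fun u hu => hN₀ u (P.U_anti ((le_max_left _ _).trans hN') hu))
          (hN N' ((le_max_right _ _).trans hN')) h⟩
      · rintro x y - - ⟨N, hN⟩ ⟨N', hN'⟩
        exact ⟨max N N', fun n hn => by
          rw [map_add, hN n ((le_max_left _ _).trans hn), hN' n ((le_max_right _ _).trans hn),
            add_zero]⟩
      · rintro c x - ⟨N, hN⟩
        exact ⟨N, fun n hn => by rw [map_smul, hN n hn, smul_zero]⟩
    rw [← avg_of_mem_eigen (N := N) hv, hN N le_rfl]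
  · obtain ⟨N, hN⟩ := exists_level (P := P) hπ v
    have := Submodule.add_mem_sup (avg_mem_eigen (Θ := Θ) (N := max N₀ N)
      (fun u hu => hN₀ u (P.U_anti (le_max_left _ _) hu)) (hN _ (le_max_right _ _)))
      (sub_avg_mem_defect (π := π) (Θ := Θ) (N := max N₀ N) (v := v))
    rwa [add_sub_cancel] at this

/-- If a linear map `φ` is invariant under a subgroup that contains the commutators of `H`, then `φ`
is nonzero on an eigenvector of `H` in every `H`-stable subspace on which it is nonzero. -/
lemma exists_eigen_of_map_ne_zero [IsAlgClosed Ω] [CharZero Ω] (hπ : IsSmooth π) {U : Type*}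
    [AddCommGroup U] [Module Ω U] (φ : V →ₗ[Ω] U)
    (hφ : ∀ g ∈ P.H, ∀ h ∈ P.H, ∀ v, φ (π (g * h * g⁻¹ * h⁻¹) v) = φ v)
    (p : Submodule Ω V) (hp : ∀ h ∈ P.H, ∀ v ∈ p, π h v ∈ p) {v : V} (hvp : v ∈ p)
    (hv : φ v ≠ 0) :
    ∃ Ξ : P.H →* Ωˣ, (∃ N, ∀ u : P.H, (u : G) ∈ P.U N → Ξ u = 1) ∧
      ∃ v' ∈ p, v' ∈ eigen π Ξ ∧ φ v' ≠ 0 := by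
  obtain ⟨N, hN⟩ := exists_level (P := P) hπ v
  have hvN := hN N le_rfl
  -- `h ↦ φ (h v)` as a function on the finite quotient `H / U N`
  let f : P.Quot N → U := fun q => φ (π (q.out : P.H) v)
  have hf (h : P.H) : f h = φ (π h v) := by
    have := translate_congr (Θ := 1) (fun _ _ => rfl) hvN (QuotientGroup.out_eq' (h : P.Quot N))
    simp only [MonoidHom.one_apply, inv_one, one_smul] at this
    exact congrArg φ this
  have hcomm : ∀ x ∈ commutator (P.Quot N), ∀ y, f (x * y) = f y := by
    intro x hx
    rw [commutator_eq_closure] at hx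
    refine Subgroup.closure_induction (p := fun x _ => ∀ y, f (x * y) = f y) ?_
      (fun y => by rw [one_mul]) (fun x y _ _ hx hy z => by rw [mul_assoc, hx, hy])
      (fun x _ hx y => by rw [← hx (x⁻¹ * y), mul_inv_cancel_left]) hx
    rintro _ ⟨a, b, rfl⟩ y
    obtain ⟨a, rfl⟩ := QuotientGroup.mk_surjective a
    obtain ⟨b, rfl⟩ := QuotientGroup.mk_surjective b
    obtain ⟨y, rfl⟩ := QuotientGroup.mk_surjective y
    have := hφ a a.2 b b.2 (π y v)
    rw [← Module.End.mul_apply, ← map_mul] at this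
    exact (hf (a * b * a⁻¹ * b⁻¹ * y)).trans (this.trans (hf y).symm)
  obtain ⟨χ, hχ⟩ := exists_char_sum_ne_zero (Ω := Ω) f hcomm (by
    have := hf 1
    rw [QuotientGroup.mk_one, Subgroup.coe_one, map_one, Module.End.one_apply] at this
    rwa [this])
  -- the component of `v` in the eigenspace of this character is not killed by `φ`
  let Ξ : P.H →* Ωˣ := χ.comp (QuotientGroup.mk' _)
  have hΞ (u : P.H) (hu : (u : G) ∈ P.U N) : Ξ u = 1 :=
    (congrArg χ ((QuotientGroup.eq_one_iff (N := (P.U N).subgroupOf P.H) u).2 hu)).trans (map_one χ)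
  refine ⟨Ξ, ⟨N, hΞ⟩, avg π Ξ N v, ?_, avg_mem_eigen hΞ hvN, ?_⟩
  · rw [avg_apply]
    exact p.smul_mem _ (p.sum_mem fun q _ => p.smul_mem _ (hp _ (q.out).2 _ hvp))
  · rw [avg_apply, map_smul, map_sum]
    refine smul_ne_zero (inv_ne_zero (Nat.cast_ne_zero.2 Fintype.card_ne_zero)) ?_
    convert hχ using 2 with q
    have : Ξ q.out = χ q := congrArg χ (QuotientGroup.out_eq' q)
    rw [this, Units.smul_def, map_smul, ← Units.smul_def]

end OpenPair

end Abstract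

/-! ### Schur's lemma and finiteness -/

section Schur

variable {Ω G : Type*} [Field Ω] [Group G]
variable {M : Type*} [AddCommGroup M] [Module Ω M] {ρ : Representation Ω G M}

/-- A nonzero equivariant map between irreducible representations is bijective. -/
lemma bijective_of_equivariant {M' : Type*} [AddCommGroup M'] [Module Ω M']
    {ρ' : Representation Ω G M'} (hρ : ρ.IsIrreducible) (hρ' : ρ'.IsIrreducible)
    (f : M →ₗ[Ω] M') (hf : ∀ g v, f (ρ g v) = ρ' g (f v)) (h0 : f ≠ 0) :
    Function.Bijective f :=
  (Representation.IsIrreducible.bijective_or_eq_zero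
    (f.intertwiningMap_of_isIntertwiningMap ρ ρ' hf)).resolve_right fun h =>
      h0 (congrArg Representation.IntertwiningMap.toLinearMap h)

lemma exists_eq_smul_of_commute [IsAlgClosed Ω] [FiniteDimensional Ω M] (hρ : ρ.IsIrreducible)
    (T : M →ₗ[Ω] M) (hT : ∀ g v, T (ρ g v) = ρ g (T v)) : ∃ c : Ω, ∀ v, T v = c • v := by
  obtain ⟨c, hc⟩ :=
    (Representation.IsIrreducible.algebraMap_intertwiningMap_bijective_of_isAlgClosed (ρ := ρ)).2
      (T.intertwiningMap_of_isIntertwiningMap ρ ρ hT)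
  exact ⟨c, fun v => (DFunLike.congr_fun hc v).symm⟩

lemma span_orbit_eq_top (hirr : ρ.IsIrreducible) {p : Set M} (hp : ∃ v ∈ p, v ≠ 0) :
    Submodule.span Ω {u | ∃ g, ∃ v ∈ p, u = ρ g v} = ⊤ := by
  obtain ⟨v, hv, h0⟩ := hp
  refine (((isIrreducible_iff ρ).1 hirr).2 _ fun g v hv => ?_).resolve_left fun h => h0 ?_
  · refine Submodule.mem_comap.1 (Submodule.span_le.2 ?_ hv)
    rintro _ ⟨g', w, hw, rfl⟩
    exact Submodule.subset_span ⟨g * g', w, hw, by simp⟩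
  · rw [← Submodule.mem_bot Ω, ← h]
    exact Submodule.subset_span ⟨1, v, hv, by simp⟩

/-- An invertible operator on a nonzero vector space generated by finitely many vectors over the
powers of the operator has an eigenvalue, in the form: `T - c` is not surjective for some `c`. -/
lemma exists_not_surjective [IsAlgClosed Ω] [Nontrivial M] (T T' : Module.End Ω M)
    (h1 : T * T' = 1) (h2 : T' * T = 1) (S : Set M) (hS : S.Finite)
    (hspan : ∀ p : Submodule Ω M, S ⊆ p → (∀ v ∈ p, T v ∈ p) → (∀ v ∈ p, T' v ∈ p) → p = ⊤) :
    ∃ c : Ω, ¬ Function.Surjective (T - c • (1 : Module.End Ω M)) := by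
  classical
  let A := Algebra.adjoin Ω ({T, T'} : Set (Module.End Ω M))
  have hA : IsMulCommutative A := Algebra.isMulCommutative_adjoin Ω (by
    rintro a (rfl | rfl) b (rfl | rfl) <;> simp [h1, h2])
  let _ : CommRing A := { A.toRing with mul_comm := hA.is_comm.comm }
  have hT : T ∈ A := Algebra.subset_adjoin (by simp)
  have hT' : T' ∈ A := Algebra.subset_adjoin (by simp)
  have hAft : Algebra.FiniteType Ω A := by
    rw [← Subalgebra.fg_iff_finiteType]
    exact ⟨{T, T'}, by simp [A]⟩
  have hfin : Module.Finite A M := by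
    refine ⟨⟨hS.toFinset, ?_⟩⟩
    have := hspan ((Submodule.span A (hS.toFinset : Set M)).restrictScalars Ω)
      (fun v hv => Submodule.subset_span (by simpa using hv))
      (fun v hv => Submodule.smul_mem _ (⟨T, hT⟩ : A) hv)
      (fun v hv => Submodule.smul_mem _ (⟨T', hT'⟩ : A) hv)
    exact (Submodule.restrictScalars_eq_top_iff Ω A M).1 this
  -- `M` is finite over the commutative algebra `A = Ω[T, T']`, so it has a simple quotient; by the
  -- Nullstellensatz the residue field of `A` acting on this quotient is `Ω`
  obtain ⟨N, hN, -⟩ := (eq_top_or_exists_le_coatom (⊥ : Submodule A M)).resolve_left bot_ne_top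
  have hsimple : IsSimpleModule A (M ⧸ N) := isSimpleModule_iff_isCoatom.2 hN
  obtain ⟨I, hI, ⟨e⟩⟩ := isSimpleModule_iff_quot_maximal.1 hsimple
  let _ : Field (A ⧸ I) := Ideal.Quotient.field I
  have hfinI : Module.Finite Ω (A ⧸ I) := finite_of_finite_type_of_isJacobsonRing Ω (A ⧸ I)
  obtain ⟨c, hc⟩ := IsAlgClosed.algebraMap_bijective_of_isIntegral (k := Ω) (K := A ⧸ I) |>.2
    (Ideal.Quotient.mk I ⟨T, hT⟩)
  refine ⟨c, fun hsurj => hN.1 ?_⟩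
  rw [eq_top_iff]
  rintro v -
  obtain ⟨w, rfl⟩ := hsurj v
  rw [← Submodule.Quotient.mk_eq_zero]
  -- `T - c` annihilates the simple quotient
  have e1 : (T - c • (1 : Module.End Ω M)) w = ((⟨T, hT⟩ : A) - algebraMap Ω A c) • w := by
    rw [sub_smul, algebraMap_smul]
    rfl
  rw [e1, Submodule.Quotient.mk_smul]
  apply e.injective
  obtain ⟨a, ha⟩ := Ideal.Quotient.mk_surjective (e (Submodule.Quotient.mk w))
  rw [map_smul, map_zero, ← ha]
  change Ideal.Quotient.mk I (((⟨T, hT⟩ : A) - algebraMap Ω A c) * a) = 0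
  rw [map_mul, map_sub, ← hc]
  exact (congrArg (· * _) (sub_self _)).trans (zero_mul _)

/-- An irreducible representation of a group that is finite modulo a central element and elements
that act by scalars is finite-dimensional. -/
lemma finiteDimensional_of_irreducible [IsAlgClosed Ω] (hρ : ρ.IsIrreducible) (z : G)
    (hz : ∀ g, z * g = g * z) (S : Set G) (hS : S.Finite)
    (hG : ∀ g, ∃ k : ℤ, ∃ s ∈ S, ∃ h, (∃ c : Ω, ∀ v, ρ h v = c • v) ∧ g = z ^ k * s * h) :
    FiniteDimensional Ω M := by
  have := ((isIrreducible_iff ρ).1 hρ).1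
  obtain ⟨w, hw⟩ := exists_ne (0 : M)
  have hgen : ∀ p : Submodule Ω M, (fun s => ρ s w) '' S ⊆ p → (∀ v ∈ p, ρ z v ∈ p) →
      (∀ v ∈ p, ρ z⁻¹ v ∈ p) → p = ⊤ := by
    intro p hp h1 h2
    have hk (k : ℤ) : ∀ v ∈ p, ρ (z ^ k) v ∈ p := by
      induction k with
      | zero => intro v hv; simpa using hv
      | succ i ih => exact fun v hv => by rw [zpow_add_one, map_mul]; exact ih _ (h1 v hv)
      | pred i ih => exact fun v hv => by rw [zpow_sub_one, map_mul]; exact ih _ (h2 v hv)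
    rw [eq_top_iff, ← span_orbit_eq_top hρ ⟨w, Set.mem_singleton w, hw⟩, Submodule.span_le]
    rintro _ ⟨g, _, rfl, rfl⟩
    obtain ⟨k, s, hs, h, ⟨c, hc⟩, rfl⟩ := hG g
    rw [map_mul, Module.End.mul_apply, hc, map_smul, map_mul, Module.End.mul_apply]
    exact p.smul_mem _ (hk k _ (hp ⟨s, hs, rfl⟩))
  -- `z - c` is equivariant and not surjective, hence zero by Schur's lemma
  obtain ⟨c, hc⟩ := exists_not_surjective (ρ z) (ρ z⁻¹) (by rw [← map_mul]; simp)
    (by rw [← map_mul]; simp) ((fun s => ρ s w) '' S) (hS.image _) hgen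
  have hzc (v : M) : ρ z v = c • v := by
    by_contra hne
    refine hc (bijective_of_equivariant hρ hρ (ρ z - c • (1 : Module.End Ω M)) (fun g v => ?_)
      fun h => hne (sub_eq_zero.1 (LinearMap.congr_fun h v))).2
    have : ρ z (ρ g v) = ρ g (ρ z v) := by
      rw [← Module.End.mul_apply, ← map_mul, hz, map_mul, Module.End.mul_apply]
    simp [this]
  have hcz (v : M) : c • ρ z⁻¹ v = v := by rw [← hzc, ρ.self_inv_apply]
  have hc0 : c ≠ 0 := by
    rintro rfl
    exact hw (by rw [← hcz w, zero_smul])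
  have htop := hgen (Submodule.span Ω ((fun s => ρ s w) '' S)) Submodule.subset_span
    (fun v hv => by rw [hzc]; exact Submodule.smul_mem _ _ hv) (fun v hv => by
      rw [← inv_smul_smul₀ hc0 (ρ z⁻¹ v), hcz]; exact Submodule.smul_mem _ _ hv)
  exact ⟨⟨(hS.image fun s => ρ s w).toFinset, by simpa using htop⟩⟩

end Schur

/-! ### Types and induced representations -/

/-- The homomorphism to an induced representation that corresponds to an equivariant map. -/
def frobeniusLift {Ω G : Type*} [Field Ω] [Group G] [TopologicalSpace G] [IsTopologicalGroup G]
    {V W : Type*} [AddCommGroup V] [Module Ω V] [AddCommGroup W] [Module Ω W] {H : Subgroup G}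
    {ρ : Representation Ω G V} {σ : Representation Ω H W} (hρ : IsSmooth ρ) (φ : V →ₗ[Ω] W)
    (hφ : ∀ (h : H) v, φ (ρ h v) = σ h (φ v)) : Representation.IntertwiningMap ρ (ind σ) :=
  LinearMap.intertwiningMap_of_isIntertwiningMap (W := indSpace σ) ρ (ind σ)
    { toFun := fun v => ⟨fun g => φ (ρ g v), fun h g => by simp [hφ], by
        filter_upwards [hρ v] with u hu g
        rw [map_mul, Module.End.mul_apply, hu]⟩
      map_add' := fun v w => Subtype.ext (funext fun g => by simp)
      map_smul' := fun c v => Subtype.ext (funext fun g => by simp) }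
    fun g v => Subtype.ext (funext fun x =>
      congrArg φ (LinearMap.congr_fun (map_mul ρ x g) v).symm)

namespace OpenPair

variable {Ω G : Type*} [Field Ω] [Group G] [TopologicalSpace G] {P : OpenPair G}
variable {V : Type*} [AddCommGroup V] [Module Ω V] {π : Representation Ω G V}
variable {Θ : P.H →* Ωˣ}

lemma IsType.conj_inv (hΘ : P.IsType Θ) {g : G} (hg : g ∈ P.J) {h : G} (hh : h ∈ P.H)
    (hh' : g⁻¹ * h * g ∈ P.H) : Θ ⟨g⁻¹ * h * g, hh'⟩ = Θ ⟨h, hh⟩ := by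
  have h1 := hΘ.conj g⁻¹ (P.J.inv_mem hg) h hh (by rwa [inv_inv])
  simpa using h1

lemma conj_inv_mem_H {g : G} (hg : g ∈ P.J) {h : G} (hh : h ∈ P.H) : g⁻¹ * h * g ∈ P.H := by
  simpa using P.conj_mem_H g⁻¹ (P.J.inv_mem hg) h hh

lemma IsType.inv (hΘ : P.IsType Θ) : P.IsType Θ⁻¹ where
  smooth := by
    obtain ⟨N, hN⟩ := hΘ.smooth
    exact ⟨N, fun u hu => by rw [MonoidHom.inv_apply, hN u hu, inv_one]⟩
  conj g hg h hh hh' := by simp only [MonoidHom.inv_apply, hΘ.conj g hg h hh hh']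
  mem_J g hg := hΘ.mem_J g fun h hh hh' => inv_injective (hg h hh hh')
  support N := by
    obtain ⟨S, hS, hS'⟩ := hΘ.support N
    exact ⟨S, hS, fun g hg => hS' g fun h hh => inv_injective (by
      rw [inv_one]; exact hg h hh)⟩

/-- Types are stable under twisting by smooth characters of `G`. -/
lemma IsType.twist (hΘ : P.IsType Θ) {c : G →* Ωˣ} (hc : IsSmoothChar c) :
    P.IsType (Θ * c.comp P.H.subtype) := by
  obtain ⟨M, hM⟩ := P.exists_U _ (hc.mem_nhds c.ker.one_mem)
  have hM' : ∀ N ≥ M, ∀ u ∈ P.U N, c u = 1 := fun N hN u hu => hM (P.U_anti hN hu)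
  have hcc : ∀ g h, c (g * h * g⁻¹) = c h := fun g h => by
    rw [map_mul, map_mul, map_inv, mul_inv_cancel_comm]
  have hcc' : ∀ g h, c (g⁻¹ * h * g) = c h := fun g h => by simp
  refine ⟨?_, ?_, ?_, ?_⟩
  · obtain ⟨N, hN⟩ := hΘ.smooth
    refine ⟨max N M, fun u hu => ?_⟩
    rw [MonoidHom.mul_apply, hN u (P.U_anti (le_max_left _ _) hu), one_mul]
    exact hM' _ (le_max_right _ _) u hu
  · intro g hg h hh hh'
    change Θ _ * c (g * h * g⁻¹) = Θ _ * c h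
    rw [hΘ.conj g hg h hh hh', hcc]
  · intro g hg
    refine hΘ.mem_J g fun h hh hh' => ?_
    have h1 : Θ ⟨h, hh⟩ * c h = Θ _ * c (g⁻¹ * h * g) := hg h hh hh'
    rw [hcc'] at h1
    exact mul_right_cancel h1
  · intro N
    obtain ⟨S, hS, hS'⟩ := hΘ.support (max N M)
    refine ⟨S, hS, fun g hg => hS' g fun h hh => ?_⟩
    have h1 : Θ h * c h = 1 := hg h (P.U_anti (le_max_left _ _) hh)
    have h2 : c (g⁻¹ * h * g) = 1 := hM' _ (le_max_right _ _) _ hh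
    rw [hcc'] at h2
    rwa [h2, mul_one] at h1

lemma IsType.map_mem_eigen (hΘ : P.IsType Θ) {g : G} (hg : g ∈ P.J) {v : V}
    (hv : v ∈ eigen π Θ) : π g v ∈ eigen π Θ := fun h => by
  have e : (h : G) * g = g * (g⁻¹ * h * g) := by group
  rw [← Module.End.mul_apply, ← map_mul, e, map_mul, Module.End.mul_apply,
    hv ⟨_, conj_inv_mem_H hg h.2⟩, hΘ.conj_inv hg h.2, map_smul]

lemma IsType.map_mem_defect (hΘ : P.IsType Θ) {g : G} (hg : g ∈ P.J) {v : V}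
    (hv : v ∈ defect π Θ) : π g v ∈ defect π Θ := by
  refine Submodule.mem_comap.1 (Submodule.span_le.2 ?_ hv)
  rintro _ ⟨h, w, rfl⟩
  refine Submodule.subset_span ⟨⟨g * h * g⁻¹, P.conj_mem_H g hg h h.2⟩, π g w, ?_⟩
  rw [hΘ.conj g hg h h.2]
  simp

/-- Translates of eigenvectors by elements that do not intertwine the type project to zero. -/
lemma IsType.map_mem_defect_of_notMem (hΘ : P.IsType Θ) {g : G} (hg : g ∉ P.J) {v : V}
    (hv : v ∈ eigen π Θ) : π g v ∈ defect π Θ := by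
  by_contra hne
  refine hg (hΘ.mem_J g fun h hh hh' => by_contra fun hne' => hne ?_)
  have h1 : π h (π g v) - (Θ ⟨h, hh⟩ : Ω) • π g v ∈ defect π Θ :=
    Submodule.subset_span ⟨⟨h, hh⟩, _, rfl⟩
  have e : π h (π g v) = (Θ ⟨_, hh'⟩ : Ω) • π g v := by
    have e : h * g = g * (g⁻¹ * h * g) := by group
    rw [← Module.End.mul_apply, ← map_mul, e, map_mul, Module.End.mul_apply, hv ⟨_, hh'⟩, map_smul]
  rw [e, ← sub_smul] at h1
  refine (Submodule.smul_mem_iff _ ?_).1 h1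
  rw [sub_ne_zero]
  exact fun h => hne' (Units.ext h.symm)

variable (π) in
/-- The representation of `J` on the eigenspace of a type. -/
def eigenRep (hΘ : P.IsType Θ) : Representation Ω P.J (eigen π Θ) where
  toFun g := (π g).restrict fun _ hv => hΘ.map_mem_eigen g.2 hv
  map_one' := by ext v; simp
  map_mul' x y := by ext v; simp

lemma coe_eigenRep (hΘ : P.IsType Θ) (g : P.J) (v : eigen π Θ) :
    (eigenRep π hΘ g v : V) = π g v := rfl

lemma eigenRep_apply_H (hΘ : P.IsType Θ) {h : G} (hh : h ∈ P.H) (v : eigen π Θ) :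
    eigenRep π hΘ ⟨h, P.H_le_J hh⟩ v = (Θ ⟨h, hh⟩ : Ω) • v :=
  Subtype.ext (v.2 ⟨h, hh⟩)

variable [CharZero Ω]

/-- The projection to the eigenspace of a type. -/
noncomputable def eigenProj (hπ : IsSmooth π) (hΘ : P.IsType Θ) : V →ₗ[Ω] eigen π Θ :=
  Submodule.projectionOnto _ _ (isCompl_eigen_defect hπ hΘ.smooth)

lemma eigenProj_of_mem (hπ : IsSmooth π) (hΘ : P.IsType Θ) (v : eigen π Θ) :
    eigenProj hπ hΘ (v : V) = v := Submodule.projectionOnto_apply_left _ v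

lemma eigenProj_eq_zero (hπ : IsSmooth π) (hΘ : P.IsType Θ) {v : V} :
    eigenProj hπ hΘ v = 0 ↔ v ∈ defect π Θ := Submodule.projectionOnto_apply_eq_zero_iff _

lemma eigenProj_map (hπ : IsSmooth π) (hΘ : P.IsType Θ) (g : P.J) (v : V) :
    eigenProj hπ hΘ (π g v) = eigenRep π hΘ g (eigenProj hπ hΘ v) := by
  have h1 : v - eigenProj hπ hΘ v ∈ defect π Θ := by
    rw [← eigenProj_eq_zero hπ hΘ, map_sub, eigenProj_of_mem, sub_self]
  have h2 := (eigenProj_eq_zero hπ hΘ).2 (hΘ.map_mem_defect g.2 h1)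
  rw [map_sub, map_sub, ← coe_eigenRep, eigenProj_of_mem, sub_eq_zero] at h2
  exact h2

lemma eigenProj_map_of_notMem (hπ : IsSmooth π) (hΘ : P.IsType Θ) {g : G} (hg : g ∉ P.J)
    (v : eigen π Θ) : eigenProj hπ hΘ (π g v) = 0 :=
  (eigenProj_eq_zero hπ hΘ).2 (hΘ.map_mem_defect_of_notMem hg v.2)

/-- The eigenspace of a type in an irreducible representation of `G` is irreducible for `J`. -/
lemma isIrreducible_eigenRep (hπ : IsSmooth π) (hirr : π.IsIrreducible) (hΘ : P.IsType Θ)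
    (h0 : eigen π Θ ≠ ⊥) : (eigenRep π hΘ).IsIrreducible := by
  rw [isIrreducible_iff]
  refine ⟨Submodule.nontrivial_iff_ne_bot.2 h0, fun p hp => or_iff_not_imp_left.2 fun hp0 => ?_⟩
  obtain ⟨v₀, hv₀, h0⟩ := Submodule.exists_mem_ne_zero_of_ne_bot hp0
  have htop := span_orbit_eq_top hirr (p := Subtype.val '' (p : Set (eigen π Θ)))
    ⟨v₀, ⟨v₀, hv₀, rfl⟩, fun h => h0 (Subtype.ext h)⟩
  have hle : ⊤ ≤ p.comap (eigenProj hπ hΘ) := by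
    rw [← htop, Submodule.span_le]
    rintro _ ⟨g, _, ⟨v, hv, rfl⟩, rfl⟩
    change eigenProj hπ hΘ (π g v) ∈ p
    by_cases hg : g ∈ P.J
    · have := eigenProj_map hπ hΘ ⟨g, hg⟩ v
      rw [eigenProj_of_mem] at this
      exact this ▸ hp _ _ hv
    · rw [eigenProj_map_of_notMem hπ hΘ hg]
      exact p.zero_mem
  refine eq_top_iff.2 fun w _ => ?_
  rw [← eigenProj_of_mem hπ hΘ w]
  exact hle Submodule.mem_top

lemma finiteDimensional_eigen [IsAlgClosed Ω] (hπ : IsSmooth π) (hirr : π.IsIrreducible)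
    (hΘ : P.IsType Θ) (h0 : eigen π Θ ≠ ⊥) : FiniteDimensional Ω (eigen π Θ) := by
  obtain ⟨z, S, hS, hSJ, hz, hzc, hc⟩ := P.exists_cover_J
  refine finiteDimensional_of_irreducible (isIrreducible_eigenRep hπ hirr hΘ h0) ⟨z, hz⟩
    (fun g => Subtype.ext (hzc g)) ((↑) ⁻¹' S) (hS.preimage Subtype.val_injective.injOn) ?_
  intro g
  obtain ⟨k, s, hs, h, hh, e⟩ := hc g g.2
  exact ⟨k, ⟨s, hSJ hs⟩, hs, ⟨h, P.H_le_J hh⟩, ⟨_, eigenRep_apply_H hΘ hh⟩, Subtype.ext e⟩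

section Ind

variable [IsTopologicalGroup G]
variable {W : Type*} [AddCommGroup W] [Module Ω W] {σ : Representation Ω P.J W}

/-- `σ` is a representation of `J` on which `H` acts by the character `Θ`. -/
def LiesOver (σ : Representation Ω P.J W) (Θ : P.H →* Ωˣ) : Prop :=
  ∀ (h : G) (hh : h ∈ P.H), σ ⟨h, P.H_le_J hh⟩ = (Θ ⟨h, hh⟩ : Ω) • 1

open Classical in
/-- The function in the induced representation that is supported on `J` and has a given value
at `1`. -/
noncomputable def bump (hΘ : P.IsType Θ) (hσ : LiesOver σ Θ) : W →ₗ[Ω] indSpace σ where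
  toFun w := ⟨fun g => if hg : g ∈ P.J then σ ⟨g, hg⟩ w else 0, by
    constructor
    · intro h g
      by_cases hg : g ∈ P.J
      · have hg' : (h : G) * g ∈ P.J := P.J.mul_mem h.2 hg
        simp only [dif_pos hg, dif_pos hg']
        rw [← Module.End.mul_apply, ← map_mul]
        rfl
      · have hg' : (h : G) * g ∉ P.J := fun h' => hg ((P.J.mul_mem_cancel_left h.2).1 h')
        simp only [dif_neg hg, dif_neg hg', map_zero]
    · obtain ⟨N, hN⟩ := hΘ.smooth
      filter_upwards [P.U_mem_nhds N] with u hu g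
      have huH := P.U_le_H N hu
      by_cases hg : g ∈ P.J
      · have hg' : g * u ∈ P.J := P.J.mul_mem hg (P.H_le_J huH)
        simp only [dif_pos hg, dif_pos hg']
        have e : (⟨g * u, hg'⟩ : P.J) = ⟨g, hg⟩ * ⟨u, P.H_le_J huH⟩ := rfl
        rw [e, map_mul, Module.End.mul_apply, hσ u huH, hN ⟨u, huH⟩ hu]
        simp
      · have hg' : g * u ∉ P.J := fun h' => hg ((P.J.mul_mem_cancel_right (P.H_le_J huH)).1 h')
        simp only [dif_neg hg, dif_neg hg']⟩
  map_add' x y := by ext g; by_cases hg : g ∈ P.J <;> simp [hg]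
  map_smul' c x := by ext g; by_cases hg : g ∈ P.J <;> simp [hg]

variable {hΘ : P.IsType Θ} {hσ : LiesOver σ Θ}

lemma bump_apply_of_mem (w : W) {g : G} (hg : g ∈ P.J) :
    (bump hΘ hσ w).1 g = σ ⟨g, hg⟩ w := dif_pos hg

lemma bump_apply_of_notMem (w : W) {g : G} (hg : g ∉ P.J) : (bump hΘ hσ w).1 g = 0 := dif_neg hg

lemma bump_one (w : W) : (bump hΘ hσ w).1 1 = w := by
  rw [bump_apply_of_mem w P.J.one_mem]
  exact LinearMap.congr_fun (map_one σ) w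

lemma bump_injective : Function.Injective (bump hΘ hσ) := fun w w' h => by
  rw [← bump_one (hΘ := hΘ) (hσ := hσ) w, h, bump_one]

lemma ind_bump (j : P.J) (w : W) : ind σ (j : G) (bump hΘ hσ w) = bump hΘ hσ (σ j w) := by
  refine Subtype.ext (funext fun g => ?_)
  change (bump hΘ hσ w).1 (g * j) = _
  by_cases hg : g ∈ P.J
  · rw [bump_apply_of_mem _ hg, bump_apply_of_mem _ (P.J.mul_mem hg j.2), ← Module.End.mul_apply,
      ← map_mul]
    rfl
  · rw [bump_apply_of_notMem _ hg, bump_apply_of_notMem _ fun h' =>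
      hg ((P.J.mul_mem_cancel_right j.2).1 h')]

/-- The induced representation is generated by the functions supported on `J`. -/
lemma mem_of_bump_mem (hΘ : P.IsType Θ) (hσ : LiesOver σ Θ) (p : Submodule Ω (indSpace σ))
    (hp : ∀ g, ∀ f ∈ p, ind σ g f ∈ p) (hb : ∀ w, bump hΘ hσ w ∈ p) (f : indSpace σ) :
    f ∈ p := by
  classical
  obtain ⟨N, hN⟩ := P.exists_U _ f.2.2
  obtain ⟨S, hS, hS'⟩ := hΘ.support N
  -- induction on the number of cosets of `J` in the support of `f`: subtract a translated bump
  have key : ∀ T : Finset G, ∀ f : indSpace σ,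
      (∀ g, f.1 g ≠ 0 → ∃ s ∈ T, ∃ j ∈ P.J, g = j * s) → f ∈ p := by
    intro T
    induction T using Finset.induction_on with
    | empty =>
      intro f hf
      have : f = 0 := Subtype.ext (funext fun g => by_contra fun h => by simpa using hf g h)
      rw [this]; exact p.zero_mem
    | insert s T hs ih =>
      intro f hf
      have h1 : ∀ g, (f - ind σ s⁻¹ (bump hΘ hσ (f.1 s))).1 g =
          f.1 g - (bump hΘ hσ (f.1 s)).1 (g * s⁻¹) := fun g => rfl
      have h2 : f - ind σ s⁻¹ (bump hΘ hσ (f.1 s)) ∈ p := by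
        refine ih _ fun g hg => ?_
        rw [h1] at hg
        by_cases hgs : g * s⁻¹ ∈ P.J
        · refine absurd ?_ hg
          rw [bump_apply_of_mem _ hgs, ← f.2.1, inv_mul_cancel_right, sub_self]
        · rw [bump_apply_of_notMem _ hgs, sub_zero] at hg
          obtain ⟨t, ht, j, hj, e⟩ := hf g hg
          rcases Finset.mem_insert.1 ht with rfl | ht
          · exact absurd (by rw [e, mul_inv_cancel_right]; exact hj) hgs
          · exact ⟨t, ht, j, hj, e⟩
      have := p.add_mem h2 (hp s⁻¹ _ (hb (f.1 s)))
      rwa [sub_add_cancel] at this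
  refine key hS.toFinset f fun g hg => ?_
  -- if `f g ≠ 0`, then `Θ` is trivial on the elements of `H` that `g` conjugates into `U N`
  obtain ⟨s, hs, h⟩ := hS' g fun h hh => by
    have h1 : f.1 (g * (g⁻¹ * h * g)) = f.1 g := hN hh g
    have e : g * (g⁻¹ * h * g) = h * g := by group
    rw [e, f.2.1 ⟨h, P.H_le_J h.2⟩ g, hσ h h.2] at h1
    have h2 : ((Θ h : Ω) - 1) • f.1 g = 0 := by
      rw [sub_smul, one_smul, sub_eq_zero]; exact h1
    exact Units.ext (sub_eq_zero.1 ((smul_eq_zero.1 h2).resolve_right hg))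
  exact ⟨s, hS.mem_toFinset.2 hs, h⟩

lemma liesOver_eigenRep (hΘ : P.IsType Θ) : LiesOver (eigenRep π hΘ) Θ := fun _ hh =>
  LinearMap.ext (eigenRep_apply_H hΘ hh)

/-- An irreducible smooth representation that contains a type is induced from the eigenspace. -/
lemma nonempty_equiv_ind (hπ : IsSmooth π) (hirr : π.IsIrreducible) (hΘ : P.IsType Θ)
    (h0 : eigen π Θ ≠ ⊥) : Nonempty (π.Equiv (ind (eigenRep π hΘ))) := by
  let f := frobeniusLift hπ (eigenProj hπ hΘ) (eigenProj_map hπ hΘ)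
  have hb (w : eigen π Θ) : f w = bump hΘ (liesOver_eigenRep hΘ) w :=
    Subtype.ext (funext fun g => by
      change eigenProj hπ hΘ (π g w) = _
      by_cases hg : g ∈ P.J
      · rw [bump_apply_of_mem _ hg]
        have := eigenProj_map hπ hΘ ⟨g, hg⟩ w
        rwa [eigenProj_of_mem] at this
      · rw [bump_apply_of_notMem _ hg, eigenProj_map_of_notMem hπ hΘ hg])
  obtain ⟨v, hv, hv0⟩ := Submodule.exists_mem_ne_zero_of_ne_bot h0
  have hinj := (Representation.IsIrreducible.injective_or_eq_zero f).resolve_right fun h => hv0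
    (congrArg Subtype.val (bump_injective (a₁ := ⟨v, hv⟩) (a₂ := 0) (by rw [← hb, h, map_zero]; rfl)))
  exact ⟨f.ofBijective ⟨hinj, fun x => mem_of_bump_mem hΘ (liesOver_eigenRep hΘ) f.range.toSubmodule
    (fun g x hx => f.range.apply_mem_toSubmodule g hx) (fun w => ⟨(w : V), hb w⟩) x⟩⟩

/-- A representation over a type that embeds into an irreducible representation of `G` is the
eigenspace. -/
lemma nonempty_equiv_eigenRep_of_injective [Nontrivial W] (hπ : IsSmooth π)
    (hirr : π.IsIrreducible) (hΘ : P.IsType Θ) (hσ : LiesOver σ Θ) (f : W →ₗ[Ω] V)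
    (hf : Function.Injective f) (heq : ∀ (g : P.J) w, f (σ g w) = π (g : G) (f w)) :
    eigen π Θ ≠ ⊥ ∧ Nonempty (σ.Equiv (eigenRep π hΘ)) := by
  let k : Representation.IntertwiningMap σ (eigenRep π hΘ) :=
    (f.codRestrict (eigen π Θ) fun w h => by
      rw [← heq ⟨h, P.H_le_J h.2⟩, hσ h h.2]; simp).intertwiningMap_of_isIntertwiningMap _ _
        fun g w => Subtype.ext (heq g w)
  have hk : Function.Injective k := fun w w' h => hf (congrArg Subtype.val h)
  obtain ⟨w, hw⟩ := exists_ne (0 : W)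
  have hkw : k w ≠ 0 := fun h => hw (hk (h.trans (map_zero k).symm))
  have h0 : eigen π Θ ≠ ⊥ := Submodule.ne_bot_iff _ |>.2
    ⟨k w, (k w).2, fun h => hkw (Subtype.ext h)⟩
  have := isIrreducible_eigenRep hπ hirr hΘ h0
  exact ⟨h0, ⟨k.ofBijective ⟨hk, (Representation.IsIrreducible.surjective_or_eq_zero k).resolve_right
    fun h => hkw (by rw [h]; rfl)⟩⟩⟩

/-- If an irreducible representation is induced from a representation over a type, the latter is the
eigenspace. -/
lemma nonempty_equiv_eigenRep (hπ : IsSmooth π) (hirr : π.IsIrreducible) (hΘ : P.IsType Θ)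
    (hσ : LiesOver σ Θ) (e : π.Equiv (ind σ)) :
    eigen π Θ ≠ ⊥ ∧ Nonempty (σ.Equiv (eigenRep π hΘ)) := by
  have hW : Nontrivial W := by
    by_contra hW
    rw [not_nontrivial_iff_subsingleton] at hW
    have : Subsingleton (indSpace σ) := ⟨fun f g => Subtype.ext (funext fun _ => Subsingleton.elim _ _)⟩
    have := ((isIrreducible_iff π).1 hirr).1
    exact not_subsingleton V e.toLinearEquiv.toEquiv.subsingleton
  refine nonempty_equiv_eigenRep_of_injective hπ hirr hΘ hσ
    (e.symm.toLinearEquiv.toLinearMap ∘ₗ bump hΘ hσ)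
    (e.symm.toLinearEquiv.injective.comp bump_injective) fun g w => ?_
  exact (congrArg e.symm (ind_bump g w).symm).trans
    (Representation.IntertwiningMap.isIntertwining _ _ e.symm.toIntertwiningMap (g : G) _)

end Ind

end OpenPair

/-! ### Duals and twists of induced representations -/

section Functoriality

variable {Ω G : Type*} [Field Ω] [Group G] [TopologicalSpace G] [IsTopologicalGroup G]

lemma equiv_map_rep {G : Type*} [Monoid G] {V W : Type*} [AddCommMonoid V] [Module Ω V]
    [AddCommMonoid W] [Module Ω W]
    {ρ : Representation Ω G V} {σ : Representation Ω G W} (e : ρ.Equiv σ) (g : G) (v : V) :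
    e (ρ g v) = σ g (e v) := Representation.IntertwiningMap.isIntertwining _ _ e.toIntertwiningMap g v

section

variable {V W : Type*} [AddCommGroup V] [Module Ω V] [AddCommGroup W] [Module Ω W]

lemma isIrreducible_of_equiv {G : Type*} [Group G] {ρ : Representation Ω G V}
    {σ : Representation Ω G W} (h : ρ.IsIrreducible) (e : ρ.Equiv σ) : σ.IsIrreducible := by
  rw [isIrreducible_iff] at h ⊢
  have := h.1
  have hinj := Submodule.comap_injective_of_surjective (f := e.toLinearEquiv.toLinearMap)
    e.toLinearEquiv.surjective
  refine ⟨e.symm.toLinearEquiv.toEquiv.nontrivial, fun p hp => (h.2 (p.comap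
    e.toLinearEquiv.toLinearMap) fun g v hv => ?_).imp (fun h => hinj (h.trans ?_)) fun h => hinj h⟩
  · exact Set.mem_of_eq_of_mem (s := (p : Set W)) (equiv_map_rep e g v) (hp g _ hv)
  · exact e.toLinearEquiv.ker.symm

/-- Composition with an equivalence, as a map of induced representations. -/
def indMap {H : Subgroup G} {σ : Representation Ω H V} {σ' : Representation Ω H W}
    (e : σ.Equiv σ') : indSpace σ →ₗ[Ω] indSpace σ' where
  toFun f := ⟨fun g => e (f.1 g), fun h g => by dsimp only; rw [f.2.1, equiv_map_rep],
    f.2.2.mono fun u hu g => congrArg e (hu g)⟩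
  map_add' f f' := Subtype.ext (funext fun g => map_add e.toLinearEquiv _ _)
  map_smul' c f := Subtype.ext (funext fun g => map_smul e.toLinearEquiv _ _)

lemma nonempty_ind_equiv {H : Subgroup G} {σ : Representation Ω H V} {σ' : Representation Ω H W}
    (e : σ.Equiv σ') : Nonempty ((ind σ).Equiv (ind σ')) :=
  ⟨.mk (LinearEquiv.ofLinearMap (indMap e) (indMap e.symm)
    (LinearMap.ext fun _ => Subtype.ext (funext fun _ => e.apply_symm_apply _))
    (LinearMap.ext fun _ => Subtype.ext (funext fun _ => e.symm_apply_apply _))) fun _ => rfl⟩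

lemma dual_apply_apply {G : Type*} [Group G] {V : Type*} [AddCommGroup V] [Module Ω V]
    (ρ : Representation Ω G V) (g : G)
    (l : Module.Dual Ω V) (v : V) : ρ.dual g l v = l (ρ g⁻¹ v) := rfl

/-- The transpose of an equivalence, as a map of smooth duals. -/
def smoothDualMap {ρ : Representation Ω G V} {σ : Representation Ω G W} (e : ρ.Equiv σ) :
    Representation.IntertwiningMap (contragredient σ) (contragredient ρ) :=
  have key (g : G) (l : Module.Dual Ω W) : ρ.dual g (l ∘ₗ e.toLinearEquiv.toLinearMap) =
      σ.dual g l ∘ₗ e.toLinearEquiv.toLinearMap := LinearMap.ext fun w =>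
    congrArg l (equiv_map_rep e g⁻¹ w)
  LinearMap.intertwiningMap_of_isIntertwiningMap (V := smoothDualSpace σ) (W := smoothDualSpace ρ) _ _
    { toFun := fun l => ⟨l.1 ∘ₗ e.toLinearEquiv.toLinearMap, by
        filter_upwards [l.2] with u hu
        rw [key, hu]⟩
      map_add' := fun f f' => rfl
      map_smul' := fun c f => rfl } fun g l => Subtype.ext (key g l.1).symm

lemma nonempty_contragredient_equiv {ρ : Representation Ω G V} {σ : Representation Ω G W}
    (e : ρ.Equiv σ) : Nonempty ((contragredient ρ).Equiv (contragredient σ)) :=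
  ⟨(smoothDualMap e.symm).ofBijective ⟨fun l l' h => Subtype.ext (LinearMap.ext fun w => by
      rw [← e.symm_apply_apply w]
      exact LinearMap.congr_fun (congrArg Subtype.val h) (e w)),
    fun l => ⟨smoothDualMap e l, Subtype.ext (LinearMap.ext fun w =>
      congrArg l.1 (e.apply_symm_apply w))⟩⟩⟩

end

lemma twist_apply {G : Type*} [Group G] {V : Type*} [AddCommGroup V] [Module Ω V]
    (c : G →* Ωˣ) (π : Representation Ω G V) (g : G) (v : V) :
    twist c π g v = (c g : Ω) • π g v := rfl

/-- Multiplication by a smooth character `c`, as a map of induced representations. -/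
def twistInd {H : Subgroup G} {W : Type*} [AddCommGroup W] [Module Ω W]
    {σ σ' : Representation Ω H W} {c : G →* Ωˣ} (hc : IsSmoothChar c)
    (h : ∀ h w, σ' h w = (c h : Ω) • σ h w) : indSpace σ →ₗ[Ω] indSpace σ' where
  toFun f := ⟨fun g => (c g : Ω) • f.1 g, fun k g => by
    dsimp only
    rw [f.2.1, h, map_smul, smul_smul, map_mul, Units.val_mul], by
    filter_upwards [f.2.2, hc.mem_nhds c.ker.one_mem] with u hu (hu' : c u = 1) g
    rw [map_mul, hu', mul_one, hu g]⟩
  map_add' f f' := Subtype.ext (funext fun g => smul_add _ _ _)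
  map_smul' a f := Subtype.ext (funext fun g => smul_comm _ _ _)

lemma nonempty_twist_ind_equiv {H : Subgroup G} {W : Type*} [AddCommGroup W] [Module Ω W]
    (σ : Representation Ω H W) {c : G →* Ωˣ} (hc : IsSmoothChar c) :
    Nonempty ((twist c (ind σ)).Equiv (ind (twist (c.comp H.subtype) σ))) := by
  have hc' : IsSmoothChar c⁻¹ := by
    have : (c⁻¹).ker = c.ker := by ext; simp [MonoidHom.mem_ker]
    rwa [IsSmoothChar, this]
  refine ⟨.mk (LinearEquiv.ofLinearMap (M := indSpace σ)
    (M₂ := indSpace (twist (c.comp H.subtype) σ)) (twistInd hc fun h w => rfl)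
    (twistInd hc' fun h w => ?_)
    (LinearMap.ext fun f => Subtype.ext (funext fun g => smul_inv_smul (c g) (f.1 g)))
    (LinearMap.ext fun f => Subtype.ext (funext fun g => inv_smul_smul (c g) (f.1 g))))
    fun g => LinearMap.ext fun f => Subtype.ext (funext fun x => ?_)⟩
  · exact (inv_smul_smul (c h) (σ h w)).symm
  · change (c x : Ω) • (c g : Ω) • f.1 (x * g) = (c (x * g) : Ω) • f.1 (x * g)
    rw [smul_smul, map_mul, Units.val_mul]

end Functoriality

namespace OpenPair

variable {Ω G : Type*} [Field Ω] [Group G] [TopologicalSpace G] [IsTopologicalGroup G]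
  {P : OpenPair G} {V : Type*} [AddCommGroup V] [Module Ω V] {π : Representation Ω G V}
variable {Θ : P.H →* Ωˣ}
variable [CharZero Ω]
variable {W : Type*} [AddCommGroup W] [Module Ω W] {σ : Representation Ω P.J W}

/-- The dual of a representation over `Θ` lies over `Θ⁻¹`. -/
lemma LiesOver.dual (hσ : LiesOver σ Θ) : LiesOver σ.dual Θ⁻¹ := fun h hh => by
  ext l w
  rw [dual_apply_apply]
  have e : (⟨h, P.H_le_J hh⟩ : P.J)⁻¹ = ⟨h⁻¹, P.H_le_J (P.H.inv_mem hh)⟩ := rfl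
  have e' : (⟨h⁻¹, P.H.inv_mem hh⟩ : P.H) = (⟨h, hh⟩ : P.H)⁻¹ := rfl
  rw [e, hσ _ (P.H.inv_mem hh), e', map_inv]
  simp

/-- A linear functional on `W`, composed with evaluation at `1`, as a vector of the contragredient
of the induced representation. -/
noncomputable def evalDual (hΘ : P.IsType Θ) (hσ : LiesOver σ Θ) :
    Module.Dual Ω W →ₗ[Ω] smoothDualSpace (ind σ) where
  toFun l := ⟨{ toFun := fun f => l (f.1 1)
                map_add' := fun f f' => map_add l _ _
                map_smul' := fun a f => map_smul l _ _ }, by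
    obtain ⟨N, hN⟩ := hΘ.smooth
    filter_upwards [P.U_mem_nhds N] with u hu
    have huH := P.U_le_H N ((P.U N).inv_mem hu)
    ext f
    change l (f.1 (1 * u⁻¹)) = l (f.1 1)
    have := f.2.1 ⟨u⁻¹, P.H_le_J huH⟩ 1
    rw [mul_one, hσ _ huH, hN _ ((P.U N).inv_mem hu)] at this
    rw [one_mul, this]
    simp⟩
  map_add' l l' := rfl
  map_smul' a l := rfl

variable {hΘ : P.IsType Θ} {hσ : LiesOver σ Θ}

lemma evalDual_apply (l : Module.Dual Ω W) (f : indSpace σ) : (evalDual hΘ hσ l).1 f = l (f.1 1) :=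
  rfl

lemma evalDual_injective : Function.Injective (evalDual hΘ hσ) := fun l l' h => by
  ext w
  have := LinearMap.congr_fun (congrArg Subtype.val h) (bump hΘ hσ w)
  rwa [evalDual_apply, evalDual_apply, bump_one] at this

lemma contragredient_evalDual (j : P.J) (l : Module.Dual Ω W) :
    contragredient (ind σ) (j : G) (evalDual hΘ hσ l) = evalDual hΘ hσ (σ.dual j l) := by
  apply Subtype.ext
  ext f
  change l (f.1 (1 * (j : G)⁻¹)) = l (σ j⁻¹ (f.1 1))
  have h := f.2.1 j⁻¹ 1
  rw [mul_one] at h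
  rw [one_mul, ← h]
  rfl

/-- If `π` is the contragredient of a representation induced from a representation over a type,
the dual of the latter is the eigenspace of the inverse type in `π`. -/
lemma nonempty_dual_equiv_eigenRep [Nontrivial W] (hπ : IsSmooth π) (hirr : π.IsIrreducible)
    (hΘ : P.IsType Θ) (hσ : LiesOver σ Θ) (e : π.Equiv (contragredient (ind σ))) :
    eigen π Θ⁻¹ ≠ ⊥ ∧ Nonempty (σ.dual.Equiv (eigenRep π hΘ.inv)) :=
  nonempty_equiv_eigenRep_of_injective hπ hirr hΘ.inv hσ.dual
    (e.symm.toLinearEquiv.toLinearMap ∘ₗ evalDual hΘ hσ)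
    (e.symm.toLinearEquiv.injective.comp evalDual_injective) fun g w =>
      (congrArg e.symm (contragredient_evalDual g w).symm).trans (equiv_map_rep e.symm (g : G) _)

/-- The restriction of functionals to the translates of functions supported on `J`, as a map from
the contragredient of an induced representation to the representation induced from the dual. -/
noncomputable def contragredientToInd (hΘ : P.IsType Θ) (hσ : LiesOver σ Θ) :
    smoothDualSpace (ind σ) →ₗ[Ω] indSpace σ.dual where
  toFun l := ⟨fun g => l.1 ∘ₗ ind σ g⁻¹ ∘ₗ bump hΘ hσ, fun h g => by
      ext w
      change l.1 (ind σ (h * g)⁻¹ (bump hΘ hσ w)) = l.1 (ind σ g⁻¹ (bump hΘ hσ (σ h⁻¹ w)))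
      rw [mul_inv_rev, map_mul, Module.End.mul_apply, ← ind_bump]
      rfl, by
    filter_upwards [l.2] with u hu g
    ext w
    have h1 := LinearMap.congr_fun hu (ind σ g⁻¹ (bump hΘ hσ w))
    change l.1 (ind σ (g * u)⁻¹ (bump hΘ hσ w)) = l.1 (ind σ g⁻¹ (bump hΘ hσ w))
    rw [← h1, mul_inv_rev, map_mul, Module.End.mul_apply]
    rfl⟩
  map_add' l l' := rfl
  map_smul' a l := rfl

/-- If the eigenspace of the inverse of a type in `π` is the dual of a representation `σ`, then
`π` is the contragredient of the representation induced from `σ`. -/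
lemma nonempty_equiv_contragredient_ind [Nontrivial W] (hπ : IsSmooth π) (hirr : π.IsIrreducible)
    (hΘ : P.IsType Θ) (hσ : LiesOver σ Θ) (h0 : eigen π Θ⁻¹ ≠ ⊥)
    (e : σ.dual.Equiv (eigenRep π hΘ.inv)) : Nonempty (π.Equiv (contragredient (ind σ))) := by
  obtain ⟨e1⟩ := nonempty_equiv_ind hπ hirr hΘ.inv h0
  obtain ⟨e2⟩ := nonempty_ind_equiv e.symm
  have e3 : π.Equiv (ind σ.dual) := e1.trans e2
  have hir := isIrreducible_of_equiv (W := ↥(indSpace σ.dual)) hirr e3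
  let f := (contragredientToInd hΘ hσ).intertwiningMap_of_isIntertwiningMap
    (contragredient (ind σ)) (ind σ.dual) fun g l => Subtype.ext (funext fun x => by
      ext w
      change l.1 (ind σ g⁻¹ (ind σ x⁻¹ (bump hΘ hσ w))) = l.1 (ind σ (x * g)⁻¹ (bump hΘ hσ w))
      rw [mul_inv_rev, map_mul, Module.End.mul_apply])
  have hinj : Function.Injective f := by
    intro l l' hl
    have hz (g : G) (w : W) : l.1 (ind σ g (bump hΘ hσ w)) = l'.1 (ind σ g (bump hΘ hσ w)) := by
      have : l.1 (ind σ g⁻¹⁻¹ (bump hΘ hσ w)) = l'.1 (ind σ g⁻¹⁻¹ (bump hΘ hσ w)) :=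
        LinearMap.congr_fun (congrFun (congrArg Subtype.val hl) g⁻¹) w
      rwa [inv_inv] at this
    have htop (x : indSpace σ) := mem_of_bump_mem hΘ hσ
      (Submodule.span Ω {f | ∃ g w, f = ind σ g (bump hΘ hσ w)}) (fun g f hf => by
        refine Submodule.mem_comap.1 (Submodule.span_le.2 ?_ hf)
        rintro _ ⟨g', w, rfl⟩
        exact Submodule.subset_span ⟨g * g', w, by rw [map_mul]; rfl⟩)
      (fun w => Submodule.subset_span ⟨1, w, by rw [map_one]; rfl⟩) x
    refine Subtype.ext (LinearMap.ext_on (eq_top_iff.2 fun x _ => htop x) ?_)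
    rintro _ ⟨g, w, rfl⟩
    exact hz g w
  have hsurj := (Representation.IsIrreducible.surjective_or_eq_zero (V := indSpace σ.dual)
    (W := smoothDualSpace (ind σ)) f).resolve_right fun h => by
    obtain ⟨l, hl⟩ := exists_ne (0 : Module.Dual Ω W)
    exact hl (evalDual_injective (hΘ := hΘ) (hσ := hσ) (hinj (by rw [h]; rfl)))
  exact ⟨e3.trans (f.ofBijective ⟨hinj, hsurj⟩).symm⟩

end OpenPair

/-! ### Equivalences of twists and duals -/

section Equivalences

variable {Ω G : Type*} [Field Ω] [Group G]
variable {V W : Type*} [AddCommGroup V] [Module Ω V] [AddCommGroup W] [Module Ω W]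

lemma _root_.TameTypes.OpenPair.LiesOver.equiv [TopologicalSpace G] [IsTopologicalGroup G]
    {P : OpenPair G} {σ : Representation Ω P.J V} {σ' : Representation Ω P.J W} {Θ : P.H →* Ωˣ}
    (h : OpenPair.LiesOver σ Θ) (e : σ.Equiv σ') : OpenPair.LiesOver σ' Θ := by
  intro g hg
  refine LinearMap.ext fun v => ?_
  obtain ⟨w, rfl⟩ := e.toLinearEquiv.surjective v
  refine (equiv_map_rep e _ w).symm.trans ?_
  rw [h g hg]
  exact map_smul e.toLinearEquiv _ _

lemma twist_twist_inv (c : G →* Ωˣ) (ρ : Representation Ω G V) : twist c (twist c⁻¹ ρ) = ρ := by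
  ext g v
  rw [twist_apply, twist_apply, smul_smul, MonoidHom.inv_apply, Units.mul_inv, one_smul]

lemma twist_inv_twist (c : G →* Ωˣ) (ρ : Representation Ω G V) : twist c⁻¹ (twist c ρ) = ρ := by
  ext g v
  rw [twist_apply, twist_apply, smul_smul, MonoidHom.inv_apply, Units.inv_mul, one_smul]

lemma nonempty_dual_equiv {ρ : Representation Ω G V} {σ : Representation Ω G W}
    (e : ρ.Equiv σ) : Nonempty (σ.dual.Equiv ρ.dual) := by
  refine ⟨.mk e.toLinearEquiv.dualMap fun g => LinearMap.ext fun l => LinearMap.ext fun v => ?_⟩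
  change l (σ g⁻¹ (e v)) = l (e (ρ g⁻¹ v))
  rw [equiv_map_rep]

lemma nonempty_dual_dual_equiv [FiniteDimensional Ω V] (ρ : Representation Ω G V) :
    Nonempty (ρ.dual.dual.Equiv ρ) := by
  refine ⟨Representation.Equiv.symm (.mk (Module.evalEquiv Ω V) fun g =>
    LinearMap.ext fun v => LinearMap.ext fun l => ?_)⟩
  change l (ρ g v) = l (ρ (g⁻¹)⁻¹ v)
  rw [inv_inv]

/-- A finite-dimensional representation is equivalent to one on a space of column vectors. -/
lemma exists_equiv_fin [FiniteDimensional Ω V] (ρ : Representation Ω G V) :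
    ∃ (d : ℕ) (σ : Representation Ω G (Fin d → Ω)), Nonempty (ρ.Equiv σ) := by
  let b := (Module.finBasis Ω V).equivFun
  refine ⟨_, b.conjRingEquiv.toMonoidHom.comp ρ, ⟨.mk b fun g => LinearMap.ext fun v => ?_⟩⟩
  change b (ρ g v) = b (ρ g (b.symm (b v)))
  rw [b.symm_apply_apply]

end Equivalences

/-! ### Heisenberg representations -/

section Heisenberg

variable {Ω K : Type*} [Field Ω] [Group K] {L N : Subgroup K} [hL : L.Normal]
  [hN : N.Normal] [Finite (L ⧸ N.subgroupOf L)]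
variable {W W₁ W₂ : Type*} [AddCommGroup W] [Module Ω W] [AddCommGroup W₁] [Module Ω W₁]
  [AddCommGroup W₂] [Module Ω W₂]
variable {τ : Representation Ω K W} {τ₁ : Representation Ω K W₁} {τ₂ : Representation Ω K W₂}

/-- A representation of `K` in which the normal subgroup `N` acts by the scalars `c`, such that the
commutator pairing on `L / N` is nondegenerate. -/
structure IsHeisenberg (L N : Subgroup K) (c : K → Ω) (τ : Representation Ω K W) : Prop where
  irreducible : τ.IsIrreducible
  finite : FiniteDimensional Ω W
  scalar : ∀ z ∈ N, τ z = c z • 1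
  pairing : ∀ l ∈ L, l ∉ N → ∃ l' : K, ∃ a : Ω, a ≠ 1 ∧ τ (l' * l * l'⁻¹ * l⁻¹) = a • 1

variable {c : K → Ω}

noncomputable instance : Fintype (L ⧸ N.subgroupOf L) := Fintype.ofFinite _

lemma rep_mul_inv (τ : Representation Ω K W) (k : K) : τ k * τ k⁻¹ = 1 := by
  rw [← map_mul, mul_inv_cancel, map_one]

lemma rep_inv_mul (τ : Representation Ω K W) (k : K) : τ k⁻¹ * τ k = 1 := by
  rw [← map_mul, inv_mul_cancel, map_one]

lemma IsHeisenberg.trace_eq_zero (h : IsHeisenberg L N c τ) {l : K} (hl : l ∈ L) (hl' : l ∉ N) :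
    LinearMap.trace Ω W (τ l) = 0 := by
  obtain ⟨l', a, ha, e⟩ := h.pairing l hl hl'
  have h2 : LinearMap.trace Ω W (τ (l' * l * l'⁻¹)) = LinearMap.trace Ω W (τ l) := by
    rw [map_mul, LinearMap.trace_mul_comm, ← map_mul, inv_mul_cancel_left]
  have : l' * l * l'⁻¹ = (l' * l * l'⁻¹ * l⁻¹) * l := by group
  rw [this, map_mul, e, smul_mul_assoc, one_mul, map_smul, smul_eq_mul] at h2
  by_contra hne
  exact ha (mul_right_cancel₀ hne (by rw [one_mul]; exact h2))

variable (L N τ₁ τ₂) in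
/-- The average of a linear map over `L / N`. -/
noncomputable def avgHom (A : W₁ →ₗ[Ω] W₂) : W₁ →ₗ[Ω] W₂ :=
  ∑ q : L ⧸ N.subgroupOf L, τ₂ (q.out : L) ∘ₗ A ∘ₗ τ₁ ((q.out : L) : K)⁻¹

lemma avgHom_summand_congr (h₁ : IsHeisenberg L N c τ₁) (h₂ : IsHeisenberg L N c τ₂)
    (A : W₁ →ₗ[Ω] W₂) {l l' : L} (e : (l : L ⧸ N.subgroupOf L) = l') :
    τ₂ (l : K) ∘ₗ A ∘ₗ τ₁ (l : K)⁻¹ = τ₂ (l' : K) ∘ₗ A ∘ₗ τ₁ (l' : K)⁻¹ := by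
  obtain ⟨z, hz, rfl⟩ : ∃ z : L, (z : K) ∈ N ∧ l * z = l' :=
    ⟨l⁻¹ * l', (QuotientGroup.eq (s := N.subgroupOf L)).1 e, mul_inv_cancel_left _ _⟩
  have := ((isIrreducible_iff _).1 h₁.irreducible).1
  obtain ⟨x, hx⟩ := exists_ne (0 : W₁)
  have hc : c z * c (z : K)⁻¹ = 1 := by
    have h3 := LinearMap.congr_fun (rep_mul_inv τ₁ (z : K)) x
    rw [h₁.scalar _ hz, h₁.scalar _ (N.inv_mem hz), smul_mul_smul_comm, mul_one] at h3
    exact smul_left_injective Ω hx (h3.trans (one_smul Ω x).symm)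
  rw [Subgroup.coe_mul, map_mul, h₂.scalar _ hz, mul_smul_comm, mul_one, mul_inv_rev, map_mul,
    h₁.scalar _ (N.inv_mem hz), smul_mul_assoc, one_mul]
  ext w
  simp only [LinearMap.comp_apply, LinearMap.smul_apply, map_smul, smul_smul,
    mul_comm (c (z : K)⁻¹), hc, one_smul]

/-- The average intertwines the actions of `L`. -/
lemma avgHom_comm (h₁ : IsHeisenberg L N c τ₁) (h₂ : IsHeisenberg L N c τ₂)
    (A : W₁ →ₗ[Ω] W₂) {l : K} (hl : l ∈ L) :
    avgHom L N τ₁ τ₂ A ∘ₗ τ₁ l = τ₂ l ∘ₗ avgHom L N τ₁ τ₂ A := by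
  have key : τ₂ l ∘ₗ avgHom L N τ₁ τ₂ A ∘ₗ τ₁ l⁻¹ = avgHom L N τ₁ τ₂ A := by
    have e0 : τ₂ l ∘ₗ avgHom L N τ₁ τ₂ A ∘ₗ τ₁ l⁻¹ = ∑ q : L ⧸ N.subgroupOf L,
        τ₂ l ∘ₗ (τ₂ (q.out : L) ∘ₗ A ∘ₗ τ₁ ((q.out : L) : K)⁻¹) ∘ₗ τ₁ l⁻¹ := by
      ext w
      simp [avgHom]
    rw [e0, avgHom]
    refine Fintype.sum_equiv (Equiv.mulLeft (QuotientGroup.mk ⟨l, hl⟩)) _ _ fun q => ?_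
    refine Eq.trans ?_ (avgHom_summand_congr h₁ h₂ A (l' := ⟨l, hl⟩ * q.out) (by
      rw [Equiv.coe_mulLeft, QuotientGroup.out_eq', QuotientGroup.mk_mul,
        QuotientGroup.out_eq'])).symm
    rw [Subgroup.coe_mul, mul_inv_rev, map_mul, map_mul]
    rfl
  conv_lhs => rw [← key]
  ext w
  simp only [LinearMap.comp_apply, τ₁.inv_self_apply]

/-- The average of an operator commutes with the centraliser of the operator. -/
lemma avgHom_comm_of_commute (h : IsHeisenberg L N c τ) (A : W →ₗ[Ω] W) {k : K}
    (hk : τ k * A = A * τ k) : avgHom L N τ τ A * τ k = τ k * avgHom L N τ τ A := by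
  let θ : L ≃* L := MulAut.conjNormal k
  have hθ (l : L) : ((θ l : L) : K) = k * l * k⁻¹ := MulAut.conjNormal_apply k l
  have hmem (l : L) : θ l ∈ N.subgroupOf L ↔ l ∈ N.subgroupOf L := by
    rw [Subgroup.mem_subgroupOf, hθ, Subgroup.mem_subgroupOf]
    refine ⟨fun h => ?_, fun h => hN.conj_mem _ h k⟩
    simpa [mul_assoc] using hN.conj_mem _ h k⁻¹
  let q₀ := QuotientGroup.congr (N.subgroupOf L) (N.subgroupOf L) θ <|
    Subgroup.ext fun l => ⟨fun ⟨l', hl', e⟩ => e ▸ (hmem l').2 hl', fun hl =>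
      ⟨θ.symm l, (hmem _).1 (by rwa [θ.apply_symm_apply]), θ.apply_symm_apply l⟩⟩
  have key : τ k * avgHom L N τ τ A * τ k⁻¹ = avgHom L N τ τ A := by
    have e0 : τ k * avgHom L N τ τ A * τ k⁻¹ = ∑ q : L ⧸ N.subgroupOf L,
        τ k * (τ (q.out : L) * (A * τ ((q.out : L) : K)⁻¹)) * τ k⁻¹ := by
      simp only [avgHom, Finset.mul_sum, Finset.sum_mul]
      rfl
    rw [e0, avgHom]
    refine Fintype.sum_equiv q₀.toEquiv _ _ fun q => ?_
    have e : (QuotientGroup.mk (q₀ q).out : L ⧸ N.subgroupOf L) = QuotientGroup.mk (θ q.out) := by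
      rw [QuotientGroup.out_eq']
      conv_lhs => rw [← QuotientGroup.out_eq' q]
      rfl
    refine Eq.trans ?_ (avgHom_summand_congr h h A e).symm
    have e2 : (k * ((q.out : L) : K) * k⁻¹)⁻¹ = k * ((q.out : L) : K)⁻¹ * k⁻¹ := by group
    rw [hθ, e2, ← Module.End.mul_eq_comp, ← Module.End.mul_eq_comp, map_mul, map_mul, map_mul,
      map_mul]
    have h3 : τ k⁻¹ * (A * τ k) = A := by rw [← hk, ← mul_assoc, rep_inv_mul, one_mul]
    conv_lhs => rw [← h3]
    simp only [mul_assoc]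
  conv_lhs => rw [← key]
  rw [mul_assoc, rep_inv_mul, mul_one]

variable [IsAlgClosed Ω]

/-- The average of `τ ζ⁻¹` over `L / N` is a scalar, provided that `K` is generated by `L` and the
centraliser of `ζ`. -/
lemma IsHeisenberg.exists_scalar (h : IsHeisenberg L N c τ) {ζ : K}
    (hK : ∀ k : K, ∃ l ∈ L, ∃ k', ζ * k' = k' * ζ ∧ k = l * k') :
    ∃ s : Ω, avgHom L N τ τ (τ ζ⁻¹) = s • 1 := by
  have := h.finite
  obtain ⟨s, hs⟩ := exists_eq_smul_of_commute h.irreducible (avgHom L N τ τ (τ ζ⁻¹)) (by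
    intro k v
    obtain ⟨l, hl, k', hk', rfl⟩ := hK k
    have h1 : avgHom L N τ τ (τ ζ⁻¹) * τ l = τ l * avgHom L N τ τ (τ ζ⁻¹) :=
      avgHom_comm h h _ hl
    have h2 := avgHom_comm_of_commute h (τ ζ⁻¹) (k := k') (by
      rw [← map_mul, ← map_mul, eq_inv_mul_of_mul_eq (a := k' * ζ⁻¹) (b := ζ) (c := k') (by
        rw [← mul_assoc, hk', mul_inv_cancel_right])])
    refine LinearMap.congr_fun (f := avgHom L N τ τ (τ ζ⁻¹) * τ (l * k'))
      (g := τ (l * k') * avgHom L N τ τ (τ ζ⁻¹)) ?_ v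
    rw [map_mul, ← mul_assoc, h1, mul_assoc, h2, mul_assoc])
  exact ⟨s, LinearMap.ext hs⟩

lemma mul_avgHom (ζ : K) : τ ζ * avgHom L N τ τ (τ ζ⁻¹) =
    ∑ q : L ⧸ N.subgroupOf L, τ (ζ * (q.out : L) * ζ⁻¹ * ((q.out : L) : K)⁻¹) := by
  simp only [avgHom, Finset.mul_sum]
  refine Finset.sum_congr rfl fun q _ => ?_
  rw [map_mul, map_mul, map_mul]
  simp only [← Module.End.mul_eq_comp, mul_assoc]

lemma out_one_mem : (((1 : L ⧸ N.subgroupOf L).out : L) : K) ∈ N := by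
  rw [← Subgroup.mem_subgroupOf, ← QuotientGroup.eq_one_iff, QuotientGroup.out_eq']

lemma IsHeisenberg.trace_mul_avgHom (h : IsHeisenberg L N c τ) {ζ : K}
    (hζ : ∀ l ∈ L, ζ * l * ζ⁻¹ * l⁻¹ ∈ N → l ∈ N) :
    LinearMap.trace Ω W (τ ζ * avgHom L N τ τ (τ ζ⁻¹)) = Module.finrank Ω W := by
  have := h.finite
  rw [mul_avgHom, map_sum, Finset.sum_eq_single 1]
  · have hq : (((1 : L ⧸ N.subgroupOf L).out : L) : K) ∈ N := out_one_mem
    rw [map_mul τ, map_mul τ, map_mul τ, h.scalar _ hq, mul_smul_comm, mul_one, smul_mul_assoc,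
      rep_mul_inv, ← h.scalar _ hq, rep_mul_inv, LinearMap.trace_one]
  · intro q _ hq
    refine h.trace_eq_zero ?_ fun hmem => hq ?_
    · exact L.mul_mem (hL.conj_mem _ (q.out : L).2 ζ) (L.inv_mem (q.out : L).2)
    · rw [← QuotientGroup.out_eq' q, QuotientGroup.eq_one_iff]
      exact hζ _ (q.out : L).2 hmem
  · intro h; exact absurd (Finset.mem_univ _) h

lemma trace_avgHom (ζ : K) : LinearMap.trace Ω W (avgHom L N τ τ (τ ζ⁻¹)) =
    Fintype.card (L ⧸ N.subgroupOf L) * LinearMap.trace Ω W (τ ζ⁻¹) := by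
  rw [avgHom, map_sum, Finset.sum_congr rfl, Finset.sum_const, Finset.card_univ, nsmul_eq_mul]
  intro q _
  rw [← Module.End.mul_eq_comp, LinearMap.trace_mul_comm, ← Module.End.mul_eq_comp, mul_assoc,
    rep_inv_mul, mul_one]

/-- The dimension of a Heisenberg representation, in terms of the traces of an element that
acts on `L / N` without fixed points. -/
lemma IsHeisenberg.finrank_sq (h : IsHeisenberg L N c τ) {ζ : K}
    (hK : ∀ k : K, ∃ l ∈ L, ∃ k', ζ * k' = k' * ζ ∧ k = l * k')
    (hζ : ∀ l ∈ L, ζ * l * ζ⁻¹ * l⁻¹ ∈ N → l ∈ N) :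
    (Module.finrank Ω W : Ω) * Module.finrank Ω W = Fintype.card (L ⧸ N.subgroupOf L) *
      (LinearMap.trace Ω W (τ ζ) * LinearMap.trace Ω W (τ ζ⁻¹)) := by
  obtain ⟨s, hs⟩ := h.exists_scalar hK
  have h1 := h.trace_mul_avgHom hζ
  have h2 := trace_avgHom (L := L) (N := N) (τ := τ) ζ
  have := h.finite
  rw [hs, mul_smul_comm, mul_one, map_smul, smul_eq_mul] at h1
  rw [hs, map_smul, LinearMap.trace_one, smul_eq_mul] at h2
  linear_combination (LinearMap.trace Ω W (τ ζ)) * h2 - (Module.finrank Ω W : Ω) * h1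

variable [CharZero Ω]

/-- Two Heisenberg representations with the same scalars admit a nonzero map that commutes with
`L`, because the operators of `L / N` are linearly independent. -/
lemma exists_avgHom_ne_zero (h₁ : IsHeisenberg L N c τ₁) (h₂ : IsHeisenberg L N c τ₂) :
    ∃ A : W₁ →ₗ[Ω] W₂, avgHom L N τ₁ τ₂ A ≠ 0 := by
  classical
  by_contra! hcon
  have := ((isIrreducible_iff _).1 h₁.irreducible).1
  have := ((isIrreducible_iff _).1 h₂.irreducible).1
  have := h₂.finite
  obtain ⟨x, hx⟩ := exists_ne (0 : W₁)
  obtain ⟨l, hl⟩ : ∃ l : Module.Dual Ω W₁, l x ≠ 0 := by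
    by_contra! h
    exact hx ((Module.forall_dual_apply_eq_zero_iff Ω x).1 h)
  let a : L ⧸ N.subgroupOf L → Ω := fun q => l (τ₁ ((q.out : L) : K)⁻¹ x)
  let q₁ : L ⧸ N.subgroupOf L := 1
  -- averaging all maps of rank one to zero gives a linear relation between the operators `τ₂ q`,
  -- whose traces vanish for `q ≠ 1`; so the coefficient at `q = 1` is zero
  have hB : ∑ q : L ⧸ N.subgroupOf L, a q • τ₂ (q.out : L) = 0 := by
    ext w
    have h3 := LinearMap.congr_fun (hcon (l.smulRight w)) x
    rw [LinearMap.zero_apply] at h3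
    rw [LinearMap.zero_apply, ← h3, avgHom, LinearMap.sum_apply, LinearMap.sum_apply]
    refine Finset.sum_congr rfl fun q _ => ?_
    simp [a]
  have hq : ((q₁.out : L) : K) ∈ N := out_one_mem
  have htr := congrArg (fun T => LinearMap.trace Ω W₂ (T * τ₂ (((q₁.out : L) : K)⁻¹))) hB
  simp only [zero_mul, map_zero, Finset.sum_mul, map_sum] at htr
  rw [Finset.sum_eq_single q₁] at htr
  · rw [smul_mul_assoc, rep_mul_inv, map_smul, LinearMap.trace_one, smul_eq_mul] at htr
    have hne : (Module.finrank Ω W₂ : Ω) ≠ 0 := Nat.cast_ne_zero.2 Module.finrank_pos.ne'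
    have ha : a q₁ = 0 := (mul_eq_zero.1 htr).resolve_right hne
    change l (τ₁ ((q₁.out : L) : K)⁻¹ x) = 0 at ha
    rw [h₁.scalar _ (N.inv_mem hq), LinearMap.smul_apply,
      Module.End.one_apply, map_smul, smul_eq_mul] at ha
    have h4 := LinearMap.congr_fun (rep_mul_inv τ₁ ((q₁.out : L) : K)) x
    rw [h₁.scalar _ (N.inv_mem hq), (mul_eq_zero.1 ha).resolve_right hl, zero_smul, mul_zero] at h4
    exact hx h4.symm
  · intro q _ hqq
    rw [smul_mul_assoc, ← map_mul, map_smul, smul_eq_mul, h₂.trace_eq_zero, mul_zero]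
    · exact L.mul_mem (q.out : L).2 (L.inv_mem (q₁.out : L).2)
    · refine fun hmem => hqq ?_
      rw [← QuotientGroup.out_eq' q, show q₁ = 1 from rfl, QuotientGroup.eq_one_iff]
      exact (N.mul_mem_cancel_right (N.inv_mem hq)).1 hmem
  · intro h; exact absurd (Finset.mem_univ _) h

/-- Uniqueness of the extension of a Heisenberg representation with trace `-1` on elements that act
on `L / N` without fixed points. -/
lemma exists_hom_of_isHeisenberg (h₁ : IsHeisenberg L N c τ₁) (h₂ : IsHeisenberg L N c τ₂)
    (Z : Set K) (hK : ∀ ζ ∈ Z, ∀ k : K, ∃ l ∈ L, ∃ k', ζ * k' = k' * ζ ∧ k = l * k')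
    (hZ : ∀ ζ ∈ Z, ∀ l ∈ L, ζ * l * ζ⁻¹ * l⁻¹ ∈ N → l ∈ N) (hinv : ∀ ζ ∈ Z, ζ⁻¹ ∈ Z)
    (ht₁ : ∀ ζ ∈ Z, LinearMap.trace Ω W₁ (τ₁ ζ) = -1)
    (ht₂ : ∀ ζ ∈ Z, LinearMap.trace Ω W₂ (τ₂ ζ) = -1)
    (hgen : ∀ k : K, ∃ l ∈ L, ∃ a, τ₁ a = 1 ∧ τ₂ a = 1 ∧ (k = l * a ∨ ∃ ζ ∈ Z, k = l * a * ζ)) :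
    ∃ f : W₁ →ₗ[Ω] W₂, f ≠ 0 ∧ ∀ k w, f (τ₁ k w) = τ₂ k (f w) := by
  obtain ⟨A, hA⟩ := exists_avgHom_ne_zero h₁ h₂
  set f := avgHom L N τ₁ τ₂ A with hf
  have hfL (l : K) (hl : l ∈ L) (w : W₁) : f (τ₁ l w) = τ₂ l (f w) :=
    LinearMap.congr_fun (avgHom_comm h₁ h₂ A hl) w
  -- Up to a scalar, `τ ζ` is the sum of the operators of the commutators `ζ q ζ⁻¹ q⁻¹`, with which `f`
  -- commutes. The scalar is determined by the trace of `τ ζ`, so it is the same for `τ₁` and `τ₂`.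
  have hfζ (ζ : K) (hζ : ζ ∈ Z) (w : W₁) : f (τ₁ ζ w) = τ₂ ζ (f w) := by
    have := h₁.finite
    have := ((isIrreducible_iff _).1 h₁.irreducible).1
    obtain ⟨s₁, hs₁⟩ := h₁.exists_scalar (hK ζ hζ)
    obtain ⟨s₂, hs₂⟩ := h₂.exists_scalar (hK ζ hζ)
    have e₁ := h₁.trace_mul_avgHom (hZ ζ hζ)
    have e₂ := h₂.trace_mul_avgHom (hZ ζ hζ)
    rw [hs₁, mul_smul_comm, mul_one, map_smul, smul_eq_mul, ht₁ ζ hζ] at e₁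
    rw [hs₂, mul_smul_comm, mul_one, map_smul, smul_eq_mul, ht₂ ζ hζ] at e₂
    have d₁ := h₁.finrank_sq (hK ζ hζ) (hZ ζ hζ)
    have d₂ := h₂.finrank_sq (hK ζ hζ) (hZ ζ hζ)
    rw [ht₁ ζ hζ, ht₁ _ (hinv ζ hζ)] at d₁
    rw [ht₂ ζ hζ, ht₂ _ (hinv ζ hζ), ← d₁] at d₂
    have hdd : Module.finrank Ω W₂ = Module.finrank Ω W₁ := Nat.mul_self_inj.1 (by exact_mod_cast d₂)
    obtain rfl : s₁ = s₂ := by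
      rw [hdd] at e₂
      linear_combination e₂ - e₁
    have hs0 : s₁ ≠ 0 := by
      rintro rfl
      rw [zero_mul] at e₁
      exact Nat.cast_ne_zero.2 Module.finrank_pos.ne' e₁.symm
    have m₁ := mul_avgHom (L := L) (N := N) (τ := τ₁) ζ
    have m₂ := mul_avgHom (L := L) (N := N) (τ := τ₂) ζ
    rw [hs₁, mul_smul_comm, mul_one] at m₁
    rw [hs₂, mul_smul_comm, mul_one] at m₂
    have hsum : f ((s₁ • τ₁ ζ) w) = (s₁ • τ₂ ζ) (f w) := by
      simp only [m₁, m₂, LinearMap.sum_apply, map_sum]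
      exact Finset.sum_congr rfl fun q _ => hfL _ (L.mul_mem (hL.conj_mem _ (q.out : L).2 ζ)
        (L.inv_mem (q.out : L).2)) w
    rw [LinearMap.smul_apply, map_smul] at hsum
    exact smul_right_injective _ hs0 hsum
  refine ⟨f, hA, fun k w => ?_⟩
  obtain ⟨l, hl, a, ha₁, ha₂, rfl | ⟨ζ, hζ, rfl⟩⟩ := hgen k
  · rw [map_mul, map_mul, ha₁, ha₂, mul_one, mul_one, hfL l hl]
  · rw [map_mul, map_mul, map_mul, map_mul, ha₁, ha₂, mul_one, mul_one, Module.End.mul_apply,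
      Module.End.mul_apply, hfL l hl, hfζ ζ hζ]

end Heisenberg

/-! ### Duality for abelian groups -/

section Duality

variable {Ω : Type*} [Field Ω] [IsAlgClosed Ω] [CharZero Ω]

/-- A group of characters of a finite abelian group that separates points is the whole dual. -/
lemma eq_top_of_separates {Q : Type*} [CommGroup Q] [Finite Q] (S : Subgroup (Q →* Ωˣ))
    (h : ∀ a : Q, (∀ s ∈ S, s a = 1) → a = 1) : S = ⊤ := by
  have : NeZero ((Monoid.exponent Q : ℕ) : Ω) :=
    ⟨Nat.cast_ne_zero.2 Monoid.exponent_ne_zero_of_finite⟩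
  let i := CommGroup.subgroupOrderIsoSubgroupMonoidHom Q Ω
  have hS : i.symm (OrderDual.toDual S) = ⊥ := (Subgroup.eq_bot_iff_forall _).2 fun a ha =>
    h a ((CommGroup.mem_subgroupOrderIsoSubgroupMonoidHom_symm_iff _ _ _).1 ha)
  exact OrderDual.toDual.injective (((i.symm_apply_eq).1 hS).trans i.map_bot)

/-- The same for the characters of an abelian group that are trivial on a subgroup of finite
index. -/
lemma mem_of_separates {A : Type*} [CommGroup A] (N : Subgroup A) [Finite (A ⧸ N)]
    (S : Subgroup (A →* Ωˣ)) (h : ∀ a, (∀ s ∈ S, s a = 1) → a ∈ N) (hS : ∀ s ∈ S, ∀ n ∈ N, s n = 1)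
    {χ : A →* Ωˣ} (hχ : ∀ n ∈ N, χ n = 1) : χ ∈ S := by
  have h1 : (S.comap (MonoidHom.compHom' (QuotientGroup.mk' N)) : Subgroup (A ⧸ N →* Ωˣ)) = ⊤ := by
    refine eq_top_of_separates _ fun a ha => ?_
    obtain ⟨a, rfl⟩ := QuotientGroup.mk_surjective a
    refine (QuotientGroup.eq_one_iff a).2 (h a fun s hs => ?_)
    have hle : N ≤ s.ker := hS s hs
    exact ha (QuotientGroup.lift N s hle) (show (QuotientGroup.lift N s hle).comp
      (QuotientGroup.mk' N) ∈ S by rwa [QuotientGroup.lift_comp_mk'])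
  have hle : N ≤ χ.ker := hχ
  have h2 : QuotientGroup.lift N χ hle ∈ S.comap (MonoidHom.compHom' (QuotientGroup.mk' N)) :=
    h1 ▸ Subgroup.mem_top _
  have h3 : (QuotientGroup.lift N χ hle).comp (QuotientGroup.mk' N) ∈ S := h2
  rwa [QuotientGroup.lift_comp_mk'] at h3

/-- The multiplicative group of `Ω` is divisible, so that its characters extend. -/
lemma exists_hom_factor {G A : Type*} [Group G] [CommGroup A] (f : G →* Ωˣ) (n : G →* A)
    (h : n.ker ≤ f.ker) : ∃ ω : A →* Ωˣ, ∀ g, ω (n g) = f g := by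
  have hdiv : DivisibleBy (Additive Ωˣ) ℕ := divisibleByOfSMulRightSurj _ _ (by
    intro k hk u
    obtain ⟨z, hz⟩ := IsAlgClosed.exists_pow_nat_eq (u.toMul : Ω) (Nat.pos_of_ne_zero hk)
    have hz0 : z ≠ 0 := by
      rintro rfl
      rw [zero_pow hk] at hz
      exact u.toMul.ne_zero hz.symm
    exact ⟨Additive.ofMul (Units.mk0 z hz0), Additive.toMul.injective (Units.ext (by simpa using hz))⟩)
  have hdiv' : DivisibleBy (Additive Ωˣ) ℤ := AddGroup.divisibleByIntOfDivisibleByNat _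
  let g : n.range →* Ωˣ := n.rangeRestrict.liftOfRightInverse
    (Function.surjInv n.rangeRestrict_surjective) (Function.rightInverse_surjInv _)
    ⟨f, by rwa [MonoidHom.ker_rangeRestrict]⟩
  obtain ⟨ω, hω⟩ := (Module.Baer.of_divisible (Additive Ωˣ)).extension_property_addMonoidHom
    (MonoidHom.toAdditive n.range.subtype) (fun a b hab => Subtype.ext hab) (MonoidHom.toAdditive g)
  refine ⟨MonoidHom.toAdditive.symm ω, fun x => ?_⟩
  have h1 := DFunLike.congr_fun hω (Additive.ofMul (n.rangeRestrict x))
  have h2 : g (n.rangeRestrict x) = f x :=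
    MonoidHom.liftOfRightInverse_comp_apply _ _ _ ⟨f, by rwa [MonoidHom.ker_rangeRestrict]⟩ x
  rw [← h2]
  exact h1

end Duality

/-! ### Representations by scalars -/

section Scalars

variable {Ω G V : Type*} [Field Ω] [Group G] [AddCommGroup V] [Module Ω V]

lemma exists_char_of_smul [Nontrivial V] {ρ : Representation Ω G V}
    (h : ∀ g, ∃ c : Ω, ρ g = c • 1) : ∃ χ : G →* Ωˣ, ∀ g, ρ g = (χ g : Ω) • 1 := by
  choose c hc using h
  have hinj : ∀ a b : Ω, a • (1 : V →ₗ[Ω] V) = b • 1 → a = b := fun a b hab =>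
    smul_left_injective Ω (one_ne_zero (α := Module.End Ω V)) hab
  let χ : G →* Ω :=
    { toFun := c
      map_one' := hinj _ _ (by rw [← hc, map_one, one_smul])
      map_mul' := fun x y => hinj _ _ (by
        rw [← hc, map_mul, hc, hc, smul_mul_smul_comm, mul_one]) }
  exact ⟨χ.toHomUnits, hc⟩

lemma finrank_eq_one_of_smul {ρ : Representation Ω G V} (hρ : ρ.IsIrreducible)
    (h : ∀ g, ∃ c : Ω, ρ g = c • 1) : Module.finrank Ω V = 1 := by
  have hn := (isIrreducible_iff _).1 hρ
  have := hn.1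
  obtain ⟨w, hw⟩ := exists_ne (0 : V)
  refine finrank_eq_one_iff'.2 ⟨w, hw, fun v => ?_⟩
  have h1 := (hn.2 (Submodule.span Ω {w}) (fun g v hv => by
    obtain ⟨c, hc⟩ := h g
    rw [hc]
    exact Submodule.smul_mem _ _ hv)).resolve_left (by
      rwa [Submodule.span_singleton_eq_bot])
  exact Submodule.mem_span_singleton.1 (h1 ▸ Submodule.mem_top)

end Scalars

/-! ### Frobenius reciprocity -/

section Frobenius

variable {Ω G : Type*} [Field Ω] [Group G] [TopologicalSpace G] [IsTopologicalGroup G]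
variable {V W : Type*} [AddCommGroup V] [Module Ω V] [AddCommGroup W] [Module Ω W]
variable {H : Subgroup G} {ρ : Representation Ω G V} {σ : Representation Ω H W}

/-- The linear map `V → W` that corresponds to a homomorphism from `V` to an induced
representation. -/
def frobenius (T : Representation.IntertwiningMap ρ (ind σ)) : V →ₗ[Ω] W where
  toFun v := (T v).1 1
  map_add' v w := by rw [map_add]; rfl
  map_smul' c v := by rw [map_smul]; rfl

lemma frobenius_apply_map (T : Representation.IntertwiningMap ρ (ind σ)) (g : G) (v : V) :
    frobenius T (ρ g v) = (T v).1 g :=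
  (congrArg (fun f : indSpace σ => f.1 1) (T.isIntertwining _ _ g v)).trans
    (congrArg (T v).1 (one_mul g))

lemma frobenius_map (T : Representation.IntertwiningMap ρ (ind σ)) (h : H) (v : V) :
    frobenius T (ρ h v) = σ h (frobenius T v) := by
  rw [frobenius_apply_map, ← mul_one (h : G), (T v).2.1 h 1]
  rfl

lemma frobenius_injective :
    Function.Injective (frobenius : Representation.IntertwiningMap ρ (ind σ) → V →ₗ[Ω] W) :=
  fun T T' h => Representation.IntertwiningMap.ext (LinearMap.ext fun v => Subtype.ext (funext fun g =>
    (frobenius_apply_map T g v).symm.trans ((LinearMap.congr_fun h _).trans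
      (frobenius_apply_map T' g v))))

/-- If all equivariant maps vanish, then so do all homomorphisms to the induced representation. -/
lemma rank_eq_zero_of_frobenius
    (h : ∀ φ : V →ₗ[Ω] W, (∀ (h : H) v, φ (ρ h v) = σ h (φ v)) → φ = 0) :
    Module.rank Ω (Representation.IntertwiningMap ρ (ind σ)) = 0 :=
  rank_zero_iff.2 ⟨fun T T' => frobenius_injective <|
    (h _ (frobenius_map T)).trans (h _ (frobenius_map T')).symm⟩

lemma rank_eq_one_of_frobenius (hρ : IsSmooth ρ) {φ : V →ₗ[Ω] W} (h0 : φ ≠ 0)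
    (hφ : ∀ (h : H) v, φ (ρ h v) = σ h (φ v))
    (h : ∀ φ₂ : V →ₗ[Ω] W, (∀ (h : H) v, φ₂ (ρ h v) = σ h (φ₂ v)) → ∃ c : Ω, φ₂ = c • φ) :
    Module.rank Ω (Representation.IntertwiningMap ρ (ind σ)) = 1 := by
  obtain ⟨T, rfl⟩ : ∃ T : Representation.IntertwiningMap ρ (ind σ), frobenius T = φ :=
    ⟨frobeniusLift hρ φ hφ, LinearMap.ext fun v => congrArg φ (LinearMap.congr_fun (map_one ρ) v)⟩
  refine Module.rank_of_bijective_toSpanSingleton (x := T) ⟨fun c c' hc => ?_, fun T' => ?_⟩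
  · have h1 : c • frobenius T = c' • frobenius T := congrArg frobenius hc
    exact smul_left_injective Ω h0 h1
  · obtain ⟨c, hc⟩ := h _ (frobenius_map T')
    exact ⟨c, frobenius_injective hc.symm⟩

lemma isSmooth_extTensor {G' V' : Type*} [Group G'] [TopologicalSpace G'] [IsTopologicalGroup G']
    [AddCommGroup V'] [Module Ω V'] {ρ' : Representation Ω G' V'} (h : IsSmooth ρ)
    (h' : IsSmooth ρ') : IsSmooth (extTensor ρ ρ') := by
  intro x
  induction x with
  | zero => exact .of_forall fun g => map_zero _
  | tmul v v' =>
    filter_upwards [(continuous_fst.tendsto (1 : G × G')).eventually (h v),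
      (continuous_snd.tendsto (1 : G × G')).eventually (h' v')] with g h1 h2
    exact congrArg₂ (· ⊗ₜ ·) h1 h2
  | add x y hx hy =>
    filter_upwards [hx, hy] with g h1 h2
    rw [map_add, h1, h2]

lemma nonempty_ind_inclusion {H' : Subgroup G} (h : H = H') (σ : Representation Ω H W) :
    Nonempty ((ind σ).Equiv (ind (σ.comp (Subgroup.inclusion h.ge)))) := by
  subst h
  exact ⟨.refl _⟩

end Frobenius

/-! ### The quadratic extension -/

section QuadraticAlgebra

variable {F : Type*} [Field F] {E : Type*} [Field E] [Algebra F E] [Algebra.IsQuadraticExtension F E]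

lemma matrix_mul_self (M : Matrix (Fin 2) (Fin 2) F) : M * M = M.trace • M - M.det • 1 := by
  ext i j
  fin_cases i <;> fin_cases j <;>
    simp [Matrix.mul_apply, Fin.sum_univ_two, Matrix.trace_fin_two, Matrix.det_fin_two] <;> ring

lemma sq_eq_trace_norm (x : E) : x * x =
    algebraMap F E (Algebra.trace F E x) * x - algebraMap F E (Algebra.norm F x) := by
  have : Module.Finite F E := Module.finite_of_finrank_pos (by
    rw [Algebra.IsQuadraticExtension.finrank_eq_two F E]; norm_num)
  let b : Module.Basis (Fin 2) F E := Module.finBasisOfFinrankEq F E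
    (Algebra.IsQuadraticExtension.finrank_eq_two F E)
  apply Algebra.leftMulMatrix_injective b
  rw [Algebra.trace_eq_matrix_trace b, Algebra.norm_eq_matrix_det b, map_sub, map_mul, map_mul,
    AlgHom.commutes, AlgHom.commutes, matrix_mul_self, Algebra.smul_def, Algebra.smul_def, mul_one]

lemma trace_algebraMap_quadratic (a : F) : Algebra.trace F E (algebraMap F E a) = 2 * a := by
  rw [Algebra.trace_algebraMap, Algebra.IsQuadraticExtension.finrank_eq_two F E, nsmul_eq_mul]
  norm_num

lemma trace_algebraMap_mul (a : F) (x : E) :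
    Algebra.trace F E (algebraMap F E a * x) = a * Algebra.trace F E x := by
  rw [← Algebra.smul_def, map_smul, smul_eq_mul]

variable (F E) in
/-- The nontrivial automorphism `x ↦ tr x - x` of a quadratic extension of fields of
characteristic different from `2`. -/
noncomputable def conj [NeZero (2 : F)] : E →ₐ[F] E where
  toFun x := algebraMap F E (Algebra.trace F E x) - x
  map_one' := by
    rw [← map_one (algebraMap F E), trace_algebraMap_quadratic, mul_one, map_ofNat, map_one]
    norm_num
  map_mul' x y := by
    have h2 : (2 : E) ≠ 0 := by
      rw [← map_ofNat (algebraMap F E) 2]; exact hom_ne_zero (NeZero.ne (2 : F))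
    have h := sq_eq_trace_norm (F := F) (x + y)
    have hx := sq_eq_trace_norm (F := F) x
    have hy := sq_eq_trace_norm (F := F) y
    -- polarise the quadratic equation
    set c : F := Algebra.norm F x + Algebra.norm F y - Algebra.norm F (x + y) with hc
    have h1 : 2 * (x * y) = algebraMap F E (Algebra.trace F E x) * y +
        algebraMap F E (Algebra.trace F E y) * x + algebraMap F E c := by
      simp only [map_add, hc, map_sub] at h ⊢
      linear_combination h - hx - hy
    have h3 := congrArg (Algebra.trace F E) h1
    rw [← map_ofNat (algebraMap F E) 2, map_add, map_add, trace_algebraMap_mul,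
      trace_algebraMap_mul, trace_algebraMap_mul, trace_algebraMap_quadratic] at h3
    have hcc : c = Algebra.trace F E (x * y) - Algebra.trace F E x * Algebra.trace F E y :=
      mul_left_cancel₀ (NeZero.ne (2 : F)) (by linear_combination -h3)
    rw [hcc, RingHom.map_sub, RingHom.map_mul] at h1
    linear_combination -h1
  map_zero' := by simp
  map_add' x y := by simp only [map_add]; ring
  commutes' a := by rw [trace_algebraMap_quadratic, map_mul, map_ofNat]; ring

variable [NeZero (2 : F)]

lemma conj_apply (x : E) : conj F E x = algebraMap F E (Algebra.trace F E x) - x := rfl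

lemma algebraMap_trace (x : E) : algebraMap F E (Algebra.trace F E x) = x + conj F E x := by
  rw [conj_apply]; ring

lemma algebraMap_norm (x : E) : algebraMap F E (Algebra.norm F x) = x * conj F E x := by
  rw [conj_apply, mul_sub, sq_eq_trace_norm (F := F) x]; ring

@[simp] lemma conj_conj (x : E) : conj F E (conj F E x) = x := by
  rw [conj_apply x, map_sub, AlgHom.commutes, conj_apply]; ring

lemma trace_conj (x : E) : Algebra.trace F E (conj F E x) = Algebra.trace F E x := by
  apply (algebraMap F E).injective
  rw [algebraMap_trace, algebraMap_trace, conj_conj, add_comm]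

lemma norm_conj (x : E) : Algebra.norm F (conj F E x) = Algebra.norm F x := by
  apply (algebraMap F E).injective
  rw [algebraMap_norm, algebraMap_norm, conj_conj, mul_comm]

lemma two_ne_zero_ext (F E : Type*) [Field F] [Field E] [Algebra F E] [NeZero (2 : F)] : (2 : E) ≠ 0 := by
  rw [← map_ofNat (algebraMap F E) 2]; exact hom_ne_zero (NeZero.ne (2 : F))

lemma mem_range_of_conj_eq {x : E} (h : conj F E x = x) : x ∈ Set.range (algebraMap F E) := by
  refine ⟨Algebra.trace F E x / 2, ?_⟩
  rw [map_div₀, algebraMap_trace, h, map_ofNat, ← two_mul, mul_div_assoc, mul_div_cancel₀]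
  exact two_ne_zero_ext F E

variable (F E) in
lemma exists_conj_eq_neg : ∃ a : E, a ≠ 0 ∧ conj F E a = -a := by
  by_contra! hcon
  have hsurj : Function.Surjective (algebraMap F E) := by
    intro x
    apply mem_range_of_conj_eq
    by_contra hne
    exact hcon (x - conj F E x) (sub_ne_zero.2 (Ne.symm hne)) (by simp)
  have h := Algebra.IsQuadraticExtension.finrank_eq_two F E
  have hb := (LinearEquiv.ofBijective (Algebra.linearMap F E)
    ⟨(algebraMap F E).injective, hsurj⟩).finrank_eq
  rw [h, Module.finrank_self] at hb
  omega

end QuadraticAlgebra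

section

variable {F : Type*} [Field F] [ValuativeRel F] [TopologicalSpace F] [IsNonarchimedeanLocalField F]
  [Fact (ringChar 𝓀[F] ≠ 2)]
variable {E : Type*} [Field E] [ValuativeRel E] [TopologicalSpace E] [IsNonarchimedeanLocalField E]
variable [Algebra F E] [ValuativeExtension F E] [Algebra.IsQuadraticExtension F E]
variable {Ω : Type*} [Field Ω]
variable {ψ : AddChar F Ω} {m : ℕ} {α β : E} {χ : Eˣ →* Ωˣ}

section QuadraticLocal

lemma ord_algebraMap_le_iff {x y : F} (hx : x ≠ 0) (hy : y ≠ 0) :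
    ord (algebraMap F E x) ≤ ord (algebraMap F E y) ↔ ord x ≤ ord y := by
  rw [← vle_iff_ord_le hx hy, ← ValuativeExtension.vle_iff_vle (B := E),
    vle_iff_ord_le (hom_ne_zero hx) (hom_ne_zero hy)]

lemma exists_ord_algebraMap : ∃ e : ℤ, 1 ≤ e ∧
    ∀ x : F, x ≠ 0 → ord (algebraMap F E x) = e * ord x := by
  obtain ⟨ϖ, hϖ, hϖ1⟩ := exists_ord_eq (K := F) 1
  have hϖE : algebraMap F E ϖ ≠ 0 := hom_ne_zero hϖ
  refine ⟨ord (algebraMap F E ϖ), ?_, fun x hx => ?_⟩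
  · have h := not_congr (ord_algebraMap_le_iff (E := E) hϖ one_ne_zero)
    rw [hϖ1, ord_one, map_one, ord_one] at h
    have := h.2 (by norm_num)
    omega
  · have h1 := ord_algebraMap_le_iff (E := E) hx (zpow_ne_zero (ord x) hϖ)
    have h2 := ord_algebraMap_le_iff (E := E) (zpow_ne_zero (ord x) hϖ) hx
    rw [map_zpow₀, ord_zpow hϖ, ord_zpow hϖE, hϖ1, mul_one] at h1 h2
    have := h1.2 le_rfl
    have := h2.2 le_rfl
    rw [mul_comm]; omega

/-- If `σ x` had smaller valuation than `x`, then by Hensel's lemma the discriminant of `x` would be a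
square in `F`, and `x` would lie in `F`. -/
lemma ord_conj_le {x : E} (hx : x ≠ 0) : ord x ≤ ord (conj F E x) := by
  have hsx : conj F E x ≠ 0 := hom_ne_zero hx
  by_contra! hlt
  obtain ⟨e, he1, he⟩ := exists_ord_algebraMap (F := F) (E := E)
  set y := conj F E x with hy
  have hq1 : (1 + x / y) - 1 ∈ pPow E 1 := by
    rw [add_sub_cancel_left, mem_pPow (div_ne_zero hx hsx), ord_div hx hsx]; omega
  obtain ⟨hq0, hqo⟩ := ne_zero_and_ord_eq_zero hq1
  have hts : algebraMap F E (Algebra.trace F E x) = x + y := algebraMap_trace x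
  set t := algebraMap F E (Algebra.trace F E x)
  have hty : t = y * (1 + x / y) := by rw [hts]; field_simp; ring
  have ht0 : t ≠ 0 := hty ▸ mul_ne_zero hsx hq0
  have hto : ord t = ord y := by rw [hty, ord_mul hsx hq0, hqo, add_zero]
  set c : F := Algebra.norm F x / (Algebra.trace F E x) ^ 2 with hc
  have hcE : algebraMap F E c = x * y / t ^ 2 := by
    rw [hc, map_div₀, map_pow, algebraMap_norm]
  have hc0 : c ≠ 0 := by
    rw [← _root_.map_ne_zero (algebraMap F E), hcE]
    exact div_ne_zero (mul_ne_zero hx hsx) (pow_ne_zero 2 ht0)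
  have hc1 : 1 ≤ ord c := by
    have h := he c hc0
    rw [hcE, ord_div (mul_ne_zero hx hsx) (pow_ne_zero 2 ht0), ord_mul hx hsx, ord_pow ht0,
      hto] at h
    push_cast at h
    by_contra hlt'
    have : e * ord c ≤ 0 := by nlinarith
    omega
  -- the discriminant of `x` is a square in `F`, so that `x - σ x` lies in `F`
  obtain ⟨v, hv, -⟩ := exists_sqrt (u := 1 - 4 * c) le_rfl (by
    have := mul_mem_pPow (natCast_mem_pPow 4) ((mem_pPow hc0).2 hc1)
    rw [zero_add] at this
    simpa using neg_mem_pPow this)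
  have hvE := congrArg (algebraMap F E) hv
  rw [map_mul, map_sub, map_one, map_mul, hcE, map_ofNat] at hvE
  have hprod : (x - y - t * algebraMap F E v) * (x - y + t * algebraMap F E v) = 0 := by
    have : (t * algebraMap F E v) * (t * algebraMap F E v) = t * t - 4 * (x * y) := by
      rw [mul_mul_mul_comm, hvE]; field_simp
    linear_combination (-1 : E) * this - (t + x + y) * hts
  have hσ : conj F E (x - y) = x - y := by
    have htv : conj F E (t * algebraMap F E v) = t * algebraMap F E v := by
      rw [map_mul, AlgHom.commutes, AlgHom.commutes]
    rcases mul_eq_zero.1 hprod with h | h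
    · rw [sub_eq_zero.1 h, htv]
    · rw [eq_neg_of_add_eq_zero_left h, map_neg, htv]
  have h2 := two_ne_zero_ext F E
  rw [map_sub, hy, conj_conj, ← hy] at hσ
  have : x = y := mul_left_cancel₀ h2 (by linear_combination (-1 : E) * hσ)
  rw [← this] at hlt
  exact lt_irrefl _ hlt

/-- The valuation of `E` is invariant under conjugation. -/
lemma ord_conj (x : E) : ord (conj F E x) = ord x := by
  by_cases hx : x = 0
  · rw [hx, map_zero]
  refine le_antisymm ?_ (ord_conj_le hx)
  have := ord_conj_le (F := F) (x := conj F E x) (hom_ne_zero hx)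
  rwa [conj_conj] at this

lemma conj_mem_pPow {x : E} {n : ℤ} (hx : x ∈ pPow E n) : conj F E x ∈ pPow E n := by
  by_cases hx0 : x = 0
  · rw [hx0, map_zero]; exact zero_mem_pPow _
  · rwa [mem_pPow (hom_ne_zero hx0), ord_conj, ← mem_pPow hx0]

variable (F E) in
open Classical in
/-- The ramification index of the quadratic extension `E / F`. -/
noncomputable def ramIdx : ℤ := if Unramified F E then 1 else 2

lemma ord_algebraMap {x : F} (hx : x ≠ 0) : ord (algebraMap F E x) = ramIdx F E * ord x := by
  obtain ⟨e, he1, he⟩ := exists_ord_algebraMap (F := F) (E := E)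
  obtain ⟨y, hy, hy1⟩ := exists_ord_eq (K := E) 1
  have hN : Algebra.norm F y ≠ 0 := by rwa [Algebra.norm_ne_zero_iff]
  have h := he _ hN
  rw [algebraMap_norm, ord_mul hy (hom_ne_zero hy), ord_conj, hy1] at h
  have hd : e ∣ 2 := ⟨_, h⟩
  have h2 : e ≤ 2 := Int.le_of_dvd (by norm_num) hd
  have hee : ramIdx F E = e := by
    rw [ramIdx]
    split_ifs with hu
    · obtain ⟨ϖ, hϖ, hϖ1⟩ := exists_ord_eq (K := F) 1
      have h3 := hu ϖ hϖ1
      rw [he ϖ hϖ, hϖ1, mul_one] at h3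
      exact h3.symm
    · by_contra hne
      have : e = 1 := by omega
      refine hu fun ϖ hϖ1 => ?_
      have hϖ : ϖ ≠ 0 := by
        rintro rfl
        simp [ord, val_eq_zero.2] at hϖ1
      rw [he ϖ hϖ, hϖ1, this, mul_one]
  rw [hee, he x hx]

variable (F E) in
lemma ramIdx_eq : (Unramified F E ∧ ramIdx F E = 1) ∨ (¬ Unramified F E ∧ ramIdx F E = 2) := by
  by_cases h : Unramified F E <;> simp [ramIdx, h]

lemma ramIdx_of_unramified (hu : Unramified F E) : ramIdx F E = 1 := if_pos hu

variable (F E) in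
lemma ramIdx_pos : 1 ≤ ramIdx F E := by rcases ramIdx_eq F E with h | h <;> omega

lemma algebraMap_mem_pPow_iff {x : F} {n : ℤ} :
    algebraMap F E x ∈ pPow E (ramIdx F E * n) ↔ x ∈ pPow F n := by
  by_cases hx : x = 0
  · simp [hx, zero_mem_pPow]
  · rw [mem_pPow hx, mem_pPow (hom_ne_zero hx), ord_algebraMap hx]
    exact mul_le_mul_iff_right₀ (by have := ramIdx_pos F E; omega)

lemma algebraMap_mem_pPow_one {x : F} : algebraMap F E x ∈ pPow E 1 ↔ x ∈ pPow F 1 := by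
  refine ⟨fun h => ?_, fun h => pPow_anti ?_ (algebraMap_mem_pPow_iff.2 h)⟩
  · by_cases hx : x = 0
    · simp [hx, zero_mem_pPow]
    rw [mem_pPow (hom_ne_zero hx), ord_algebraMap hx] at h
    rw [mem_pPow hx]
    by_contra hlt
    have := ramIdx_pos F E
    have : ramIdx F E * ord x ≤ 0 := by nlinarith
    omega
  · have := ramIdx_pos F E; omega

lemma algebraMap_mem_pPow_zero {x : F} : algebraMap F E x ∈ pPow E 0 ↔ x ∈ pPow F 0 := by
  simpa using algebraMap_mem_pPow_iff (F := F) (E := E) (x := x) (n := 0)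

lemma ord_norm {x : E} (hx : x ≠ 0) : ramIdx F E * ord (Algebra.norm F x) = 2 * ord x := by
  have hN : Algebra.norm F x ≠ 0 := by rwa [Algebra.norm_ne_zero_iff]
  rw [← ord_algebraMap (E := E) hN, algebraMap_norm, ord_mul hx (hom_ne_zero hx), ord_conj]
  ring

lemma trace_mem_pPow_one {x : E} (hx : x ∈ pPow E 1) : Algebra.trace F E x ∈ pPow F 1 := by
  rw [← algebraMap_mem_pPow_one (E := E), algebraMap_trace]
  exact add_mem_pPow hx (conj_mem_pPow hx)

lemma trace_mem_pPow_zero {x : E} (hx : x ∈ pPow E 0) : Algebra.trace F E x ∈ pPow F 0 := by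
  rw [← algebraMap_mem_pPow_zero (E := E), algebraMap_trace]
  exact add_mem_pPow hx (conj_mem_pPow hx)

variable (F) in
/-- The trace pairing puts `𝔭_E ^ i` and `𝔭_E ^ (1 - i)` in duality, because `E / F` is tame. -/
lemma mem_pPow_of_trace {x : E} {i : ℤ}
    (h : ∀ z ∈ pPow E i, Algebra.trace F E (x * z) ∈ pPow F 1) : x ∈ pPow E (1 - i) := by
  by_cases hx : x = 0
  · rw [hx]; exact zero_mem_pPow _
  rw [mem_pPow hx]
  by_contra hlt
  have := h x⁻¹ (pPow_anti (by omega) (inv_mem_pPow hx))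
  rw [mul_inv_cancel₀ hx, ← map_one (algebraMap F E), trace_algebraMap_quadratic, mul_one] at this
  exact two_not_mem_pPow F this

/-- The set on which a level zero character is trivial contains no larger `𝒪_F`-module
than `𝔭_F`. -/
lemma mem_pPow_of_char {Ω : Type*} [Field Ω] {ψ : AddChar F Ω} (hψ : IsLevelZero F ψ) {t : F}
    (h : ∀ y ∈ pPow F 0, ψ (y * t) = 1) : t ∈ pPow F 1 := by
  by_cases ht : t = 0
  · rw [ht]; exact zero_mem_pPow _
  obtain ⟨x, hx, hx1⟩ := hψ.2
  rw [mem_pPow ht]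
  by_contra hlt
  apply hx1
  have := h (x * t⁻¹) (pPow_anti (by omega) (mul_mem_pPow hx (inv_mem_pPow ht)))
  rwa [inv_mul_cancel_right₀ ht] at this

end QuadraticLocal

/-! ### Minimal elements -/

section Minimal

lemma minpoly_integer {x : E} (hx : x ∉ Set.range (algebraMap F E)) (t n : 𝒪[F])
    (ht : (t : F) = Algebra.trace F E x) (hn : (n : F) = Algebra.norm F x) :
    minpoly 𝒪[F] x = X ^ 2 - C t * X + C n := by
  have hfin : Module.Finite F E := Module.finite_of_finrank_pos (by
    rw [Algebra.IsQuadraticExtension.finrank_eq_two F E]; norm_num)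
  have hdeg : ∀ (R : Type _) [CommRing R] [Nontrivial R] (a b : R),
      (X ^ 2 - C a * X + C b : R[X]).Monic := fun R _ _ a b => by
    have : (X ^ 2 - C a * X + C b : R[X]) = X ^ 2 + (-(C a * X) + C b) := by ring
    rw [this]
    exact monic_X_pow_add (by compute_degree!)
  have haev : aeval x (X ^ 2 - C t * X + C n) = 0 := by
    have h := sq_eq_trace_norm (F := F) x
    rw [← ht, ← hn] at h
    simp only [map_add, map_sub, map_mul, aeval_X, aeval_C, map_pow]
    change x ^ 2 - algebraMap F E t * x + algebraMap F E n = 0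
    linear_combination h
  have hint : IsIntegral 𝒪[F] x := ⟨_, hdeg _ t n, by simpa [aeval_def] using haev⟩
  have hintF : IsIntegral F x := IsIntegral.of_finite F x
  apply Polynomial.map_injective (algebraMap 𝒪[F] F) (IsFractionRing.injective 𝒪[F] F)
  rw [← minpoly.isIntegrallyClosed_eq_field_fractions' F hint]
  symm
  have hmon := (hdeg _ t n).map (algebraMap 𝒪[F] F)
  refine eq_of_monic_of_dvd_of_natDegree_le (minpoly.monic hintF) hmon ?_ ?_
  · apply minpoly.dvd
    rw [aeval_map_algebraMap]; exact haev
  · have h1 : (minpoly F x).natDegree ≠ 0 := (minpoly.natDegree_pos hintF).ne'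
    have h2 : (minpoly F x).natDegree ≠ 1 := fun h => hx (minpoly.natDegree_eq_one_iff.1 h)
    have h3 : ((X ^ 2 - C t * X + C n : 𝒪[F][X]).map (algebraMap 𝒪[F] F)).natDegree ≤ 2 := by
      refine natDegree_map_le.trans ?_
      compute_degree!
    omega

/-- In the unramified case the minimality of `α` is a condition on the trace and the norm. -/
lemma irreducible_iff_quadratic {x : E} (hx : x ∉ Set.range (algebraMap F E)) (t n : 𝒪[F])
    (ht : (t : F) = Algebra.trace F E x) (hn : (n : F) = Algebra.norm F x) :
    Irreducible ((minpoly 𝒪[F] x).map (IsLocalRing.residue 𝒪[F])) ↔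
      Irreducible (X ^ 2 - C (IsLocalRing.residue 𝒪[F] t) * X +
        C (IsLocalRing.residue 𝒪[F] n) : 𝓀[F][X]) := by
  rw [minpoly_integer hx t n ht hn]
  simp

lemma IsMinimalElt.ne_zero {m : ℕ} {α : E} (h : IsMinimalElt F m α) : α ≠ 0 :=
  ne_zero_of_val_exp h.val_eq

lemma IsMinimalElt.ord_eq {m : ℕ} {α : E} (h : IsMinimalElt F m α) : ord α = -m :=
  ord_eq_of_val (by rw [h.val_eq, neg_neg])

lemma norm_mem_pPow {x : E} (hx : x ∈ pPow E 0) : Algebra.norm F x ∈ pPow F 0 := by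
  rw [← algebraMap_mem_pPow_zero (E := E), algebraMap_norm]
  simpa using mul_mem_pPow hx (conj_mem_pPow hx)

lemma pow_smul_mem (hu : Unramified F E) {ϖ : F} (hϖ : ϖ ≠ 0) (hϖ1 : ord ϖ = 1) (m : ℕ) {γ : E}
    {i : ℤ} (hγ : γ ∈ pPow E (i - m)) : ϖ ^ m • γ ∈ pPow E i := by
  rw [Algebra.smul_def]
  refine mem_pPow_of_eq (mul_mem_pPow (mem_pPow_self (x := algebraMap F E (ϖ ^ m))) hγ) ?_
  rw [map_pow, ord_pow (hom_ne_zero hϖ), hu ϖ hϖ1]; ring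

lemma pow_smul_not_mem_range {ϖ : F} (hϖ : ϖ ≠ 0) (m : ℕ) {γ : E}
    (hγ : γ ∉ Set.range (algebraMap F E)) : ϖ ^ m • γ ∉ Set.range (algebraMap F E) := by
  rintro ⟨y, hy⟩
  exact hγ ⟨(ϖ ^ m)⁻¹ * y, by
    rw [map_mul, hy, ← Algebra.smul_def, inv_smul_smul₀ (pow_ne_zero m hϖ)]⟩

lemma IsMinimalElt.mem_pPow {m : ℕ} {α : E} (h : IsMinimalElt F m α) : α ∈ pPow E (-m) :=
  mem_pPow_of_eq mem_pPow_self h.ord_eq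

/-- A minimal element of valuation `-m` is not congruent to its conjugate modulo `𝔭_E ^ (1 - m)`. -/
lemma IsMinimalElt.sub_conj_not_mem {m : ℕ} {α : E} (h : IsMinimalElt F m α) :
    α - conj F E α ∉ pPow E (1 - m) := by
  intro hmem
  by_cases hu : Unramified F E
  · obtain ⟨ϖ, hϖ, hϖ1⟩ := exists_ord_eq (K := F) 1
    obtain ⟨hα, hirr⟩ := h.irreducible_of_unramified hu ϖ hϖ1
    have hx0 := pow_smul_mem hu hϖ hϖ1 m (i := 0) (by simpa using h.mem_pPow)
    have hxr := pow_smul_not_mem_range hϖ m hα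
    have hxc := pow_smul_mem hu hϖ hϖ1 m hmem
    rw [smul_sub, ← map_smul] at hxc
    generalize ϖ ^ m • α = x at hirr hx0 hxr hxc
    let t : 𝒪[F] := ⟨Algebra.trace F E x, mem_integer_iff.2 (trace_mem_pPow_zero hx0)⟩
    let n : 𝒪[F] := ⟨Algebra.norm F x, mem_integer_iff.2 (norm_mem_pPow hx0)⟩
    rw [irreducible_iff_quadratic hxr t n rfl rfl] at hirr
    -- otherwise the discriminant vanishes modulo `𝔭`, and the polynomial has a double root
    have hdisc : t ^ 2 - 4 * n ∈ 𝓂[F] := by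
      rw [← IsLocalRing.residue_eq_zero_iff, ← map_zero (IsLocalRing.residue 𝒪[F]), residue_eq_iff]
      change (Algebra.trace F E x) ^ 2 - 4 * Algebra.norm F x - 0 ∈ _
      rw [sub_zero, ← algebraMap_mem_pPow_one (E := E), map_sub, map_mul, map_pow, algebraMap_trace,
        algebraMap_norm, map_ofNat]
      have := mul_mem_pPow hxc hxc
      refine pPow_anti (b := 1 + 1) (by omega) ?_
      convert this using 1; ring
    rw [← IsLocalRing.residue_eq_zero_iff, map_sub, map_mul, map_pow, map_ofNat] at hdisc
    set t' := IsLocalRing.residue 𝒪[F] t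
    set n' := IsLocalRing.residue 𝒪[F] n
    have h2 : (2 : 𝓀[F]) ≠ 0 := by
      intro h2
      exact (Fact.out : ringChar 𝓀[F] ≠ 2)
        (CharP.ringChar_of_prime_eq_zero Nat.prime_two (by exact_mod_cast h2))
    have hroot : IsRoot (X ^ 2 - C t' * X + C n' : 𝓀[F][X]) (t' / 2) := by
      simp only [IsRoot.def, eval_add, eval_sub, eval_mul, eval_pow, eval_X, eval_C]
      field_simp
      linear_combination -hdisc
    have hdeg : degree (X ^ 2 - C t' * X + C n' : 𝓀[F][X]) = 2 := by compute_degree!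
    rw [degree_eq_one_of_irreducible_of_root hirr hroot] at hdeg
    exact absurd hdeg (by decide)
  · -- `α` has odd valuation while its trace has even valuation
    have hodd := h.odd_of_ramified hu
    have he : ramIdx F E = 2 := if_neg hu
    have htr : algebraMap F E (Algebra.trace F E α) ∈ pPow E (1 - m) := by
      by_cases h0 : Algebra.trace F E α = 0
      · rw [h0, map_zero]; exact zero_mem_pPow _
      have h1 : algebraMap F E (Algebra.trace F E α) ∈ pPow E (-m) := by
        rw [algebraMap_trace]
        exact add_mem_pPow h.mem_pPow (conj_mem_pPow h.mem_pPow)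
      rw [TameTypes.mem_pPow (hom_ne_zero h0), ord_algebraMap h0, he] at h1 ⊢
      obtain ⟨k, hk⟩ := hodd
      omega
    have h2 : 2 * α ∈ pPow E (1 - m) := by
      convert add_mem_pPow hmem htr using 1
      rw [algebraMap_trace]; ring
    have h2E := two_ne_zero_ext F E
    have ho2 : ord (2 : E) = 0 := by
      rw [← map_ofNat (algebraMap F E) 2, ord_algebraMap (NeZero.ne 2), ord_two, mul_zero]
    rw [TameTypes.mem_pPow (mul_ne_zero h2E h.ne_zero), ord_mul h2E h.ne_zero, h.ord_eq, ho2] at h2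
    omega

/-- The residue characteristic of an extension of `F` is odd as well. -/
lemma fact_ringChar_ext (F : Type*) [Field F] [ValuativeRel F] [TopologicalSpace F]
    [IsNonarchimedeanLocalField F] [Fact (ringChar 𝓀[F] ≠ 2)] (E : Type*) [Field E]
    [ValuativeRel E] [TopologicalSpace E] [IsNonarchimedeanLocalField E] [Algebra F E]
    [ValuativeExtension F E] [Algebra.IsQuadraticExtension F E] : Fact (ringChar 𝓀[E] ≠ 2) := ⟨fun h => by
  have h2 : ((2 : ℕ) : 𝓀[E]) = 0 := by rw [← h]; exact ringChar.Nat.cast_ringChar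
  have h1 := (residue_eq_iff (x := (2 : 𝒪[E])) (y := 0)).1 (by
    rw [map_zero, map_ofNat]; exact_mod_cast h2)
  apply two_not_mem_pPow F
  rw [← algebraMap_mem_pPow_one (E := E), map_ofNat]
  change (2 : E) - 0 ∈ _ at h1
  rwa [sub_zero] at h1⟩

lemma norm_sub_norm_mem {x y : E} (hx : x ∈ pPow E 0) (hy : y ∈ pPow E 0) (h : x - y ∈ pPow E 1) :
    Algebra.norm F x - Algebra.norm F y ∈ pPow F 1 := by
  rw [← algebraMap_mem_pPow_one (E := E), map_sub, algebraMap_norm, algebraMap_norm]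
  have e : x * conj F E x - y * conj F E y = (x - y) * conj F E x + y * conj F E (x - y) := by
    rw [map_sub]; ring
  rw [e]
  exact add_mem_pPow (mem_pPow_of_eq (mul_mem_pPow h (conj_mem_pPow hx)) (by omega))
    (mem_pPow_of_eq (mul_mem_pPow hy (conj_mem_pPow h)) (by omega))

/-- Minimality only depends on the class modulo `𝔭_E ^ (1 - m)`. -/
lemma IsMinimalElt.congr {m : ℕ} {α β : E} (h : IsMinimalElt F m α)
    (hαβ : β - α ∈ pPow E (1 - m)) : IsMinimalElt F m β := by
  have hβα : β / α - 1 ∈ pPow E 1 := by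
    have : β / α - 1 = (β - α) * α⁻¹ := by field_simp [h.ne_zero]
    rw [this]
    exact mem_pPow_of_eq (mul_mem_pPow hαβ (inv_mem_pPow h.ne_zero)) (by rw [h.ord_eq]; ring)
  obtain ⟨h0, ho⟩ := ne_zero_and_ord_eq_zero hβα
  have hβ0 : β ≠ 0 := by rintro rfl; simp at h0
  have hβo : ord β = -m := by
    rw [ord_div hβ0 h.ne_zero, h.ord_eq] at ho; omega
  refine ⟨by rw [val_eq_exp hβ0, hβo, neg_neg], h.odd_of_ramified, fun hu ϖ hϖ1 => ?_⟩
  have hϖ : ϖ ≠ 0 := by rintro rfl; simp [ord, val_eq_zero.2] at hϖ1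
  obtain ⟨hα, hirr⟩ := h.irreducible_of_unramified hu ϖ hϖ1
  have hβ : β ∉ Set.range (algebraMap F E) := by
    rintro ⟨b, rfl⟩
    apply h.sub_conj_not_mem
    have := sub_mem_pPow (conj_mem_pPow (F := F) hαβ) hαβ
    rw [map_sub, AlgHom.commutes] at this
    convert this using 1; ring
  refine ⟨hβ, ?_⟩
  have hβm : β ∈ pPow E (-m) := mem_pPow_of_eq mem_pPow_self hβo
  have hxα := pow_smul_mem hu hϖ hϖ1 m (i := 0) (by simpa using h.mem_pPow)
  have hxβ := pow_smul_mem hu hϖ hϖ1 m (i := 0) (by simpa using hβm)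
  have hd := pow_smul_mem hu hϖ hϖ1 m hαβ
  rw [smul_sub] at hd
  have hrα := pow_smul_not_mem_range hϖ m hα
  have hrβ := pow_smul_not_mem_range hϖ m hβ
  generalize ϖ ^ m • α = x at *
  generalize ϖ ^ m • β = y at *
  let T : ∀ {z : E}, z ∈ pPow E 0 → 𝒪[F] := fun {z} hz =>
    ⟨Algebra.trace F E z, mem_integer_iff.2 (trace_mem_pPow_zero hz)⟩
  let N : ∀ {z : E}, z ∈ pPow E 0 → 𝒪[F] := fun {z} hz =>
    ⟨Algebra.norm F z, mem_integer_iff.2 (norm_mem_pPow hz)⟩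
  rw [irreducible_iff_quadratic hrα (T hxα) (N hxα) rfl rfl] at hirr
  rw [irreducible_iff_quadratic hrβ (T hxβ) (N hxβ) rfl rfl]
  have e1 : IsLocalRing.residue 𝒪[F] (N hxβ) = IsLocalRing.residue 𝒪[F] (N hxα) :=
    residue_eq_iff.2 (norm_sub_norm_mem hxβ hxα hd)
  have e2 : IsLocalRing.residue 𝒪[F] (T hxβ) = IsLocalRing.residue 𝒪[F] (T hxα) :=
    residue_eq_iff.2 (by
      have := trace_mem_pPow_one (F := F) hd
      rwa [map_sub] at this)
  rwa [e1, e2]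

lemma IsMinimalElt.conj_ne {m : ℕ} {α : E} (h : IsMinimalElt F m α) : conj F E α ≠ α := by
  intro h'
  apply h.sub_conj_not_mem
  rw [h', sub_self]; exact zero_mem_pPow _

lemma half_mem {K : Type*} [Field K] [ValuativeRel K] [TopologicalSpace K]
    [IsNonarchimedeanLocalField K] [Fact (ringChar 𝓀[K] ≠ 2)] {x : K} {n : ℤ}
    (hx : x ∈ pPow K n) : x / 2 ∈ pPow K n := by
  have := inv_mem_pPow (NeZero.ne (2 : K))
  rw [ord_two, neg_zero] at this
  rw [div_eq_mul_inv]
  exact mem_pPow_of_eq (mul_mem_pPow hx this) (by omega)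

/-- An element of `E` in terms of a basis `1, a` with `σ a = -a`. -/
lemma eq_trace_add {a : E} (ha : a ≠ 0) (hσ : conj F E a = -a) (x : E) :
    x = algebraMap F E (Algebra.trace F E x / 2) +
      algebraMap F E (-Algebra.trace F E (x * a) / (2 * Algebra.norm F a)) * a := by
  have h2 := two_ne_zero_ext F E
  rw [map_div₀, map_div₀, map_neg, (algebraMap F E).map_mul, algebraMap_trace, algebraMap_trace,
    algebraMap_norm, map_mul, hσ, map_ofNat]
  field_simp
  ring

/-- The coordinates of an element with respect to a basis `1, a` with `σ a = -a`. -/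
lemma coord_mem {a : E} (ha : a ≠ 0) (hσ : conj F E a = -a) {x : E} {i : ℤ} (hx : x ∈ pPow E i) :
    algebraMap F E (Algebra.trace F E x / 2) ∈ pPow E i ∧
      algebraMap F E (-Algebra.trace F E (x * a) / (2 * Algebra.norm F a)) ∈ pPow E (i - ord a) := by
  have := fact_ringChar_ext F E
  have h2 := two_ne_zero_ext F E
  constructor
  · rw [map_div₀, algebraMap_trace, map_ofNat]
    exact half_mem (add_mem_pPow hx (conj_mem_pPow hx))
  · have := mul_mem_pPow (half_mem (sub_mem_pPow hx (conj_mem_pPow (F := F) hx)))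
      (inv_mem_pPow ha)
    rw [← sub_eq_add_neg] at this
    convert this using 1
    rw [map_div₀, map_neg, (algebraMap F E).map_mul, algebraMap_trace, algebraMap_norm, map_mul,
      hσ, map_ofNat]
    field_simp
    ring

/-- The trace zero part `a` of a minimal element: `σ a = -a` and `a` has valuation `-m`. -/
lemma IsMinimalElt.exists_traceless {m : ℕ} {α : E} (h : IsMinimalElt F m α) :
    ∃ (a : E) (t : F), α = algebraMap F E t + a ∧ conj F E a = -a ∧ a ≠ 0 ∧ ord a = -m ∧
      algebraMap F E t ∈ pPow E (-m) := by
  have := fact_ringChar_ext F E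
  have h2 := two_ne_zero_ext F E
  have hαm := h.mem_pPow
  have hsub := sub_ne_zero.2 h.conj_ne.symm
  have hne := div_ne_zero hsub h2
  have hmem := half_mem (sub_mem_pPow hαm (conj_mem_pPow (F := F) hαm))
  refine ⟨(α - conj F E α) / 2, Algebra.trace F E α / 2, ?_, ?_, hne, ?_, ?_⟩
  · rw [map_div₀, algebraMap_trace, map_ofNat]; field_simp; ring
  · rw [map_div₀, map_sub, conj_conj, map_ofNat]; ring
  · by_contra h'
    rw [TameTypes.mem_pPow hne] at hmem
    have h3 := (TameTypes.mem_pPow hne (n := 1 - m)).2 (by omega)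
    apply h.sub_conj_not_mem
    have h4 := add_mem_pPow h3 h3
    rwa [add_halves] at h4
  · rw [map_div₀, algebraMap_trace, map_ofNat]
    exact half_mem (add_mem_pPow hαm (conj_mem_pPow hαm))

/-- In the unramified case there is a unit `a` with `σ a = -a`. -/
lemma exists_unit_conj_eq_neg (hu : Unramified F E) : ∃ a : E, a ≠ 0 ∧ conj F E a = -a ∧ ord a = 0 := by
  obtain ⟨a, ha, hσ⟩ := exists_conj_eq_neg F E
  obtain ⟨x, hx, hxo⟩ := exists_ord_eq (K := F) (-ord a)
  have hxE : algebraMap F E x ≠ 0 := hom_ne_zero hx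
  have he := ramIdx_of_unramified hu
  refine ⟨algebraMap F E x * a, mul_ne_zero hxE ha, by rw [map_mul, hσ, AlgHom.commutes]; ring, ?_⟩
  rw [ord_mul hxE ha, ord_algebraMap hx, hxo, he]; ring

/-- If `E / F` is unramified, the residue field of `E` has `q ^ 2` elements. -/
lemma natCard_residue_unramified (hu : Unramified F E) : Nat.card 𝓀[E] = Nat.card 𝓀[F] ^ 2 := by
  obtain ⟨a, ha, hσ, ha0⟩ := exists_unit_conj_eq_neg hu
  have he := ramIdx_of_unramified hu
  have hao : a ∈ pPow E 0 := by rw [mem_pPow ha]; omega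
  have hadd : ∀ x y : F, x ∈ pPow F 0 → y ∈ pPow F 0 →
      algebraMap F E x + algebraMap F E y * a ∈ pPow E 0 := fun x y hx hy =>
    add_mem_pPow (algebraMap_mem_pPow_zero.2 hx) (by
      simpa using mul_mem_pPow (algebraMap_mem_pPow_zero (E := E).2 hy) hao)
  have hta : Algebra.trace F E a = 0 := by
    apply (algebraMap F E).injective
    rw [algebraMap_trace, hσ, map_zero, add_neg_cancel]
  have htaa : Algebra.trace F E (a * a) = -(2 * Algebra.norm F a) := by
    apply (algebraMap F E).injective
    rw [algebraMap_trace, map_neg, (algebraMap F E).map_mul, algebraMap_norm, map_mul, hσ, map_ofNat]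
    ring
  have hN : Algebra.norm F a ≠ 0 := by rwa [Ne, Algebra.norm_eq_zero_iff]
  have h2 : (2 : F) ≠ 0 := NeZero.ne 2
  -- `1, a` is a basis of `𝒪_E` over `𝒪_F`, also modulo the maximal ideals
  have key : ∀ x y : F, algebraMap F E x + algebraMap F E y * a ∈ pPow E 1 →
      x ∈ pPow F 1 ∧ y ∈ pPow F 1 := fun x y h => by
    have hc := coord_mem ha hσ h
    rw [add_mul, mul_assoc, map_add, map_add, trace_algebraMap_quadratic, trace_algebraMap_mul,
      trace_algebraMap_mul, trace_algebraMap_mul, hta, htaa, ha0, sub_zero, algebraMap_mem_pPow_one,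
      algebraMap_mem_pPow_one] at hc
    convert hc using 2 <;> field_simp <;> ring
  let f : 𝒪[F] × 𝒪[F] → 𝒪[E] := fun p =>
    ⟨algebraMap F E p.1 + algebraMap F E p.2 * a,
      mem_integer_iff.2 (hadd _ _ (mem_integer_iff.1 p.1.2) (mem_integer_iff.1 p.2.2))⟩
  have hsurj := IsLocalRing.residue_surjective (R := 𝒪[F])
  let s : 𝓀[F] → 𝒪[F] := Function.surjInv hsurj
  have hs : ∀ x, IsLocalRing.residue 𝒪[F] (s x) = x := Function.surjInv_eq hsurj
  let g : 𝓀[F] × 𝓀[F] → 𝓀[E] := fun p => IsLocalRing.residue 𝒪[E] (f (s p.1, s p.2))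
  have hf : ∀ p p' : 𝒪[F] × 𝒪[F], IsLocalRing.residue 𝒪[E] (f p) = IsLocalRing.residue 𝒪[E] (f p') ↔
      IsLocalRing.residue 𝒪[F] p.1 = IsLocalRing.residue 𝒪[F] p'.1 ∧
      IsLocalRing.residue 𝒪[F] p.2 = IsLocalRing.residue 𝒪[F] p'.2 := fun p p' => by
    rw [residue_eq_iff, residue_eq_iff, residue_eq_iff]
    have e : (f p : E) - f p' = algebraMap F E (p.1 - p'.1) + algebraMap F E (p.2 - p'.2) * a := by
      simp only [f, map_sub]; ring
    rw [e]
    refine ⟨key _ _, fun ⟨h1, h2⟩ => add_mem_pPow (algebraMap_mem_pPow_one.2 h1) ?_⟩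
    simpa using mul_mem_pPow (algebraMap_mem_pPow_one (E := E).2 h2) hao
  have hg : Function.Bijective g := by
    constructor
    · rintro ⟨x, y⟩ ⟨x', y'⟩ h
      have := (hf _ _).1 h
      simp only [hs] at this
      rw [this.1, this.2]
    · intro z
      obtain ⟨w, rfl⟩ := IsLocalRing.residue_surjective z
      have hw : (w : E) ∈ pPow E 0 := mem_integer_iff.1 w.2
      have hxy := coord_mem ha hσ hw
      have hwxy := eq_trace_add ha hσ (w : E)
      rw [ha0, sub_zero, algebraMap_mem_pPow_zero, algebraMap_mem_pPow_zero] at hxy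
      generalize Algebra.trace F E (w : E) / 2 = x at hxy hwxy
      generalize -Algebra.trace F E ((w : E) * a) / (2 * Algebra.norm F a) = y at hxy hwxy
      have hwf : w = f (⟨x, mem_integer_iff.2 hxy.1⟩, ⟨y, mem_integer_iff.2 hxy.2⟩) :=
        Subtype.ext hwxy
      refine ⟨(IsLocalRing.residue 𝒪[F] ⟨x, mem_integer_iff.2 hxy.1⟩,
        IsLocalRing.residue 𝒪[F] ⟨y, mem_integer_iff.2 hxy.2⟩), ?_⟩
      simp only [g]
      rw [hwf, hf]
      exact ⟨hs _, hs _⟩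
  rw [← Nat.card_congr (Equiv.ofBijective g hg), Nat.card_prod, sq]

end Minimal

/-! ### Quaternion algebras in the form `E ⊕ E c` -/

/-- A presentation `R = E ⊕ E c` of a quaternion algebra, with `c x = σ(x) c` for `x ∈ E` and
`c ^ 2 = d ∈ F`. The element `d` is normalised to have valuation `κ ∈ {0, 1}` in `E`. The maps `X` and
`Y` are the two coordinates. -/
structure QuatModel (F E R : Type*) [Field F] [ValuativeRel F] [TopologicalSpace F]
    [IsNonarchimedeanLocalField F] [Fact (ringChar 𝓀[F] ≠ 2)] [Field E] [ValuativeRel E]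
    [TopologicalSpace E] [IsNonarchimedeanLocalField E] [Algebra F E]
    [Algebra.IsQuadraticExtension F E] [Ring R] [Algebra F R] where
  j : E →ₐ[F] R
  c : R
  d : F
  κ : ℤ
  X : R →ₗ[F] E
  Y : R →ₗ[F] E
  κ_eq : κ = 0 ∨ κ = 1
  d_ne_zero : d ≠ 0
  ord_d : ord (algebraMap F E d) = κ
  c_mul : ∀ x, c * j x = j (conj F E x) * c
  c_mul_c : c * c = algebraMap F R d
  decomp : ∀ r, r = j (X r) + j (Y r) * c
  X_mk : ∀ x y, X (j x + j y * c) = x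
  Y_mk : ∀ x y, Y (j x + j y * c) = y

namespace QuatModel

variable {R : Type*} [Ring R] [Algebra F R] (D : QuatModel F E R)

/-- The element `x + y c`. -/
def elt (x y : E) : R := D.j x + D.j y * D.c

@[simp] lemma X_elt (x y : E) : D.X (D.elt x y) = x := D.X_mk x y
@[simp] lemma Y_elt (x y : E) : D.Y (D.elt x y) = y := D.Y_mk x y

lemma elt_eta (r : R) : D.elt (D.X r) (D.Y r) = r := (D.decomp r).symm

lemma ext {r s : R} (h1 : D.X r = D.X s) (h2 : D.Y r = D.Y s) : r = s := by
  rw [← D.elt_eta r, ← D.elt_eta s, h1, h2]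

lemma j_eq_elt (x : E) : D.j x = D.elt x 0 := by simp [elt]

@[simp] lemma X_j (x : E) : D.X (D.j x) = x := by rw [j_eq_elt, X_elt]
@[simp] lemma Y_j (x : E) : D.Y (D.j x) = 0 := by rw [j_eq_elt, Y_elt]
@[simp] lemma X_one : D.X 1 = 1 := by rw [← map_one D.j, X_j]
@[simp] lemma Y_one : D.Y 1 = 0 := by rw [← map_one D.j, Y_j]

lemma elt_mul_elt (x y x' y' : E) : D.elt x y * D.elt x' y' =
    D.elt (x * x' + algebraMap F E D.d * y * conj F E y') (x * y' + y * conj F E x') := by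
  simp only [elt, add_mul, mul_add, map_add, map_mul, AlgHom.commutes]
  have h1 : D.j y * D.c * D.j x' = D.j y * D.j (conj F E x') * D.c := by
    rw [mul_assoc, D.c_mul, mul_assoc]
  have h2 : D.j y * D.c * (D.j y' * D.c) =
      algebraMap F R D.d * D.j y * D.j (conj F E y') := by
    rw [← mul_assoc, mul_assoc (D.j y), D.c_mul, ← mul_assoc, mul_assoc, D.c_mul_c,
      ← Algebra.commutes, mul_assoc]
  rw [h1, h2]
  simp only [mul_assoc]
  abel

lemma X_mul (r s : R) :
    D.X (r * s) = D.X r * D.X s + algebraMap F E D.d * D.Y r * conj F E (D.Y s) := by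
  conv_lhs => rw [← D.elt_eta r, ← D.elt_eta s, elt_mul_elt, X_elt]

lemma Y_mul (r s : R) : D.Y (r * s) = D.X r * D.Y s + D.Y r * conj F E (D.X s) := by
  conv_lhs => rw [← D.elt_eta r, ← D.elt_eta s, elt_mul_elt, Y_elt]

@[simp] lemma X_algebraMap (a : F) : D.X (algebraMap F R a) = algebraMap F E a := by
  rw [← AlgHom.commutes D.j, X_j]

@[simp] lemma Y_algebraMap (a : F) : D.Y (algebraMap F R a) = 0 := by
  rw [← AlgHom.commutes D.j, Y_j]

/-- The conjugate `σ(x) - y c` of `x + y c`. -/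
noncomputable def bar (r : R) : R := D.elt (conj F E (D.X r)) (-D.Y r)

/-- The reduced trace in coordinates. -/
noncomputable def tr : R →ₗ[F] F := Algebra.trace F E ∘ₗ D.X

/-- The reduced norm in coordinates, `N(x) - d N(y)`. -/
noncomputable def nrm : R →* F where
  toFun r := Algebra.norm F (D.X r) - D.d * Algebra.norm F (D.Y r)
  map_one' := by simp
  map_mul' r s := by
    apply (algebraMap F E).injective
    simp only [map_sub, map_mul, algebraMap_norm, X_mul, Y_mul, map_add, AlgHom.commutes, conj_conj]
    ring

lemma tr_apply (r : R) : D.tr r = Algebra.trace F E (D.X r) := rfl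

lemma nrm_apply (r : R) :
    D.nrm r = Algebra.norm F (D.X r) - D.d * Algebra.norm F (D.Y r) := rfl

lemma algebraMap_nrm (r : R) : algebraMap F E (D.nrm r) =
    D.X r * conj F E (D.X r) - algebraMap F E D.d * (D.Y r * conj F E (D.Y r)) := by
  rw [nrm_apply, map_sub, map_mul, algebraMap_norm, algebraMap_norm]

lemma mul_bar (r : R) : r * D.bar r = algebraMap F R (D.nrm r) := by
  apply D.ext
  · rw [X_mul, bar, X_elt, Y_elt, X_algebraMap, algebraMap_nrm, map_neg]; ring
  · rw [Y_mul, bar, X_elt, Y_elt, Y_algebraMap, conj_conj]; ring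

lemma bar_mul (r : R) : D.bar r * r = algebraMap F R (D.nrm r) := by
  apply D.ext
  · rw [X_mul, bar, X_elt, Y_elt, X_algebraMap, algebraMap_nrm]; ring
  · rw [Y_mul, bar, X_elt, Y_elt, Y_algebraMap]; ring

lemma bar_eq (r : R) : D.bar r = algebraMap F R (D.tr r) - r := by
  apply D.ext
  · rw [bar, X_elt, map_sub, X_algebraMap, tr_apply, algebraMap_trace]; ring
  · rw [bar, Y_elt, map_sub, Y_algebraMap]; ring

lemma tr_mul_comm (r s : R) : D.tr (r * s) = D.tr (s * r) := by
  apply (algebraMap F E).injective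
  rw [tr_apply, tr_apply, algebraMap_trace, algebraMap_trace, X_mul, X_mul]
  simp only [map_add, map_mul, conj_conj, AlgHom.commutes]
  ring

lemma nrm_unit_ne_zero (g : Rˣ) : D.nrm g ≠ 0 := (g.isUnit.map D.nrm).ne_zero

/-- The reduced norm on unit groups. -/
noncomputable def nrmUnits : Rˣ →* Fˣ := Units.map D.nrm

@[simp] lemma coe_nrmUnits (g : Rˣ) : (D.nrmUnits g : F) = D.nrm g := rfl

/-- An element with nonzero norm, as a unit. -/
noncomputable def mkUnit (r : R) (h : D.nrm r ≠ 0) : Rˣ where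
  val := r
  inv := algebraMap F R (D.nrm r)⁻¹ * D.bar r
  val_inv := by
    rw [← mul_assoc, ← Algebra.commutes, mul_assoc, mul_bar, ← map_mul, inv_mul_cancel₀ h, map_one]
  inv_val := by rw [mul_assoc, bar_mul, ← map_mul, inv_mul_cancel₀ h, map_one]

@[simp] lemma coe_mkUnit (r : R) (h : D.nrm r ≠ 0) : (D.mkUnit r h : R) = r := rfl

lemma inv_eq (g : Rˣ) : ((g⁻¹ : Rˣ) : R) = algebraMap F R (D.nrm g)⁻¹ * D.bar g := by
  have : g = D.mkUnit g (D.nrm_unit_ne_zero g) := Units.ext rfl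
  conv_lhs => rw [this]
  rfl

lemma X_algebraMap_mul (a : F) (r : R) : D.X (algebraMap F R a * r) = algebraMap F E a * D.X r := by
  rw [X_mul, X_algebraMap, Y_algebraMap]; ring

lemma Y_algebraMap_mul (a : F) (r : R) : D.Y (algebraMap F R a * r) = algebraMap F E a * D.Y r := by
  rw [Y_mul, X_algebraMap, Y_algebraMap]; ring

lemma X_inv (g : Rˣ) : D.X (g⁻¹ : Rˣ) = conj F E (D.X g) / algebraMap F E (D.nrm g) := by
  rw [D.inv_eq g, X_algebraMap_mul, bar, X_elt, map_inv₀]; ring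

lemma Y_inv (g : Rˣ) : D.Y (g⁻¹ : Rˣ) = -D.Y g / algebraMap F E (D.nrm g) := by
  rw [D.inv_eq g, Y_algebraMap_mul, bar, Y_elt, map_inv₀]; ring

/-- The embedding of unit groups `Eˣ → Rˣ`. -/
def jUnits : Eˣ →* Rˣ := Units.map (D.j : E →* R)

@[simp] lemma coe_jUnits (e : Eˣ) : (D.jUnits e : R) = D.j e := rfl

lemma nrm_j (x : E) : D.nrm (D.j x) = Algebra.norm F x := by simp [nrm_apply]

lemma nrmUnits_jUnits (e : Eˣ) : D.nrmUnits (D.jUnits e) = normUnits F E e :=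
  Units.ext (D.nrm_j e)

lemma X_j_mul (x : E) (r : R) : D.X (D.j x * r) = x * D.X r := by
  rw [X_mul, X_j, Y_j]; ring

lemma Y_j_mul (x : E) (r : R) : D.Y (D.j x * r) = x * D.Y r := by
  rw [Y_mul, X_j, Y_j]; ring

lemma X_mul_j (x : E) (r : R) : D.X (r * D.j x) = x * D.X r := by
  rw [X_mul, X_j, Y_j, map_zero]; ring

lemma Y_mul_j (x : E) (r : R) : D.Y (r * D.j x) = conj F E x * D.Y r := by
  rw [Y_mul, X_j, Y_j]; ring

/-! ### Lattices and congruence subgroups -/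

/-- The lattice `𝔭_E ^ a ⊕ 𝔭_E ^ b c`. -/
def lat (a b : ℤ) : Set R := {r | D.X r ∈ pPow E a ∧ D.Y r ∈ pPow E b}

lemma d_mul_mem {y y' : E} {b b' : ℤ} (hy : y ∈ pPow E b) (hy' : y' ∈ pPow E b') :
    algebraMap F E D.d * y * conj F E y' ∈ pPow E (D.κ + b + b') := by
  refine mul_mem_pPow (mul_mem_pPow ?_ hy) (conj_mem_pPow hy')
  rw [← D.ord_d]; exact mem_pPow_self

lemma mul_mem_lat {a b a' b' A B : ℤ} {r s : R} (hr : r ∈ D.lat a b) (hs : s ∈ D.lat a' b')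
    (h1 : A ≤ a + a') (h2 : A ≤ D.κ + b + b') (h3 : B ≤ a + b') (h4 : B ≤ b + a') :
    r * s ∈ D.lat A B := by
  refine ⟨?_, ?_⟩
  · rw [X_mul]
    exact add_mem_pPow (pPow_anti h1 (mul_mem_pPow hr.1 hs.1))
      (pPow_anti h2 (D.d_mul_mem hr.2 hs.2))
  · rw [Y_mul]
    exact add_mem_pPow (pPow_anti h3 (mul_mem_pPow hr.1 hs.2))
      (pPow_anti h4 (mul_mem_pPow hr.2 (conj_mem_pPow hs.1)))

lemma add_mem_lat {a b : ℤ} {r s : R} (hr : r ∈ D.lat a b) (hs : s ∈ D.lat a b) :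
    r + s ∈ D.lat a b := by
  refine ⟨?_, ?_⟩
  · rw [map_add]; exact add_mem_pPow hr.1 hs.1
  · rw [map_add]; exact add_mem_pPow hr.2 hs.2

lemma algebraMap_mul_mem_lat {a b : ℤ} {y : F} (hy : y ∈ pPow F 0) {w : R} (hw : w ∈ D.lat a b) :
    algebraMap F R y * w ∈ D.lat a b := by
  have hyE : algebraMap F E y ∈ pPow E 0 := algebraMap_mem_pPow_zero.2 hy
  constructor
  · rw [X_algebraMap_mul]; exact mem_pPow_of_eq (mul_mem_pPow hyE hw.1) (zero_add a)
  · rw [Y_algebraMap_mul]; exact mem_pPow_of_eq (mul_mem_pPow hyE hw.2) (zero_add b)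

/-- Membership in `1 + (𝔭_E ^ a ⊕ 𝔭_E ^ b c)`. -/
def InCong (a b : ℤ) (g : R) : Prop := D.X g - 1 ∈ pPow E a ∧ D.Y g ∈ pPow E b

lemma inCong_iff {a b : ℤ} {g : R} : D.InCong a b g ↔ g - 1 ∈ D.lat a b := by
  simp [InCong, lat]

lemma InCong.anti {a b a' b' : ℤ} {g : R} (h : D.InCong a b g) (h1 : a' ≤ a) (h2 : b' ≤ b) :
    D.InCong a' b' g := ⟨pPow_anti h1 h.1, pPow_anti h2 h.2⟩

lemma X_mem_zero {a : ℤ} (ha : 0 ≤ a) {x : E} (h : x - 1 ∈ pPow E a) : x ∈ pPow E 0 := by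
  have := add_mem_pPow (pPow_anti ha h) one_mem_pPow_zero
  rwa [sub_add_cancel] at this

lemma InCong.mul {a b : ℤ} (ha : 1 ≤ a) (hab : a ≤ D.κ + 2 * b) {g h : R}
    (hg : D.InCong a b g) (hh : D.InCong a b h) : D.InCong a b (g * h) := by
  constructor
  · rw [X_mul, add_sub_right_comm]
    exact add_mem_pPow (mul_sub_one_mem (by omega) hg.1 hh.1)
      (pPow_anti (by omega) (D.d_mul_mem hg.2 hh.2))
  · rw [Y_mul]
    refine add_mem_pPow ?_ ?_
    · exact mem_pPow_of_eq (mul_mem_pPow (X_mem_zero (by omega) hg.1) hh.2) (by omega)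
    · exact mem_pPow_of_eq (mul_mem_pPow hg.2 (conj_mem_pPow (X_mem_zero (by omega) hh.1)))
        (by omega)

lemma InCong.nrm_mem {a b : ℤ} (ha : 1 ≤ a) (hab : a ≤ D.κ + 2 * b) {g : R}
    (hg : D.InCong a b g) : algebraMap F E (D.nrm g) - 1 ∈ pPow E a := by
  rw [algebraMap_nrm, sub_right_comm]
  refine sub_mem_pPow (mul_sub_one_mem (by omega) hg.1 ?_) ?_
  · have := conj_mem_pPow (F := F) hg.1
    rwa [map_sub, map_one] at this
  · rw [← mul_assoc]
    exact pPow_anti (by omega) (D.d_mul_mem hg.2 hg.2)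

/-- The congruence subgroup `1 + (𝔭_E ^ a ⊕ 𝔭_E ^ b c)`. -/
def cong (a b : ℤ) (ha : 1 ≤ a) (hab : a ≤ D.κ + 2 * b) : Subgroup Rˣ where
  carrier := {g | D.InCong a b g}
  mul_mem' hg hh := InCong.mul D ha hab hg hh
  one_mem' := by
    refine ⟨?_, ?_⟩ <;> simp [zero_mem_pPow]
  inv_mem' := by
    intro g hg
    have hn := inv_sub_one_mem ha (InCong.nrm_mem D ha hab hg)
    constructor
    · rw [X_inv, div_eq_mul_inv]
      refine mul_sub_one_mem (by omega) ?_ hn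
      have := conj_mem_pPow (F := F) hg.1
      rwa [map_sub, map_one] at this
    · rw [Y_inv, div_eq_mul_inv]
      exact mem_pPow_of_eq (mul_mem_pPow (neg_mem_pPow hg.2) (X_mem_zero (by omega) hn)) (by omega)

lemma InCong.inv {a b : ℤ} (ha : 1 ≤ a) (hab : a ≤ D.κ + 2 * b) {g : Rˣ}
    (hg : D.InCong a b (g : R)) : D.InCong a b ((g⁻¹ : Rˣ) : R) :=
  (D.cong a b ha hab).inv_mem hg

lemma InCong.nrm_ne_zero {a b : ℤ} (ha : 1 ≤ a) (hab : a ≤ D.κ + 2 * b) {g : R}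
    (hg : D.InCong a b g) : D.nrm g ≠ 0 := by
  have := (ne_zero_and_ord_eq_zero (pPow_anti ha (InCong.nrm_mem D ha hab hg))).1
  exact (_root_.map_ne_zero (algebraMap F E)).1 this

lemma InCong.mem_lat_zero {a b : ℤ} (ha : 0 ≤ a) (hb : 0 ≤ b) {g : R} (hg : D.InCong a b g) :
    g ∈ D.lat 0 0 := ⟨X_mem_zero ha hg.1, pPow_anti hb hg.2⟩

/-- Conjugation by `Eˣ` multiplies the second coordinate by a unit. -/
lemma InCong.conj_jUnits {a b : ℤ} {g : Rˣ} (hg : D.InCong a b (g : R)) (e : Eˣ) :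
    D.InCong a b ((D.jUnits e * g * (D.jUnits e)⁻¹ : Rˣ) : R) := by
  have he : ((D.jUnits e)⁻¹ : Rˣ) = D.jUnits e⁻¹ := (map_inv _ _).symm
  rw [he]
  have h0 := e.ne_zero
  constructor
  · simp only [Units.val_mul, coe_jUnits, X_mul_j, X_j_mul]
    rw [← mul_assoc, Units.inv_mul, one_mul]
    exact hg.1
  · simp only [Units.val_mul, coe_jUnits, Y_mul_j, Y_j_mul]
    have h1 := conj_mem_pPow (F := F) (mem_pPow_self (x := ((e⁻¹ : Eˣ) : E)))
    refine mem_pPow_of_eq (mul_mem_pPow h1 (mul_mem_pPow mem_pPow_self hg.2)) ?_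
    rw [Units.val_inv_eq_inv_val, ord_inv h0]; ring

/-! ### The groups `H` and `J` -/

/-- The depth of `H` in the direction of the complement of `E`. -/
def bH (m : ℕ) : ℤ := (m + 2 - D.κ) / 2

/-- The depth of `J` in the direction of the complement of `E`. -/
def bJ (m : ℕ) : ℤ := (m + 1 - D.κ) / 2

lemma depth_facts (m : ℕ) : D.bJ m + D.bH m = m + 1 - D.κ ∧ D.bJ m ≤ D.bH m ∧
    D.bH m ≤ D.bJ m + 1 ∧ 0 ≤ D.bJ m ∧ 0 ≤ D.bH m ∧ m + 1 ≤ D.κ + 2 * D.bH m ∧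
    m ≤ D.κ + 2 * D.bJ m ∧ 0 ≤ D.κ ∧ D.κ ≤ 1 := by
  unfold bH bJ
  rcases D.κ_eq with h | h <;> rw [h] <;> omega

/-- The group `H = U_E^1 (1 + W)`. -/
def grpH (m : ℕ) : Subgroup Rˣ :=
  D.cong 1 (D.bH m) le_rfl (by have := D.depth_facts m; omega)

lemma mem_grpH {m : ℕ} {g : Rˣ} : g ∈ D.grpH m ↔ D.InCong 1 (D.bH m) (g : R) := Iff.rfl

/-- The elements of the group `J = Eˣ U`, with `U` the congruence subgroup of depth `bJ`. -/
def InJ (m : ℕ) (g : Rˣ) : Prop :=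
  ∃ (e : Eˣ) (u : Rˣ), D.InCong 1 (D.bJ m) (u : R) ∧ g = D.jUnits e * u

lemma exists_unit {a b : ℤ} (ha : 1 ≤ a) (hab : a ≤ D.κ + 2 * b) {w : R} (hw : w ∈ D.lat a b) :
    ∃ u : Rˣ, (u : R) = 1 + w ∧ D.InCong a b (u : R) := by
  have h : D.InCong a b (1 + w) := by rw [inCong_iff]; simpa using hw
  exact ⟨D.mkUnit _ (InCong.nrm_ne_zero D ha hab h), rfl, h⟩

lemma mul_sub_mul_mem {m : ℕ} {g h : R} (hg : D.InCong 1 (D.bJ m) g) (hh : D.InCong 1 (D.bH m) h) :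
    g * h - h * g ∈ D.lat (m + 1) (D.bH m) := by
  have hf := D.depth_facts m
  have key : ∀ {x : E}, x - 1 ∈ pPow E 1 → x - conj F E x ∈ pPow E 1 := by
    intro x hx
    have h := conj_mem_pPow (F := F) hx
    rw [map_sub, map_one] at h
    simpa using sub_mem_pPow hx h
  constructor
  · rw [map_sub, D.X_mul, D.X_mul, mul_comm (D.X h)]
    rw [add_sub_add_left_eq_sub]
    exact sub_mem_pPow (pPow_anti (by omega) (D.d_mul_mem hg.2 hh.2))
      (pPow_anti (by omega) (D.d_mul_mem hh.2 hg.2))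
  · have e : D.Y (g * h - h * g) = D.Y h * (D.X g - conj F E (D.X g)) -
        D.Y g * (D.X h - conj F E (D.X h)) := by
      rw [map_sub, D.Y_mul, D.Y_mul]; ring
    rw [e]
    exact sub_mem_pPow (pPow_anti (by omega) (mul_mem_pPow hh.2 (key hg.1)))
      (pPow_anti (by omega) (mul_mem_pPow hg.2 (key hh.1)))

lemma lat_mul_inCong {m : ℕ} {r g : R} (hr : r ∈ D.lat (m + 1) (D.bH m))
    (hg : D.InCong 1 (D.bJ m) g) : r * g ∈ D.lat (m + 1) (D.bH m) := by
  have hf := D.depth_facts m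
  have hg' : g ∈ D.lat 0 (D.bJ m) := ⟨X_mem_zero zero_le_one hg.1, hg.2⟩
  exact D.mul_mem_lat hr hg' (by omega) (by omega) (by omega) (by omega)

lemma commutator_sub_one (g h : Rˣ) : ((g * h * g⁻¹ * h⁻¹ : Rˣ) : R) - 1 =
    ((g : R) * h - h * g) * (((h * g)⁻¹ : Rˣ) : R) := by
  have : (1 : R) = (h : R) * g * (((h * g)⁻¹ : Rˣ) : R) := by
    rw [← Units.val_mul, Units.mul_inv]
  rw [sub_mul, ← this, mul_inv_rev]
  push_cast
  simp only [mul_assoc]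

lemma inCong_commutator {m : ℕ} (hm : 1 ≤ m) {g h : Rˣ} (hg : D.InCong 1 (D.bJ m) (g : R))
    (hh : D.InCong 1 (D.bH m) (h : R)) :
    D.InCong (m + 1) (D.bH m) ((g * h * g⁻¹ * h⁻¹ : Rˣ) : R) := by
  have hf := D.depth_facts m
  rw [inCong_iff]
  have hhJ : D.InCong 1 (D.bJ m) (h : R) := hh.anti D le_rfl hf.2.1
  have h1 := InCong.inv D (g := h * g) le_rfl (by omega)
    (InCong.mul D le_rfl (by omega) hhJ hg)
  rw [commutator_sub_one]
  exact D.lat_mul_inCong (D.mul_sub_mul_mem hg hh) h1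

/-- A character of `H` is pure for `α` if it is `h ↦ ψ_E (α (X h - 1))` on `1 + W`. -/
def IsPure (ψ : AddChar F Ω) (m : ℕ) (α : E) (Θ : D.grpH m →* Ωˣ) : Prop :=
  ∀ h : D.grpH m, D.X (h : Rˣ) - 1 ∈ pPow E m →
    (Θ h : Ω) = ψ (Algebra.trace F E (α * (D.X (h : Rˣ) - 1)))

lemma psi_eq_one {ψ : AddChar F Ω} (hψ : IsLevelZero F ψ) {m : ℕ} {α x : E}
    (hα : α ∈ pPow E (-m)) (hx : x ∈ pPow E (m + 1)) : ψ (Algebra.trace F E (α * x)) = 1 :=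
  hψ.1 _ (trace_mem_pPow_one (mem_pPow_of_eq (mul_mem_pPow hα hx) (by ring)))

variable {ψ : AddChar F Ω} {m : ℕ} {α : E}

variable {Θ : D.grpH m →* Ωˣ}

lemma IsPure.eq_one (hψ : IsLevelZero F ψ) (hα : IsMinimalElt F m α) (hΘ : D.IsPure ψ m α Θ)
    (h : D.grpH m) (hh : D.X (h : Rˣ) - 1 ∈ pPow E (m + 1)) : Θ h = 1 := by
  apply Units.ext
  rw [hΘ h (pPow_anti (by omega) hh), psi_eq_one hψ hα.mem_pPow hh, Units.val_one]

/-- A pure character depends only on the `E`-coordinate. -/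
lemma IsPure.eq_of_X_eq (hψ : IsLevelZero F ψ) (hα : IsMinimalElt F m α) (hΘ : D.IsPure ψ m α Θ)
    {h h' : D.grpH m} (e : D.X (h : Rˣ) = D.X (h' : Rˣ)) : Θ h = Θ h' := by
  have hf := D.depth_facts m
  have hinv : D.InCong 1 (D.bH m) (((h⁻¹ : D.grpH m) : Rˣ) : R) := (h⁻¹).2
  have e1 : D.X (((h⁻¹ * h' : D.grpH m) : Rˣ) : R) - 1 ∈ pPow E (m + 1) := by
    have : (((h⁻¹ * h' : D.grpH m) : Rˣ) : R) - 1 =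
        (((h⁻¹ : D.grpH m) : Rˣ) : R) * (((h' : Rˣ) : R) - (h : Rˣ)) := by
      rw [mul_sub]
      push_cast
      rw [Units.inv_mul]
    rw [← D.X_one, ← map_sub, this, D.X_mul, map_sub, map_sub, e, sub_self, mul_zero, zero_add]
    exact pPow_anti (by omega) (D.d_mul_mem hinv.2 (sub_mem_pPow h'.2.2 h.2.2))
  have := hΘ.eq_one D hψ hα _ e1
  rw [map_mul, map_inv, inv_mul_eq_one] at this
  exact this

lemma InJ.conj_mem (hm : 1 ≤ m) {g : Rˣ} (hg : D.InJ m g) {h : Rˣ} (hh : h ∈ D.grpH m) :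
    g * h * g⁻¹ ∈ D.grpH m := by
  have hf := D.depth_facts m
  obtain ⟨e, u, hu, rfl⟩ := hg
  have h1 : u * h * u⁻¹ ∈ D.grpH m := by
    have := (D.inCong_commutator hm hu hh).anti D (a' := 1) (by omega) le_rfl
    have := InCong.mul D le_rfl (by omega) this hh
    rw [← Units.val_mul, inv_mul_cancel_right] at this
    exact this
  have h2 := InCong.conj_jUnits D h1 e
  rwa [show D.jUnits e * u * h * (D.jUnits e * u)⁻¹ =
    D.jUnits e * (u * h * u⁻¹) * (D.jUnits e)⁻¹ by group]

/-- `J` fixes every pure character of `H`. -/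
lemma IsPure.conj_eq (hψ : IsLevelZero F ψ) (hm : 1 ≤ m) (hα : IsMinimalElt F m α)
    (hΘ : D.IsPure ψ m α Θ)
    {g : Rˣ} (hg : D.InJ m g) {h : Rˣ} (hh : h ∈ D.grpH m) (hh' : g * h * g⁻¹ ∈ D.grpH m) :
    Θ ⟨g * h * g⁻¹, hh'⟩ = Θ ⟨h, hh⟩ := by
  have hf := D.depth_facts m
  obtain ⟨e, u, hu, rfl⟩ := hg
  have h0 := D.inCong_commutator hm hu hh
  have h1 : u * h * u⁻¹ ∈ D.grpH m := InJ.conj_mem D hm ⟨1, u, hu, by simp⟩ hh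
  have h2 : Θ ⟨u * h * u⁻¹, h1⟩ = Θ ⟨h, hh⟩ := by
    have h3 : u * h * u⁻¹ * h⁻¹ ∈ D.grpH m := (D.grpH m).mul_mem h1 ((D.grpH m).inv_mem hh)
    have := hΘ.eq_one D hψ hα ⟨_, h3⟩ h0.1
    have e2 : (⟨u * h * u⁻¹, h1⟩ : D.grpH m) = ⟨_, h3⟩ * ⟨h, hh⟩ :=
      Subtype.ext (by simp)
    rw [e2, map_mul, this, one_mul]
  rw [← h2]
  apply hΘ.eq_of_X_eq D hψ hα
  have he : ((D.jUnits e)⁻¹ : Rˣ) = D.jUnits e⁻¹ := (map_inv _ _).symm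
  have e3 : D.jUnits e * u * h * (D.jUnits e * u)⁻¹ =
    D.jUnits e * (u * h * u⁻¹) * D.jUnits e⁻¹ := by rw [← he]; group
  simp only [e3]
  rw [Units.val_mul, Units.val_mul, coe_jUnits, coe_jUnits, X_mul_j, X_j_mul, ← mul_assoc,
    Units.inv_mul, one_mul]

/-- `J` as a subgroup. -/
def grpJ (m : ℕ) (hm : 1 ≤ m) : Subgroup Rˣ where
  carrier := {g | D.InJ m g}
  one_mem' := ⟨1, 1, by simp [InCong, zero_mem_pPow], by simp⟩
  mul_mem' := by
    rintro _ _ ⟨e, u, hu, rfl⟩ ⟨e', u', hu', rfl⟩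
    have hf := D.depth_facts m
    have h1 := InCong.conj_jUnits D hu e'⁻¹
    rw [map_inv, inv_inv] at h1
    exact ⟨e * e', (D.jUnits e')⁻¹ * u * D.jUnits e' * u',
      InCong.mul D le_rfl (by omega) h1 hu', by rw [map_mul]; group⟩
  inv_mem' := by
    rintro _ ⟨e, u, hu, rfl⟩
    have hf := D.depth_facts m
    have h1 := InCong.conj_jUnits D (InCong.inv D le_rfl (by omega) hu) e
    exact ⟨e⁻¹, _, h1, by rw [map_inv]; group⟩

lemma grpH_le_grpJ (hm : 1 ≤ m) : D.grpH m ≤ D.grpJ m hm := fun u hu =>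
  ⟨1, u, InCong.anti D hu le_rfl (D.depth_facts m).2.1, by simp⟩

lemma jUnits_mem_grpJ (hm : 1 ≤ m) (e : Eˣ) : D.jUnits e ∈ D.grpJ m hm :=
  ⟨e, 1, by simp [InCong, zero_mem_pPow], by simp⟩

end QuatModel

/-! ### Duality of lattices -/

/-- A linear functional that takes values in `P` on the intersection of two lattices is a sum of two
functionals, each with values in `P` on one of the lattices. -/
lemma exists_functional_split {O F R : Type*} [CommRing O] [IsDomain O] [IsPrincipalIdealRing O]
    [Field F] [Algebra O F] [IsFractionRing O F] [AddCommGroup R] [Module F R] [Module O R]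
    [IsScalarTower O F R] {L₁ L₂ : Submodule O R} (h₁ : L₁.FG) (h₂ : L₂.FG) (ℓ : R →ₗ[F] F)
    (P : Submodule O F) (h : ∀ x ∈ L₁ ⊓ L₂, ℓ x ∈ P) :
    ∃ ℓ' : R →ₗ[F] F, (∀ x ∈ L₁, ℓ' x ∈ P) ∧ ∀ y ∈ L₂, ℓ y - ℓ' y ∈ P := by
  have htf : Module.IsTorsionFree O ↥(L₁ ⊔ L₂) := by
    refine Module.IsTorsionFree.of_smul_eq_zero fun a x hax => ?_
    by_cases ha : a = 0
    · exact .inl ha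
    right
    have h1 : a • (x : R) = 0 := congrArg Subtype.val hax
    rw [← algebraMap_smul F, smul_eq_zero] at h1
    exact Subtype.ext (h1.resolve_left ((IsFractionRing.to_map_eq_zero_iff (K := F)).not.2 ha))
  have hfin : Module.Finite O ↥(L₁ ⊔ L₂) := Module.Finite.iff_fg.2 (h₁.sup h₂)
  have : Module.Free O ↥(L₁ ⊔ L₂) := Module.free_of_finite_type_torsion_free'
  let b := Module.Free.chooseBasis O ↥(L₁ ⊔ L₂)
  have hli : LinearIndependent F fun i => (b i : R) := by
    rw [← LinearIndependent.iff_fractionRing O F]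
    exact b.linearIndependent.map' (L₁ ⊔ L₂).subtype (Submodule.ker_subtype _)
  -- `ℓ'` is `ℓ` on the `L₂`-components of a basis of `L₁ + L₂`
  have hb : ∀ i, ∃ x ∈ L₁, ∃ y ∈ L₂, x + y = b i := fun i => Submodule.mem_sup.1 (b i).2
  choose x hx y hy hxy using hb
  obtain ⟨ℓ', hℓ'⟩ := LinearMap.exists_extend ((Module.Basis.span hli).constr F fun i => ℓ (y i))
  have hℓb : ∀ i, ℓ' (b i) = ℓ (y i) := by
    intro i
    have h1 := LinearMap.congr_fun hℓ' (Module.Basis.span hli i)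
    rw [Module.Basis.constr_basis, LinearMap.comp_apply, Submodule.subtype_apply,
      Module.Basis.span_apply] at h1
    exact h1
  have hrep : ∀ z ∈ L₁ ⊔ L₂, ∃ p ∈ L₁, ∃ q ∈ L₂, p + q = z ∧ ℓ' z = ℓ q := by
    intro z hz
    have h1 := congrArg Subtype.val (b.sum_repr ⟨z, hz⟩)
    simp only [Submodule.coe_sum, Submodule.coe_smul] at h1
    generalize b.repr ⟨z, hz⟩ = r at h1
    refine ⟨∑ i, r i • x i, Submodule.sum_mem _ fun i _ => L₁.smul_mem _ (hx i), ∑ i, r i • y i,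
      Submodule.sum_mem _ fun i _ => L₂.smul_mem _ (hy i), ?_, ?_⟩
    · rw [← Finset.sum_add_distrib]
      simp only [← smul_add, hxy, h1]
    · rw [← h1, map_sum, map_sum]
      refine Finset.sum_congr rfl fun i _ => ?_
      rw [← algebraMap_smul F (r i) (b i : R), ← algebraMap_smul F (r i) (y i), map_smul, map_smul,
        hℓb]
  refine ⟨ℓ', fun z hz => ?_, fun z hz => ?_⟩
  · obtain ⟨p, hp, q, hq, rfl, e⟩ := hrep z (Submodule.mem_sup_left hz)
    rw [e]
    refine h q ⟨?_, hq⟩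
    simpa using L₁.sub_mem hz hp
  · obtain ⟨p, hp, q, hq, rfl, e⟩ := hrep z (Submodule.mem_sup_right hz)
    rw [e, ← map_sub, add_sub_cancel_right]
    refine h p ⟨hp, ?_⟩
    simpa using L₂.sub_mem hz hq

namespace QuatModel

lemma exists_trace_form (f : E →ₗ[F] F) : ∃ z : E, ∀ x, f x = Algebra.trace F E (z * x) := by
  have hinj : Function.Injective (Algebra.traceForm F E) :=
    (injective_iff_map_eq_zero _).2 fun z hz => by
      by_contra h
      have h1 := LinearMap.congr_fun hz z⁻¹
      rw [Algebra.traceForm_apply, mul_inv_cancel₀ h, ← map_one (algebraMap F E),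
        trace_algebraMap_quadratic, mul_one] at h1
      exact NeZero.ne (2 : F) h1
  have : FiniteDimensional F E := Module.finite_of_finrank_eq_succ
    (Algebra.IsQuadraticExtension.finrank_eq_two F E)
  obtain ⟨z, rfl⟩ := (LinearMap.injective_iff_surjective_of_finrank_eq_finrank
    (Subspace.dual_finrank_eq (K := F) (V := E)).symm).1 hinj f
  exact ⟨z, fun x => rfl⟩

variable {R : Type*} [Ring R] [Algebra F R] (D : QuatModel F E R)

lemma exists_tr_form (f : R →ₗ[F] F) : ∃ r, ∀ x, f x = D.tr (r * x) := by
  obtain ⟨z, hz⟩ := exists_trace_form (f ∘ₗ D.j.toLinearMap)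
  obtain ⟨z', hz'⟩ := exists_trace_form (f ∘ₗ (LinearMap.mulRight F D.c) ∘ₗ D.j.toLinearMap)
  have hd : algebraMap F E D.d ≠ 0 := hom_ne_zero D.d_ne_zero
  refine ⟨D.elt z (conj F E z' / algebraMap F E D.d), fun x => ?_⟩
  rw [tr_apply, D.X_mul, X_elt, Y_elt, mul_div_cancel₀ _ hd, ← map_mul, map_add, trace_conj, ← hz,
    ← hz']
  conv_lhs => rw [D.decomp x, map_add]
  rfl

/-- The dual of the lattice `𝔭_E ^ a ⊕ 𝔭_E ^ b c` for the trace form. -/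
lemma mem_lat_of_tr {a b : ℤ} {r : R} (h : ∀ w ∈ D.lat a b, D.tr (r * w) ∈ pPow F 1) :
    r ∈ D.lat (1 - a) (1 - D.κ - b) := by
  have hd : algebraMap F E D.d ≠ 0 := hom_ne_zero D.d_ne_zero
  constructor
  · refine mem_pPow_of_trace F fun z hz => ?_
    have := h (D.j z) ⟨by simpa using hz, by simp [zero_mem_pPow]⟩
    rwa [tr_apply, X_mul_j, mul_comm] at this
  · have h1 : algebraMap F E D.d * D.Y r ∈ pPow E (1 - b) := by
      refine mem_pPow_of_trace F fun z hz => ?_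
      have := h (D.elt 0 (conj F E z)) ⟨by simp [zero_mem_pPow], by simpa using conj_mem_pPow hz⟩
      rwa [tr_apply, D.X_mul, X_elt, Y_elt, conj_conj, mul_zero, zero_add] at this
    have h2 := mul_mem_pPow (mem_pPow_self (x := (algebraMap F E D.d)⁻¹)) h1
    rw [inv_mul_cancel_left₀ hd, ord_inv hd, D.ord_d] at h2
    exact mem_pPow_of_eq h2 (by ring)

lemma eq_zero_of_tr {r : R} (h : ∀ w, D.tr (r * w) = 0) : r = 0 := by
  have h1 : ∀ a b, r ∈ D.lat (1 - a) (1 - D.κ - b) := fun a b =>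
    D.mem_lat_of_tr fun w _ => by rw [h]; exact zero_mem_pPow _
  apply D.ext
  · rw [map_zero]
    exact eq_zero_of_forall_mem_pPow fun n => mem_pPow_of_eq (h1 (1 - n) 0).1 (by ring)
  · rw [map_zero]
    exact eq_zero_of_forall_mem_pPow fun n => mem_pPow_of_eq (h1 0 (1 - D.κ - n)).2 (by ring)

/-- The lattice `𝔭_E ^ a ⊕ 𝔭_E ^ b c` as an `𝒪_F`-module. -/
noncomputable def latO (a b : ℤ) : Submodule 𝒪[F] R where
  carrier := D.lat a b
  add_mem' := D.add_mem_lat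
  zero_mem' := by simp [lat, zero_mem_pPow]
  smul_mem' y _ hr := by
    rw [show ∀ r : R, y • r = algebraMap F R y * r from Algebra.smul_def (y : F)]
    exact D.algebraMap_mul_mem_lat (mem_integer_iff.1 y.2) hr

variable (F) in
/-- A fractional ideal of `E` lies in a lattice spanned over `𝒪_F` by two elements. -/
lemma exists_span_pPow (i : ℤ) : ∃ p q : E, ∀ x ∈ pPow E i, ∃ t s : 𝒪[F],
    x = algebraMap F E t * p + algebraMap F E s * q := by
  obtain ⟨a, ha, hσ⟩ := exists_conj_eq_neg F E
  obtain ⟨P, hP0, hP⟩ := exists_ord_eq (K := F) (-(|i| + |i - ord a|))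
  have hPE : algebraMap F E P ≠ 0 := hom_ne_zero hP0
  have hPo : ord (algebraMap F E P) ≤ i ∧ ord (algebraMap F E P) ≤ i - ord a := by
    rw [ord_algebraMap hP0, hP]
    have h1 := neg_abs_le i
    have h3 := neg_abs_le (i - ord a)
    have h4 := abs_nonneg i
    have h5 := abs_nonneg (i - ord a)
    rcases ramIdx_eq F E with ⟨-, h⟩ | ⟨-, h⟩ <;> rw [h] <;> constructor <;> linarith
  have hint : ∀ {z : F} {k : ℤ}, algebraMap F E z ∈ pPow E k → ord (algebraMap F E P) ≤ k →
      z / P ∈ 𝒪[F] := by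
    intro z k hz hk
    rw [mem_integer_iff, ← algebraMap_mem_pPow_zero (E := E), map_div₀, div_eq_mul_inv]
    have := mul_mem_pPow hz (mem_pPow_self (x := (algebraMap F E P)⁻¹))
    rw [ord_inv hPE] at this
    exact pPow_anti (by omega) this
  refine ⟨algebraMap F E P, algebraMap F E P * a, fun x hx => ?_⟩
  obtain ⟨h3, h4⟩ := coord_mem ha hσ hx
  refine ⟨⟨_, hint h3 hPo.1⟩, ⟨_, hint h4 hPo.2⟩, ?_⟩
  conv_lhs => rw [eq_trace_add ha hσ x]
  simp only [map_div₀ _ _ P]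
  field_simp

lemma latO_fg (a b : ℤ) : (D.latO a b).FG := by
  obtain ⟨p, q, h⟩ := exists_span_pPow F (E := E) a
  obtain ⟨p', q', h'⟩ := exists_span_pPow F (E := E) b
  refine Submodule.FG.of_le (T := Submodule.span 𝒪[F]
    {D.j p, D.j q, D.j p' * D.c, D.j q' * D.c}) (Submodule.fg_span (by simp)) fun r hr => ?_
  obtain ⟨t, s, e⟩ := h _ hr.1
  obtain ⟨t', s', e'⟩ := h' _ hr.2
  have e1 : r = t • D.j p + s • D.j q + t' • (D.j p' * D.c) + s' • (D.j q' * D.c) := by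
    have hs : ∀ (y : 𝒪[F]) (r : R), y • r = algebraMap F R y * r :=
      fun y r => Algebra.smul_def (y : F) r
    rw [hs, hs, hs, hs]
    conv_lhs => rw [D.decomp r, e, e']
    simp only [map_add, map_mul, AlgHom.commutes, add_mul, mul_assoc, add_assoc]
  rw [e1]
  refine Submodule.add_mem _ (Submodule.add_mem _ (Submodule.add_mem _ ?_ ?_) ?_) ?_ <;>
    exact Submodule.smul_mem _ _ (Submodule.subset_span (by simp))

/-- The key duality: if `tr (a w)` and `tr (a' g⁻¹ w g)` agree modulo `𝔭_F` for all `w` in a lattice `L`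
with `g⁻¹ w g` in a lattice `L'`, then `a` and `a'` have translates under the dual lattices of `L`
and `L'` that are conjugate by `g`. -/
lemma exists_conj_of_tr {a b a' b' : ℤ} {x x' : R} (g : Rˣ)
    (h : ∀ w ∈ D.lat a b, (g⁻¹ : Rˣ) * w * g ∈ D.lat a' b' →
      D.tr (x * w) - D.tr (x' * ((g⁻¹ : Rˣ) * w * g)) ∈ pPow F 1) :
    ∃ z ∈ D.lat (1 - a) (1 - D.κ - b), ∃ z' ∈ D.lat (1 - a') (1 - D.κ - b'),
      (x - z) * g = g * (x' - z') := by
  let P : Submodule 𝒪[F] F :=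
    { carrier := pPow F 1
      add_mem' := add_mem_pPow
      zero_mem' := zero_mem_pPow _
      smul_mem' := fun y r hr => by
        have : y • r = (y : F) * r := rfl
        rw [this]
        exact mem_pPow_of_eq (mul_mem_pPow (mem_integer_iff.1 y.2) hr) (by ring) }
  let c : R →ₗ[𝒪[F]] R :=
    { toFun := fun w => g * w * (g⁻¹ : Rˣ)
      map_add' := fun u v => by rw [mul_add, add_mul]
      map_smul' := fun y r => by
        rw [RingHom.id_apply, mul_smul_comm, smul_mul_assoc] }
  have hc : ∀ w, c w = g * w * (g⁻¹ : Rˣ) := fun _ => rfl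
  -- the functional `w ↦ tr (x w) - tr (x' g⁻¹ w g)` maps `L ∩ g L' g⁻¹` to `𝔭_F`; split it accordingly
  let ℓ : R →ₗ[F] F := D.tr ∘ₗ LinearMap.mulLeft F (x - g * x' * (g⁻¹ : Rˣ))
  have hℓ : ∀ w, ℓ w = D.tr (x * w) - D.tr (x' * ((g⁻¹ : Rˣ) * w * g)) := by
    intro w
    change D.tr ((x - g * x' * (g⁻¹ : Rˣ)) * w) = _
    rw [sub_mul, map_sub, mul_assoc (g * x'), mul_assoc (g : R), D.tr_mul_comm g]
    simp only [mul_assoc]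
  have hP : ∀ w ∈ D.latO a b ⊓ (D.latO a' b').map c, ℓ w ∈ P := by
    rintro w ⟨hw, w', hw', rfl⟩
    rw [hℓ]
    refine h _ hw ?_
    rw [hc]
    have : ((g⁻¹ : Rˣ) : R) * (g * w' * (g⁻¹ : Rˣ)) * g = w' := by
      simp [mul_assoc]
    rwa [this]
  obtain ⟨ℓ', h1, h2⟩ := exists_functional_split (D.latO_fg a b) ((D.latO_fg a' b').map c) ℓ P hP
  obtain ⟨z, hz⟩ := D.exists_tr_form ℓ'
  obtain ⟨z₂, hz₂⟩ := D.exists_tr_form (ℓ - ℓ')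
  have e : x - g * x' * (g⁻¹ : Rˣ) = z + z₂ := by
    rw [← sub_eq_zero]
    refine D.eq_zero_of_tr fun w => ?_
    have := hz₂ w
    rw [LinearMap.sub_apply, hz] at this
    have h3 : ℓ w = D.tr ((x - g * x' * (g⁻¹ : Rˣ)) * w) := rfl
    rw [sub_mul, add_mul, map_sub, map_add, ← this, ← h3]
    ring
  refine ⟨z, D.mem_lat_of_tr fun w hw => by rw [← hz]; exact h1 w hw,
    -((g⁻¹ : Rˣ) * z₂ * g), D.mem_lat_of_tr fun w hw => ?_, ?_⟩
  · have h3 := h2 (c w) ⟨w, hw, rfl⟩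
    have h4 : ℓ (c w) - ℓ' (c w) = D.tr ((g⁻¹ : Rˣ) * z₂ * g * w) := by
      rw [← LinearMap.sub_apply, hz₂, hc, ← mul_assoc, D.tr_mul_comm]
      simp only [mul_assoc]
    rw [neg_mul, map_neg, ← h4]
    exact P.neg_mem h3
  · have : x - z = g * x' * (g⁻¹ : Rˣ) + z₂ := by rw [← sub_eq_zero] at e ⊢; rw [← e]; abel
    rw [this, add_mul, sub_neg_eq_add, mul_add]
    simp [mul_assoc]

variable {ψ : AddChar F Ω} {m : ℕ} {α : E} {Θ : D.grpH m →* Ωˣ}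

/-! ### Conjugation into `E` and intertwining -/

/-- Square roots of elements of `F` that are close to `1` in `E`. -/
lemma exists_sqrt_algebraMap {z : F} {i : ℤ} (hi : 1 ≤ i) (hz : algebraMap F E z - 1 ∈ pPow E i) :
    ∃ v : F, v * v = z ∧ algebraMap F E v - 1 ∈ pPow E i := by
  have hr : ∃ k : ℤ, 1 ≤ k ∧ ∀ x : F, x ∈ pPow F k ↔ algebraMap F E x ∈ pPow E i := by
    rcases ramIdx_eq F E with ⟨-, h⟩ | ⟨-, h⟩
    · refine ⟨i, hi, fun x => ?_⟩
      rw [← algebraMap_mem_pPow_iff (E := E), h, one_mul]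
    · refine ⟨(i + 1) / 2, by omega, fun x => ?_⟩
      rw [← algebraMap_mem_pPow_iff (E := E), h]
      by_cases hx : x = 0
      · simp [hx, zero_mem_pPow]
      have hx' : algebraMap F E x ≠ 0 := hom_ne_zero hx
      rw [mem_pPow hx', mem_pPow hx', ord_algebraMap hx, h]
      omega
  obtain ⟨k, hk1, hk⟩ := hr
  have h1 : z - 1 ∈ pPow F k := by rw [hk, map_sub, map_one]; exact hz
  obtain ⟨v, hv, hv1⟩ := exists_sqrt hk1 h1
  exact ⟨v, hv, by rw [hk, map_sub, map_one] at hv1; exact hv1⟩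

/-- An element of `α + lat (1 - m) (bJ - m)`, with `α` minimal, is conjugate in the group of depth
`bJ` to an element of `α + 𝔭_E ^ (1 - m)`. If the trace zero part is `P = a + y c` and
`s a ∈ E` has the same square, then `P (P + s a) = (P + s a) s a`. -/
lemma exists_conj_into {m : ℕ} (hm : 1 ≤ m) {α : E} (hα : IsMinimalElt F m α) {S : R}
    (hX : D.X S - α ∈ pPow E (1 - m)) (hY : D.Y S ∈ pPow E (D.bJ m - m)) :
    ∃ (k : Rˣ) (α' : E), D.InCong 1 (D.bJ m) (k : R) ∧ α' - α ∈ pPow E (1 - m) ∧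
      S * k = k * D.j α' := by
  have hf := D.depth_facts m
  obtain ⟨a, t, hat, hσ, ha, hao, -⟩ := (hα.congr hX).exists_traceless
  obtain ⟨y, hy⟩ : ∃ y, D.Y S = y := ⟨_, rfl⟩
  rw [hy] at hY
  have := fact_ringChar_ext F E
  have h2 := two_ne_zero_ext F E
  have h2o : ord (2 : E) = 0 := ord_two
  have hia : a⁻¹ ∈ pPow E m := mem_pPow_of_eq mem_pPow_self (by rw [ord_inv ha, hao, neg_neg])
  have hN : algebraMap F E (Algebra.norm F a) = -(a * a) := by rw [algebraMap_norm, hσ]; ring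
  -- `S - t` has square `a ^ 2 + d N(y)`, which is `(s a) ^ 2` with `s ∈ F` near `1`
  have hz : algebraMap F E (1 - D.d * Algebra.norm F y / Algebra.norm F a) - 1 ∈ pPow E 1 := by
    have e : algebraMap F E (1 - D.d * Algebra.norm F y / Algebra.norm F a) - 1 =
        algebraMap F E D.d * y * conj F E y * a⁻¹ * a⁻¹ := by
      rw [map_sub, map_one, map_div₀, hN, map_mul, algebraMap_norm]
      field_simp
      ring
    rw [e]
    exact pPow_anti (by omega) (mul_mem_pPow (mul_mem_pPow (D.d_mul_mem hY hY) hia) hia)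
  obtain ⟨s, hs, hs1⟩ := exists_sqrt_algebraMap (F := F) (E := E) le_rfl hz
  obtain ⟨hsE, hso⟩ := ne_zero_and_ord_eq_zero hs1
  have hss : algebraMap F E s * algebraMap F E s * (a * a) =
      a * a + algebraMap F E D.d * y * conj F E y := by
    rw [← map_mul, hs, map_sub, map_one, map_div₀, hN, map_mul, algebraMap_norm]
    field_simp
    ring
  obtain ⟨σ, hsσ⟩ : ∃ σ, algebraMap F E s = σ := ⟨_, rfl⟩
  have hσσ : conj F E σ = σ := by rw [← hsσ, AlgHom.commutes]
  rw [hsσ] at hss hs1 hsE hso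
  have hSelt : S = D.elt (algebraMap F E t + a) y := by rw [← hat, ← hy, elt_eta]
  have h2s : (2 * σ)⁻¹ ∈ pPow E 0 := by
    refine mem_pPow_of_eq mem_pPow_self ?_
    rw [ord_inv (mul_ne_zero h2 hsE), ord_mul h2 hsE, h2o, hso]; rfl
  -- `k = P (s a)⁻¹ + 1` up to the factor `2`, where `P = S - t`
  have hkin : D.InCong 1 (D.bJ m) (D.elt ((1 + σ) * (2 * σ)⁻¹) (-(y * (2 * σ)⁻¹ * a⁻¹))) := by
    constructor
    · have e : D.X (D.elt ((1 + σ) * (2 * σ)⁻¹) (-(y * (2 * σ)⁻¹ * a⁻¹))) - 1 =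
          -((σ - 1) * (2 * σ)⁻¹) := by
        rw [X_elt]; field_simp; ring
      rw [e]
      exact mem_pPow_of_eq (neg_mem_pPow (mul_mem_pPow hs1 h2s)) (by ring)
    · rw [Y_elt]
      exact mem_pPow_of_eq (neg_mem_pPow (mul_mem_pPow (mul_mem_pPow hY h2s) hia)) (by ring)
  refine ⟨D.mkUnit _ (InCong.nrm_ne_zero D le_rfl (by omega) hkin), algebraMap F E t + σ * a,
    hkin, ?_, ?_⟩
  · have e : algebraMap F E t + σ * a - α = (σ - 1) * a + (D.X S - α) := by rw [hat]; ring
    rw [e]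
    exact add_mem_pPow (mem_pPow_of_eq (mul_mem_pPow hs1 mem_pPow_self) (by rw [hao]; ring)) hX
  · rw [coe_mkUnit, hSelt, j_eq_elt, elt_mul_elt, elt_mul_elt]
    simp only [map_add, map_mul, map_neg, map_inv₀, hσ, hσσ, AlgHom.commutes, map_ofNat, map_zero,
      map_one, mul_zero, add_zero, zero_add]
    congr 1
    · field_simp
      linear_combination (-1 : E) * hss
    · field_simp
      ring

/-- The lattice `X ∈ α + 𝔭_E ^ (1 - m)`, `Y ∈ 𝔭_E ^ (bJ - m)` is the coset of `α` under the dual of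
`lat m bH`. -/
lemma exists_conj_into' {m : ℕ} (hm : 1 ≤ m) {α : E} (hα : IsMinimalElt F m α) {z : R}
    (hz : z ∈ D.lat (1 - m) (1 - D.κ - D.bH m)) :
    ∃ (k : Rˣ) (α' : E), D.InCong 1 (D.bJ m) (k : R) ∧ α' - α ∈ pPow E (1 - m) ∧
      (D.j α - z) * k = k * D.j α' := by
  have hf := D.depth_facts m
  apply D.exists_conj_into hm hα
  · have := neg_mem_pPow hz.1
    simpa using this
  · have := neg_mem_pPow hz.2
    rw [map_sub, Y_j, zero_sub]
    exact mem_pPow_of_eq this (by omega)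

/-- If `w` and `g⁻¹ w g` lie in lattices, then so do their multiples by `y ∈ 𝒪_F`, and `1 + y w` is a
unit. -/
lemma exists_unit_smul {a b a' b' : ℤ} (ha : 1 ≤ a) (hab : a ≤ D.κ + 2 * b) {g : Rˣ} {w : R}
    (hw : w ∈ D.lat a b) (hw' : (g⁻¹ : Rˣ) * w * g ∈ D.lat a' b') {y : F} (hy : y ∈ pPow F 0) :
    ∃ u : Rˣ, (u : R) = 1 + algebraMap F R y * w ∧
      ((g⁻¹ * u * g : Rˣ) : R) = 1 + algebraMap F R y * ((g⁻¹ : Rˣ) * w * g) ∧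
      D.InCong a b (u : R) ∧ D.InCong a' b' ((g⁻¹ * u * g : Rˣ) : R) := by
  obtain ⟨u, hu, huc⟩ := D.exists_unit ha hab (D.algebraMap_mul_mem_lat hy hw)
  have e : ((g⁻¹ * u * g : Rˣ) : R) = 1 + algebraMap F R y * ((g⁻¹ : Rˣ) * w * g) := by
    push_cast
    rw [hu, mul_add, mul_one, add_mul, Units.inv_mul, ← mul_assoc, ← Algebra.commutes]
    simp only [mul_assoc]
  refine ⟨u, hu, e, huc, ?_⟩
  rw [e, inCong_iff, add_sub_cancel_left]
  exact D.algebraMap_mul_mem_lat hy hw'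

lemma X_one_add (w : R) : D.X (1 + w) - 1 = D.X w := by simp

/-- The intertwining theorem: elements that intertwine two pure characters of `H`, the second of
them up to a twist by a character `ω` of the reduced norm, lie in `J`; and the two characters then
coincide. -/
theorem intertwine (hψ : IsLevelZero F ψ) (hm : 1 ≤ m) (hα : IsMinimalElt F m α)
    {Θ₁ Θ₂ : D.grpH m →* Ωˣ} (h₁ : D.IsPure ψ m α Θ₁) (ω : Fˣ →* Ωˣ)
    (h₂ : ∀ h : D.grpH m, D.X (h : Rˣ) - 1 ∈ pPow E m →
      (Θ₂ h : Ω) = ψ (Algebra.trace F E (α * (D.X (h : Rˣ) - 1))) * ω (D.nrmUnits h))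
    {g : Rˣ} (hg : ∀ (h : Rˣ) (hh : h ∈ D.grpH m) (hh' : g⁻¹ * h * g ∈ D.grpH m),
      Θ₁ ⟨h, hh⟩ = Θ₂ ⟨g⁻¹ * h * g, hh'⟩) :
    D.InJ m g ∧ Θ₁ = Θ₂ := by
  have hf := D.depth_facts m
  have hm' : (1 : ℤ) ≤ m := by exact_mod_cast hm
  -- Scalars commute with `g`, so `ω` is trivial on squares of scalars in `1 + W`. These are all of
  -- `F ∩ (1 + 𝔭_E ^ m)`.
  have hω : ∀ z : Fˣ, algebraMap F E (z : F) - 1 ∈ pPow E m → ω z = 1 := by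
    intro z hz
    obtain ⟨v, hv, hv1⟩ := exists_sqrt_algebraMap (F := F) (E := E) hm' hz
    have hw : D.j (algebraMap F E v - 1) ∈ D.lat m (D.bH m) := by
      refine ⟨by simpa using hv1, by simp [zero_mem_pPow]⟩
    obtain ⟨u, hu, huc⟩ := D.exists_unit hm' (by omega) hw
    have huH : u ∈ D.grpH m := huc.anti D (by omega) le_rfl
    have hu' : (u : R) = algebraMap F R v := by
      rw [hu, map_sub, AlgHom.commutes, map_one]; abel
    have hcomm : g⁻¹ * u * g = u := by
      apply Units.ext
      push_cast
      rw [hu', ← Algebra.commutes, mul_assoc, Units.inv_mul, mul_one]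
    have h3 := hg u huH (by rw [hcomm]; exact huH)
    have h4 : (⟨g⁻¹ * u * g, by rw [hcomm]; exact huH⟩ : D.grpH m) = ⟨u, huH⟩ :=
      Subtype.ext hcomm
    rw [h4] at h3
    have h5 := congrArg (Units.val) h3
    rw [h₁ ⟨u, huH⟩ huc.1, h₂ ⟨u, huH⟩ huc.1] at h5
    have hne : ψ (Algebra.trace F E (α * (D.X (u : R) - 1))) ≠ 0 :=
      (AddChar.val_isUnit ψ _).ne_zero
    have h6 : ((ω (D.nrmUnits u) : Ωˣ) : Ω) = 1 :=
      mul_left_cancel₀ hne (by rw [mul_one]; exact h5.symm)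
    have h7 : D.nrmUnits u = z := by
      apply Units.ext
      rw [coe_nrmUnits, hu', ← AlgHom.commutes D.j, nrm_j, Algebra.norm_algebraMap,
        Algebra.IsQuadraticExtension.finrank_eq_two F E, pow_two, hv]
    rw [h7] at h6
    exact Units.ext h6
  have h₂' : D.IsPure ψ m α Θ₂ := by
    intro h hh
    rw [h₂ h hh, hω (D.nrmUnits h), Units.val_one, mul_one]
    exact InCong.nrm_mem D hm' (by omega) ⟨hh, h.2.2⟩
  -- On the elements `1 + y w` with `y ∈ 𝒪_F` the intertwining condition says that
  -- `tr (α w) - tr (α g⁻¹ w g)` lies in `𝔭_F`.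
  have hJ : D.InJ m g := by
    obtain ⟨z, hz, z', hz', e⟩ := D.exists_conj_of_tr (a := m) (b := D.bH m) (a' := m)
      (b' := D.bH m) (x := D.j α) (x' := D.j α) g (fun w hw hw' => by
        refine mem_pPow_of_char hψ fun y hy => ?_
        obtain ⟨u, hu, e1, huc, huc'⟩ := D.exists_unit_smul hm' (by omega) hw hw' hy
        have huH : u ∈ D.grpH m := huc.anti D (by omega) le_rfl
        have huH' : g⁻¹ * u * g ∈ D.grpH m := huc'.anti D (by omega) le_rfl
        have h3 := congrArg Units.val (hg u huH huH')
        rw [h₁ _ huc.1, h₂' _ huc'.1] at h3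
        simp only at h3
        rw [e1, hu, X_one_add, X_one_add, X_algebraMap_mul, X_algebraMap_mul] at h3
        rw [mul_sub, AddChar.map_sub_eq_div, div_eq_one_iff_eq (AddChar.val_isUnit ψ _).ne_zero]
        rw [tr_apply, tr_apply, X_j_mul, X_j_mul]
        rw [← trace_algebraMap_mul, ← trace_algebraMap_mul, mul_left_comm, mul_left_comm _ α]
        exact h3)
    obtain ⟨k₁, α₁, hk₁, hα₁, e₁⟩ := D.exists_conj_into' hm hα hz
    obtain ⟨k₂, α₂, hk₂, hα₂, e₂⟩ := D.exists_conj_into' hm hα hz'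
    obtain ⟨h, hh⟩ : ∃ h : Rˣ, h = k₁⁻¹ * g * k₂ := ⟨_, rfl⟩
    have hgh : g = k₁ * h * k₂⁻¹ := by rw [hh]; group
    have hcom : D.j α₁ * h = h * D.j α₂ := by
      have e3 : (k₁ : R) * (D.j α₁ * h) = k₁ * (h * D.j α₂) := by
        rw [← mul_assoc, ← e₁, mul_assoc]
        have e4 : (k₁ : R) * h = g * k₂ := by rw [hh]; push_cast; simp [mul_assoc]
        rw [e4, ← mul_assoc, e, mul_assoc, e₂, ← mul_assoc, ← mul_assoc, e4]
      exact k₁.isUnit.mul_left_cancel e3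
    -- `h` conjugates `α₂` to `α₁`, both near `α`; a component along `E c` would conjugate `α₂` to `σ α₂`
    have hY0 : D.Y (h : R) = 0 := by
      by_contra hne
      have h3 := congrArg D.Y hcom
      rw [Y_j_mul, Y_mul_j] at h3
      have h4 := mul_right_cancel₀ hne h3
      apply hα.sub_conj_not_mem
      have h5 := conj_mem_pPow (F := F) hα₂
      rw [map_sub, ← h4] at h5
      have h6 := sub_mem_pPow h5 hα₁
      have h7 : α - conj F E α = α₁ - conj F E α - (α₁ - α) := by ring
      rw [h7]; exact h6
    have hX0 : D.X (h : R) ≠ 0 := by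
      intro h0
      have := D.nrm_unit_ne_zero h
      rw [nrm_apply, h0, hY0] at this
      simp at this
    have hhj : h = D.jUnits (Units.mk0 _ hX0) := by
      apply Units.ext
      rw [coe_jUnits, Units.val_mk0]
      apply D.ext <;> simp [hY0]
    have hk : ∀ k : Rˣ, D.InCong 1 (D.bJ m) (k : R) → k ∈ D.grpJ m hm :=
      fun k hk => ⟨1, k, hk, by simp⟩
    change g ∈ D.grpJ m hm
    rw [hgh]
    refine (D.grpJ m hm).mul_mem ((D.grpJ m hm).mul_mem (hk _ hk₁) ?_)
      ((D.grpJ m hm).inv_mem (hk _ hk₂))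
    rw [hhj]; exact D.jUnits_mem_grpJ hm _
  refine ⟨hJ, ?_⟩
  ext1 h
  have hJ' : D.InJ m g⁻¹ := (D.grpJ m hm).inv_mem hJ
  have h3 := InJ.conj_mem D hm hJ' h.2
  rw [inv_inv] at h3
  have h4 := h₂'.conj_eq D hψ hm hα hJ' h.2 (by rw [inv_inv]; exact h3)
  simp only [inv_inv] at h4
  exact (hg h h.2 h3).trans h4

/-! ### Finiteness -/

/-- A set of elements of bounded norm in the standard order is covered by finitely many cosets of a
congruence subgroup. -/
lemma exists_finite_cover (P : Set Rˣ) (B L : ℤ) (hP : ∀ h ∈ P, (h : R) ∈ D.lat 0 0)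
    (hB : ∀ h ∈ P, ord (algebraMap F E (D.nrm h)) ≤ B) :
    ∃ S : Set Rˣ, S.Finite ∧ S ⊆ P ∧ ∀ h ∈ P, ∃ s ∈ S,
      D.InCong L L ((h * s⁻¹ : Rˣ) : R) ∧ D.InCong L L ((s⁻¹ * h : Rˣ) : R) := by
  have hκ : 0 ≤ D.κ := by rcases D.κ_eq with h | h <;> omega
  obtain ⟨T, hT⟩ := exists_finset_pPow (K := E) 0 (L + B)
  let Q : E × E → Rˣ → Prop := fun t h =>
    h ∈ P ∧ D.X (h : R) - t.1 ∈ pPow E (L + B) ∧ D.Y (h : R) - t.2 ∈ pPow E (L + B)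
  classical
  let f : E × E → Rˣ := fun t => if h : ∃ s, Q t s then h.choose else 1
  have hfQ : ∀ t, (∃ s, Q t s) → Q t (f t) := by
    intro t ht
    simp only [f, dif_pos ht]
    exact ht.choose_spec
  refine ⟨(f '' (T ×ˢ T : Finset (E × E))) ∩ P, (Set.Finite.image f (Finset.finite_toSet _)).subset
    Set.inter_subset_left, Set.inter_subset_right, fun h hh => ?_⟩
  obtain ⟨t, ht, ht'⟩ := hT _ (hP h hh).1
  obtain ⟨u, hu, hu'⟩ := hT _ (hP h hh).2
  have hq := hfQ (t, u) ⟨h, hh, ht', hu'⟩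
  generalize hs : f (t, u) = s at hq
  refine ⟨s, ⟨⟨(t, u), by simp [ht, hu], hs⟩, hq.1⟩, ?_⟩
  -- elements of bounded norm that are congruent modulo a high power of `𝔭_E` have a quotient near `1`
  have hdiff : (h : R) - s ∈ D.lat (L + B) (L + B) := by
    constructor
    · rw [map_sub, ← sub_sub_sub_cancel_right _ _ t]; exact sub_mem_pPow ht' hq.2.1
    · rw [map_sub, ← sub_sub_sub_cancel_right _ _ u]; exact sub_mem_pPow hu' hq.2.2
  have hsinv : ((s⁻¹ : Rˣ) : R) ∈ D.lat (-B) (-B) := by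
    have hn : algebraMap F E (D.nrm s) ≠ 0 := hom_ne_zero (D.nrm_unit_ne_zero s)
    have hi : (algebraMap F E (D.nrm s))⁻¹ ∈ pPow E (-B) :=
      pPow_anti (by rw [ord_inv hn]; have := hB s hq.1; omega) mem_pPow_self
    constructor
    · rw [X_inv, div_eq_mul_inv]
      exact mem_pPow_of_eq (mul_mem_pPow (conj_mem_pPow (hP s hq.1).1) hi) (by ring)
    · rw [Y_inv, div_eq_mul_inv]
      exact mem_pPow_of_eq (mul_mem_pPow (neg_mem_pPow (hP s hq.1).2) hi) (by ring)
  constructor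
  · have e : ((h * s⁻¹ : Rˣ) : R) - 1 = ((h : R) - s) * (s⁻¹ : Rˣ) := by
      rw [sub_mul, Units.mul_inv, Units.val_mul]
    rw [inCong_iff, e]
    exact D.mul_mem_lat hdiff hsinv (by omega) (by omega) (by omega) (by omega)
  · have e : ((s⁻¹ * h : Rˣ) : R) - 1 = (s⁻¹ : Rˣ) * ((h : R) - s) := by
      rw [mul_sub, Units.inv_mul, Units.val_mul]
    rw [inCong_iff, e]
    exact D.mul_mem_lat hsinv hdiff (by omega) (by omega) (by omega) (by omega)

lemma ord_nrm_jUnits_mul (e : Eˣ) (h : Rˣ) : ord (algebraMap F E (D.nrm ((D.jUnits e * h : Rˣ) : R))) =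
    2 * ord (e : E) + ord (algebraMap F E (D.nrm h)) := by
  have hn : algebraMap F E (D.nrm h) ≠ 0 := hom_ne_zero (D.nrm_unit_ne_zero h)
  have he := e.ne_zero
  have hce : conj F E (e : E) ≠ 0 := hom_ne_zero he
  rw [Units.val_mul, map_mul, coe_jUnits, nrm_j, map_mul, algebraMap_norm,
    ord_mul (mul_ne_zero he hce) hn, ord_mul he hce, ord_conj]
  ring

lemma InCong.ord_nrm {a b : ℤ} (ha : 1 ≤ a) (hab : a ≤ D.κ + 2 * b) {g : R}
    (hg : D.InCong a b g) : ord (algebraMap F E (D.nrm g)) = 0 :=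
  (ne_zero_and_ord_eq_zero (pPow_anti ha (InCong.nrm_mem D ha hab hg))).2

/-- A function in the representation induced from `J` that is fixed by the congruence subgroup of
level `N` is supported on finitely many cosets of `J`. If `h⁻¹ α h` is bounded then so are both
terms of `N(x) - d N(y)` relative to the norm of `h = x + y c`. -/
lemma exists_finite_support (hψ : IsLevelZero F ψ) (hm : 1 ≤ m) (hα : IsMinimalElt F m α)
    (hΘ : D.IsPure ψ m α Θ) (N : ℕ) :
    ∃ S : Set Rˣ, S.Finite ∧ ∀ g : Rˣ,
      (∀ h : D.grpH m, D.InCong (N + 1) (N + 1) ((g⁻¹ * h * g : Rˣ) : R) → Θ h = 1) →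
      ∃ s ∈ S, ∃ j : Rˣ, D.InJ m j ∧ g = j * s := by
  have hf := D.depth_facts m
  have hm' : (1 : ℤ) ≤ m := by exact_mod_cast hm
  obtain ⟨S, hS, -, hcov⟩ := D.exists_finite_cover
    {h | (h : R) ∈ D.lat 0 0 ∧ ord (algebraMap F E (D.nrm h)) ≤ N + 2} (N + 2) (1 + D.bJ m)
    (fun h hh => hh.1) (fun h hh => hh.2)
  refine ⟨S, hS, fun g hg => ?_⟩
  -- the hypothesis on `g` is the vanishing of `tr (α w)` modulo `𝔭_F` for `w` in the intersection of a
  -- lattice with the conjugate of another one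
  obtain ⟨z, hz, z', hz', e⟩ := D.exists_conj_of_tr (a := m) (b := D.bH m) (a' := N + 1)
    (b' := N + 1) (x := D.j α) (x' := 0) g (fun w hw hw' => by
      rw [zero_mul, map_zero, sub_zero]
      refine mem_pPow_of_char hψ fun y hy => ?_
      obtain ⟨u, hu, -, huc, huc'⟩ := D.exists_unit_smul hm' (by omega) hw hw' hy
      have huH : u ∈ D.grpH m := huc.anti D (by omega) le_rfl
      have h3 := congrArg Units.val (hg ⟨u, huH⟩ huc')
      rw [hΘ _ huc.1] at h3
      simp only at h3
      rw [hu, X_one_add, X_algebraMap_mul] at h3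
      rw [tr_apply, X_j_mul, ← smul_eq_mul, ← map_smul, Algebra.smul_def, mul_left_comm]
      exact h3)
  obtain ⟨k, α₁, hk, hα₁, e₁⟩ := D.exists_conj_into' hm hα hz
  obtain ⟨h, hh⟩ : ∃ h : Rˣ, h = k⁻¹ * g := ⟨_, rfl⟩
  have hkh : k * h = g := by rw [hh]; group
  have hcom : D.j α₁ * h = h * -z' := by
    have e3 : (k : R) * (D.j α₁ * h) = k * (h * -z') := by
      rw [← mul_assoc, ← e₁, mul_assoc, ← Units.val_mul, hkh, e, zero_sub, ← mul_assoc,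
        ← Units.val_mul, hkh]
    exact k.isUnit.mul_left_cancel e3
  have hαm := hα.congr hα₁
  have hδ0 : α₁ - conj F E α₁ ≠ 0 := fun h0 =>
    hαm.sub_conj_not_mem (by rw [h0]; exact zero_mem_pPow _)
  have hδ : ord (α₁ - conj F E α₁) ≤ -m := by
    have := hαm.sub_conj_not_mem
    rw [mem_pPow hδ0] at this
    omega
  have hn : algebraMap F E (D.nrm h) ≠ 0 := hom_ne_zero (D.nrm_unit_ne_zero h)
  have hdE : algebraMap F E D.d ≠ 0 := hom_ne_zero D.d_ne_zero
  obtain ⟨ζ, hζ⟩ : ∃ ζ, ζ = D.X (-z') := ⟨_, rfl⟩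
  have hζm : ζ ∈ pPow E (-(N + m)) := by
    rw [hζ, map_neg]; exact pPow_anti (by omega) (neg_mem_pPow hz'.1)
  have hα₁m : α₁ ∈ pPow E (-(N + m)) := pPow_anti (by omega) hαm.mem_pPow
  -- `ζ` is the first coordinate of `h⁻¹ α₁ h`
  have hX : algebraMap F E (D.nrm h) * ζ = α₁ * (D.X (h : R) * conj F E (D.X (h : R))) -
      conj F E α₁ * (algebraMap F E D.d * (D.Y (h : R) * conj F E (D.Y (h : R)))) := by
    have h1 : algebraMap F R (D.nrm h) * -z' = D.bar h * (D.j α₁ * h) := by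
      rw [hcom, ← mul_assoc, bar_mul]
    have h2 := congrArg D.X h1
    rw [X_algebraMap_mul, ← hζ, D.X_mul, bar, X_elt, Y_elt, X_j_mul, Y_j_mul, map_mul] at h2
    rw [h2]; ring
  have hnrm := D.algebraMap_nrm h
  generalize hx : D.X (h : R) = x at hX hnrm
  generalize hy : D.Y (h : R) = y at hX hnrm
  generalize hnn : algebraMap F E (D.nrm h) = n at hX hnrm hn
  -- `(α₁ - σ α₁) N(x)` and `(α₁ - σ α₁) d N(y)` are combinations of `n ζ` and `n`
  have key : ∀ {u ξ : E}, u ≠ 0 → ξ ∈ pPow E (-(N + m)) → (α₁ - conj F E α₁) * u = n * ξ →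
      ord n ≤ ord u + N := by
    intro u ξ hu hξ h1
    have hξ0 : ξ ≠ 0 := fun h0 => mul_ne_zero hδ0 hu (by rw [h1, h0, mul_zero])
    have h3 := congrArg ord h1
    rw [ord_mul hδ0 hu, ord_mul hn hξ0] at h3
    rw [mem_pPow hξ0] at hξ
    omega
  have hxn : x ≠ 0 → ord n ≤ 2 * ord x + (N + 2) := fun h0 => by
    have hc : conj F E x ≠ 0 := hom_ne_zero h0
    have := key (mul_ne_zero h0 hc) (sub_mem_pPow hζm (conj_mem_pPow (F := F) hα₁m))
      (by rw [mul_sub, hX, hnrm]; ring)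
    rw [ord_mul h0 hc, ord_conj] at this
    omega
  have hyn : y ≠ 0 → ord n ≤ 2 * ord y + (N + 2) := fun h0 => by
    have hc : conj F E y ≠ 0 := hom_ne_zero h0
    have := key (mul_ne_zero hdE (mul_ne_zero h0 hc)) (sub_mem_pPow hζm hα₁m)
      (by rw [mul_sub, hX, hnrm]; ring)
    rw [ord_mul hdE (mul_ne_zero h0 hc), ord_mul h0 hc, ord_conj, D.ord_d] at this
    omega
  -- dividing by the coordinate of smaller valuation makes `h` integral
  obtain ⟨z, hz0, hxz, hyz, hzn⟩ : ∃ z : E, z ≠ 0 ∧ x ∈ pPow E (ord z) ∧ y ∈ pPow E (ord z) ∧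
      ord n ≤ 2 * ord z + (N + 2) := by
    by_cases hc : x ≠ 0 ∧ y ∈ pPow E (ord x)
    · exact ⟨x, hc.1, mem_pPow_self, hc.2, hxn hc.1⟩
    have hy0 : y ≠ 0 := by
      rintro rfl
      have hx0 : x = 0 := by_contra fun h0 => hc ⟨h0, zero_mem_pPow _⟩
      exact hn (by rw [hnrm, hx0]; ring)
    refine ⟨y, hy0, ?_, mem_pPow_self, hyn hy0⟩
    by_cases hx0 : x = 0
    · rw [hx0]; exact zero_mem_pPow _
    · have : y ∉ pPow E (ord x) := fun h1 => hc ⟨hx0, h1⟩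
      rw [mem_pPow hy0] at this
      rw [mem_pPow hx0]; omega
  obtain ⟨e, he1, he2⟩ : ∃ e : Eˣ, ((D.jUnits e⁻¹ * h : Rˣ) : R) ∈ D.lat 0 0 ∧
      ord (algebraMap F E (D.nrm ((D.jUnits e⁻¹ * h : Rˣ) : R))) ≤ N + 2 := by
    have hz := mem_pPow_self (x := z⁻¹)
    rw [ord_inv hz0] at hz
    refine ⟨Units.mk0 z hz0, ⟨?_, ?_⟩, ?_⟩
    · rw [Units.val_mul, coe_jUnits, X_j_mul, hx]
      exact mem_pPow_of_eq (mul_mem_pPow hz hxz) (by ring)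
    · rw [Units.val_mul, coe_jUnits, Y_j_mul, hy]
      exact mem_pPow_of_eq (mul_mem_pPow hz hyz) (by ring)
    · rw [ord_nrm_jUnits_mul, Units.val_inv_eq_inv_val, Units.val_mk0, ord_inv hz0, hnn]
      omega
  obtain ⟨s, hs, hs1, -⟩ := hcov _ ⟨he1, he2⟩
  refine ⟨s, hs, k * (D.jUnits e * (D.jUnits e⁻¹ * h * s⁻¹)), ?_, ?_⟩
  · have hk' : ∀ k : Rˣ, D.InCong 1 (D.bJ m) (k : R) → k ∈ D.grpJ m hm :=
      fun k hk => ⟨1, k, hk, by simp⟩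
    change _ ∈ D.grpJ m hm
    exact (D.grpJ m hm).mul_mem (hk' _ hk) ((D.grpJ m hm).mul_mem (D.jUnits_mem_grpJ hm _)
      (hk' _ (hs1.anti D (by omega) (by omega))))
  · rw [map_inv, ← hkh]; group

/-- The principal congruence subgroup of level `N + 1`. -/
def grpU (N : ℕ) : Subgroup Rˣ :=
  D.cong (N + 1) (N + 1) (by omega) (by rcases D.κ_eq with h | h <;> omega)

lemma mem_grpU {N : ℕ} {g : Rˣ} : g ∈ D.grpU N ↔ D.InCong (N + 1) (N + 1) (g : R) := Iff.rfl

lemma grpU_anti {N N' : ℕ} (h : N ≤ N') : D.grpU N' ≤ D.grpU N := fun _ hu =>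
  InCong.anti D hu (by omega) (by omega)

lemma mem_lat_zero_of_mem_grpH {g : Rˣ} (hg : g ∈ D.grpH m) : (g : R) ∈ D.lat 0 0 :=
  InCong.mem_lat_zero D (by omega) (D.depth_facts m).2.2.2.2.1 hg

lemma conj_mem_grpU {N : ℕ} {g u : Rˣ} (hg : g ∈ D.grpH m) (hu : u ∈ D.grpU N) :
    g * u * g⁻¹ ∈ D.grpU N := by
  have hκ : 0 ≤ D.κ := by rcases D.κ_eq with h | h <;> omega
  have h1 := D.mem_lat_zero_of_mem_grpH hg
  have h2 := D.mem_lat_zero_of_mem_grpH ((D.grpH m).inv_mem hg)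
  have hu' := (D.inCong_iff).1 hu
  rw [mem_grpU, inCong_iff]
  have e : ((g * u * g⁻¹ : Rˣ) : R) - 1 = g * ((u : R) - 1) * (g⁻¹ : Rˣ) := by
    rw [mul_sub, sub_mul, mul_one, Units.mul_inv]; push_cast; rfl
  rw [e]
  exact D.mul_mem_lat (D.mul_mem_lat h1 hu' (A := N + 1) (B := N + 1) (by omega) (by omega)
    (by omega) (by omega)) h2 (by omega) (by omega) (by omega) (by omega)

lemma grpU_le_grpH : D.grpU (D.bH m).toNat ≤ D.grpH m := fun _ hu =>
  InCong.anti D hu (by omega) (by omega)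

/-- Congruence subgroups have finite index in `H`. -/
lemma exists_finite_grpH (m N : ℕ) : ∃ S : Set Rˣ, S.Finite ∧ S ⊆ D.grpH m ∧
    ∀ h ∈ D.grpH m, ∃ s ∈ S, s⁻¹ * h ∈ D.grpU N := by
  have hf := D.depth_facts m
  obtain ⟨S, hS, hSP, hc⟩ := D.exists_finite_cover (D.grpH m : Set Rˣ) 0 (N + 1)
    (fun h hh => D.mem_lat_zero_of_mem_grpH hh)
    (fun h hh => (InCong.ord_nrm D le_rfl (by omega) hh).le)
  exact ⟨S, hS, hSP, fun h hh => by obtain ⟨s, hs, -, h2⟩ := hc h hh; exact ⟨s, hs, h2⟩⟩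

/-- Scalars from `Fˣ`, in `Rˣ`. -/
def scalar : Fˣ →* Rˣ := Units.map (algebraMap F R : F →* R)

lemma scalar_eq (a : Fˣ) : scalar a = D.jUnits (Units.map (algebraMap F E : F →* E) a) :=
  Units.ext (D.j.commutes (a : F)).symm

lemma scalar_comm (a : Fˣ) (g : Rˣ) : scalar a * g = g * scalar a :=
  Units.ext (Algebra.commutes _ _)

/-- `J` is finite over `H` modulo the powers of a uniformizer of `F`. -/
lemma exists_finite_grpJ (hm : 1 ≤ m) : ∃ (ϖ : Fˣ) (S : Set Rˣ), S.Finite ∧ S ⊆ D.grpJ m hm ∧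
    ∀ g ∈ D.grpJ m hm, ∃ (k : ℤ), ∃ s ∈ S, ∃ h ∈ D.grpH m, g = scalar (ϖ ^ k) * s * h := by
  have hf := D.depth_facts m
  obtain ⟨p, hp0, hp⟩ := exists_ord_eq (K := F) 1
  obtain ⟨S, hS, hSP, hc⟩ := D.exists_finite_cover
    {h | h ∈ D.grpJ m hm ∧ (h : R) ∈ D.lat 0 0 ∧ ord (algebraMap F E (D.nrm h)) ≤ 2} 2
    (1 + D.bH m) (fun h hh => hh.2.1) (fun h hh => hh.2.2)
  refine ⟨Units.mk0 p hp0, S, hS, fun s hs => (hSP hs).1, ?_⟩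
  rintro _ ⟨e, u, hu, rfl⟩
  obtain ⟨k, hk⟩ : ∃ k : ℤ, 0 ≤ ord (e : E) - k * ramIdx F E ∧
      ord (e : E) - k * ramIdx F E ≤ 1 := by
    rcases ramIdx_eq F E with ⟨-, h⟩ | ⟨-, h⟩ <;> rw [h]
    · exact ⟨ord (e : E), by omega⟩
    · exact ⟨ord (e : E) / 2, by omega⟩
  have hpE : algebraMap F E p ≠ 0 := hom_ne_zero hp0
  have hpo : ord (algebraMap F E p) = ramIdx F E := by rw [ord_algebraMap hp0, hp, mul_one]
  obtain ⟨e', he'⟩ : ∃ e' : Eˣ,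
      e' = (Units.map (algebraMap F E : F →* E) (Units.mk0 p hp0 ^ k))⁻¹ * e := ⟨_, rfl⟩
  have heo : ord (e' : E) = ord (e : E) - k * ramIdx F E := by
    have e1 : (e' : E) = (algebraMap F E p ^ k)⁻¹ * e := by
      rw [he']; simp
    rw [e1, ord_mul (inv_ne_zero (zpow_ne_zero _ hpE)) e.ne_zero, ord_inv (zpow_ne_zero _ hpE),
      ord_zpow hpE, hpo]
    ring
  have hg : D.jUnits e * u = scalar (Units.mk0 p hp0 ^ k) * (D.jUnits e' * u) := by
    rw [D.scalar_eq, ← mul_assoc, ← map_mul, he', mul_inv_cancel_left]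
  have hu0 : (u : R) ∈ D.lat 0 0 := InCong.mem_lat_zero D (by omega) hf.2.2.2.1 hu
  have he0 : (e' : E) ∈ pPow E 0 := pPow_anti (by omega) mem_pPow_self
  have hP : D.jUnits e' * u ∈ {h | h ∈ D.grpJ m hm ∧ (h : R) ∈ D.lat 0 0 ∧
      ord (algebraMap F E (D.nrm h)) ≤ 2} := by
    refine ⟨⟨e', u, hu, rfl⟩, ⟨?_, ?_⟩, ?_⟩
    · rw [Units.val_mul, coe_jUnits, X_j_mul]; exact mem_pPow_of_eq (mul_mem_pPow he0 hu0.1) rfl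
    · rw [Units.val_mul, coe_jUnits, Y_j_mul]; exact mem_pPow_of_eq (mul_mem_pPow he0 hu0.2) rfl
    · rw [ord_nrm_jUnits_mul, InCong.ord_nrm D le_rfl (by omega) hu]; omega
  obtain ⟨s, hs, -, h2⟩ := hc _ hP
  exact ⟨k, s, hs, _, h2.anti D (by omega) (by omega), by rw [hg]; group⟩

end QuatModel

/-! ### Topology -/

section Topology

variable (F E)

lemma continuous_algebraMap_ext : Continuous (algebraMap F E) := by
  refine continuous_of_continuousAt_zero (algebraMap F E) ?_
  rw [ContinuousAt, map_zero]
  intro U hU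
  obtain ⟨n, hn⟩ := exists_pPow_subset hU
  refine Filter.mem_map.2 (Filter.mem_of_superset (pPow_mem_nhds F |n|) fun x hx => hn ?_)
  refine pPow_anti ?_ (algebraMap_mem_pPow_iff.2 hx)
  have h1 := le_abs_self n
  have h2 := abs_nonneg n
  rcases ramIdx_eq F E with ⟨-, h⟩ | ⟨-, h⟩ <;> rw [h] <;> omega

lemma continuous_trace_ext : Continuous (Algebra.trace F E) := by
  refine continuous_of_continuousAt_zero (Algebra.trace F E) ?_
  rw [ContinuousAt, map_zero]
  intro U hU
  obtain ⟨n, hn⟩ := exists_pPow_subset hU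
  refine Filter.mem_map.2
    (Filter.mem_of_superset (pPow_mem_nhds E (ramIdx F E * n)) fun x hx => hn ?_)
  rw [← algebraMap_mem_pPow_iff (E := E), algebraMap_trace]
  exact add_mem_pPow hx (conj_mem_pPow hx)

lemma continuousSMul_ext : ContinuousSMul F E :=
  continuousSMul_of_algebraMap F E (continuous_algebraMap_ext F E)

end Topology

namespace QuatModel

variable {R : Type*} [Ring R] [Algebra F R] (D : QuatModel F E R)
variable [TopologicalSpace R] [IsTopologicalRing R] [IsModuleTopology F R]

lemma continuous_X : Continuous D.X := by
  have := continuousSMul_ext F E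
  exact IsModuleTopology.continuous_of_linearMap D.X

lemma continuous_Y : Continuous D.Y := by
  have := continuousSMul_ext F E
  exact IsModuleTopology.continuous_of_linearMap D.Y

lemma continuous_j : Continuous D.j := by
  obtain ⟨a, ha, hσ⟩ := exists_conj_eq_neg F E
  have h1 : Continuous fun x : E => (Algebra.trace F E x / 2) • (1 : R) +
      (-Algebra.trace F E (x * a) / (2 * Algebra.norm F a)) • D.j a := by
    have h2 := continuous_trace_ext F E
    have := IsModuleTopology.toContinuousSMul F R
    refine Continuous.add (Continuous.smul (h2.div_const _) continuous_const)
      (Continuous.smul (Continuous.div_const (Continuous.neg (h2.comp (continuous_mul_const a))) _)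
      continuous_const)
  convert h1 using 2 with x
  conv_lhs => rw [eq_trace_add ha hσ x]
  rw [map_add, map_mul, AlgHom.commutes, AlgHom.commutes, Algebra.smul_def, Algebra.smul_def,
    mul_one]

lemma grpU_mem_nhds (N : ℕ) : (D.grpU N : Set Rˣ) ∈ 𝓝 (1 : Rˣ) := by
  have hX : Continuous fun u : Rˣ => D.X (u : R) - 1 :=
    (D.continuous_X.comp Units.continuous_val).sub continuous_const
  have hY : Continuous fun u : Rˣ => D.Y (u : R) := D.continuous_Y.comp Units.continuous_val
  have h1 := hX.continuousAt.preimage_mem_nhds (x := 1) (t := pPow E (N + 1))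
    (by simpa using pPow_mem_nhds E (N + 1))
  have h2 := hY.continuousAt.preimage_mem_nhds (x := 1) (t := pPow E (N + 1))
    (by simpa using pPow_mem_nhds E (N + 1))
  filter_upwards [h1, h2] with u hu1 hu2 using ⟨hu1, hu2⟩

lemma exists_grpU_subset {U : Set Rˣ} (hU : U ∈ 𝓝 (1 : Rˣ)) :
    ∃ N : ℕ, (D.grpU N : Set Rˣ) ⊆ U := by
  rw [Units.isEmbedding_embedProduct.nhds_eq_comap, Filter.mem_comap] at hU
  obtain ⟨T, hT, hTU⟩ := hU
  rw [map_one, Prod.one_eq_mk, nhds_prod_eq, Filter.mem_prod_iff] at hT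
  obtain ⟨T₁, hT₁, T₂, hT₂, hTT⟩ := hT
  have hT₂' : MulOpposite.op ⁻¹' T₂ ∈ 𝓝 (1 : R) :=
    MulOpposite.continuous_op.continuousAt.preimage_mem_nhds hT₂
  have hc : Continuous fun p : E × E => 1 + D.elt p.1 p.2 :=
    continuous_const.add ((D.continuous_j.comp continuous_fst).add
      ((D.continuous_j.comp continuous_snd).mul continuous_const))
  have h0 : (fun p : E × E => 1 + D.elt p.1 p.2) (0, 0) = 1 := by simp [elt]
  have hT : T₁ ∩ MulOpposite.op ⁻¹' T₂ ∈ 𝓝 ((fun p : E × E => 1 + D.elt p.1 p.2) (0, 0)) := by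
    rw [h0]; exact Filter.inter_mem hT₁ hT₂'
  have h1 := hc.continuousAt.preimage_mem_nhds hT
  rw [nhds_prod_eq, Filter.mem_prod_iff] at h1
  obtain ⟨V₁, hV₁, V₂, hV₂, hVV⟩ := h1
  obtain ⟨n₁, hn₁⟩ := exists_pPow_subset hV₁
  obtain ⟨n₂, hn₂⟩ := exists_pPow_subset hV₂
  have key : ∀ u ∈ D.grpU (n₁.toNat + n₂.toNat), (u : R) ∈ T₁ ∩ MulOpposite.op ⁻¹' T₂ := by
    intro u hu
    have h2 := hVV (Set.mk_mem_prod (hn₁ (pPow_anti (by omega) hu.1))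
      (hn₂ (pPow_anti (by omega) hu.2)))
    have e : 1 + D.elt (D.X (u : R) - 1) (D.Y (u : R)) = u := by
      apply D.ext <;> simp
    have h3 : 1 + D.elt (D.X (u : R) - 1) (D.Y (u : R)) ∈ T₁ ∩ MulOpposite.op ⁻¹' T₂ := h2
    rwa [e] at h3
  refine ⟨n₁.toNat + n₂.toNat, fun u hu => hTU (hTT ?_)⟩
  exact ⟨(key u hu).1, (key u⁻¹ ((D.grpU _).inv_mem hu)).2⟩

end QuatModel

namespace QuatModel

variable {R : Type*} [Ring R] [Algebra F R] (D : QuatModel F E R)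

/-! ### Identification of traces, norms and corestrictions -/

/-- A trace form is determined by its value at `1`. -/
lemma eq_tr (T : R →ₗ[F] F) (hT : ∀ x y, T (x * y) = T (y * x)) (h1 : T 1 = 2) (r : R) :
    T r = D.tr r := by
  have h2 : (2 : F) ≠ 0 := NeZero.ne 2
  have key : ∀ {s u u' : R}, u * u' = 1 → u' * u = 1 → u * s = -(s * u) → T s = 0 := by
    intro s u u' h h' hs
    have h3 : T s = -T s := by
      conv_lhs => rw [← mul_one s, ← h, ← mul_assoc, hT, ← neg_neg (s * u), ← hs, mul_neg,
        ← mul_assoc, h', one_mul, map_neg]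
    have : 2 * T s = 0 := by linear_combination h3
    exact (mul_eq_zero.1 this).resolve_left h2
  obtain ⟨a, ha, hσ⟩ := exists_conj_eq_neg F E
  have hYc : ∀ y : E, T (D.j y * D.c) = 0 := fun y => by
    refine key (u := D.j a) (u' := D.j a⁻¹) ?_ ?_ ?_
    · rw [← map_mul, mul_inv_cancel₀ ha, map_one]
    · rw [← map_mul, inv_mul_cancel₀ ha, map_one]
    · rw [mul_assoc, D.c_mul, hσ, ← mul_assoc, ← mul_assoc, ← map_mul, ← map_mul, mul_neg, map_neg,
        neg_mul, neg_neg, mul_comm]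
  have hja : T (D.j a) = 0 := by
    have hd := D.d_ne_zero
    refine key (u := D.c) (u' := algebraMap F R D.d⁻¹ * D.c) ?_ ?_ ?_
    · rw [← mul_assoc, ← Algebra.commutes, mul_assoc, D.c_mul_c, ← map_mul, inv_mul_cancel₀ hd,
        map_one]
    · rw [mul_assoc, D.c_mul_c, ← map_mul, inv_mul_cancel₀ hd, map_one]
    · rw [D.c_mul, hσ, map_neg, neg_mul]
  have hjt : ∀ (t s : F), T (D.j (algebraMap F E t + algebraMap F E s * a)) = 2 * t := by
    intro t s
    rw [map_add, map_mul, AlgHom.commutes, AlgHom.commutes, map_add, ← Algebra.smul_def, map_smul,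
      hja, smul_zero, add_zero, Algebra.algebraMap_eq_smul_one, map_smul, h1, smul_eq_mul, mul_comm]
  conv_lhs => rw [D.decomp r, map_add, hYc, add_zero, eq_trace_add ha hσ (D.X r), hjt]
  rw [tr_apply]
  field_simp

lemma eq_nrm {T : R → F} (hT : ∀ r, T r = D.tr r) {N : R → F}
    (hN : ∀ r : R, r * r = T r • r - algebraMap F R (N r)) (r : R) : N r = D.nrm r := by
  have h := D.mul_bar r
  rw [bar_eq, mul_sub, hN, hT, Algebra.smul_def, Algebra.commutes, sub_sub_cancel] at h
  have h2 := congrArg D.X h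
  rw [X_algebraMap, X_algebraMap] at h2
  exact (algebraMap F E).injective h2

lemma corestriction_eq {T : R → F} (hT : ∀ r, T r = D.tr r) (r : R) :
    corestriction T D.j r = D.X r := by
  have hex : ∃ e : E, ∀ x : E, T (D.j x * (r - D.j e)) = 0 :=
    ⟨D.X r, fun x => by rw [hT, tr_apply, X_j_mul, map_sub, X_j, sub_self, mul_zero, map_zero]⟩
  have h := Classical.epsilon_spec hex
  have h1 : D.X r - corestriction T D.j r = 0 := by
    refine eq_zero_of_forall_mem_pPow fun n => ?_
    refine mem_pPow_of_eq (mem_pPow_of_trace F (i := 1 - n) fun z _ => ?_) (by ring)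
    have h2 := h z
    rw [hT, tr_apply, X_j_mul, map_sub, X_j] at h2
    rw [mul_comm]
    exact h2 ▸ zero_mem_pPow _
  exact (sub_eq_zero.1 h1).symm

end QuatModel

section Models

/-! ### The matrix algebra -/

/-- The model of `M₂(F)` attached to an embedding of `E`: a nonzero vector identifies `F²` with
`E`, and `c` is the Galois conjugation. -/
theorem exists_modelA (jA : E →ₐ[F] Matrix (Fin 2) (Fin 2) F) :
    ∃ D : QuatModel F E (Matrix (Fin 2) (Fin 2) F), D.j = jA ∧ D.κ = 0 ∧
      (∀ a, sA jA a = D.X a) ∧ (∀ n : ℕ, radA jA n = D.lat n n) ∧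
      (∀ a, Matrix.trace a = D.tr a) ∧ ∀ a : Matrix (Fin 2) (Fin 2) F, a.det = D.nrm a := by
  obtain ⟨a, ha, hσ⟩ := exists_conj_eq_neg F E
  have h2 := two_ne_zero_ext F E
  obtain ⟨v, hv⟩ : ∃ v : Fin 2 → F, v ≠ 0 := ⟨fun _ => 1, fun h => one_ne_zero (congrFun h 0)⟩
  let ev : (Fin 2 → F) → E →ₗ[F] (Fin 2 → F) := fun v =>
    { toFun := fun y => (jA y).mulVec v
      map_add' := fun x y => by rw [map_add, Matrix.add_mulVec]
      map_smul' := fun t x => by rw [map_smul, Matrix.smul_mulVec, RingHom.id_apply] }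
  have hbij : ∀ v : Fin 2 → F, v ≠ 0 → Function.Bijective (ev v) := by
    intro v hv
    have hinj : Function.Injective (ev v) := by
      rw [injective_iff_map_eq_zero]
      intro y hy
      by_contra hy0
      apply hv
      have h1 : (jA y⁻¹).mulVec ((jA y).mulVec v) = v := by
        rw [Matrix.mulVec_mulVec, ← map_mul, inv_mul_cancel₀ hy0, map_one, Matrix.one_mulVec]
      have hy' : (jA y).mulVec v = 0 := hy
      rw [← h1, hy', Matrix.mulVec_zero]
    refine ⟨hinj, (LinearMap.injective_iff_surjective_of_finrank_eq_finrank ?_).1 hinj⟩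
    rw [Algebra.IsQuadraticExtension.finrank_eq_two F E]; simp
  -- identify `F²` with `E` by a nonzero vector
  let L : E ≃ₗ[F] (Fin 2 → F) := LinearEquiv.ofBijective (ev v) (hbij v hv)
  have hL : ∀ x y : E, (jA x).mulVec (L y) = L (x * y) := by
    intro x y
    change (jA x).mulVec ((jA y).mulVec v) = (jA (x * y)).mulVec v
    rw [Matrix.mulVec_mulVec, map_mul]
  have hext : ∀ M N : Matrix (Fin 2) (Fin 2) F, (∀ z, M.mulVec (L z) = N.mulVec (L z)) →
      M = N := by
    intro M N h
    apply Matrix.toLin'.injective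
    ext1 i
    ext1
    obtain ⟨z, hz⟩ := L.surjective (Pi.single i 1)
    have := h z
    rw [hz] at this
    simpa using this
  let c : Matrix (Fin 2) (Fin 2) F :=
    LinearMap.toMatrix' (L.toLinearMap ∘ₗ (conj F E).toLinearMap ∘ₗ L.symm.toLinearMap)
  have hc : ∀ z, c.mulVec (L z) = L (conj F E z) := by
    intro z
    rw [LinearMap.toMatrix'_mulVec]
    simp
  -- the coordinates of `M` are read off from its values `T 1 M` and `T a M` at `1` and `a`
  let T : E → Matrix (Fin 2) (Fin 2) F →ₗ[F] E := fun z =>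
    { toFun := fun M => L.symm (M.mulVec (L z))
      map_add' := fun M N => by rw [Matrix.add_mulVec, map_add]
      map_smul' := fun t M => by rw [Matrix.smul_mulVec, map_smul, RingHom.id_apply] }
  have hT : ∀ z M, L (T z M) = M.mulVec (L z) := fun z M => L.apply_symm_apply _
  let X : Matrix (Fin 2) (Fin 2) F →ₗ[F] E :=
    LinearMap.mulLeft F (2 : E)⁻¹ ∘ₗ (T 1 + LinearMap.mulLeft F a⁻¹ ∘ₗ T a)
  let Y : Matrix (Fin 2) (Fin 2) F →ₗ[F] E :=
    LinearMap.mulLeft F (2 : E)⁻¹ ∘ₗ (T 1 - LinearMap.mulLeft F a⁻¹ ∘ₗ T a)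
  have hX : ∀ M, X M = 2⁻¹ * (T 1 M + a⁻¹ * T a M) := fun _ => rfl
  have hY : ∀ M, Y M = 2⁻¹ * (T 1 M - a⁻¹ * T a M) := fun _ => rfl
  have hTelt : ∀ x y z, T z (jA x + jA y * c) = x * z + y * conj F E z := by
    intro x y z
    apply L.injective
    rw [hT, Matrix.add_mulVec, ← Matrix.mulVec_mulVec, hc, hL, hL, map_add]
  have hTM : ∀ z M, T z M = X M * z + Y M * conj F E z := by
    intro z M
    have hz : ∀ t s : F, T (algebraMap F E t + algebraMap F E s * a) M =
        algebraMap F E t * T 1 M + algebraMap F E s * T a M := by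
      intro t s
      apply L.injective
      rw [hT, map_add, ← Algebra.smul_def, ← Algebra.smul_def, ← Algebra.smul_def, map_add,
        map_smul, map_smul, map_smul, hT, hT, Algebra.algebraMap_eq_smul_one, map_smul,
        Matrix.mulVec_add, Matrix.mulVec_smul, Matrix.mulVec_smul]
    have hz' := eq_trace_add ha hσ z
    generalize Algebra.trace F E z / 2 = t at hz'
    generalize -Algebra.trace F E (z * a) / (2 * Algebra.norm F a) = s at hz'
    subst hz'
    rw [hz, hX, hY]
    simp only [map_add, map_mul, AlgHom.commutes, hσ]
    field_simp
    ring
  let D : QuatModel F E (Matrix (Fin 2) (Fin 2) F) :=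
    { j := jA, c := c, d := 1, κ := 0, X := X, Y := Y
      κ_eq := .inl rfl
      d_ne_zero := one_ne_zero
      ord_d := by rw [map_one, ord_one]
      c_mul := fun x => hext _ _ fun z => by
        rw [← Matrix.mulVec_mulVec, ← Matrix.mulVec_mulVec, hL, hc, hc, hL, map_mul]
      c_mul_c := hext _ _ fun z => by
        rw [← Matrix.mulVec_mulVec, hc, hc, conj_conj, map_one, Matrix.one_mulVec]
      decomp := fun M => hext _ _ fun z => by rw [← hT, ← hT, hTelt, hTM]
      X_mk := fun x y => by
        rw [hX, hTelt, hTelt, map_one, hσ]; field_simp; ring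
      Y_mk := fun x y => by
        rw [hY, hTelt, hTelt, map_one, hσ]; field_simp; ring }
  have htr : ∀ M, Matrix.trace M = D.tr M :=
    D.eq_tr (Matrix.traceLinearMap (Fin 2) F F) (fun x y => Matrix.trace_mul_comm x y) (by simp)
  refine ⟨D, rfl, rfl, fun M => D.corestriction_eq htr M, fun n => ?_, htr,
    D.eq_nrm htr fun M => ?_⟩
  · ext M
    have := fact_ringChar_ext F E
    constructor
    · intro hM
      -- the vector of `z` lies in the lattice `𝔭_E ^ (ord z) v`
      have hz : ∀ z : E, z ≠ 0 → z⁻¹ * T z M ∈ pPow E n := by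
        intro z hz
        obtain ⟨w, hw, e⟩ := hM v (ord z) (L z) ⟨z, mem_pPow_self, rfl⟩
        have e' : M.mulVec (L z) = L w := e
        rw [← hT] at e'
        rw [L.injective e']
        exact mem_pPow_of_eq (mul_mem_pPow mem_pPow_self hw) (by rw [ord_inv hz]; ring)
      have h3 := hz 1 one_ne_zero
      rw [inv_one, one_mul] at h3
      have h4 := hz a ha
      constructor
      · change X M ∈ _
        rw [hX, inv_mul_eq_div]
        exact half_mem (add_mem_pPow h3 h4)
      · change Y M ∈ _
        rw [hY, inv_mul_eq_div]
        exact half_mem (sub_mem_pPow h3 h4)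
    · rintro ⟨h3, h4⟩ u i _ ⟨y, hy, rfl⟩
      have h3' : X M ∈ pPow E n := h3
      have h4' : Y M ∈ pPow E n := h4
      by_cases hu : u = 0
      · exact ⟨0, zero_mem_pPow _, by simp [hu]⟩
      obtain ⟨z, rfl⟩ := L.surjective u
      have hz : z ≠ 0 := fun h => hu (by rw [h, map_zero])
      refine ⟨X M * y + Y M * (conj F E (y * z) * z⁻¹), ?_, ?_⟩
      · refine add_mem_pPow (mem_pPow_of_eq (mul_mem_pPow h3' hy) (by ring)) ?_
        have h5 : conj F E (y * z) ∈ pPow E (i + ord z) :=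
          conj_mem_pPow (mul_mem_pPow hy mem_pPow_self)
        exact mem_pPow_of_eq (mul_mem_pPow h4' (mul_mem_pPow h5 mem_pPow_self))
          (by rw [ord_inv hz]; ring)
      · rw [hL, hL, ← hT, hTM]
        congr 1
        field_simp
  · have hM := M.eta_fin_two
    rw [hM]
    ext i k
    fin_cases i <;> fin_cases k <;>
      simp [Matrix.trace_fin_two, Matrix.det_fin_two, Matrix.mul_apply, Fin.sum_univ_two,
        Matrix.algebraMap_matrix_apply] <;> ring

/-! ### The quaternion division algebra -/

lemma norm_div_ext {x y : E} (hy : y ≠ 0) :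
    Algebra.norm F (x / y) = Algebra.norm F x / Algebra.norm F y := by
  rw [eq_div_iff (by rwa [Ne, Algebra.norm_eq_zero_iff]), ← map_mul, div_mul_cancel₀ _ hy]

lemma exists_norm_eq_mul_self_mul {x : E} {z : F} (hz : z - 1 ∈ pPow F 1) :
    ∃ y : E, Algebra.norm F y = z * Algebra.norm F x := by
  obtain ⟨v, hv, -⟩ := exists_sqrt le_rfl hz
  refine ⟨algebraMap F E v * x, ?_⟩
  rw [map_mul, Algebra.norm_algebraMap, Algebra.IsQuadraticExtension.finrank_eq_two F E, pow_two, hv]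

/-- In an unramified quadratic extension every unit is a norm. -/
lemma exists_norm_eq_unit (hu : Unramified F E) {u : F} (hu0 : u ≠ 0) (huo : ord u = 0) :
    ∃ y : E, Algebra.norm F y = u := by
  obtain ⟨a, ha, hσ, hao⟩ := exists_unit_conj_eq_neg (F := F) hu
  have hNa : Algebra.norm F a ≠ 0 := by rwa [Ne, Algebra.norm_eq_zero_iff]
  have hNao : ord (Algebra.norm F a) = 0 := by
    have := ord_norm (F := F) ha
    rw [hao] at this
    have hr := ramIdx_pos F E
    rw [mul_zero] at this
    exact (mul_eq_zero.1 this).resolve_left (by omega)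
  have hmem : ∀ {z : F}, z ≠ 0 → ord z = 0 → z ∈ 𝒪[F] := fun hz h => by
    rw [mem_integer_iff, mem_pPow hz]; omega
  have hne : ∀ {z : F} (hz : z ≠ 0) (h : ord z = 0),
      IsLocalRing.residue 𝒪[F] ⟨z, hmem hz h⟩ ≠ 0 := by
    intro z hz h h0
    rw [← map_zero (IsLocalRing.residue 𝒪[F]), residue_eq_iff] at h0
    have h1 : z - 0 ∈ pPow F 1 := h0
    rw [sub_zero, mem_pPow hz] at h1
    omega
  let _ := Fintype.ofFinite 𝓀[F]
  have hcard : Fintype.card 𝓀[F] % 2 = 1 := by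
    have hc : ringChar 𝓀[F] ≠ 2 := Fact.out
    exact FiniteField.odd_card_of_char_ne_two hc
  -- over the residue field the norm form `X ^ 2 + N(a) Y ^ 2` represents every element
  obtain ⟨p, q, hpq⟩ := FiniteField.exists_root_sum_quadratic (R := 𝓀[F])
    (f := X ^ 2 - C (IsLocalRing.residue 𝒪[F] ⟨u, hmem hu0 huo⟩))
    (g := C (IsLocalRing.residue 𝒪[F] ⟨_, hmem hNa hNao⟩) * X ^ 2)
    (degree_X_pow_sub_C two_pos _) (degree_C_mul_X_pow 2 (hne hNa hNao)) hcard
  obtain ⟨p, rfl⟩ := IsLocalRing.residue_surjective p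
  obtain ⟨q, rfl⟩ := IsLocalRing.residue_surjective q
  have hN : Algebra.norm F (algebraMap F E (p : F) + algebraMap F E (q : F) * a) =
      p ^ 2 + Algebra.norm F a * q ^ 2 := by
    apply (algebraMap F E).injective
    rw [algebraMap_norm, map_add, map_add, map_mul, hσ, (algebraMap F E).map_mul, algebraMap_norm,
      hσ, AlgHom.commutes, AlgHom.commutes, map_pow, map_pow]
    ring
  have h1 : (p : F) ^ 2 + Algebra.norm F a * q ^ 2 - u ∈ pPow F 1 := by
    simp only [eval_sub, eval_pow, eval_X, eval_C, eval_mul, ← map_pow, ← map_mul, ← map_sub,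
      ← map_add] at hpq
    rw [← map_zero (IsLocalRing.residue 𝒪[F]), residue_eq_iff] at hpq
    -- `1`-units of `F` are squares, hence norms
    have h2 : ((p : F) ^ 2 - u + Algebra.norm F a * q ^ 2) - 0 ∈ pPow F 1 := hpq
    rwa [sub_zero, sub_add_eq_add_sub] at h2
  rw [← hN] at h1
  generalize algebraMap F E (p : F) + algebraMap F E (q : F) * a = w at h1
  have h2 : Algebra.norm F w / u - 1 ∈ pPow F 1 := by
    have e : Algebra.norm F w / u - 1 = (Algebra.norm F w - u) * u⁻¹ := by field_simp
    rw [e]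
    exact mem_pPow_of_eq (mul_mem_pPow h1 mem_pPow_self) (by rw [ord_inv hu0, huo]; rfl)
  have h3 := inv_sub_one_mem le_rfl h2
  have hw := (ne_zero_and_ord_eq_zero h2).1
  obtain ⟨y, hy⟩ := exists_norm_eq_mul_self_mul (x := w) h3
  refine ⟨y, hy.trans ?_⟩
  have : Algebra.norm F w ≠ 0 := fun h => hw (by rw [h, zero_div])
  field_simp

/-- If `d` is not a norm, the two terms of `N(x) - d N(y)` cannot cancel: a quotient `d N(y) / N(x)` that
is close to `1` would be a square. -/
lemma mem_lat_of_nrm_mem {R : Type*} [Ring R] [Algebra F R] (D : QuatModel F E R)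
    (hD : ∀ x : E, Algebra.norm F x ≠ D.d) {n : ℤ} {r : R} (h : D.nrm r ∈ pPow F n) :
    Algebra.norm F (D.X r) ∈ pPow F n ∧ D.d * Algebra.norm F (D.Y r) ∈ pPow F n := by
  have h1 : Algebra.norm F (D.X r) ∈ pPow F n := by
    by_contra hX
    have hX0 : Algebra.norm F (D.X r) ≠ 0 := fun h0 => hX (h0 ▸ zero_mem_pPow _)
    have hXr : D.X r ≠ 0 := by rwa [Ne, Algebra.norm_eq_zero_iff] at hX0
    rw [mem_pPow hX0] at hX
    have h2 : D.d * Algebra.norm F (D.Y r) / Algebra.norm F (D.X r) - 1 ∈ pPow F 1 := by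
      have e : D.d * Algebra.norm F (D.Y r) / Algebra.norm F (D.X r) - 1 =
          -(D.nrm r * (Algebra.norm F (D.X r))⁻¹) := by
        rw [QuatModel.nrm_apply]; field_simp; ring
      rw [e]
      exact pPow_anti (by rw [ord_inv hX0]; omega) (neg_mem_pPow (mul_mem_pPow h mem_pPow_self))
    obtain ⟨y, hy⟩ := exists_norm_eq_mul_self_mul (x := D.X r / D.Y r) h2
    have h3 := (ne_zero_and_ord_eq_zero h2).1
    have hY : Algebra.norm F (D.Y r) ≠ 0 := fun h0 => h3 (by rw [h0, mul_zero, zero_div])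
    refine hD y (hy.trans ?_)
    rw [norm_div_ext (by rwa [Ne, Algebra.norm_eq_zero_iff] at hY)]
    field_simp
  refine ⟨h1, ?_⟩
  have := sub_mem_pPow h1 h
  rwa [QuatModel.nrm_apply, sub_sub_cancel] at this

lemma mul_norm_mem_pPow_iff {d : F} (hd : d ≠ 0) {x : E} {n k : ℤ}
    (h : ∀ i : ℤ, ramIdx F E * n ≤ ord (algebraMap F E d) + 2 * i ↔ k ≤ i) :
    d * Algebra.norm F x ∈ pPow F n ↔ x ∈ pPow E k := by
  by_cases hx : x = 0
  · simp [hx, zero_mem_pPow]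
  have hN := Algebra.norm_ne_zero_iff (R := F).2 hx
  rw [← algebraMap_mem_pPow_iff (E := E), mem_pPow (hom_ne_zero (mul_ne_zero hd hN)), mem_pPow hx,
    map_mul, ord_mul (hom_ne_zero hd) (hom_ne_zero hN), ord_algebraMap hN, ord_norm hx, h]

open Classical in
/-- The model of the quaternion division algebra attached to an embedding of `E`. Since the algebra
has no zero divisors, `d` is not a norm from `E`. -/
theorem exists_modelB {B : Type*} [DivisionRing B] [Algebra F B] [IsQuaternionDivision F B]
    (jB : E →ₐ[F] B) :
    ∃ D : QuatModel F E B, D.j = jB ∧ (D.κ = if Unramified F E then 1 else 0) ∧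
      (∀ b, sB jB b = D.X b) ∧
      (∀ n : ℕ, radB F B n = D.lat ((n + D.κ) / (1 + D.κ)) (n / (1 + D.κ))) ∧
      (∀ b, redTrace F b = D.tr b) ∧ ∀ b : B, redNormFun F b = D.nrm b := by
  have hB4 : Module.finrank F B = 4 := IsQuaternionDivision.finrank_eq
  have : FiniteDimensional F B := finiteDimensional_of_isQuaternionDivision
  have h2F : (2 : F) ≠ 0 := NeZero.ne 2
  have h2B : (2 : B) ≠ 0 := by
    rw [← map_ofNat (algebraMap F B) 2]; exact hom_ne_zero h2F
  obtain ⟨a, ha, hσ⟩ := exists_conj_eq_neg F E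
  have hself : ∀ b : B, b = -b → b = 0 := fun b hb => by
    have h1 : 2 * b = 0 := by rw [two_mul]; nth_rewrite 1 [hb]; exact neg_add_cancel b
    exact (mul_eq_zero.1 h1).resolve_left h2B
  have haa : jB a * jB a = algebraMap F B (-Algebra.norm F a) := by
    rw [← map_mul, ← AlgHom.commutes jB, map_neg, algebraMap_norm, hσ]; congr 1; ring
  have hja : jB a ≠ 0 := hom_ne_zero ha
  obtain ⟨y, hy⟩ : ∃ y : B, jB a * y ≠ y * jB a := by
    by_contra! hcon
    have hcen : jB a ∈ Subalgebra.center F B :=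
      Subalgebra.mem_center_iff.2 fun y => (hcon y).symm
    obtain ⟨t, ht⟩ := Algebra.IsCentral.out (K := F) (D := B) hcen
    have ht' : jB (algebraMap F E t) = jB a := (AlgHom.commutes jB t).trans ht
    have h1 := jB.toRingHom.injective ht'
    rw [← h1, AlgHom.commutes] at hσ
    refine ha ?_
    rw [← h1]
    have h3 : 2 * algebraMap F E t = 0 := by linear_combination hσ
    exact (mul_eq_zero.1 h3).resolve_left (two_ne_zero_ext F E)
  -- a commutator with `a` anticommutes with `a`
  obtain ⟨z, hz⟩ : ∃ z : B, z = jB a * y - y * jB a := ⟨_, rfl⟩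
  have hz0 : z ≠ 0 := hz ▸ sub_ne_zero.2 hy
  have hanti : z * jB a = -(jB a * z) := by
    rw [hz, sub_mul, mul_sub, mul_assoc y, haa, ← mul_assoc (jB a), haa, Algebra.commutes,
      mul_assoc]
    abel
  have hzj : ∀ x, z * jB x = jB (conj F E x) * z := by
    intro x
    have hx := eq_trace_add ha hσ x
    generalize Algebra.trace F E x / 2 = t at hx
    generalize -Algebra.trace F E (x * a) / (2 * Algebra.norm F a) = s at hx
    subst hx
    simp only [map_add, map_mul, AlgHom.commutes, hσ, mul_add, add_mul, map_neg]
    rw [Algebra.commutes t z, ← mul_assoc, ← Algebra.commutes s z, mul_assoc, hanti]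
    simp [mul_assoc]
  -- `z` has reduced trace zero, because otherwise it would commute with `a`
  obtain ⟨d₀, hd₀⟩ : ∃ d₀ : F, z * z = algebraMap F B d₀ := by
    have h1 := mul_self_eq_redTrace_redNorm (F := F) z
    have h3 : redTrace F z = 0 := by
      by_contra ht
      have h4 : z * z * jB a = jB a * (z * z) := by
        rw [mul_assoc, hanti, mul_neg, ← mul_assoc, hanti, neg_mul, neg_neg, mul_assoc]
      rw [h1, sub_mul, mul_sub, Algebra.commutes (redNormFun F z) (jB a), sub_left_inj,
        smul_mul_assoc, mul_smul_comm, hanti] at h4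
      have h5 := smul_right_injective B ht h4
      exact mul_ne_zero hja hz0 (hself _ h5.symm)
    refine ⟨-redNormFun F z, ?_⟩
    rw [h1, h3, zero_smul, zero_sub, map_neg]
  have hd₀0 : d₀ ≠ 0 := fun h0 => mul_ne_zero hz0 hz0 (by rw [hd₀, h0, map_zero])
  have hnot : ∀ x w : E, jB x + jB w * z = 0 → x = 0 ∧ w = 0 := by
    intro x w h
    by_cases hw : w = 0
    · rw [hw, map_zero, zero_mul, add_zero] at h
      exact ⟨(map_eq_zero_iff jB jB.toRingHom.injective).1 h, hw⟩
    exfalso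
    have h1 : z = jB (-(w⁻¹ * x)) := by
      have h3 : jB w⁻¹ * (jB x + jB w * z) = jB (w⁻¹ * x) + z := by
        rw [mul_add, ← map_mul, ← mul_assoc, ← map_mul, inv_mul_cancel₀ hw, map_one, one_mul]
      rw [h, mul_zero] at h3
      rw [map_neg]
      exact (neg_eq_of_add_eq_zero_right h3.symm).symm
    have h3 : z * jB a = jB a * z := by rw [h1, ← map_mul, ← map_mul, mul_comm]
    rw [hanti] at h3
    exact mul_ne_zero hja hz0 (hself _ h3.symm)
  -- `d₀` is not a norm, because `B` has no zero divisors
  have hnorm : ∀ x : E, Algebra.norm F x ≠ d₀ := by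
    intro x hx
    have h1 : (jB (conj F E x) - z) * (jB x + z) = 0 := by
      rw [sub_mul, mul_add, mul_add, hzj, hd₀, ← map_mul, mul_comm (conj F E x), ← algebraMap_norm,
        AlgHom.commutes, hx]
      abel
    rcases mul_eq_zero.1 h1 with h3 | h3
    · have := hnot (conj F E x) (-1) (by rw [map_neg, map_one, neg_one_mul, ← sub_eq_add_neg, h3])
      exact neg_ne_zero.2 one_ne_zero this.2
    · have := hnot x 1 (by rw [map_one, one_mul, h3])
      exact one_ne_zero this.2
  -- Multiplying `z` by an element of `E` changes `d₀` by a norm.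
  obtain ⟨e, he0, heκ⟩ : ∃ e : E, e ≠ 0 ∧ ord (algebraMap F E (d₀ * Algebra.norm F e)) =
      if Unramified F E then 1 else 0 := by
    have hro := ord_algebraMap (E := E) hd₀0
    have hgen : ∀ k : ℤ, ∃ e : E, e ≠ 0 ∧ ord (algebraMap F E (d₀ * Algebra.norm F e)) =
        ramIdx F E * ord d₀ + 2 * k := by
      intro k
      obtain ⟨e, he, hek⟩ := exists_ord_eq (K := E) k
      have hce : conj F E e ≠ 0 := hom_ne_zero he
      refine ⟨e, he, ?_⟩
      rw [map_mul, algebraMap_norm, ord_mul (hom_ne_zero hd₀0) (mul_ne_zero he hce),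
        ord_mul he hce, ord_conj, hro, hek]
      ring
    rcases ramIdx_eq F E with ⟨hu, hr⟩ | ⟨hu, hr⟩
    · obtain ⟨e, he, hek⟩ := hgen (-(ord d₀ / 2))
      refine ⟨e, he, ?_⟩
      rw [hek, hr, if_pos hu]
      by_contra hodd
      have hNe : Algebra.norm F e ≠ 0 := by rwa [Ne, Algebra.norm_eq_zero_iff]
      have h0 : ord (d₀ * Algebra.norm F e) = 0 := by
        have h5 := ord_algebraMap (E := E) (mul_ne_zero hd₀0 hNe)
        rw [hek, hr] at h5
        omega
      obtain ⟨w, hw⟩ := exists_norm_eq_unit hu (mul_ne_zero hd₀0 hNe) h0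
      refine hnorm (w / e) ?_
      rw [norm_div_ext he, hw, mul_div_cancel_right₀ _ hNe]
    · obtain ⟨e, he, hek⟩ := hgen (-ord d₀)
      exact ⟨e, he, by rw [hek, hr, if_neg hu]; ring⟩
  have hje : jB e ≠ 0 := hom_ne_zero he0
  have hNe : Algebra.norm F e ≠ 0 := by rwa [Ne, Algebra.norm_eq_zero_iff]
  let L : (E × E) →ₗ[F] B := jB.toLinearMap.coprod
    (LinearMap.mulRight F (jB e * z) ∘ₗ jB.toLinearMap)
  have hL : ∀ x w : E, L (x, w) = jB x + jB w * (jB e * z) := fun _ _ => rfl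
  have hLbij : Function.Bijective L := by
    have hinj : Function.Injective L := by
      rw [injective_iff_map_eq_zero]
      rintro ⟨x, w⟩ h
      rw [hL, ← mul_assoc, ← map_mul] at h
      have := hnot _ _ h
      exact Prod.ext this.1 ((mul_eq_zero.1 this.2).resolve_right he0)
    refine ⟨hinj, (LinearMap.injective_iff_surjective_of_finrank_eq_finrank ?_).1 hinj⟩
    rw [Module.finrank_prod, Algebra.IsQuadraticExtension.finrank_eq_two F E, hB4]
  let L' := LinearEquiv.ofBijective L hLbij
  let D : QuatModel F E B :=
    { j := jB, c := jB e * z, d := d₀ * Algebra.norm F e, κ := if Unramified F E then 1 else 0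
      X := LinearMap.fst F E E ∘ₗ L'.symm.toLinearMap
      Y := LinearMap.snd F E E ∘ₗ L'.symm.toLinearMap
      κ_eq := by split_ifs <;> simp
      d_ne_zero := mul_ne_zero hd₀0 hNe
      ord_d := heκ
      c_mul := fun x => by
        rw [mul_assoc, hzj, ← mul_assoc, ← mul_assoc, ← map_mul, ← map_mul, mul_comm e]
      c_mul_c := by
        rw [← mul_assoc, mul_assoc (jB e), hzj, ← mul_assoc, mul_assoc, hd₀, ← map_mul,
          ← algebraMap_norm, AlgHom.commutes, ← map_mul, mul_comm]
      decomp := fun r => by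
        change r = L ((L'.symm r).1, (L'.symm r).2)
        exact (L'.apply_symm_apply r).symm
      X_mk := fun x w => by
        change (L'.symm (L' (x, w))).1 = x
        rw [L'.symm_apply_apply]
      Y_mk := fun x w => by
        change (L'.symm (L' (x, w))).2 = w
        rw [L'.symm_apply_apply] }
  have hDd : ∀ x : E, Algebra.norm F x ≠ D.d := by
    intro x hx
    refine hnorm (x / e) ?_
    rw [norm_div_ext he0, hx]
    exact mul_div_cancel_right₀ _ hNe
  have htr : ∀ b, redTrace F b = D.tr b :=
    D.eq_tr { toFun := redTrace F, map_add' := redTrace_add, map_smul' := redTrace_smul }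
      redTrace_mul_comm (by
        have := redTrace_algebraMap (F := F) (B := B) 1
        rwa [map_one, mul_one] at this)
  have hnr : ∀ b : B, redNormFun F b = D.nrm b :=
    D.eq_nrm htr fun b => mul_self_eq_redTrace_redNorm b
  refine ⟨D, rfl, rfl, fun b => D.corestriction_eq htr b, fun n => ?_, htr, hnr⟩
  ext b
  have hκ : (D.κ = 1 ∧ ramIdx F E = 1) ∨ (D.κ = 0 ∧ ramIdx F E = 2) :=
    (ramIdx_eq F E).imp (.imp_left fun h => if_pos h) (.imp_left fun h => if_neg h)
  have hY : D.d * Algebra.norm F (D.Y b) ∈ pPow F n ↔ D.Y b ∈ pPow E (n / (1 + D.κ)) :=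
    mul_norm_mem_pPow_iff D.d_ne_zero fun i => by
      rcases hκ with ⟨h, h'⟩ | ⟨h, h'⟩ <;> rw [D.ord_d, h, h'] <;> omega
  have hX : Algebra.norm F (D.X b) ∈ pPow F n ↔ D.X b ∈ pPow E ((n + D.κ) / (1 + D.κ)) := by
    rw [← one_mul (Algebra.norm F _)]
    refine mul_norm_mem_pPow_iff one_ne_zero fun i => ?_
    rcases hκ with ⟨h, h'⟩ | ⟨h, h'⟩ <;> rw [map_one, ord_one, h, h'] <;> omega
  change redNormFun F b ∈ pPow F n ↔ _
  rw [hnr]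
  constructor
  · intro h
    have h1 := mem_lat_of_nrm_mem D hDd h
    exact ⟨hX.1 h1.1, hY.1 h1.2⟩
  · intro h
    rw [QuatModel.nrm_apply]
    exact sub_mem_pPow (hX.2 h.1) (hY.2 h.2)

end Models

/-! ### Pure characters are types -/

namespace QuatModel

variable {R : Type*} [Ring R] [Algebra F R] (D : QuatModel F E R)
variable [TopologicalSpace R] [IsTopologicalRing R] [IsModuleTopology F R]

/-- The groups `H ◁ J` with the congruence subgroups as neighbourhoods of `1`. -/
def openPair (m : ℕ) (hm : 1 ≤ m) : OpenPair Rˣ where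
  H := D.grpH m
  J := D.grpJ m hm
  U N := D.grpU (N + (D.bH m).toNat)
  H_le_J := D.grpH_le_grpJ hm
  conj_mem_H g hg h hh := InJ.conj_mem D hm hg hh
  U_anti N N' h := D.grpU_anti (by omega)
  U_le_H N := (D.grpU_anti (by omega)).trans D.grpU_le_grpH
  U_mem_nhds N := D.grpU_mem_nhds _
  exists_U S hS := by
    obtain ⟨N, hN⟩ := D.exists_grpU_subset hS
    exact ⟨N, fun u hu => hN (D.grpU_anti (by omega) hu)⟩
  conj_mem_U N g hg u hu := D.conj_mem_grpU hg hu
  exists_cover N := D.exists_finite_grpH m _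
  exists_cover_J := by
    obtain ⟨ϖ, S, hS, hSJ, h⟩ := D.exists_finite_grpJ hm
    refine ⟨scalar ϖ, S, hS, hSJ, ?_, fun g => scalar_comm _ _, fun g hg => ?_⟩
    · rw [D.scalar_eq]; exact D.jUnits_mem_grpJ hm _
    · obtain ⟨k, s, hs, h', hh', e⟩ := h g hg
      exact ⟨k, s, hs, h', hh', by rw [e, map_zpow]⟩

variable {Θ : D.grpH m →* Ωˣ}

lemma IsPure.isType (hψ : IsLevelZero F ψ) (hm : 1 ≤ m) (hα : IsMinimalElt F m α)
    (hΘ : D.IsPure ψ m α Θ) : (D.openPair m hm).IsType (Θ : (D.openPair m hm).H →* Ωˣ) where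
  smooth := by
    refine ⟨m, fun u hu => ?_⟩
    refine hΘ.eq_one D hψ hα u ?_
    have h1 : D.InCong (m + (D.bH m).toNat + 1) (m + (D.bH m).toNat + 1) ((u : Rˣ) : R) := by
      have h2 := (D.mem_grpU).1 hu
      push_cast at h2
      exact h2
    exact pPow_anti (by omega) h1.1
  conj g hg h hh hh' := hΘ.conj_eq D hψ hm hα hg hh hh'
  mem_J g hg := by
    have := D.intertwine hψ hm hα hΘ 1 (Θ₂ := Θ) (fun h hh => by
      rw [hΘ h hh, MonoidHom.one_apply, Units.val_one, mul_one]) hg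
    exact this.1
  support N := by
    obtain ⟨S, hS, h⟩ := D.exists_finite_support hψ hm hα hΘ (N + (D.bH m).toNat)
    exact ⟨S, hS, fun g hg => h g fun h' hh' => hg h' (D.mem_grpU.2 hh')⟩

/-- The character `Ξ` of `H` is the product of a character that is pure for `α` and of
`ω ∘ nrm`. -/
def IsTwistedPure (ψ : AddChar F Ω) (m : ℕ) (α : E) (ω : Fˣ →* Ωˣ) (Ξ : D.grpH m →* Ωˣ) : Prop :=
  ∀ h : D.grpH m, D.X (h : Rˣ) - 1 ∈ pPow E m →
    (Ξ h : Ω) = ψ (Algebra.trace F E (α * (D.X (h : Rˣ) - 1))) * ω (D.nrmUnits h)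

variable {D} in
lemma IsTwistedPure.isPure {ω : Fˣ →* Ωˣ} {Ξ : D.grpH m →* Ωˣ}
    (h : D.IsTwistedPure ψ m α ω Ξ) :
    D.IsPure ψ m α (Ξ * ((ω⁻¹.comp D.nrmUnits).comp (D.grpH m).subtype)) := by
  intro x hx
  have h1 : (Ξ * ((ω⁻¹.comp D.nrmUnits).comp (D.grpH m).subtype)) x =
    Ξ x * (ω (D.nrmUnits x))⁻¹ := rfl
  rw [h1, Units.val_mul, h x hx, mul_assoc, Units.mul_inv, mul_one]

lemma isSmoothChar_iff {G : Type*} [Group G] [TopologicalSpace G] [IsTopologicalGroup G]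
    {χ : G →* Ωˣ} : IsSmoothChar χ ↔ ∀ᶠ g in 𝓝 (1 : G), χ g = 1 := by
  constructor
  · intro h
    exact h.mem_nhds χ.ker.one_mem
  · intro h
    exact Subgroup.isOpen_of_mem_nhds _ (g := 1) h

lemma _root_.TameTypes.IsSmoothChar.inv {G : Type*} [Group G] [TopologicalSpace G]
    {χ : G →* Ωˣ} (h : IsSmoothChar χ) : IsSmoothChar χ⁻¹ := by
  unfold IsSmoothChar at h ⊢
  have : (χ⁻¹.ker : Set G) = χ.ker := by
    ext g
    simp [MonoidHom.mem_ker]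
  rwa [this]

lemma _root_.TameTypes.IsSmoothChar.comp {G G' : Type*} [Group G] [TopologicalSpace G] [Group G']
    [TopologicalSpace G'] {χ : G →* Ωˣ} (h : IsSmoothChar χ) {f : G' →* G} (hf : Continuous f) :
    IsSmoothChar (χ.comp f) := h.preimage hf

lemma continuous_nrm : Continuous D.nrm := by
  have h : (fun r => D.nrm r) = fun r => (1 / 2 : F) * (D.tr r * D.tr r - D.tr (r * r)) := by
    funext r
    have h2 : (2 : F) ≠ 0 := NeZero.ne 2
    have h1 : r * r = D.tr r • r - algebraMap F R (D.nrm r) := by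
      have h3 := D.mul_bar r
      rw [D.bar_eq, mul_sub, ← Algebra.commutes, ← Algebra.smul_def] at h3
      rw [← h3]; abel
    have h4 : D.tr (algebraMap F R (D.nrm r)) = 2 * D.nrm r := by
      rw [D.tr_apply, ← mul_one (algebraMap F R _), D.X_algebraMap_mul, D.X_one, mul_one,
        trace_algebraMap_quadratic]
    rw [h1, map_sub, map_smul, h4, smul_eq_mul]
    field_simp
    ring
  have ht : Continuous D.tr := IsModuleTopology.continuous_of_linearMap D.tr
  change Continuous fun r => D.nrm r
  rw [h]
  fun_prop

lemma continuous_nrmUnits : Continuous D.nrmUnits :=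
  Units.continuous_iff.2 ⟨D.continuous_nrm.comp Units.continuous_val, by
    have : (fun g : Rˣ => (((D.nrmUnits g)⁻¹ : Fˣ) : F)) = fun g => D.nrm ((g⁻¹ : Rˣ) : R) := by
      funext g
      rw [← map_inv]
      rfl
    change Continuous fun g : Rˣ => (((D.nrmUnits g)⁻¹ : Fˣ) : F)
    rw [this]
    exact D.continuous_nrm.comp (Units.continuous_val.comp continuous_inv)⟩

variable {D} in
lemma IsTwistedPure.isType {ω : Fˣ →* Ωˣ} {Ξ : D.grpH m →* Ωˣ} (hψ : IsLevelZero F ψ) (hm : 1 ≤ m)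
    (hα : IsMinimalElt F m α) (hω : IsSmoothChar ω)
    (h : D.IsTwistedPure ψ m α ω Ξ) :
    (D.openPair m hm).IsType (Ξ : (D.openPair m hm).H →* Ωˣ) := by
  have h1 := (IsPure.isType D hψ hm hα h.isPure).twist (hω.comp D.continuous_nrmUnits)
  have e : (Ξ * ((ω⁻¹.comp D.nrmUnits).comp (D.grpH m).subtype)) *
      (ω.comp D.nrmUnits).comp (D.grpH m).subtype = Ξ := MonoidHom.ext fun x =>
    inv_mul_cancel_right (Ξ x) (ω (D.nrmUnits x))
  exact e ▸ h1

variable [CharZero Ω]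

/-- An irreducible smooth representation contains at most one twisted pure character for a given
minimal element. -/
lemma IsTwistedPure.eq {ω ω' : Fˣ →* Ωˣ} {Ξ Ξ' : D.grpH m →* Ωˣ} (hψ : IsLevelZero F ψ)
    (hm : 1 ≤ m) (hα : IsMinimalElt F m α) (hω' : IsSmoothChar ω')
    (h : D.IsTwistedPure ψ m α ω Ξ) (h' : D.IsTwistedPure ψ m α ω' Ξ')
    {V : Type*} [AddCommGroup V] [Module Ω V] {π : Representation Ω Rˣ V} (hπ : IsSmooth π)
    (hirr : π.IsIrreducible)
    (h0 : OpenPair.eigen (P := D.openPair m hm) π Ξ ≠ ⊥)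
    (h0' : OpenPair.eigen (P := D.openPair m hm) π Ξ' ≠ ⊥) : Ξ = Ξ' := by
  have hT' := h'.isType hψ hm hα hω'
  have htop := span_orbit_eq_top hirr (Submodule.exists_mem_ne_zero_of_ne_bot h0)
  obtain ⟨v', hv', hv0'⟩ := Submodule.exists_mem_ne_zero_of_ne_bot h0'
  -- some translate of an eigenvector for `Ξ` has a nonzero component along `Ξ'`
  have hex : ∃ g : Rˣ, ∃ v ∈ OpenPair.eigen (P := D.openPair m hm) π Ξ,
      OpenPair.eigenProj hπ hT' (π g v) ≠ 0 := by
    by_contra! hcon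
    have hz : OpenPair.eigenProj hπ hT' = 0 := LinearMap.ext_on htop (by
      rintro _ ⟨g, v, hv, rfl⟩
      exact hcon g v hv)
    have := OpenPair.eigenProj_of_mem hπ hT' ⟨v', hv'⟩
    rw [hz] at this
    exact hv0' (congrArg Subtype.val this).symm
  obtain ⟨g, v, hv, hgv⟩ := hex
  have hint : ∀ (x : Rˣ) (hx : x ∈ D.grpH m) (hx' : g⁻¹ * x * g ∈ D.grpH m),
      Ξ' ⟨x, hx⟩ = Ξ ⟨g⁻¹ * x * g, hx'⟩ := by
    intro x hx hx'
    have h1 := OpenPair.eigenProj_map hπ hT' ⟨x, D.grpH_le_grpJ hm hx⟩ (π g v)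
    have e : x * g = g * (g⁻¹ * x * g) := by group
    have e2 : π x (π g v) = (Ξ ⟨g⁻¹ * x * g, hx'⟩ : Ω) • π g v := by
      rw [← Module.End.mul_apply, ← map_mul, e, map_mul, Module.End.mul_apply,
        hv ⟨g⁻¹ * x * g, hx'⟩, map_smul]
      rfl
    change OpenPair.eigenProj hπ hT' (π x (π g v)) = _ at h1
    rw [e2, map_smul] at h1
    have h3 := OpenPair.eigenRep_apply_H hT' hx (OpenPair.eigenProj hπ hT' (π g v))
    have h4 := h1.trans h3
    rw [← sub_eq_zero, ← sub_smul] at h4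
    exact Units.ext (sub_eq_zero.1 ((smul_eq_zero.1 h4).resolve_right hgv)).symm
  -- untwist by `ω'`, so that the first of the two characters becomes pure
  let c : D.grpH m →* Ωˣ := (ω'⁻¹.comp D.nrmUnits).comp (D.grpH m).subtype
  have hc : ∀ (x : Rˣ) (hx : x ∈ D.grpH m), c ⟨x, hx⟩ = (ω' (D.nrmUnits x))⁻¹ := fun x hx => rfl
  have h2 := (D.intertwine hψ hm hα h'.isPure (ω * ω'⁻¹) (Θ₂ := Ξ * c) ?_ (g := g) ?_).2
  · have h3 : Ξ' * c = Ξ * c := h2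
    exact (mul_right_cancel h3).symm
  · intro x hx
    rw [MonoidHom.mul_apply, Units.val_mul, h x hx, MonoidHom.mul_apply, Units.val_mul, mul_assoc]
    rfl
  · intro x hx hx'
    change Ξ' _ * c _ = Ξ _ * c _
    rw [hint x hx hx', hc, hc]
    congr 3
    rw [map_mul, map_mul, map_inv, mul_right_comm, inv_mul_cancel, one_mul]

end QuatModel

/-! ### The commutator pairing -/

section

lemma IsLevelZero.inv (hψ : IsLevelZero F ψ) : IsLevelZero F ψ⁻¹ := by
  refine ⟨fun x hx => ?_, ?_⟩
  · rw [AddChar.inv_apply]; exact hψ.1 _ (neg_mem_pPow hx)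
  · obtain ⟨x, hx, h⟩ := hψ.2
    exact ⟨-x, neg_mem_pPow hx, by rwa [AddChar.inv_apply, neg_neg]⟩

/-- The pairing `(t, y) ↦ ψ (tr (t y))` is nondegenerate. -/
lemma exists_char_ne_one (hψ : IsLevelZero F ψ) {t : E} {i : ℤ} (ht : t ∉ pPow E (1 - i)) :
    ∃ y ∈ pPow E i, ψ (Algebra.trace F E (t * y)) ≠ 1 := by
  by_contra! hcon
  refine ht (mem_pPow_of_trace F fun y hy => mem_pPow_of_char hψ fun z hz => ?_)
  rw [← trace_algebraMap_mul, mul_left_comm]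
  refine hcon _ (mem_pPow_of_eq (mul_mem_pPow (algebraMap_mem_pPow_zero.2 hz) hy) (by ring))

lemma natCard_sub_one_ne_zero : Nat.card 𝓀[E] - 1 ≠ 0 := fun h =>
  natCard_sub_one_not_mem (K := E) (by rw [h, Nat.cast_zero]; exact zero_mem_pPow _)

lemma ord_eq_zero_of_pow_eq_one {z : E} (h : z ^ (Nat.card 𝓀[E] - 1) = 1) : z ≠ 0 ∧ ord z = 0 := by
  have h0 : z ≠ 0 := by
    rintro rfl
    exact zero_ne_one ((zero_pow natCard_sub_one_ne_zero).symm.trans h)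
  have h2 := congrArg ord h
  rw [ord_pow h0, ord_one] at h2
  exact ⟨h0, (mul_eq_zero.1 h2).resolve_left (Nat.cast_ne_zero.2 natCard_sub_one_ne_zero)⟩

lemma IsRootOutside.pow_eq_one {ζ : Eˣ} (h : IsRootOutside F E ζ) :
    (ζ : E) ^ (Nat.card 𝓀[E] - 1) = 1 := by
  rw [← Units.val_pow_eq_pow_val, h.1, Units.val_one]

lemma IsRootOutside.ord_eq {ζ : Eˣ} (h : IsRootOutside F E ζ) : ord (ζ : E) = 0 :=
  (ord_eq_zero_of_pow_eq_one h.pow_eq_one).2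

lemma IsRootOutside.inv {ζ : Eˣ} (h : IsRootOutside F E ζ) : IsRootOutside F E ζ⁻¹ := by
  refine ⟨by rw [inv_pow, h.1, inv_one], ?_⟩
  rintro ⟨a, ha⟩
  refine h.2 ⟨a⁻¹, ?_⟩
  rw [map_inv₀, ha, Units.val_inv_eq_inv_val, inv_inv]

lemma IsRootOutside.sub_conj_not_mem {ζ : Eˣ} (h : IsRootOutside F E ζ) :
    (ζ : E) - conj F E ζ ∉ pPow E 1 := by
  intro hmem
  have hc0 : conj F E (ζ : E) ≠ 0 := hom_ne_zero ζ.ne_zero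
  have h2 : (ζ : E) / conj F E ζ = 1 := by
    refine eq_one_of_pow_eq_one ?_ ?_
    · have e : (ζ : E) / conj F E ζ - 1 = (ζ - conj F E ζ) * (conj F E (ζ : E))⁻¹ := by
        field_simp
      rw [e]
      refine mem_pPow_of_eq (mul_mem_pPow hmem (inv_mem_pPow hc0)) ?_
      rw [ord_conj, h.ord_eq]; norm_num
    · rw [div_pow, ← map_pow, h.pow_eq_one, map_one, div_one]
  exact h.2 (mem_range_of_conj_eq ((div_eq_one_iff_eq hc0).1 h2).symm)

lemma exists_isRootOutside (hu : Unramified F E) : ∃ ζ : Eˣ, IsRootOutside F E ζ := by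
  obtain ⟨a, ha, hca, hoa⟩ := exists_unit_conj_eq_neg (F := F) hu
  obtain ⟨z, hz, hza⟩ := exists_teichmuller ha hoa
  refine ⟨Units.mk0 z (ord_eq_zero_of_pow_eq_one hz).1, Units.ext (by simpa using hz), ?_⟩
  rintro ⟨t, ht⟩
  change algebraMap F E t = z at ht
  have h1 := conj_mem_pPow (F := F) hza
  rw [← ht, map_sub, AlgHom.commutes, hca, ht] at h1
  have h2 := sub_mem_pPow h1 hza
  have := fact_ringChar_ext F E
  have e : z - -a - (z - a) = 2 * a := by ring
  rw [e, mem_pPow (mul_ne_zero (two_ne_zero_ext F E) ha), ord_mul (two_ne_zero_ext F E) ha,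
    ord_two, hoa] at h2
  omega

/-- For unramified `E / F`, the group `Eˣ` is generated by `Fˣ`, `U_E^1` and the roots of unity. -/
lemma exists_decomp_unit (hu : Unramified F E) (e : Eˣ) : ∃ (a : Fˣ) (u z : Eˣ),
    (u : E) - 1 ∈ pPow E 1 ∧ z ^ (Nat.card 𝓀[E] - 1) = 1 ∧
    e = Units.map (algebraMap F E : F →* E) a * u * z := by
  obtain ⟨ϖ, hϖ0, hϖ⟩ := exists_ord_eq (K := F) (ord (e : E))
  have hA0 : algebraMap F E ϖ ≠ 0 := hom_ne_zero hϖ0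
  have hoA : ord (algebraMap F E ϖ) = ord (e : E) := by rw [ord_algebraMap hϖ0, ramIdx_of_unramified hu, hϖ, one_mul]
  set x : E := e / algebraMap F E ϖ with hx
  have hx0 : x ≠ 0 := div_ne_zero e.ne_zero hA0
  have hxo : ord x = 0 := by rw [hx, ord_div e.ne_zero hA0, hoA, sub_self]
  obtain ⟨z, hz, hzx⟩ := exists_teichmuller hx0 hxo
  obtain ⟨hz0, hzo⟩ := ord_eq_zero_of_pow_eq_one hz
  refine ⟨Units.mk0 ϖ hϖ0, Units.mk0 (x / z) (div_ne_zero hx0 hz0), Units.mk0 z hz0, ?_,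
    Units.ext (by simpa using hz), ?_⟩
  · change x / z - 1 ∈ pPow E 1
    have e : x / z - 1 = -(z - x) * z⁻¹ := by field_simp; ring
    rw [e]
    exact mem_pPow_of_eq (mul_mem_pPow (neg_mem_pPow hzx) (inv_mem_pPow hz0)) (by rw [hzo]; norm_num)
  · ext
    simp only [Units.val_mul, Units.coe_map, Units.val_mk0]
    change (e : E) = algebraMap F E ϖ * (x / z) * z
    rw [hx]
    field_simp

namespace QuatModel

variable {R : Type*} [Ring R] [Algebra F R] (D : QuatModel F E R)

lemma exists_unit_Y_eq (hm : 1 ≤ m) {y : E} (hy : y ∈ pPow E (D.bJ m)) :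
    ∃ v : Rˣ, D.InCong m (D.bJ m) (v : R) ∧ D.X v = 1 ∧ D.Y v = y := by
  have hf := D.depth_facts m
  obtain ⟨v, hv, hvJ⟩ := D.exists_unit (a := m) (b := D.bJ m) (by omega) (by omega)
    (w := D.elt 0 y) ⟨by rw [X_elt]; exact zero_mem_pPow _, by rwa [Y_elt]⟩
  exact ⟨v, hvJ, by rw [hv, map_add, X_one, X_elt, add_zero],
    by rw [hv, map_add, Y_one, Y_elt, zero_add]⟩

/-- An element of a congruence subgroup differs by an element of `Eˣ` from one with first coordinate `1`. -/
lemma exists_jUnits_inv_mul {i b : ℤ} (hi : 1 ≤ i) {u : Rˣ} (hu : D.InCong i b (u : R)) :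
    ∃ x : Eˣ, (x : E) = D.X u ∧ ∀ k, D.InCong k b (((D.jUnits x)⁻¹ * u : Rˣ) : R) := by
  obtain ⟨h0, h0'⟩ := ne_zero_and_ord_eq_zero (pPow_anti hi hu.1)
  refine ⟨Units.mk0 _ h0, rfl, fun k => ?_⟩
  rw [← map_inv, Units.val_mul, coe_jUnits]
  refine ⟨?_, ?_⟩
  · rw [X_j_mul, Units.val_inv_eq_inv_val, Units.val_mk0, inv_mul_cancel₀ h0, sub_self]
    exact zero_mem_pPow _
  · rw [Y_j_mul, Units.val_inv_eq_inv_val, Units.val_mk0]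
    exact mem_pPow_of_eq (mul_mem_pPow (inv_mem_pPow h0) hu.2) (by rw [h0']; ring)

/-- The commutator pairing on `(1 + V) / (1 + W)` is nondegenerate. -/
lemma exists_pairing_ne_one (hψ : IsLevelZero F ψ) (hm : 1 ≤ m) (hα : IsMinimalElt F m α) {u : Rˣ}
    (hu : D.InCong m (D.bJ m) (u : R)) (hY : D.Y u ∉ pPow E (D.bH m)) :
    ∃ v : Rˣ, D.InCong m (D.bJ m) (v : R) ∧
      D.InCong m (D.bH m) ((v * u * v⁻¹ * u⁻¹ : Rˣ) : R) ∧
      ψ (Algebra.trace F E (α * (D.X ((v * u * v⁻¹ * u⁻¹ : Rˣ) : R) - 1))) ≠ 1 := by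
  have hf := D.depth_facts m
  have hne : D.bH m ≠ D.bJ m := fun h => hY (h ▸ hu.2)
  have hbH : D.bH m = D.bJ m + 1 := by omega
  have hκ : D.κ + 2 * D.bJ m = m := by omega
  have hY0 : D.Y u ≠ 0 := fun h => hY (h ▸ zero_mem_pPow _)
  have hordY : ord (D.Y u) = D.bJ m := by
    have h10 := (mem_pPow hY0).1 hu.2
    rw [mem_pPow hY0] at hY
    omega
  have hA0 : algebraMap F E D.d ≠ 0 := hom_ne_zero D.d_ne_zero
  have hα0 : α - conj F E α ≠ 0 := sub_ne_zero.2 fun h => hα.conj_ne h.symm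
  have hαo : ord (α - conj F E α) ≤ -m := by
    have := hα.sub_conj_not_mem
    rw [mem_pPow hα0] at this
    omega
  have hcY0 : conj F E (D.Y u) ≠ 0 := hom_ne_zero hY0
  obtain ⟨y, hy, hψy⟩ := exists_char_ne_one hψ (i := D.bJ m)
    (t := (α - conj F E α) * algebraMap F E D.d * conj F E (D.Y u)) (by
      rw [mem_pPow (mul_ne_zero (mul_ne_zero hα0 hA0) hcY0), ord_mul (mul_ne_zero hα0 hA0) hcY0,
        ord_mul hα0 hA0, ord_conj, hordY, D.ord_d]
      omega)
  obtain ⟨v, hvJ, hXv, hYv⟩ := D.exists_unit_Y_eq hm hy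
  -- up to higher terms the commutator is `1 + r`; the first coordinate of `r` is
  -- `d (y σ(Y u) - Y u σ(y))`
  set r : R := (v : R) * u - u * v with hr
  have hXr : D.X r = algebraMap F E D.d * (y * conj F E (D.Y u) - D.Y u * conj F E y) := by
    rw [hr, map_sub, D.X_mul, D.X_mul, hXv, hYv]; ring
  have hYr : D.Y r = y * (conj F E (D.X u) - D.X u) := by
    rw [hr, map_sub, D.Y_mul, D.Y_mul, hXv, hYv, map_one]; ring
  have hXu := conj_mem_pPow (F := F) hu.1
  rw [map_sub, map_one] at hXu
  have hXrm : D.X r ∈ pPow E m := by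
    rw [hXr, mul_sub, ← mul_assoc, ← mul_assoc]
    exact mem_pPow_of_eq (sub_mem_pPow (D.d_mul_mem hy hu.2) (D.d_mul_mem hu.2 hy)) (by omega)
  have hYrm : D.Y r ∈ pPow E (D.bH m) := by
    rw [hYr]
    refine pPow_anti (by omega) (mul_mem_pPow hy (b := m) ?_)
    have := sub_mem_pPow hXu hu.1
    simpa using this
  have huv : D.InCong m (D.bJ m) (((u * v)⁻¹ : Rˣ) : R) :=
    InCong.inv D (by omega) (by omega) (InCong.mul D (by omega) (by omega) hu hvJ)
  obtain ⟨t, ht⟩ : ∃ t : R, (((u * v)⁻¹ : Rˣ) : R) = 1 + t := ⟨_, (add_sub_cancel _ _).symm⟩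
  have htl : t ∈ D.lat m (D.bJ m) := by
    have := D.inCong_iff.1 huv
    rwa [ht, add_sub_cancel_left] at this
  have hw : ((v * u * v⁻¹ * u⁻¹ : Rˣ) : R) - 1 = r + r * t := by
    rw [commutator_sub_one, ht, mul_add, mul_one]
  have hrt : r * t ∈ D.lat (m + 1) (D.bH m) :=
    D.mul_mem_lat ⟨hXrm, hYrm⟩ htl (by omega) (by omega) (by omega) (by omega)
  refine ⟨v, hvJ, ?_, ?_⟩
  · rw [inCong_iff, hw]
    exact D.add_mem_lat ⟨hXrm, hYrm⟩ ⟨pPow_anti (by omega) hrt.1, hrt.2⟩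
  · rw [← D.X_one, ← map_sub, hw, map_add, mul_add, map_add, AddChar.map_add_eq_mul,
      psi_eq_one hψ hα.mem_pPow hrt.1, mul_one]
    -- `tr (α X(r))` is the trace of `(α - σ α) d σ(Y u) y`, by invariance of the trace under `σ`
    have e : Algebra.trace F E (α * D.X r) = Algebra.trace F E
        ((α - conj F E α) * algebraMap F E D.d * conj F E (D.Y u) * y) := by
      have e1 : Algebra.trace F E (algebraMap F E D.d * (α * D.Y u * conj F E y)) =
          Algebra.trace F E (algebraMap F E D.d * (conj F E α * conj F E (D.Y u) * y)) := by
        rw [trace_algebraMap_mul, trace_algebraMap_mul, ← trace_conj (α * D.Y u * conj F E y)]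
        simp only [map_mul, conj_conj]
      have e2 : α * D.X r = algebraMap F E D.d * (α * conj F E (D.Y u) * y) -
          algebraMap F E D.d * (α * D.Y u * conj F E y) := by rw [hXr]; ring
      rw [e2, map_sub, e1, ← map_sub]
      congr 1
      ring
    rw [e]
    exact hψy

end QuatModel

end

/-! ### The group `𝒦` -/

section GroupK

variable {R : Type*} [Ring R] [Algebra F R] (D : QuatModel F E R)
variable {R' : Type*} [Ring R'] [Algebra F R'] (D' : QuatModel F E R')

open QuatModel

/-- The group `1 + V`. -/
def QuatModel.grpV (m : ℕ) (hm : 1 ≤ m) : Subgroup Rˣ :=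
  D.cong m (D.bJ m) (by exact_mod_cast hm) (D.depth_facts m).2.2.2.2.2.2.1

/-- The group `1 + W`. -/
def QuatModel.grpW (m : ℕ) (hm : 1 ≤ m) : Subgroup Rˣ :=
  D.cong m (D.bH m) (by exact_mod_cast hm) (by have := D.depth_facts m; omega)

/-- The diagonal embedding of `Eˣ`. -/
def diagUnits : Eˣ →* Rˣ × R'ˣ := D.jUnits.prod D'.jUnits

/-- The group `𝒦 = Eˣ (1 + V)`. -/
def grpK (m : ℕ) (hm : 1 ≤ m) : Subgroup (Rˣ × R'ˣ) where
  carrier := {k | ∃ e : Eˣ, ∃ l ∈ (D.grpV m hm).prod (D'.grpV m hm), k = diagUnits D D' e * l}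
  one_mem' := ⟨1, 1, Subgroup.one_mem _, by simp⟩
  mul_mem' := by
    rintro _ _ ⟨e, l, hl, rfl⟩ ⟨e', l', hl', rfl⟩
    refine ⟨e * e', (diagUnits D D' e')⁻¹ * l * diagUnits D D' e' * l',
      Subgroup.mul_mem _ ?_ hl', by rw [map_mul]; group⟩
    have h1 := InCong.conj_jUnits D hl.1 e'⁻¹
    have h2 := InCong.conj_jUnits D' hl.2 e'⁻¹
    rw [map_inv, inv_inv] at h1 h2
    exact ⟨h1, h2⟩
  inv_mem' := by
    rintro _ ⟨e, l, hl, rfl⟩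
    have hl' := Subgroup.inv_mem _ hl
    refine ⟨e⁻¹, diagUnits D D' e * l⁻¹ * (diagUnits D D' e)⁻¹,
      ⟨InCong.conj_jUnits D hl'.1 e, InCong.conj_jUnits D' hl'.2 e⟩, by rw [map_inv]; group⟩

variable {D D'}

lemma diagUnits_mem_grpK (hm : 1 ≤ m) (e : Eˣ) : diagUnits D D' e ∈ grpK D D' m hm :=
  ⟨e, 1, Subgroup.one_mem _, by simp⟩

lemma mem_grpK_of_mem {hm : 1 ≤ m} {l : Rˣ × R'ˣ} (h : l ∈ (D.grpV m hm).prod (D'.grpV m hm)) :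
    l ∈ grpK D D' m hm := ⟨1, l, h, by simp⟩

lemma prod_grpW_le {hm : 1 ≤ m} :
    (D.grpW m hm).prod (D'.grpW m hm) ≤ (D.grpV m hm).prod (D'.grpV m hm) := fun _ h =>
  ⟨InCong.anti D h.1 le_rfl (D.depth_facts m).2.1, InCong.anti D' h.2 le_rfl (D'.depth_facts m).2.1⟩

variable (D D') in
/-- The subgroup `1 + V` of `𝒦`. -/
def subV (m : ℕ) (hm : 1 ≤ m) : Subgroup (grpK D D' m hm) :=
  ((D.grpV m hm).prod (D'.grpV m hm)).subgroupOf (grpK D D' m hm)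

variable (D D') in
/-- The subgroup `1 + W` of `𝒦`. -/
def subW (m : ℕ) (hm : 1 ≤ m) : Subgroup (grpK D D' m hm) :=
  ((D.grpW m hm).prod (D'.grpW m hm)).subgroupOf (grpK D D' m hm)

lemma QuatModel.conj_mem_grpV {hm : 1 ≤ m} {u g : Rˣ} (hu : u ∈ D.grpV m hm) (hg : g ∈ D.grpV m hm)
    (e : Eˣ) : D.jUnits e * u * g * (D.jUnits e * u)⁻¹ ∈ D.grpV m hm := by
  have h1 : u * g * u⁻¹ ∈ D.grpV m hm :=
    Subgroup.mul_mem _ (Subgroup.mul_mem _ hu hg) (Subgroup.inv_mem _ hu)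
  have h2 := InCong.conj_jUnits D h1 e
  rwa [show D.jUnits e * u * g * (D.jUnits e * u)⁻¹ =
    D.jUnits e * (u * g * u⁻¹) * (D.jUnits e)⁻¹ by group]

lemma QuatModel.conj_mem_grpW {hm : 1 ≤ m} {u g : Rˣ} (hu : u ∈ D.grpV m hm) (hg : g ∈ D.grpW m hm)
    (e : Eˣ) : D.jUnits e * u * g * (D.jUnits e * u)⁻¹ ∈ D.grpW m hm := by
  have hf := D.depth_facts m
  have h0 := D.inCong_commutator hm (InCong.anti D hu (by omega) le_rfl)
    (InCong.anti D hg (by omega) le_rfl)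
  have h1 : u * g * u⁻¹ ∈ D.grpW m hm := by
    have := InCong.mul D (by omega) (by omega)
      (h0.anti D (a' := m) (by omega) le_rfl) hg
    rw [← Units.val_mul, inv_mul_cancel_right] at this
    exact this
  have h2 := InCong.conj_jUnits D h1 e
  rwa [show D.jUnits e * u * g * (D.jUnits e * u)⁻¹ =
    D.jUnits e * (u * g * u⁻¹) * (D.jUnits e)⁻¹ by group]

instance {hm : 1 ≤ m} : (subV D D' m hm).Normal := ⟨by
  rintro g hg ⟨_, e, l, hl, rfl⟩
  exact ⟨D.conj_mem_grpV hl.1 hg.1 e, D'.conj_mem_grpV hl.2 hg.2 e⟩⟩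

instance {hm : 1 ≤ m} : (subW D D' m hm).Normal := ⟨by
  rintro g hg ⟨_, e, l, hl, rfl⟩
  exact ⟨D.conj_mem_grpW hl.1 hg.1 e, D'.conj_mem_grpW hl.2 hg.2 e⟩⟩

variable (D) in
/-- Cosets of `1 + W` in `1 + V` are distinguished by the second coordinate. -/
lemma QuatModel.inv_mul_mem_grpW {hm : 1 ≤ m} {u v : Rˣ} (hu : u ∈ D.grpV m hm)
    (hv : v ∈ D.grpV m hm) : u⁻¹ * v ∈ D.grpW m hm ↔ D.Y u - D.Y v ∈ pPow E (D.bH m) := by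
  have hf := D.depth_facts m
  have key : ∀ {g w : Rˣ}, g ∈ D.grpV m hm → w ∈ D.grpV m hm →
      D.Y ((g * w : Rˣ) : R) - D.Y g - D.Y w ∈ pPow E (D.bH m) := by
    intro g w hg hw
    have e : D.Y ((g * w : Rˣ) : R) - D.Y g - D.Y w =
        (D.X g - 1) * D.Y w + D.Y g * conj F E (D.X w - 1) := by
      rw [Units.val_mul, D.Y_mul, map_sub, map_one]; ring
    rw [e]
    exact add_mem_pPow (pPow_anti (by omega) (mul_mem_pPow hg.1 hw.2))
      (pPow_anti (by omega) (mul_mem_pPow hg.2 (conj_mem_pPow hw.1)))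
  have hz : u⁻¹ * v ∈ D.grpV m hm := Subgroup.mul_mem _ (Subgroup.inv_mem _ hu) hv
  have h1 := key hu hz
  rw [mul_inv_cancel_left] at h1
  have e : D.Y u - D.Y v = -(D.Y v - D.Y u - D.Y ((u⁻¹ * v : Rˣ) : R)) -
      D.Y ((u⁻¹ * v : Rˣ) : R) := by ring
  have e' : D.Y ((u⁻¹ * v : Rˣ) : R) = -(D.Y v - D.Y u - D.Y ((u⁻¹ * v : Rˣ) : R)) -
      (D.Y u - D.Y v) := by ring
  constructor
  · intro h
    rw [e]
    exact sub_mem_pPow (neg_mem_pPow h1) h.2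
  · intro h
    refine ⟨hz.1, ?_⟩
    rw [e']
    exact sub_mem_pPow (neg_mem_pPow h1) h

/-- If cosets of `N` are distinguished by a coordinate in `𝔭_E ^ b` modulo `𝔭_E ^ (b + 1)`, then there are as
many of them as elements of the residue field. -/
lemma nonempty_equiv_residue {Q : Type*} [Group Q] (N : Subgroup Q) (y : Q → E) (b : ℤ)
    (h1 : ∀ l, y l ∈ pPow E b) (h2 : ∀ l l', l⁻¹ * l' ∈ N ↔ y l - y l' ∈ pPow E (b + 1))
    (h3 : ∀ z ∈ pPow E b, ∃ l, y l = z) : Nonempty (Q ⧸ N ≃ 𝓀[E]) := by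
  obtain ⟨ϖ, hϖ0, hϖ⟩ := exists_ord_eq (K := E) b
  have hmem : ∀ l, y l * ϖ⁻¹ ∈ 𝒪[E] := fun l => mem_integer_iff.2
    (mem_pPow_of_eq (mul_mem_pPow (h1 l) (inv_mem_pPow hϖ0)) (by rw [hϖ]; ring))
  let f : Q → 𝓀[E] := fun l => IsLocalRing.residue 𝒪[E] ⟨_, hmem l⟩
  have hf : ∀ l l', f l = f l' ↔ l⁻¹ * l' ∈ N := by
    intro l l'
    rw [residue_eq_iff, h2]
    have e : y l * ϖ⁻¹ - y l' * ϖ⁻¹ = (y l - y l') * ϖ⁻¹ := by ring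
    change y l * ϖ⁻¹ - y l' * ϖ⁻¹ ∈ _ ↔ _
    rw [e]
    constructor
    · intro h
      have := mul_mem_pPow h (mem_pPow_self (x := ϖ))
      rw [inv_mul_cancel_right₀ hϖ0, hϖ] at this
      exact mem_pPow_of_eq this (by ring)
    · intro h
      exact mem_pPow_of_eq (mul_mem_pPow h (inv_mem_pPow hϖ0)) (by rw [hϖ]; ring)
  refine ⟨Equiv.ofBijective (Quotient.lift f fun a b hab =>
    (hf a b).2 (QuotientGroup.leftRel_apply.1 hab)) ⟨?_, ?_⟩⟩
  · intro a b
    induction a using Quotient.inductionOn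
    induction b using Quotient.inductionOn
    intro h
    exact QuotientGroup.eq.2 ((hf _ _).1 h)
  · intro r
    obtain ⟨x, rfl⟩ := IsLocalRing.residue_surjective r
    obtain ⟨l, hl⟩ := h3 ((x : E) * ϖ) (mem_pPow_of_eq
      (mul_mem_pPow (mem_integer_iff.1 x.2) (mem_pPow_self (x := ϖ))) (by rw [hϖ]; ring))
    refine ⟨QuotientGroup.mk l, ?_⟩
    change f l = _
    simp only [f]
    congr 1
    apply Subtype.ext
    change y l * ϖ⁻¹ = x
    rw [hl, mul_inv_cancel_right₀ hϖ0]

/-- The valuations `κ` are those of `M₂(F)` for `D`, and of the quaternion division algebra for `D'`. -/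
structure IsModelPair (D : QuatModel F E R) (D' : QuatModel F E R') : Prop where
  split : D.κ = 0
  ramified : ¬ Unramified F E → D'.κ = 0
  unramified : Unramified F E → D'.κ = 1

/-- The group `(1 + V) / (1 + W)`, as a quotient of subgroups of `𝒦`. -/
abbrev quotVW (D : QuatModel F E R) (D' : QuatModel F E R') (m : ℕ) (hm : 1 ≤ m) : Type _ :=
  subV D D' m hm ⧸ (subW D D' m hm).subgroupOf (subV D D' m hm)

/-- For unramified `E / F` the groups `1 + V` and `1 + W` differ in exactly one of the two factors, and
their quotient is in bijection with the residue field of `E`. -/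
lemma nonempty_quotient_equiv {hm : 1 ≤ m} (hκ : IsModelPair D D') (hu : Unramified F E) :
    Nonempty (quotVW D D' m hm ≃ 𝓀[E]) := by
  have hs := hκ.split
  have hs' := hκ.unramified hu
  have hf := D.depth_facts m
  have hf' := D'.depth_facts m
  have hcases : (D.bH m = D.bJ m + 1 ∧ D'.bH m = D'.bJ m) ∨
      (D.bH m = D.bJ m ∧ D'.bH m = D'.bJ m + 1) := by
    unfold QuatModel.bH QuatModel.bJ
    rw [hs, hs']
    omega
  have hW : ∀ l l' : subV D D' m hm, l⁻¹ * l' ∈ (subW D D' m hm).subgroupOf (subV D D' m hm) ↔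
      D.Y ((l : grpK D D' m hm).1.1 : Rˣ) - D.Y ((l' : grpK D D' m hm).1.1 : Rˣ) ∈
        pPow E (D.bH m) ∧
      D'.Y ((l : grpK D D' m hm).1.2 : R'ˣ) - D'.Y ((l' : grpK D D' m hm).1.2 : R'ˣ) ∈
        pPow E (D'.bH m) := by
    intro l l'
    exact and_congr (D.inv_mul_mem_grpW l.2.1 l'.2.1) (D'.inv_mul_mem_grpW l.2.2 l'.2.2)
  rcases hcases with ⟨h, h'⟩ | ⟨h, h'⟩
  · refine nonempty_equiv_residue _ (fun l => D.Y ((l : grpK D D' m hm).1.1 : Rˣ)) (D.bJ m)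
      (fun l => l.2.1.2) (fun l l' => ?_) fun z hz => ?_
    · rw [hW, h]
      exact and_iff_left (h' ▸ sub_mem_pPow l.2.2.2 l'.2.2.2)
    · obtain ⟨u, hu, -, hu'⟩ := D.exists_unit_Y_eq hm hz
      exact ⟨⟨⟨(u, 1), mem_grpK_of_mem ⟨hu, Subgroup.one_mem _⟩⟩, hu, Subgroup.one_mem _⟩, hu'⟩
  · refine nonempty_equiv_residue _ (fun l => D'.Y ((l : grpK D D' m hm).1.2 : R'ˣ)) (D'.bJ m)
      (fun l => l.2.2.2) (fun l l' => ?_) fun z hz => ?_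
    · rw [hW, h']
      exact and_iff_right (h ▸ sub_mem_pPow l.2.1.2 l'.2.1.2)
    · obtain ⟨u, hu, -, hu'⟩ := D'.exists_unit_Y_eq hm hz
      exact ⟨⟨⟨(1, u), mem_grpK_of_mem ⟨Subgroup.one_mem _, hu⟩⟩, Subgroup.one_mem _, hu⟩, hu'⟩

lemma finite_quotVW {hm : 1 ≤ m} (hκ : IsModelPair D D') (hu : Unramified F E) :
    Finite (quotVW D D' m hm) :=
  let ⟨e⟩ := nonempty_quotient_equiv hκ hu
  Finite.of_equiv _ e.symm

end GroupK

/-! ### The representation `τ_α` -/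

section Tau

variable {R : Type*} [Ring R] [Algebra F R] {D : QuatModel F E R}
variable {R' : Type*} [Ring R'] [Algebra F R'] {D' : QuatModel F E R'}
variable {hm : 1 ≤ m}
variable {W W₁ W₂ : Type*} [AddCommGroup W] [Module Ω W] [AddCommGroup W₁] [Module Ω W₁]
  [AddCommGroup W₂] [Module Ω W₂]

open QuatModel

variable (D D') in
/-- The diagonal embedding of `Eˣ` in `𝒦`. -/
def diagK (m : ℕ) (hm : 1 ≤ m) : Eˣ →* grpK D D' m hm :=
  (diagUnits D D').codRestrict _ (diagUnits_mem_grpK hm)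

/-- The function `1 + w ↦ ψ_E (α (s_A(w_A) - s_B(w_B)))` on `𝒦`. -/
noncomputable def psiK (ψ : AddChar F Ω) (α : E) (k : grpK D D' m hm) : Ω :=
  ψ (Algebra.trace F E (α * ((D.X (k.1.1 : Rˣ) - 1) - (D'.X (k.1.2 : R'ˣ) - 1))))

/-- The defining properties of `τ_α`, in the coordinates of two quaternion algebras. -/
structure IsTauModel (ψ : AddChar F Ω) (α : E) (τ : Representation Ω (grpK D D' m hm) W) :
    Prop where
  irreducible : τ.IsIrreducible
  trivial : ∀ e : Eˣ, ((e : E) ∈ Set.range (algebraMap F E) ∨ (e : E) - 1 ∈ pPow E 1) →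
    τ (diagK D D' m hm e) = 1
  one_add : ∀ k ∈ subW D D' m hm, τ k = psiK ψ α k • 1
  ramified : ¬ Unramified F E → ∀ e : Eˣ,
    τ (diagK D D' m hm e) = ((-1 : Ω) ^ ord (e : E)) • 1
  unramified : Unramified F E → ∀ ζ : Eˣ, IsRootOutside F E ζ →
    LinearMap.trace Ω W (τ (diagK D D' m hm ζ)) = -1

lemma exists_eq_mul_diagK (k : grpK D D' m hm) :
    ∃ l ∈ subV D D' m hm, ∃ e : Eˣ, k = l * diagK D D' m hm e := by
  obtain ⟨e, l, hl, hk⟩ := k.2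
  set l' : grpK D D' m hm := ⟨l, mem_grpK_of_mem hl⟩ with hl'
  have hmem : l' ∈ subV D D' m hm := hl
  have hk' : k = diagK D D' m hm e * l' := Subtype.ext hk
  refine ⟨diagK D D' m hm e * l' * (diagK D D' m hm e)⁻¹,
    Subgroup.Normal.conj_mem inferInstance _ hmem _, e, ?_⟩
  rw [inv_mul_cancel_right, hk']

lemma subV_eq_subW (h : D.bH m = D.bJ m) (h' : D'.bH m = D'.bJ m) {k : grpK D D' m hm}
    (hk : k ∈ subV D D' m hm) : k ∈ subW D D' m hm := by
  have h1 := hk.1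
  have h2 := hk.2
  exact ⟨by change D.InCong m (D.bH m) _; rw [h]; exact h1,
    by change D'.InCong m (D'.bH m) _; rw [h']; exact h2⟩

lemma depth_of_ramified (hα : IsMinimalElt F m α) (hr : ¬ Unramified F E) (hκ : D.κ = 0) :
    D.bH m = D.bJ m := by
  obtain ⟨k, hk⟩ := hα.odd_of_ramified hr
  unfold QuatModel.bH QuatModel.bJ
  omega

lemma exists_decomp_grpK (hu : Unramified F E) (k : grpK D D' m hm) :
    ∃ l ∈ subV D D' m hm, ∃ (a : Fˣ) (u z : Eˣ), (u : E) - 1 ∈ pPow E 1 ∧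
      z ^ (Nat.card 𝓀[E] - 1) = 1 ∧
      k = l * diagK D D' m hm (Units.map (algebraMap F E : F →* E) a * u) * diagK D D' m hm z := by
  obtain ⟨l, hl, e, rfl⟩ := exists_eq_mul_diagK k
  obtain ⟨a, u, z, hu, hz, rfl⟩ := exists_decomp_unit hu e
  exact ⟨l, hl, a, u, z, hu, hz, by rw [map_mul (diagK D D' m hm) _ z, mul_assoc]⟩

variable {τ : Representation Ω (grpK D D' m hm) W}

lemma IsTauModel.trivial_mul (h : IsTauModel ψ α τ) (a : Fˣ) {u : Eˣ} (hu : (u : E) - 1 ∈ pPow E 1) :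
    τ (diagK D D' m hm (Units.map (algebraMap F E : F →* E) a * u)) = 1 := by
  rw [map_mul, map_mul, h.trivial _ (.inl ⟨a, rfl⟩), h.trivial u (.inr hu), mul_one]

lemma IsTauModel.exists_eq_smul (h : IsTauModel ψ α τ) (hα : IsMinimalElt F m α)
    (hr : ¬ Unramified F E) (hκ : IsModelPair D D') (k : grpK D D' m hm) :
    ∃ c : Ω, τ k = c • 1 := by
  obtain ⟨l, hl, e, rfl⟩ := exists_eq_mul_diagK k
  have hl' := subV_eq_subW (depth_of_ramified hα hr hκ.split)
    (depth_of_ramified hα hr (hκ.ramified hr)) hl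
  rw [map_mul, h.one_add l hl', h.ramified hr]
  exact ⟨_, by rw [smul_mul_smul_comm, mul_one]⟩

variable [IsAlgClosed Ω]

/-- `𝒦` is finite modulo elements that act by scalars. -/
lemma IsTauModel.finiteDimensional (h : IsTauModel ψ α τ) (hα : IsMinimalElt F m α)
    (hκ : IsModelPair D D') :
    FiniteDimensional Ω W := by
  by_cases hu : Unramified F E
  · have := finite_quotVW (hm := hm) hκ hu
    have hne : NeZero (Nat.card 𝓀[E] - 1) := ⟨natCard_sub_one_ne_zero⟩
    have hroots : Finite (rootsOfUnity (Nat.card 𝓀[E] - 1) E) := inferInstance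
    refine finiteDimensional_of_irreducible h.irreducible 1 (fun g => by rw [one_mul, mul_one])
      (Set.image2 (fun q z => (q.out : grpK D D' m hm) * diagK D D' m hm z)
        (Set.univ : Set (quotVW D D' m hm)) {z | z ∈ rootsOfUnity (Nat.card 𝓀[E] - 1) E})
      (Set.finite_univ.image2 _ hroots) fun k => ?_
    obtain ⟨l, hl, a, u, z, hu, hz, rfl⟩ := exists_decomp_grpK hu k
    set q : quotVW D D' m hm := QuotientGroup.mk ⟨l, hl⟩
    set n : grpK D D' m hm := ((q.out : subV D D' m hm) : grpK D D' m hm)⁻¹ * l with hn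
    have hnW : n ∈ subW D D' m hm :=
      (QuotientGroup.eq (s := (subW D D' m hm).subgroupOf (subV D D' m hm))
        (a := q.out) (b := ⟨l, hl⟩)).1 (QuotientGroup.out_eq' q)
    have hl' : l = (q.out : subV D D' m hm) * n := by rw [hn, mul_inv_cancel_left]
    have hcomm : ∀ x y : Eˣ, diagK D D' m hm x * diagK D D' m hm y =
        diagK D D' m hm y * diagK D D' m hm x := fun x y => by rw [← map_mul, mul_comm, map_mul]
    set b := diagK D D' m hm (Units.map (algebraMap F E : F →* E) a * u) with hb
    have hb1 : τ b = 1 := h.trivial_mul a hu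
    have h1 := h.one_add _ (Subgroup.Normal.conj_mem inferInstance n hnW (diagK D D' m hm z)⁻¹)
    rw [inv_inv] at h1
    refine ⟨0, _, ⟨q, Set.mem_univ _, z, (mem_rootsOfUnity _ _).2 hz, rfl⟩,
      (diagK D D' m hm z)⁻¹ * n * diagK D D' m hm z * b,
      ⟨psiK ψ α ((diagK D D' m hm z)⁻¹ * n * diagK D D' m hm z), fun v => ?_⟩, ?_⟩
    · rw [map_mul, h1, hb1, mul_one]
      rfl
    · rw [hl', mul_assoc, hcomm _ z, ← hb, zpow_zero, one_mul]
      simp only [mul_assoc, mul_inv_cancel_left]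
  · exact finiteDimensional_of_irreducible h.irreducible 1 (fun g => by rw [one_mul, mul_one]) {1}
      (Set.finite_singleton _) fun k => ⟨0, 1, rfl, k, by
        obtain ⟨c, hc⟩ := h.exists_eq_smul hα hu hκ k
        exact ⟨c, fun v => by rw [hc]; rfl⟩, by group⟩

/-- For unramified `E / F`, the restriction of `τ_α` to `1 + V` is a Heisenberg representation. -/
lemma IsTauModel.isHeisenberg (h : IsTauModel ψ α τ) (hψ : IsLevelZero F ψ)
    (hα : IsMinimalElt F m α) (hfin : FiniteDimensional Ω W) :
    IsHeisenberg (subV D D' m hm) (subW D D' m hm) (psiK ψ α) τ where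
  irreducible := h.irreducible
  finite := hfin
  scalar := h.one_add
  pairing := by
    intro l hl hlW
    have hor : D.Y (l.1.1 : Rˣ) ∉ pPow E (D.bH m) ∨ D'.Y (l.1.2 : R'ˣ) ∉ pPow E (D'.bH m) := by
      by_contra! hcon
      exact hlW ⟨⟨hl.1.1, hcon.1⟩, ⟨hl.2.1, hcon.2⟩⟩
    rcases hor with hY | hY
    · obtain ⟨v, hv, hvW, hne⟩ := D.exists_pairing_ne_one hψ hm hα hl.1 hY
      have h2 : (1 : R'ˣ) * l.1.2 * 1⁻¹ * l.1.2⁻¹ = 1 := by group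
      set l' : grpK D D' m hm := ⟨(v, 1), mem_grpK_of_mem ⟨hv, Subgroup.one_mem _⟩⟩
      refine ⟨l', _, ?_, h.one_add (l' * l * l'⁻¹ * l⁻¹) ⟨hvW, ?_⟩⟩
      · change ψ (Algebra.trace F E (α * ((D.X ((v * l.1.1 * v⁻¹ * l.1.1⁻¹ : Rˣ) : R) - 1) -
          (D'.X ((1 * l.1.2 * 1⁻¹ * l.1.2⁻¹ : R'ˣ) : R') - 1)))) ≠ 1
        rwa [h2, Units.val_one, X_one, sub_self, sub_zero]
      · exact (congrArg (· ∈ D'.grpW m hm) h2).mpr (Subgroup.one_mem _)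
    · obtain ⟨v, hv, hvW, hne⟩ := D'.exists_pairing_ne_one hψ.inv hm hα hl.2 hY
      have h2 : (1 : Rˣ) * l.1.1 * 1⁻¹ * l.1.1⁻¹ = 1 := by group
      set l' : grpK D D' m hm := ⟨(1, v), mem_grpK_of_mem ⟨Subgroup.one_mem _, hv⟩⟩
      refine ⟨l', _, ?_, h.one_add (l' * l * l'⁻¹ * l⁻¹) ⟨?_, hvW⟩⟩
      · change ψ (Algebra.trace F E (α * ((D.X ((1 * l.1.1 * 1⁻¹ * l.1.1⁻¹ : Rˣ) : R) - 1) -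
          (D'.X ((v * l.1.2 * v⁻¹ * l.1.2⁻¹ : R'ˣ) : R') - 1)))) ≠ 1
        rwa [h2, Units.val_one, X_one, sub_self, zero_sub, mul_neg, map_neg, ← AddChar.inv_apply]
      · exact (congrArg (· ∈ D.grpW m hm) h2).mpr (Subgroup.one_mem _)

lemma diagK_commute (k : grpK D D' m hm) (ζ : Eˣ) : ∃ l ∈ subV D D' m hm, ∃ k',
    diagK D D' m hm ζ * k' = k' * diagK D D' m hm ζ ∧ k = l * k' := by
  obtain ⟨l, hl, e, rfl⟩ := exists_eq_mul_diagK k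
  exact ⟨l, hl, _, by rw [← map_mul, mul_comm, map_mul], rfl⟩

/-- Conjugation by `ζ` multiplies the second coordinate by `ζ / σ ζ`, which is not `1` modulo `𝔭_E`. -/
lemma QuatModel.mem_grpW_of_commutator {ζ : Eˣ} (hζ : IsRootOutside F E ζ) {u : Rˣ}
    (hu : u ∈ D.grpV m hm) (hW : D.jUnits ζ * u * (D.jUnits ζ)⁻¹ * u⁻¹ ∈ D.grpW m hm) :
    u ∈ D.grpW m hm := by
  refine ⟨hu.1, ?_⟩
  have hcj : D.jUnits ζ * u * (D.jUnits ζ)⁻¹ ∈ D.grpV m hm := InCong.conj_jUnits D hu ζ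
  have hW' : u⁻¹ * (D.jUnits ζ * u * (D.jUnits ζ)⁻¹) ∈ D.grpW m hm := by
    have := D.conj_mem_grpW (Subgroup.inv_mem _ hu) hW 1
    rw [map_one, one_mul, inv_inv] at this
    rwa [show u⁻¹ * (D.jUnits ζ * u * (D.jUnits ζ)⁻¹ * u⁻¹) * u =
      u⁻¹ * (D.jUnits ζ * u * (D.jUnits ζ)⁻¹) by group] at this
  rw [D.inv_mul_mem_grpW hu hcj, ← map_inv, Units.val_mul, Units.val_mul, coe_jUnits, coe_jUnits,
    Y_mul_j, Y_j_mul, Units.val_inv_eq_inv_val, map_inv₀] at hW'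
  have hc0 : conj F E (ζ : E) ≠ 0 := hom_ne_zero ζ.ne_zero
  by_cases hY : D.Y (u : R) = 0
  · rw [hY]; exact zero_mem_pPow _
  have hs0 : (ζ : E) - conj F E ζ ≠ 0 := fun h0 => hζ.sub_conj_not_mem (h0 ▸ zero_mem_pPow _)
  have hs : ord ((ζ : E) - conj F E ζ) ≤ 0 := by
    have := hζ.sub_conj_not_mem
    rw [mem_pPow hs0] at this
    omega
  have e : D.Y (u : R) - (conj F E (ζ : E))⁻¹ * (ζ * D.Y (u : R)) =
      -((ζ - conj F E ζ) * (conj F E (ζ : E))⁻¹ * D.Y (u : R)) := by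
    field_simp; ring
  rw [e] at hW'
  have h1 := neg_mem_pPow hW'
  rw [neg_neg, mem_pPow (mul_ne_zero (mul_ne_zero hs0 (inv_ne_zero hc0)) hY),
    ord_mul (mul_ne_zero hs0 (inv_ne_zero hc0)) hY, ord_mul hs0 (inv_ne_zero hc0), ord_inv hc0,
    ord_conj, hζ.ord_eq] at h1
  rw [mem_pPow hY]
  omega

/-- Roots of unity outside `F` act on `(1 + V) / (1 + W)` without fixed points. -/
lemma mem_subW_of_commutator {ζ : Eˣ} (hζ : IsRootOutside F E ζ) {l : grpK D D' m hm}
    (hl : l ∈ subV D D' m hm)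
    (h : diagK D D' m hm ζ * l * (diagK D D' m hm ζ)⁻¹ * l⁻¹ ∈ subW D D' m hm) :
    l ∈ subW D D' m hm :=
  ⟨mem_grpW_of_commutator hζ hl.1 h.1, mem_grpW_of_commutator hζ hl.2 h.2⟩

variable [CharZero Ω]

/-- `τ_α` is characterised by its properties: between two such representations there is a nonzero
homomorphism. -/
lemma IsTauModel.exists_hom {τ₁ : Representation Ω (grpK D D' m hm) W₁}
    {τ₂ : Representation Ω (grpK D D' m hm) W₂} (h₁ : IsTauModel ψ α τ₁) (h₂ : IsTauModel ψ α τ₂)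
    (hψ : IsLevelZero F ψ) (hα : IsMinimalElt F m α)
    (hκ : IsModelPair D D') :
    ∃ f : W₁ →ₗ[Ω] W₂, f ≠ 0 ∧ ∀ k w, f (τ₁ k w) = τ₂ k (f w) := by
  have hf₁ := h₁.finiteDimensional hα hκ
  have hf₂ := h₂.finiteDimensional hα hκ
  by_cases hu : Unramified F E
  · have := finite_quotVW (hm := hm) hκ hu
    refine exists_hom_of_isHeisenberg (h₁.isHeisenberg hψ hα hf₁) (h₂.isHeisenberg hψ hα hf₂)
      (diagK D D' m hm '' {ζ | IsRootOutside F E ζ}) ?_ ?_ ?_ ?_ ?_ fun k => ?_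
    · rintro _ ⟨ζ, -, rfl⟩ k; exact diagK_commute k ζ
    · rintro _ ⟨ζ, hζ, rfl⟩ l hl h; exact mem_subW_of_commutator hζ hl h
    · rintro _ ⟨ζ, hζ, rfl⟩; exact ⟨ζ⁻¹, hζ.inv, map_inv _ _⟩
    · rintro _ ⟨ζ, hζ, rfl⟩; exact h₁.unramified hu ζ hζ
    · rintro _ ⟨ζ, hζ, rfl⟩; exact h₂.unramified hu ζ hζ
    · obtain ⟨l, hl, a, u, z, hu, hz, rfl⟩ := exists_decomp_grpK hu k
      by_cases hzF : (z : E) ∈ Set.range (algebraMap F E)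
      · refine ⟨l, hl, _, ?_, ?_, .inl (mul_assoc _ _ _)⟩
        · rw [map_mul, h₁.trivial_mul a hu, h₁.trivial z (.inl hzF), mul_one]
        · rw [map_mul, h₂.trivial_mul a hu, h₂.trivial z (.inl hzF), mul_one]
      · exact ⟨l, hl, _, h₁.trivial_mul a hu, h₂.trivial_mul a hu, .inr ⟨_, ⟨z, ⟨hz, hzF⟩, rfl⟩, rfl⟩⟩
  · have hn₁ := ((isIrreducible_iff _).1 h₁.irreducible).1
    have hn₂ := ((isIrreducible_iff _).1 h₂.irreducible).1
    obtain ⟨f, hf⟩ := exists_ne (0 : W₁ →ₗ[Ω] W₂)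
    refine ⟨f, hf, fun k w => ?_⟩
    obtain ⟨l, hl, e, rfl⟩ := exists_eq_mul_diagK k
    have hl' := subV_eq_subW (depth_of_ramified hα hu hκ.split)
      (depth_of_ramified hα hu (hκ.ramified hu)) hl
    rw [map_mul, map_mul, h₁.one_add l hl', h₁.ramified hu, h₂.one_add l hl', h₂.ramified hu]
    simp

/-- The dimension of `τ_α` in the unramified case. -/
lemma IsTauModel.finrank_eq (h : IsTauModel ψ α τ) (hψ : IsLevelZero F ψ)
    (hα : IsMinimalElt F m α) (hκ : IsModelPair D D') (hu : Unramified F E) :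
    Module.finrank Ω W = Nat.card 𝓀[F] := by
  have hf := h.finiteDimensional hα hκ
  have := finite_quotVW (hm := hm) hκ hu
  obtain ⟨eq⟩ := nonempty_quotient_equiv (hm := hm) hκ hu
  obtain ⟨ζ, hζ⟩ := exists_isRootOutside (F := F) (E := E) hu
  have h1 := (h.isHeisenberg hψ hα hf).finrank_sq (ζ := diagK D D' m hm ζ)
    (fun k => diagK_commute k ζ) (fun l hl h => mem_subW_of_commutator hζ hl h)
  rw [h.unramified hu ζ hζ, ← map_inv, h.unramified hu _ hζ.inv, ← Nat.card_eq_fintype_card,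
    Nat.card_congr eq, natCard_residue_unramified (F := F) hu] at h1
  push_cast at h1
  refine Nat.mul_self_inj.1 ?_
  have h2 : (Module.finrank Ω W : Ω) * Module.finrank Ω W = Nat.card 𝓀[F] * Nat.card 𝓀[F] := by
    rw [h1]; ring
  exact_mod_cast h2

/-- `τ_α` is a character in the ramified case. -/
lemma IsTauModel.finrank_eq_one (h : IsTauModel ψ α τ) (hα : IsMinimalElt F m α)
    (hr : ¬ Unramified F E) (hκ : IsModelPair D D') : Module.finrank Ω W = 1 :=
  finrank_eq_one_of_smul h.irreducible (h.exists_eq_smul hα hr hκ)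

end Tau

/-! ### The representations `Λ_χ` -/

section Lambda

variable (E) in
/-- The group `U_E ^ n`, for `n ≥ 1`. -/
def oneUnits (n : ℕ) (hn : 1 ≤ n) : Subgroup Eˣ where
  carrier := {u | (u : E) - 1 ∈ pPow E n}
  one_mem' := by simp [zero_mem_pPow]
  mul_mem' := fun {a b} ha hb => by
    rw [Set.mem_ofPred_eq, Units.val_mul]
    exact mul_sub_one_mem (by omega) ha hb
  inv_mem' := fun {a} ha => by
    rw [Set.mem_ofPred_eq, Units.val_inv_eq_inv_val]
    exact inv_sub_one_mem (by exact_mod_cast hn) ha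

instance {n n' : ℕ} {hn : 1 ≤ n} {hn' : 1 ≤ n'} :
    Finite (oneUnits E n hn ⧸ (oneUnits E n' hn').subgroupOf (oneUnits E n hn)) := by
  obtain ⟨S, hS⟩ := exists_finset_pPow (K := E) n n'
  choose f hf hf' using hS
  refine Finite.of_injective (β := S) (fun q => ⟨f _ q.out.2, hf _ q.out.2⟩) fun q q' h => ?_
  have h0 : f _ q.out.2 = f _ q'.out.2 := congrArg Subtype.val h
  have h1 := sub_mem_pPow (hf' _ q'.out.2) (hf' _ q.out.2)
  rw [← h0, sub_sub_sub_cancel_right, sub_sub_sub_cancel_right] at h1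
  rw [← QuotientGroup.out_eq' q, ← QuotientGroup.out_eq' q']
  refine QuotientGroup.eq.2 ?_
  change (((q.out : Eˣ)⁻¹ * (q'.out : Eˣ) : Eˣ) : E) - 1 ∈ pPow E n'
  have ho := (ne_zero_and_ord_eq_zero (u := ((q.out : Eˣ) : E)) (pPow_anti (by omega) q.out.2)).2
  have e : (((q.out : Eˣ)⁻¹ * (q'.out : Eˣ) : Eˣ) : E) - 1 =
      ((q'.out : Eˣ) - (q.out : Eˣ)) * ((q.out : Eˣ) : E)⁻¹ := by
    rw [Units.val_mul, Units.val_inv_eq_inv_val, sub_mul, mul_inv_cancel₀ (Units.ne_zero _),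
      mul_comm]
  rw [e]
  exact mem_pPow_of_eq (mul_mem_pPow h1 (inv_mem_pPow (Units.ne_zero _))) (by rw [ho]; ring)

/-- A character of `Eˣ` that is trivial on `U_E ^ (m + 1)` is of the form `1 + x ↦ ψ_E (β x)` on
`U_E ^ n`, if `2 n ≥ m + 1`. -/
lemma exists_givenByOn [IsAlgClosed Ω] [CharZero Ω] (hψ : IsLevelZero F ψ) {n : ℕ} (hn : 1 ≤ n)
    (hnm : m + 1 ≤ 2 * n) (χ : Eˣ →* Ωˣ) (hχ : ∀ u : Eˣ, (u : E) - 1 ∈ pPow E (m + 1) → χ u = 1) :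
    ∃ β : E, GivenByOn ψ β n χ := by
  -- `S` is the group of the characters `1 + x ↦ ψ_E (β x)`; since it separates points modulo
  -- `U_E ^ (m + 1)`, it contains all characters of the quotient
  let S : Subgroup (oneUnits E n hn →* Ωˣ) :=
    { carrier := {s | ∃ β ∈ pPow E (-m), ∀ u : oneUnits E n hn,
        (s u : Ω) = ψ (Algebra.trace F E (β * ((u : Eˣ) - 1)))}
      one_mem' := ⟨0, zero_mem_pPow _, fun u => by simp⟩
      mul_mem' := by
        rintro s t ⟨β, hβ, hs⟩ ⟨γ, hγ, ht⟩
        exact ⟨β + γ, add_mem_pPow hβ hγ, fun u => by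
          rw [MonoidHom.mul_apply, Units.val_mul, hs, ht, ← AddChar.map_add_eq_mul, ← map_add,
            ← add_mul]⟩
      inv_mem' := by
        rintro s ⟨β, hβ, hs⟩
        exact ⟨-β, neg_mem_pPow hβ, fun u => by
          rw [MonoidHom.inv_apply, Units.val_inv_eq_inv_val, hs, neg_mul, map_neg,
            AddChar.map_neg_eq_inv]⟩ }
  have hmul (β : E) (hβ : β ∈ pPow E (-m)) (u v : oneUnits E n hn) :
      ψ (Algebra.trace F E (β * (((u * v : oneUnits E n hn) : Eˣ) - 1))) =
        ψ (Algebra.trace F E (β * ((u : Eˣ) - 1))) * ψ (Algebra.trace F E (β * ((v : Eˣ) - 1))) := by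
    have h1 := QuatModel.psi_eq_one hψ hβ (pPow_anti (by omega) (mul_mem_pPow u.2 v.2) :
      (((u : Eˣ) : E) - 1) * ((v : Eˣ) - 1) ∈ pPow E (m + 1))
    rw [← one_mul (ψ _ * ψ _), ← h1, ← AddChar.map_add_eq_mul, ← AddChar.map_add_eq_mul,
      ← map_add, ← map_add]
    congr 2
    push_cast
    ring
  have hmem : χ.comp (oneUnits E n hn).subtype ∈ S := by
    refine mem_of_separates ((oneUnits E (m + 1) (by omega)).subgroupOf (oneUnits E n hn)) S ?_ ?_ ?_
    · intro u hu
      by_contra hcon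
      have hcon' : ((u : Eˣ) : E) - 1 ∉ pPow E (1 - (-m : ℤ)) := fun h =>
        hcon (mem_pPow_of_eq h (by push_cast; ring))
      obtain ⟨β, hβ, hne⟩ := exists_char_ne_one hψ hcon'
      let s : oneUnits E n hn →* Ω :=
        { toFun := fun u => ψ (Algebra.trace F E (β * ((u : Eˣ) - 1)))
          map_one' := by simp
          map_mul' := hmul β hβ }
      have h1 := hu s.toHomUnits ⟨β, hβ, fun u => rfl⟩
      rw [mul_comm] at hne
      exact hne (congrArg Units.val h1)
    · rintro s ⟨β, hβ, hs⟩ u hu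
      refine Units.ext ?_
      rw [hs, Units.val_one]
      exact QuatModel.psi_eq_one hψ hβ (mem_pPow_of_eq hu (by push_cast; ring))
    · intro u hu
      exact hχ _ (mem_pPow_of_eq hu (by push_cast; ring))
  obtain ⟨β, -, h⟩ := hmem
  exact ⟨β, fun u hu => h ⟨u, hu⟩⟩

namespace QuatModel

variable {R : Type*} [Ring R] [Algebra F R] (D : QuatModel F E R)
variable {hm : 1 ≤ m}
variable {M M' : Type*} [AddCommGroup M] [Module Ω M] [AddCommGroup M'] [Module Ω M']

variable (F E Ω) in
open Classical in
/-- The character `e ↦ (-1) ^ (f v_E(e))`, where `f` is the residue degree of `E / F`. -/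
noncomputable def sgn : Eˣ →* Ωˣ where
  toFun e := if Unramified F E then 1 else (-1) ^ ord (e : E)
  map_one' := by simp [ord_one]
  map_mul' x y := by
    split_ifs
    · rw [mul_one]
    · rw [Units.val_mul, ord_mul x.ne_zero y.ne_zero, zpow_add]

lemma sgn_of_unramified (hu : Unramified F E) (e : Eˣ) : sgn F E Ω e = 1 := if_pos hu

lemma sgn_of_ramified (hr : ¬ Unramified F E) (e : Eˣ) :
    (sgn F E Ω e : Ω) = (-1) ^ ord (e : E) := by
  rw [show sgn F E Ω e = (-1) ^ ord (e : E) from if_neg hr, Units.val_zpow_eq_zpow_val,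
    Units.val_neg, Units.val_one]

/-- The embedding of `Eˣ` in `J`. -/
def jJ (hm : 1 ≤ m) : Eˣ →* D.grpJ m hm := D.jUnits.codRestrict _ (D.jUnits_mem_grpJ hm)

/-- The representation `Λ` of `J` has the dimension and the restriction to `Eˣ` that are prescribed for
`Λ_χ`. -/
structure IsLambda (χ : Eˣ →* Ωˣ) (Λ : Representation Ω (D.grpJ m hm) M) : Prop where
  finrank_eq : Module.finrank Ω M = if D.bH m = D.bJ m then 1 else Nat.card 𝓀[F]
  scalar : ∀ e : Eˣ, (D.bH m = D.bJ m ∨ (e : E) ∈ Set.range (algebraMap F E) ∨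
    (e : E) - 1 ∈ pPow E 1) → Λ (D.jJ hm e) = (χ e : Ω) • 1
  trace_eq : D.bH m ≠ D.bJ m → ∀ ζ : Eˣ, IsRootOutside F E ζ →
    LinearMap.trace Ω M (Λ (D.jJ hm ζ)) = -(χ ζ : Ω)

variable {D} {χ : Eˣ →* Ωˣ} {Λ : Representation Ω (D.grpJ m hm) M}

lemma IsLambda.equiv (h : D.IsLambda χ Λ) {Λ' : Representation Ω (D.grpJ m hm) M'}
    (e : Λ.Equiv Λ') : D.IsLambda χ Λ' := by
  let e' : M ≃ₗ[Ω] M' := e.toLinearEquiv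
  have he (g : D.grpJ m hm) : Λ' g = e'.conj (Λ g) := by
    ext v
    rw [LinearEquiv.conj_apply_apply]
    have := equiv_map_rep e g (e'.symm v)
    change e' _ = Λ' g (e' _) at this
    rw [this, LinearEquiv.apply_symm_apply]
  refine ⟨by rw [← h.finrank_eq, e'.finrank_eq], fun x hx => ?_, fun hne ζ hζ => ?_⟩
  · rw [he, h.scalar x hx]
    ext v
    simp [LinearEquiv.conj_apply_apply]
  · rw [he, LinearMap.trace_conj', h.trace_eq hne ζ hζ]

/-- The twist of a representation of `J` by the character `ω ∘ nrm`. -/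
noncomputable abbrev twistJ (ω : Fˣ →* Ωˣ) (Λ : Representation Ω (D.grpJ m hm) M) :
    Representation Ω (D.grpJ m hm) M :=
  twist ((ω.comp D.nrmUnits).comp (D.grpJ m hm).subtype) Λ

lemma IsLambda.twist (h : D.IsLambda χ Λ) (ω : Fˣ →* Ωˣ) :
    D.IsLambda (χ * ω.comp (normUnits F E)) (twistJ ω Λ) := by
  have key (e : Eˣ) : twistJ ω Λ (D.jJ hm e) =
        (ω (normUnits F E e) : Ω) • Λ (D.jJ hm e) := by
    rw [← D.nrmUnits_jUnits]
    rfl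
  refine ⟨h.finrank_eq, fun x hx => ?_, fun hne ζ hζ => ?_⟩
  · rw [key, h.scalar x hx, smul_smul, mul_comm]
    rfl
  · rw [key, map_smul, h.trace_eq hne ζ hζ, smul_eq_mul, mul_neg, mul_comm]
    rfl

lemma IsLambda.dual [FiniteDimensional Ω M] (h : D.IsLambda χ Λ) : D.IsLambda χ⁻¹ Λ.dual := by
  have key (e : Eˣ) : Λ.dual (D.jJ hm e) =
      Module.Dual.transpose (Λ (D.jJ hm e⁻¹)) := by
    rw [map_inv]; rfl
  refine ⟨by rw [Subspace.dual_finrank_eq, h.finrank_eq], fun x hx => ?_, fun hne ζ hζ => ?_⟩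
  · have hx' : D.bH m = D.bJ m ∨ ((x⁻¹ : Eˣ) : E) ∈ Set.range (algebraMap F E) ∨
        ((x⁻¹ : Eˣ) : E) - 1 ∈ pPow E 1 := by
      rcases hx with hx | ⟨a, ha⟩ | hx
      · exact .inl hx
      · exact .inr (.inl ⟨a⁻¹, by rw [map_inv₀, ha, Units.val_inv_eq_inv_val]⟩)
      · exact .inr (.inr (by
          rw [Units.val_inv_eq_inv_val]; exact inv_sub_one_mem (by norm_num) hx))
    rw [key, h.scalar _ hx', map_inv]
    exact LinearMap.ext fun l => LinearMap.ext fun v => l.map_smul _ v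
  · rw [key, LinearMap.trace_transpose', h.trace_eq hne _ hζ.inv, map_inv]
    rfl

end QuatModel

end Lambda

/-! ### The tensor product of two types -/

section Tensor

variable {R : Type*} [Ring R] [Algebra F R] {D : QuatModel F E R}
variable {R' : Type*} [Ring R'] [Algebra F R'] {D' : QuatModel F E R'}
variable {hm : 1 ≤ m}
variable {W M M' : Type*} [AddCommGroup W] [Module Ω W] [AddCommGroup M] [Module Ω M]
  [AddCommGroup M'] [Module Ω M']

open QuatModel

lemma fst_mem_grpJ {k : Rˣ × R'ˣ} (hk : k ∈ grpK D D' m hm) : k.1 ∈ D.grpJ m hm := by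
  obtain ⟨e, l, hl, rfl⟩ := hk
  exact ⟨e, l.1, InCong.anti D hl.1 (by omega) le_rfl, rfl⟩

lemma snd_mem_grpJ {k : Rˣ × R'ˣ} (hk : k ∈ grpK D D' m hm) : k.2 ∈ D'.grpJ m hm := by
  obtain ⟨e, l, hl, rfl⟩ := hk
  exact ⟨e, l.2, InCong.anti D' hl.2 (by omega) le_rfl, rfl⟩

variable (D D') in
/-- The projection of `𝒦` to the first group `J`. -/
def fstK (m : ℕ) (hm : 1 ≤ m) : grpK D D' m hm →* D.grpJ m hm :=
  ((MonoidHom.fst Rˣ R'ˣ).comp (grpK D D' m hm).subtype).codRestrict _ fun k => fst_mem_grpJ k.2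

variable (D D') in
/-- The projection of `𝒦` to the second group `J`. -/
def sndK (m : ℕ) (hm : 1 ≤ m) : grpK D D' m hm →* D'.grpJ m hm :=
  ((MonoidHom.snd Rˣ R'ˣ).comp (grpK D D' m hm).subtype).codRestrict _ fun k => snd_mem_grpJ k.2

lemma exists_mem_grpK {g : Rˣ} (hg : g ∈ D.grpJ m hm) :
    ∃ (e : Eˣ) (l : Rˣ), l ∈ D.grpV m hm ∧ g = D.jUnits e * l := by
  obtain ⟨e, u, hu, rfl⟩ := hg
  obtain ⟨x, -, hx⟩ := D.exists_jUnits_inv_mul le_rfl hu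
  exact ⟨e * x, _, hx m, by rw [map_mul]; group⟩

lemma sndK_surjective : Function.Surjective (sndK D D' m hm) := by
  rintro ⟨g, hg⟩
  obtain ⟨e, l, hl, rfl⟩ := exists_mem_grpK hg
  exact ⟨⟨diagUnits D D' e * (1, l), e, (1, l), ⟨Subgroup.one_mem _, hl⟩, rfl⟩, rfl⟩

/-- The restriction to `𝒦` of the exterior tensor product of representations of the two
groups `J`. -/
noncomputable def tensorK (σ : Representation Ω (D.grpJ m hm) M)
    (σ' : Representation Ω (D'.grpJ m hm) M') : Representation Ω (grpK D D' m hm) (M ⊗[Ω] M') :=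
  Representation.tprod (σ.comp (fstK D D' m hm)) (σ'.comp (sndK D D' m hm))

variable {σ : Representation Ω (D.grpJ m hm) M} {σ' : Representation Ω (D'.grpJ m hm) M'}

lemma tensorK_apply (k : grpK D D' m hm) : tensorK σ σ' k =
    TensorProduct.map (σ (fstK D D' m hm k)) (σ' (sndK D D' m hm k)) := rfl

/-- `σ` acts on `H` by a character that is pure for `α`. -/
def QuatModel.ActsByPure (D : QuatModel F E R) (ψ : AddChar F Ω) (α : E)
    (σ : Representation Ω (D.grpJ m hm) M) : Prop :=
  ∃ Θ : D.grpH m →* Ωˣ, D.IsPure ψ m α Θ ∧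
    ∀ h (hh : h ∈ D.grpH m), σ ⟨h, D.grpH_le_grpJ hm hh⟩ = (Θ ⟨h, hh⟩ : Ω) • 1

/-- If `bH = bJ`, then `J = Eˣ H` is abelian modulo the kernel of the character of `H`. -/
lemma exists_smul_of_bH_eq [IsAlgClosed Ω] [FiniteDimensional Ω M] (h : D.bH m = D.bJ m)
    (hσ : σ.IsIrreducible) (hp : D.ActsByPure ψ α σ) (g : D.grpJ m hm) : ∃ c : Ω, σ g = c • 1 := by
  obtain ⟨Θ, -, hΘ⟩ := hp
  have hJ (e : Eˣ) (u : Rˣ) (hu : u ∈ D.grpH m) (hg : D.jUnits e * u ∈ D.grpJ m hm) :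
      σ ⟨D.jUnits e * u, hg⟩ = (Θ ⟨u, hu⟩ : Ω) • σ (D.jJ hm e) := by
    have : (⟨D.jUnits e * u, hg⟩ : D.grpJ m hm) = D.jJ hm e * ⟨u, D.grpH_le_grpJ hm hu⟩ := rfl
    rw [this, map_mul, hΘ u hu, mul_smul_comm, mul_one]
  have hE (e : Eˣ) : ∃ c : Ω, σ (D.jJ hm e) = c • 1 := by
    obtain ⟨c, hc⟩ := exists_eq_smul_of_commute hσ
      (σ (D.jJ hm e)) (by
        rintro ⟨g, hg⟩ v
        obtain ⟨e', u, hu, rfl⟩ := id hg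
        have hu' : u ∈ D.grpH m := by rw [mem_grpH, h]; exact hu
        rw [hJ e' u hu' hg, LinearMap.smul_apply, LinearMap.smul_apply, map_smul,
          ← Module.End.mul_apply, ← Module.End.mul_apply, ← map_mul, ← map_mul]
        rw [← map_mul, ← map_mul, mul_comm])
    exact ⟨c, LinearMap.ext hc⟩
  obtain ⟨g, hg⟩ := g
  obtain ⟨e, u, hu, rfl⟩ := id hg
  have hu' : u ∈ D.grpH m := by rw [mem_grpH, h]; exact hu
  obtain ⟨c, hc⟩ := hE e
  exact ⟨_, by rw [hJ e u hu' hg, hc, smul_smul]⟩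

lemma isIrreducible_of_smul {G K : Type*} [Group G] [Group K] {ρ : Representation Ω G M}
    {ρ' : Representation Ω K W} (hρ : ρ.IsIrreducible) (i : M ≃ₗ[Ω] W)
    (h : ∀ g, ∃ (k : K) (c : Ωˣ), ∀ v, ρ' k (i v) = (c : Ω) • i (ρ g v)) : ρ'.IsIrreducible := by
  obtain ⟨hn, hp⟩ := (isIrreducible_iff _).1 hρ
  refine (isIrreducible_iff _).2 ⟨i.symm.toEquiv.nontrivial, fun p hinv => ?_⟩
  have h1 := hp (p.comap (i : M →ₗ[Ω] W)) fun g v hv => by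
    obtain ⟨k, c, hk⟩ := h g
    have h2 := p.smul_mem ((c⁻¹ : Ωˣ) : Ω) (hinv k _ hv)
    rw [LinearEquiv.coe_coe, hk, smul_smul, Units.inv_mul, one_smul] at h2
    exact h2
  have hinj := Submodule.comap_injective_of_surjective (f := (i : M →ₗ[Ω] W)) i.surjective
  exact h1.imp (fun h => hinj (h.trans (LinearMap.ker_eq_bot.2 i.injective).symm))
    fun h => hinj (h.trans (Submodule.comap_top _).symm)

lemma isIrreducible_tensorK_left (hσ : σ.IsIrreducible) (hσ' : σ'.IsIrreducible)
    (h : ∀ g, ∃ c : Ω, σ g = c • 1) : (tensorK σ σ').IsIrreducible := by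
  have hn := ((isIrreducible_iff _).1 hσ).1
  obtain ⟨χ, hχ⟩ := exists_char_of_smul h
  have hfd : FiniteDimensional Ω M :=
    Module.finite_of_finrank_pos (by rw [finrank_eq_one_of_smul hσ h]; norm_num)
  let e : M ≃ₗ[Ω] Ω := LinearEquiv.ofFinrankEq _ _ (by
    rw [finrank_eq_one_of_smul hσ h, Module.finrank_self])
  let i : M' ≃ₗ[Ω] M ⊗[Ω] M' := (TensorProduct.lid Ω M').symm ≪≫ₗ (LinearEquiv.rTensor M' e.symm)
  have hi (v : M') : i v = e.symm 1 ⊗ₜ v := rfl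
  refine isIrreducible_of_smul hσ' i fun g => ?_
  obtain ⟨k, rfl⟩ := sndK_surjective (D := D) g
  refine ⟨k, χ (fstK D D' m hm k), fun v => ?_⟩
  rw [hi, hi, tensorK_apply, TensorProduct.map_tmul, hχ, LinearMap.smul_apply,
    TensorProduct.smul_tmul']
  rfl

lemma isIrreducible_tensorK_right (hσ : σ.IsIrreducible) (hσ' : σ'.IsIrreducible)
    (h : ∀ g, ∃ c : Ω, σ' g = c • 1) : (tensorK σ σ').IsIrreducible := by
  refine isIrreducible_of_smul (isIrreducible_tensorK_left hσ' hσ h) (TensorProduct.comm Ω M' M) ?_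
  rintro ⟨_, e, l, hl, rfl⟩
  refine ⟨⟨_, e, l.swap, ⟨hl.2, hl.1⟩, rfl⟩, 1, fun v => ?_⟩
  rw [Units.val_one, one_smul]
  exact (TensorProduct.map_comm _ _ v)

/-- At least one of the two algebras satisfies `bH = bJ`: for unramified `E / F` the two values of `κ` differ
by `1`, and for ramified `E / F` the level `m` is odd. -/
lemma bH_eq_or (hα : IsMinimalElt F m α) (hκ : IsModelPair D D') :
    (D.bH m = D.bJ m ∧ D'.bH m = D'.bJ m ∧ ¬ Unramified F E) ∨
    (D.bH m = D.bJ m ∧ D'.bH m ≠ D'.bJ m ∧ Unramified F E) ∨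
    (D.bH m ≠ D.bJ m ∧ D'.bH m = D'.bJ m ∧ Unramified F E) := by
  by_cases hu : Unramified F E
  · have := hκ.unramified hu
    have := hκ.split
    unfold QuatModel.bH QuatModel.bJ
    simp only [hu, not_true_eq_false, and_false, false_or, and_true]
    omega
  · exact .inl ⟨depth_of_ramified hα hu hκ.split, depth_of_ramified hα hu (hκ.ramified hu), hu⟩

lemma isIrreducible_tensorK [IsAlgClosed Ω] [FiniteDimensional Ω M] [FiniteDimensional Ω M']
    {ψ' : AddChar F Ω}
    (hα : IsMinimalElt F m α) (hκ : IsModelPair D D') (hσ : σ.IsIrreducible) (hσ' : σ'.IsIrreducible)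
    (hp : D.ActsByPure ψ α σ) (hp' : D'.ActsByPure ψ' α σ') : (tensorK σ σ').IsIrreducible := by
  rcases bH_eq_or hα hκ with ⟨h, -, -⟩ | ⟨h, -, -⟩ | ⟨-, h, -⟩
  · exact isIrreducible_tensorK_left hσ hσ' (exists_smul_of_bH_eq h hσ hp)
  · exact isIrreducible_tensorK_left hσ hσ' (exists_smul_of_bH_eq h hσ hp)
  · exact isIrreducible_tensorK_right hσ hσ' (exists_smul_of_bH_eq h hσ' hp')

lemma tensorK_subW (hp : D.ActsByPure ψ α σ) (hp' : D'.ActsByPure ψ⁻¹ α σ') {k : grpK D D' m hm}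
    (hk : k ∈ subW D D' m hm) : tensorK σ σ' k = psiK ψ α k • 1 := by
  obtain ⟨Θ, hΘ, h⟩ := hp
  obtain ⟨Θ', hΘ', h'⟩ := hp'
  have h1 : k.1.1 ∈ D.grpH m := InCong.anti D hk.1 (by omega) le_rfl
  have h2 : k.1.2 ∈ D'.grpH m := InCong.anti D' hk.2 (by omega) le_rfl
  have e1 := h _ h1
  have e2 := h' _ h2
  rw [hΘ ⟨_, h1⟩ hk.1.1] at e1
  rw [hΘ' ⟨_, h2⟩ hk.2.1] at e2
  rw [tensorK_apply]
  unfold psiK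
  change TensorProduct.map (σ ⟨k.1.1, _⟩) (σ' ⟨k.1.2, _⟩) = _
  rw [e1, e2, TensorProduct.map_smul_left, TensorProduct.map_smul_right, smul_smul,
    AddChar.inv_apply, ← AddChar.map_add_eq_mul, ← map_neg, ← map_add, mul_sub _ _ (D'.X _ - 1),
    sub_eq_add_neg (α * _) (α * _)]
  exact congrArg _ (TensorProduct.map_one)

lemma tensorK_diagK {χ χ' : Eˣ →* Ωˣ} {e : Eˣ}
    (h : σ (D.jJ hm e) = (χ e : Ω) • 1)
    (h' : σ' (D'.jJ hm e) = (χ' e : Ω) • 1) :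
    tensorK σ σ' (diagK D D' m hm e) = (((χ * χ') e : Ωˣ) : Ω) • 1 := by
  rw [tensorK_apply]
  change TensorProduct.map (σ (D.jJ hm e)) (σ' (D'.jJ hm e)) = _
  rw [h, h', TensorProduct.map_smul_left, TensorProduct.map_smul_right, smul_smul]
  exact congrArg _ (TensorProduct.map_one)

lemma sgn_eq_one {e : Eˣ} (he : (e : E) ∈ Set.range (algebraMap F E) ∨ (e : E) - 1 ∈ pPow E 1) :
    sgn F E Ω e = 1 := by
  by_cases hu : Unramified F E
  · exact sgn_of_unramified hu e
  refine Units.ext ?_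
  rw [sgn_of_ramified hu, Units.val_one]
  rcases he with ⟨a, ha⟩ | he
  · have ha0 : a ≠ 0 := by
      rintro rfl
      exact e.ne_zero (by rw [← ha, map_zero])
    have hr : ramIdx F E = 2 := if_neg hu
    rw [← ha, ord_algebraMap ha0, hr, zpow_mul]
    norm_num
  · rw [(ne_zero_and_ord_eq_zero he).2, zpow_zero]

/-- The tensor product of representations of the kind of `Λ_χ` and of the contragredient of
`Λ'_χ` satisfies the conditions that characterise `τ_α`. -/
lemma isTauModel_tensorK [IsAlgClosed Ω] [FiniteDimensional Ω M] [FiniteDimensional Ω M']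
    (hα : IsMinimalElt F m α) (hκ : IsModelPair D D') (hσ : σ.IsIrreducible) (hσ' : σ'.IsIrreducible)
    (hp : D.ActsByPure ψ α σ) (hp' : D'.ActsByPure ψ⁻¹ α σ') {χ χ' : Eˣ →* Ωˣ}
    (hl : D.IsLambda χ σ) (hl' : D'.IsLambda χ' σ') (hχ : χ * χ' = sgn F E Ω) :
    IsTauModel ψ α (tensorK σ σ') where
  irreducible := isIrreducible_tensorK hα hκ hσ hσ' hp hp'
  trivial e he := by
    rw [tensorK_diagK (hl.scalar e (.inr he)) (hl'.scalar e (.inr he)), hχ, sgn_eq_one he,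
      Units.val_one, one_smul]
  one_add k hk := tensorK_subW hp hp' hk
  ramified hr e := by
    rw [tensorK_diagK (hl.scalar e (.inl (depth_of_ramified hα hr hκ.split)))
      (hl'.scalar e (.inl (depth_of_ramified hα hr (hκ.ramified hr)))), hχ, sgn_of_ramified hr]
  unramified hu ζ hζ := by
    have h1 : ((χ ζ : Ωˣ) : Ω) * χ' ζ = 1 := by
      rw [← Units.val_mul, ← MonoidHom.mul_apply, hχ, sgn_of_unramified hu, Units.val_one]
    rw [tensorK_apply, LinearMap.trace_tensorProduct']
    change LinearMap.trace Ω M (σ (D.jJ hm ζ)) * LinearMap.trace Ω M' (σ' (D'.jJ hm ζ)) = _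
    rcases bH_eq_or hα hκ with ⟨-, -, h⟩ | ⟨h, h', -⟩ | ⟨h, h', -⟩
    · exact absurd hu h
    · rw [hl.scalar ζ (.inl h), hl'.trace_eq h' ζ hζ, map_smul, LinearMap.trace_one, hl.finrank_eq,
        if_pos h, Nat.cast_one, smul_eq_mul, mul_one, mul_neg, h1]
    · rw [hl'.scalar ζ (.inl h'), hl.trace_eq h ζ hζ, map_smul, LinearMap.trace_one,
        hl'.finrank_eq, if_pos h', Nat.cast_one, smul_eq_mul, mul_one, neg_mul, h1]

lemma eq_smul_of_map_eq [Nontrivial M] {A : M →ₗ[Ω] M} {B : M' →ₗ[Ω] M'} {a : Ωˣ} {c : Ω}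
    (hA : A = (a : Ω) • 1) (h : TensorProduct.map A B = c • 1) : B = ((a⁻¹ : Ωˣ) * c) • 1 := by
  obtain ⟨v, hv⟩ := exists_ne (0 : M)
  obtain ⟨f, hf⟩ : ∃ f : M →ₗ[Ω] Ω, f v = 1 :=
    Module.Projective.exists_dual_eq_one Ω hv
  ext w
  have h1 := congrArg ((TensorProduct.lid Ω M').toLinearMap ∘ₗ f.rTensor M')
    (LinearMap.congr_fun h (v ⊗ₜ w))
  rw [hA, TensorProduct.map_tmul] at h1
  simp only [LinearMap.smul_apply, Module.End.one_apply, LinearMap.coe_comp, Function.comp_apply,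
    LinearEquiv.coe_coe, LinearMap.rTensor_tmul, map_smul, TensorProduct.lid_tmul, hf, one_smul,
    smul_eq_mul, mul_one] at h1
  rw [LinearMap.smul_apply, Module.End.one_apply, mul_smul, ← h1, smul_smul, Units.inv_mul,
    one_smul]

lemma map_comm (A : M →ₗ[Ω] M) (B : M' →ₗ[Ω] M') :
    TensorProduct.map B A = (TensorProduct.comm Ω M M').conj (TensorProduct.map A B) := by
  ext v w
  simp [LinearEquiv.conj_apply_apply]

/-- The case in which the first factor is a character: the second factor is then determined by the
tensor product and this character. -/
lemma exists_isLambda_of_scalar [FiniteDimensional Ω M']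
    (h : D.bH m = D.bJ m) (hσ : σ.IsIrreducible) (hs : ∀ g, ∃ c : Ω, σ g = c • 1)
    (hscal : ∀ e : Eˣ, (D'.bH m = D'.bJ m ∨ (e : E) ∈ Set.range (algebraMap F E) ∨
      (e : E) - 1 ∈ pPow E 1) → TensorProduct.map (σ (D.jJ hm e))
        (σ' (D'.jJ hm e)) = (sgn F E Ω e : Ω) • 1)
    (htr : D'.bH m ≠ D'.bJ m → ∀ ζ : Eˣ, IsRootOutside F E ζ → LinearMap.trace Ω _
      (TensorProduct.map (σ (D.jJ hm ζ))
        (σ' (D'.jJ hm ζ))) = -sgn F E Ω ζ)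
    (hfr : Module.finrank Ω (M ⊗[Ω] M') = if D'.bH m = D'.bJ m then 1 else Nat.card 𝓀[F]) :
    ∃ χ : Eˣ →* Ωˣ, D.IsLambda χ σ ∧ D'.IsLambda (χ⁻¹ * sgn F E Ω) σ' := by
  have hn := ((isIrreducible_iff _).1 hσ).1
  obtain ⟨c, hc⟩ := exists_char_of_smul hs
  have h1 := finrank_eq_one_of_smul hσ hs
  have hfd : FiniteDimensional Ω M := Module.finite_of_finrank_pos (by rw [h1]; norm_num)
  let χ : Eˣ →* Ωˣ := c.comp (D.jJ hm)
  have hχ (e : Eˣ) : σ (D.jJ hm e) = (χ e : Ω) • 1 := hc _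
  refine ⟨χ, ⟨by rw [h1, if_pos h], fun e _ => hχ e, fun hne => absurd h hne⟩, ?_, ?_, ?_⟩
  · rw [← hfr, Module.finrank_tensorProduct, h1, one_mul]
  · intro e he
    rw [eq_smul_of_map_eq (hχ e) (hscal e he)]
    rfl
  · intro hne ζ hζ
    have h2 := htr hne ζ hζ
    rw [LinearMap.trace_tensorProduct', hχ, map_smul, LinearMap.trace_one, h1, Nat.cast_one,
      smul_eq_mul, mul_one] at h2
    change _ = -(((χ ζ)⁻¹ : Ωˣ) * (sgn F E Ω ζ : Ω))
    rw [← mul_neg, ← h2, ← mul_assoc, Units.inv_mul, one_mul]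

/-- Conversely, if the tensor product satisfies the conditions that characterise `τ_α`, then the two
factors are of the kind of `Λ_χ` and of the contragredient of `Λ'_χ`, for the same `χ`. -/
lemma exists_isLambda [IsAlgClosed Ω] [CharZero Ω] [FiniteDimensional Ω M] [FiniteDimensional Ω M']
    (hψ : IsLevelZero F ψ)
    (hα : IsMinimalElt F m α) (hκ : IsModelPair D D') (hσ : σ.IsIrreducible) (hσ' : σ'.IsIrreducible)
    {ψ' : AddChar F Ω}
    (hp : D.ActsByPure ψ α σ) (hp' : D'.ActsByPure ψ' α σ')
    (hT : IsTauModel ψ α (tensorK σ σ')) :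
    ∃ χ : Eˣ →* Ωˣ, D.IsLambda χ σ ∧ D'.IsLambda (χ⁻¹ * sgn F E Ω) σ' := by
  have hscal (e : Eˣ) (he : ¬ Unramified F E ∨ (e : E) ∈ Set.range (algebraMap F E) ∨
      (e : E) - 1 ∈ pPow E 1) : TensorProduct.map (σ (D.jJ hm e))
        (σ' (D'.jJ hm e)) = (sgn F E Ω e : Ω) • 1 := by
    change tensorK σ σ' (diagK D D' m hm e) = _
    by_cases hu : Unramified F E
    · rw [hT.trivial e (he.resolve_left (not_not.2 hu)), sgn_of_unramified hu, Units.val_one,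
        one_smul]
    · rw [hT.ramified hu, sgn_of_ramified hu]
  have htr (hu : Unramified F E) (ζ : Eˣ) (hζ : IsRootOutside F E ζ) : LinearMap.trace Ω _
      (TensorProduct.map (σ (D.jJ hm ζ))
        (σ' (D'.jJ hm ζ))) = -sgn F E Ω ζ := by
    change LinearMap.trace Ω _ (tensorK σ σ' (diagK D D' m hm ζ)) = _
    rw [hT.unramified hu ζ hζ, sgn_of_unramified hu, Units.val_one]
  have hleft (h : D.bH m = D.bJ m) (hu : D'.bH m = D'.bJ m ↔ ¬ Unramified F E)
      (hfr : Module.finrank Ω (M ⊗[Ω] M') = if D'.bH m = D'.bJ m then 1 else Nat.card 𝓀[F]) :=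
    exists_isLambda_of_scalar h hσ (exists_smul_of_bH_eq h hσ hp)
      (fun e he => hscal e (by rwa [hu] at he))
      (fun hne ζ hζ => htr (not_not.1 (mt hu.2 hne)) ζ hζ) hfr
  -- both factors are characters, or only the first one is, or only the second one is
  rcases bH_eq_or hα hκ with ⟨h, h', hu⟩ | ⟨h, h', hu⟩ | ⟨h, h', hu⟩
  · exact hleft h (by simp [h', hu])
      (by rw [if_pos h', hT.finrank_eq_one hα hu hκ])
  · exact hleft h (by simp [h', hu]) (by rw [if_neg h', hT.finrank_eq hψ hα hκ hu])
  · obtain ⟨χ, h1, h2⟩ := exists_isLambda_of_scalar (D := D') (D' := D) (σ := σ') (σ' := σ) h' hσ'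
      (exists_smul_of_bH_eq h' hσ' hp')
      (fun e he => by
        rw [map_comm, hscal e (.inr (he.resolve_left h))]
        ext v; simp [LinearEquiv.conj_apply_apply])
      (fun _ ζ hζ => by rw [map_comm, LinearMap.trace_conj', htr hu ζ hζ])
      (by rw [if_neg h, (TensorProduct.comm Ω M' M).finrank_eq,
        hT.finrank_eq hψ hα hκ hu])
    refine ⟨χ⁻¹ * sgn F E Ω, h2, ?_⟩
    have : (χ⁻¹ * sgn F E Ω)⁻¹ * sgn F E Ω = χ := by
      ext; simp
    rwa [this]

end Tensor

/-! ### Homomorphisms that are equivariant for `𝒦¹` -/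

section Equivariant

variable {R : Type*} [Ring R] [Algebra F R] [TopologicalSpace R] [IsTopologicalRing R]
  [IsModuleTopology F R] {D : QuatModel F E R}
variable {R' : Type*} [Ring R'] [Algebra F R'] [TopologicalSpace R'] [IsTopologicalRing R']
  [IsModuleTopology F R'] {D' : QuatModel F E R'}
variable {hm : 1 ≤ m}
variable {V V' W : Type*} [AddCommGroup V] [Module Ω V] [AddCommGroup V'] [Module Ω V']
  [AddCommGroup W] [Module Ω W]

open QuatModel

/-- A linear map `V ⊗ V' → W` that is equivariant for `𝒦¹`. -/
def IsK1Equivariant (π : Representation Ω Rˣ V) (π' : Representation Ω R'ˣ V')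
    (τ : Representation Ω (grpK D D' m hm) W) (φ : V ⊗[Ω] V' →ₗ[Ω] W) : Prop :=
  ∀ k : grpK D D' m hm, D.nrmUnits k.1.1 = D'.nrmUnits k.1.2 →
    ∀ v v', φ (π k.1.1 v ⊗ₜ π' k.1.2 v') = τ k (φ (v ⊗ₜ v'))

variable (D) in
lemma QuatModel.X_scalar (v : Fˣ) : D.X (scalar v : Rˣ) = algebraMap F E v := by
  rw [D.scalar_eq, coe_jUnits, ← mul_one (D.j _), X_j_mul, X_one, mul_one]
  rfl

variable (D) in
lemma QuatModel.Y_scalar (v : Fˣ) : D.Y (scalar v : Rˣ) = 0 := by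
  rw [D.scalar_eq, coe_jUnits, ← mul_one (D.j _), Y_j_mul, Y_one, mul_zero]

variable (D) in
lemma QuatModel.nrmUnits_scalar (v : Fˣ) : D.nrmUnits (scalar v) = v * v := by
  rw [D.scalar_eq, nrmUnits_jUnits]
  ext
  change Algebra.norm F (algebraMap F E v) = _
  rw [Algebra.norm_algebraMap, Algebra.IsQuadraticExtension.finrank_eq_two, pow_two]
  rfl

variable (D) in
lemma QuatModel.inCong_one {i b : ℤ} : D.InCong i b ((1 : Rˣ) : R) :=
  ⟨by rw [Units.val_one, X_one, sub_self]; exact zero_mem_pPow _,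
    by rw [Units.val_one, Y_one]; exact zero_mem_pPow _⟩

variable (D) in
lemma QuatModel.inCong_scalar {v : Fˣ} {i : ℤ} (h : algebraMap F E v - 1 ∈ pPow E i) (b : ℤ) :
    D.InCong i b ((scalar v : Rˣ) : R) :=
  ⟨by rwa [X_scalar], by rw [Y_scalar]; exact zero_mem_pPow _⟩

lemma exists_sqrt_units {z : Fˣ} {i : ℤ} (hi : 1 ≤ i) (hz : algebraMap F E z - 1 ∈ pPow E i) :
    ∃ v : Fˣ, z = v * v ∧ algebraMap F E v - 1 ∈ pPow E i := by
  obtain ⟨v, hv, h⟩ := exists_sqrt_algebraMap hi hz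
  have hv0 : v ≠ 0 := by
    rintro rfl
    exact z.ne_zero (by rw [← hv, zero_mul])
  exact ⟨Units.mk0 v hv0, Units.ext hv.symm, h⟩

variable (D hm) in
/-- The character `h ↦ ψ_E (α (X h - 1))` of `1 + W`. -/
noncomputable def QuatModel.psiW (hψ : IsLevelZero F ψ) (hα : IsMinimalElt F m α) :
    D.grpW m hm →* Ωˣ :=
  MonoidHom.toHomUnits
    { toFun := fun h => ψ (Algebra.trace F E (α * (D.X ((h : Rˣ) : R) - 1)))
      map_one' := by simp [X_one]
      map_mul' := fun h h' => by
        have hf := D.depth_facts m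
        have h1 := psi_eq_one hψ hα.mem_pPow (x := (D.X ((h : Rˣ) : R) - 1) *
          (D.X ((h' : Rˣ) : R) - 1)) (pPow_anti (by omega) (mul_mem_pPow h.2.1 h'.2.1))
        have h2 := psi_eq_one hψ hα.mem_pPow (x := algebraMap F E D.d * D.Y ((h : Rˣ) : R) *
          conj F E (D.Y ((h' : Rˣ) : R))) (pPow_anti (by omega) (D.d_mul_mem h.2.2 h'.2.2))
        rw [← one_mul (ψ _ * ψ _), ← h1, ← one_mul (ψ _ * _), ← h2, ← AddChar.map_add_eq_mul,
          ← AddChar.map_add_eq_mul, ← AddChar.map_add_eq_mul, ← map_add, ← map_add, ← map_add]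
        congr 2
        rw [Subgroup.coe_mul, Units.val_mul, X_mul]
        ring }

lemma QuatModel.grpW_le_grpH : D.grpW m hm ≤ D.grpH m := fun _ h =>
  InCong.anti D h (by omega) le_rfl

/-- The space of vectors on which `H` acts by the character `Ξ`. -/
abbrev QuatModel.eigen (hm : 1 ≤ m) (π : Representation Ω Rˣ V) (Ξ : D.grpH m →* Ωˣ) :
    Submodule Ω V := OpenPair.eigen (P := D.openPair m hm) π Ξ

variable {π : Representation Ω Rˣ V} {π' : Representation Ω R'ˣ V'}
  {τ : Representation Ω (grpK D D' m hm) W} {φ : V ⊗[Ω] V' →ₗ[Ω] W}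
  {ω : Fˣ →* Ωˣ} {Ξ : D.grpH m →* Ωˣ} {Ξ' : D'.grpH m →* Ωˣ}

variable (hm) in
lemma QuatModel.isTwistedPure_of_forall (hψ : IsLevelZero F ψ) (hα : IsMinimalElt F m α)
    (h : ∀ g : D.grpW m hm, D.psiW hm hψ hα g * ω (D.nrmUnits (g : Rˣ)) =
      Ξ (Subgroup.inclusion grpW_le_grpH g)) : D.IsTwistedPure ψ m α ω Ξ := fun g hg => by
  have h1 := congrArg Units.val (h ⟨g, hg, g.2.2⟩)
  rw [Units.val_mul] at h1
  exact h1.symm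

/-- If `φ` does not vanish on eigenvectors of the two groups `H`, then on `1 + W` the eigencharacters
differ from the pure characters for `α` by the same character of the norm. -/
lemma exists_isTwistedPure [IsAlgClosed Ω] [CharZero Ω] (hψ : IsLevelZero F ψ)
    (hα : IsMinimalElt F m α) (hτ : IsTauModel ψ α τ) (hφ : IsK1Equivariant π π' τ φ)
    (hΞ : ∃ N, ∀ u : D.grpH m, (u : Rˣ) ∈ (D.openPair m hm).U N → Ξ u = 1)
    {v : V} (hv : v ∈ eigen hm π Ξ) {v' : V'} (hv' : v' ∈ eigen hm π' Ξ'⁻¹)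
    (h0 : φ (v ⊗ₜ v') ≠ 0) :
    ∃ ω : Fˣ →* Ωˣ, IsSmoothChar ω ∧ D.IsTwistedPure ψ m α ω Ξ ∧ D'.IsTwistedPure ψ m α ω Ξ' := by
  -- the quotients of the eigencharacters by the pure characters; they agree on elements of equal norm
  let f : D.grpW m hm →* Ωˣ := Ξ.comp (Subgroup.inclusion grpW_le_grpH) * (D.psiW hm hψ hα)⁻¹
  let f' : D'.grpW m hm →* Ωˣ := Ξ'.comp (Subgroup.inclusion grpW_le_grpH) * (D'.psiW hm hψ hα)⁻¹
  have hrel (h : D.grpW m hm) (h' : D'.grpW m hm)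
      (e : D.nrmUnits (h : Rˣ) = D'.nrmUnits (h' : R'ˣ)) : f h = f' h' := by
    have hk : ((h : Rˣ), (h' : R'ˣ)) ∈ grpK D D' m hm :=
      mem_grpK_of_mem (prod_grpW_le ⟨h.2, h'.2⟩)
    have h1 := hφ ⟨_, hk⟩ e v v'
    rw [hτ.one_add ⟨_, hk⟩ ⟨h.2, h'.2⟩] at h1
    have hv1 : π (h : Rˣ) v = (Ξ ⟨h, grpW_le_grpH h.2⟩ : Ω) • v := hv ⟨h, grpW_le_grpH h.2⟩
    have hv2 : π' (h' : R'ˣ) v' = ((Ξ' ⟨h', grpW_le_grpH h'.2⟩)⁻¹ : Ωˣ) • v' :=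
      hv' ⟨h', grpW_le_grpH h'.2⟩
    change φ (π (h : Rˣ) v ⊗ₜ π' (h' : R'ˣ) v') = _ at h1
    rw [hv1, hv2, Units.smul_def, TensorProduct.smul_tmul_smul, map_smul, LinearMap.smul_apply,
      Module.End.one_apply] at h1
    have h3 : psiK ψ α (⟨_, hk⟩ : grpK D D' m hm) =
        (D.psiW hm hψ hα h : Ω) * ((D'.psiW hm hψ hα h')⁻¹ : Ωˣ) := by
      rw [psiK, mul_sub, map_sub, sub_eq_add_neg, AddChar.map_add_eq_mul, AddChar.map_neg_eq_inv,
        Units.val_inv_eq_inv_val]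
      rfl
    have h2 := smul_left_injective Ω h0 h1
    rw [h3, ← Units.val_mul, ← Units.val_mul] at h2
    have h4 : Ξ ⟨h, grpW_le_grpH h.2⟩ / Ξ' ⟨h', grpW_le_grpH h'.2⟩ =
      D.psiW hm hψ hα h / D'.psiW hm hψ hα h' := by
      rw [div_eq_mul_inv, div_eq_mul_inv]; exact Units.ext h2
    change Ξ ⟨h, grpW_le_grpH h.2⟩ * (D.psiW hm hψ hα h)⁻¹ =
      Ξ' ⟨h', grpW_le_grpH h'.2⟩ * (D'.psiW hm hψ hα h')⁻¹
    rw [← div_eq_mul_inv, ← div_eq_mul_inv, div_eq_div_iff_div_eq_div, h4]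
  obtain ⟨ω, hω⟩ := exists_hom_factor f (D.nrmUnits.comp (D.grpW m hm).subtype) fun h hh => by
    have := hrel h 1 (by rw [Subgroup.coe_one, map_one]; exact hh)
    rwa [map_one] at this
  have hωf (h : D.grpW m hm) : ω (D.nrmUnits (h : Rˣ)) = f h := hω h
  -- elements of `F` close to `1` are squares, hence norms of scalars in `1 + W`
  have hsqrt {z : Fˣ} {i : ℤ} (hi : (m : ℤ) ≤ i) (hz : algebraMap F E z - 1 ∈ pPow E i) :
      ∃ h : D.grpW m hm, D.InCong i i ((h : Rˣ) : R) ∧ D.nrmUnits (h : Rˣ) = z := by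
    obtain ⟨v, rfl, hv⟩ := exists_sqrt_units (by omega) hz
    exact ⟨⟨scalar v, D.inCong_scalar (pPow_anti hi hv) _⟩, D.inCong_scalar hv _,
      D.nrmUnits_scalar v⟩
  refine ⟨ω, ?_, isTwistedPure_of_forall hm hψ hα fun h => ?_,
    isTwistedPure_of_forall hm hψ hα fun h => ?_⟩
  · rw [isSmoothChar_iff]
    obtain ⟨N, hN⟩ := hΞ
    have hnear : ∀ᶠ z : Fˣ in 𝓝 1, algebraMap F E z - 1 ∈ pPow E (m + 1 + N + (D.bH m).toNat) := by
      have hcont : Continuous fun z : Fˣ => algebraMap F E z - 1 :=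
        ((continuous_algebraMap_ext F E).comp Units.continuous_val).sub continuous_const
      have := hcont.tendsto 1
      rw [Units.val_one, map_one, sub_self] at this
      exact this (pPow_mem_nhds E _)
    filter_upwards [hnear] with z hz
    obtain ⟨h, hh, rfl⟩ := hsqrt (by omega) hz
    rw [hωf h]
    have h1 : Ξ ⟨h, grpW_le_grpH h.2⟩ = 1 := hN ⟨h, grpW_le_grpH h.2⟩ (D.mem_grpU.2 (by
      refine InCong.anti D hh ?_ ?_ <;> push_cast <;> omega))
    have h2 : D.psiW hm hψ hα h = 1 := Units.ext
      (psi_eq_one hψ hα.mem_pPow (pPow_anti (by omega) hh.1))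
    change Ξ ⟨h, grpW_le_grpH h.2⟩ * (D.psiW hm hψ hα h)⁻¹ = 1
    rw [h1, h2, inv_one, one_mul]
  · rw [hωf, mul_comm]
    exact inv_mul_cancel_right (Ξ _) _
  · have hf := D'.depth_facts m
    obtain ⟨g, -, hg⟩ := hsqrt (z := D'.nrmUnits (h : R'ˣ)) le_rfl
      (InCong.nrm_mem D' (a := m) (b := D'.bH m) (by omega) (by omega) h.2)
    rw [← hg, hωf, hrel g h hg, mul_comm]
    exact inv_mul_cancel_right (Ξ' _) _

/-- `φ` does not see pairs of equal norm in the part of `1 + W` where `ψ_E (α s(w))` is trivial; in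
particular it does not see commutators of the groups `H`. -/
lemma IsK1Equivariant.map_eq (hφ : IsK1Equivariant π π' τ φ) (hτ : IsTauModel ψ α τ)
    (hψ : IsLevelZero F ψ) (hα : IsMinimalElt F m α) {g : Rˣ} {g' : R'ˣ}
    (hg : D.InCong (m + 1) (D.bH m) (g : R)) (hg' : D'.InCong (m + 1) (D'.bH m) (g' : R'))
    (e : D.nrmUnits g = D'.nrmUnits g') (v : V) (v' : V') :
    φ (π g v ⊗ₜ π' g' v') = φ (v ⊗ₜ v') := by
  have hW : (g, g') ∈ (D.grpW m hm).prod (D'.grpW m hm) :=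
    ⟨InCong.anti D hg (by omega) le_rfl, InCong.anti D' hg' (by omega) le_rfl⟩
  have h1 := hφ ⟨_, mem_grpK_of_mem (prod_grpW_le hW)⟩ e v v'
  have h2 : psiK ψ α (⟨_, mem_grpK_of_mem (prod_grpW_le hW)⟩ : grpK D D' m hm) = 1 :=
    psi_eq_one hψ hα.mem_pPow (sub_mem_pPow hg.1 hg'.1)
  rw [hτ.one_add _ hW, h2, one_smul] at h1
  exact h1

/-- The assumptions on the algebras, on `ψ` and `α`, and on the two representations. -/
structure IsSetting (D : QuatModel F E R) (D' : QuatModel F E R') (ψ : AddChar F Ω) (m : ℕ) (α : E)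
    (π : Representation Ω Rˣ V) (π' : Representation Ω R'ˣ V') : Prop
    extends IsModelPair D D' where
  level : IsLevelZero F ψ
  minimal : IsMinimalElt F m α
  smooth : IsSmooth π
  smooth' : IsSmooth π'
  irr : π.IsIrreducible
  irr' : π'.IsIrreducible

/-- A nonzero value of `φ` on a pair of subspaces stable under the groups `H` is also attained on
eigenvectors. -/
lemma IsSetting.exists_eigen_pair [IsAlgClosed Ω] [CharZero Ω] (S : IsSetting D D' ψ m α π π')
    (hτ : IsTauModel ψ α τ) (hφ : IsK1Equivariant π π' τ φ) (p : Submodule Ω V)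
    (hp : ∀ h ∈ D.grpH m, ∀ v ∈ p, π h v ∈ p) (p' : Submodule Ω V')
    (hp' : ∀ h ∈ D'.grpH m, ∀ v ∈ p', π' h v ∈ p')
    {v : V} (hv : v ∈ p) {v' : V'} (hv' : v' ∈ p') (h0 : φ (v ⊗ₜ v') ≠ 0) :
    ∃ (ω : Fˣ →* Ωˣ) (Ξ : D.grpH m →* Ωˣ) (Ξ' : D'.grpH m →* Ωˣ),
      IsSmoothChar ω ∧ D.IsTwistedPure ψ m α ω Ξ ∧ D'.IsTwistedPure ψ m α ω Ξ' ∧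
      ∃ w ∈ p, w ∈ eigen hm π Ξ ∧ ∃ w' ∈ p', w' ∈ eigen hm π' Ξ'⁻¹ ∧ φ (w ⊗ₜ w') ≠ 0 := by
  obtain ⟨Ξ, hΞ, w, hwp, hw, hw0⟩ := OpenPair.exists_eigen_of_map_ne_zero (P := D.openPair m hm)
    S.smooth (φ ∘ₗ (TensorProduct.mk Ω V V').flip v') (fun g hg h hh x => by
      have h1 := hφ.map_eq hτ S.level S.minimal
        (D.inCong_commutator hm (InCong.anti D hg le_rfl (D.depth_facts m).2.1) hh) D'.inCong_one
        (by simp only [map_mul, map_inv, map_one]; rw [mul_inv_cancel_comm, mul_inv_cancel]) x v'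
      rw [map_one π'] at h1
      exact h1) p hp hv h0
  obtain ⟨Ξ', -, w', hwp', hw', hw0'⟩ := OpenPair.exists_eigen_of_map_ne_zero
    (P := D'.openPair m hm) S.smooth' (φ ∘ₗ (TensorProduct.mk Ω V V') w) (fun g hg h hh x => by
      have h1 := hφ.map_eq hτ S.level S.minimal D.inCong_one
        (D'.inCong_commutator hm (InCong.anti D' hg le_rfl (D'.depth_facts m).2.1) hh)
        (by simp only [map_mul, map_inv, map_one]; rw [mul_inv_cancel_comm, mul_inv_cancel]) w x
      rw [map_one π] at h1
      exact h1) p' hp' hv' hw0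
  rw [← inv_inv Ξ'] at hw'
  obtain ⟨ω, hω, h1, h2⟩ := exists_isTwistedPure (Ξ := Ξ) (Ξ' := Ξ'⁻¹) S.level S.minimal hτ hφ hΞ hw
    hw' hw0'
  exact ⟨ω, Ξ, Ξ'⁻¹, hω, h1, h2, w, hwp, hw, w', hwp', hw', hw0'⟩

lemma QuatModel.IsTwistedPure.inv {ω : Fˣ →* Ωˣ} (h : D.IsTwistedPure ψ m α ω Ξ) :
    D.IsTwistedPure ψ⁻¹ m α ω⁻¹ Ξ⁻¹ := by
  intro x hx
  rw [MonoidHom.inv_apply, MonoidHom.inv_apply, Units.val_inv_eq_inv_val, h x hx, mul_inv,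
    AddChar.inv_apply, AddChar.map_neg_eq_inv, Units.val_inv_eq_inv_val]

/-! ### Reduction to the eigenspaces of the groups `H` -/

variable (π) in
/-- The representation of `J` on the eigenspace of a character of `H`, twisted by `c ∘ nrm`. -/
noncomputable def typeRep (hΞ : (D.openPair m hm).IsType Ξ) (c : Fˣ →* Ωˣ) :
    Representation Ω (D.grpJ m hm) (eigen hm π Ξ) :=
  twistJ c (OpenPair.eigenRep π hΞ)

lemma typeRep_apply (hΞ : (D.openPair m hm).IsType Ξ) (c : Fˣ →* Ωˣ) (g : D.grpJ m hm)
    (v : eigen hm π Ξ) : typeRep π hΞ c g v =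
      (c (D.nrmUnits (g : Rˣ)) : Ω) • OpenPair.eigenRep π hΞ g v := rfl

lemma actsByPure_typeRep (hΞ : (D.openPair m hm).IsType Ξ) {c : Fˣ →* Ωˣ}
    (h : D.IsTwistedPure ψ m α c⁻¹ Ξ) : D.ActsByPure ψ α (typeRep π hΞ c) := by
  have h1 := h.isPure
  rw [show (c⁻¹)⁻¹ = c from MonoidHom.ext fun x => inv_inv _] at h1
  refine ⟨_, h1, fun x hx => LinearMap.ext fun v => ?_⟩
  rw [typeRep_apply]
  refine (congrArg _ (OpenPair.eigenRep_apply_H hΞ hx v)).trans ?_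
  rw [smul_smul, mul_comm]
  rfl

lemma isIrreducible_twist {G M : Type*} [Group G] [AddCommGroup M] [Module Ω M]
    {ρ : Representation Ω G M} (h : ρ.IsIrreducible) (c : G →* Ωˣ) :
    (twist c ρ).IsIrreducible :=
  isIrreducible_of_smul h (LinearEquiv.refl Ω M) fun g => ⟨g, c g, fun _ => rfl⟩

variable [IsAlgClosed Ω] [CharZero Ω]

/-- The characters `Ξ` and `Ξ'⁻¹` of the two groups `H` occur in `π` and `π'`, and they are obtained
from pure characters for `α` by opposite twists. -/
structure IsTypePair (ψ : AddChar F Ω) (hm : 1 ≤ m) (α : E) (π : Representation Ω Rˣ V)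
    (π' : Representation Ω R'ˣ V') (ω : Fˣ →* Ωˣ) (Ξ : D.grpH m →* Ωˣ) (Ξ' : D'.grpH m →* Ωˣ) :
    Prop extends IsSetting D D' ψ m α π π' where
  smooth_twist : IsSmoothChar ω
  pure : D.IsTwistedPure ψ m α ω Ξ
  pure' : D'.IsTwistedPure ψ m α ω Ξ'
  ne_bot : eigen hm π Ξ ≠ ⊥
  ne_bot' : eigen hm π' Ξ'⁻¹ ≠ ⊥

/-- The restriction of `φ` to the tensor product of the eigenspaces. -/
noncomputable def resEigen (φ : V ⊗[Ω] V' →ₗ[Ω] W) (p : Submodule Ω V) (p' : Submodule Ω V') :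
    p ⊗[Ω] p' →ₗ[Ω] W := φ ∘ₗ TensorProduct.map p.subtype p'.subtype

lemma resEigen_tmul {p : Submodule Ω V} {p' : Submodule Ω V'} (w : p) (w' : p') :
    resEigen φ p p' (w ⊗ₜ w') = φ ((w : V) ⊗ₜ (w' : V')) := rfl

lemma exists_tmul_ne_zero (h : φ ≠ 0) : ∃ v v', φ (v ⊗ₜ v') ≠ 0 := by
  by_contra! hcon
  exact h (TensorProduct.ext' fun v v' => by rw [hcon, LinearMap.zero_apply])

/-- A nonzero equivariant map singles out eigencharacters of the two groups `H`. -/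
lemma IsSetting.exists_isTypePair (S : IsSetting D D' ψ m α π π') (hτ : IsTauModel ψ α τ)
    (hφ : IsK1Equivariant π π' τ φ) (h0 : φ ≠ 0) :
    ∃ (ω : Fˣ →* Ωˣ) (Ξ : D.grpH m →* Ωˣ) (Ξ' : D'.grpH m →* Ωˣ),
      IsTypePair ψ hm α π π' ω Ξ Ξ' := by
  obtain ⟨v, v', hv⟩ := exists_tmul_ne_zero h0
  obtain ⟨ω, Ξ, Ξ', h1, h2, h3, w, -, hw, w', -, hw', hne⟩ := S.exists_eigen_pair hτ hφ
    ⊤ (fun _ _ _ _ => Submodule.mem_top) ⊤ (fun _ _ _ _ => Submodule.mem_top)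
    (v := v) Submodule.mem_top (v' := v') Submodule.mem_top hv
  refine ⟨ω, Ξ, Ξ', S, h1, h2, h3, fun h => ?_, fun h => ?_⟩
  · rw [h, Submodule.mem_bot] at hw
    rw [hw, TensorProduct.zero_tmul, map_zero] at hne
    exact hne rfl
  · rw [h, Submodule.mem_bot] at hw'
    rw [hw', TensorProduct.tmul_zero, map_zero] at hne
    exact hne rfl

namespace IsTypePair

lemma isType (h : IsTypePair ψ hm α π π' ω Ξ Ξ') : (D.openPair m hm).IsType Ξ :=
  h.pure.isType h.level hm h.minimal h.smooth_twist

lemma isType' (h : IsTypePair ψ hm α π π' ω Ξ Ξ') : (D'.openPair m hm).IsType Ξ'⁻¹ :=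
  (h.pure'.isType h.level hm h.minimal h.smooth_twist).inv

/-- The twist by `ω⁻¹ ∘ nrm` of the eigenspace of `Ξ` in `π`. -/
noncomputable abbrev rep (h : IsTypePair ψ hm α π π' ω Ξ Ξ') :
    Representation Ω (D.grpJ m hm) (eigen hm π Ξ) := typeRep π h.isType ω⁻¹

/-- The twist by `ω ∘ nrm` of the eigenspace of `Ξ'⁻¹` in `π'`. -/
noncomputable abbrev rep' (h : IsTypePair ψ hm α π π' ω Ξ Ξ') :
    Representation Ω (D'.grpJ m hm) (eigen hm π' Ξ'⁻¹) :=
  typeRep π' h.isType' ω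

lemma isIrreducible_rep (h : IsTypePair ψ hm α π π' ω Ξ Ξ') : h.rep.IsIrreducible :=
  isIrreducible_twist (OpenPair.isIrreducible_eigenRep h.smooth h.irr h.isType h.ne_bot) _

lemma isIrreducible_rep' (h : IsTypePair ψ hm α π π' ω Ξ Ξ') : h.rep'.IsIrreducible :=
  isIrreducible_twist (OpenPair.isIrreducible_eigenRep h.smooth' h.irr' h.isType' h.ne_bot') _

lemma finiteDimensional (h : IsTypePair ψ hm α π π' ω Ξ Ξ') :
    FiniteDimensional Ω (eigen hm π Ξ) :=
  OpenPair.finiteDimensional_eigen h.smooth h.irr h.isType h.ne_bot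

lemma finiteDimensional' (h : IsTypePair ψ hm α π π' ω Ξ Ξ') :
    FiniteDimensional Ω (eigen hm π' Ξ'⁻¹) :=
  OpenPair.finiteDimensional_eigen h.smooth' h.irr' h.isType' h.ne_bot'

lemma actsByPure (h : IsTypePair ψ hm α π π' ω Ξ Ξ') : D.ActsByPure ψ α h.rep :=
  actsByPure_typeRep _ (by
    rw [show (ω⁻¹)⁻¹ = ω from MonoidHom.ext fun x => inv_inv _]; exact h.pure)

lemma actsByPure' (h : IsTypePair ψ hm α π π' ω Ξ Ξ') : D'.ActsByPure ψ⁻¹ α h.rep' :=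
  actsByPure_typeRep _ h.pure'.inv

end IsTypePair

lemma eq_zero_of_mem_eigen_of_mem_defect (hπ : IsSmooth π) (hΞ : (D.openPair m hm).IsType Ξ) {v : V}
    (h1 : v ∈ eigen hm π Ξ) (h2 : v ∈ OpenPair.defect (P := D.openPair m hm) π Ξ) : v = 0 :=
  congrArg Subtype.val ((OpenPair.eigenProj_of_mem hπ hΞ ⟨v, h1⟩).symm.trans
    ((OpenPair.eigenProj_eq_zero hπ hΞ).2 h2))

/-- A nonzero value of `φ` on the complement of the eigenspace would give an eigenvector there, and its
character would be the same by uniqueness. -/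
lemma IsTypePair.map_defect (h : IsTypePair ψ hm α π π' ω Ξ Ξ') (hτ : IsTauModel ψ α τ)
    (hφ : IsK1Equivariant π π' τ φ) {v : V}
    (hv : v ∈ OpenPair.defect (P := D.openPair m hm) π Ξ) (v' : V') : φ (v ⊗ₜ v') = 0 := by
  by_contra h0
  obtain ⟨ω₂, Ξ₂, Ξ₂', h1, h2, h3, w, hwd, hw, w', -, hw', hne⟩ := h.exists_eigen_pair hτ hφ
    (OpenPair.defect (P := D.openPair m hm) π Ξ)
    (fun g hg x hx => h.isType.map_mem_defect (D.grpH_le_grpJ hm hg) hx)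
    ⊤ (fun _ _ _ _ => Submodule.mem_top) hv (v' := v') Submodule.mem_top h0
  have hw0 : w ≠ 0 := by
    rintro rfl
    rw [TensorProduct.zero_tmul, map_zero] at hne
    exact hne rfl
  have e : Ξ₂ = Ξ := h2.eq D h.level hm h.minimal h.smooth_twist h.pure h.smooth h.irr
    (fun hb => hw0 ((Submodule.mem_bot Ω).1 (hb ▸ hw))) h.ne_bot
  exact hw0 (eq_zero_of_mem_eigen_of_mem_defect h.smooth h.isType (e ▸ hw) hwd)

lemma IsTypePair.map_defect' (h : IsTypePair ψ hm α π π' ω Ξ Ξ') (hτ : IsTauModel ψ α τ)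
    (hφ : IsK1Equivariant π π' τ φ) (v : V) {v' : V'}
    (hv' : v' ∈ OpenPair.defect (P := D'.openPair m hm) π' Ξ'⁻¹) : φ (v ⊗ₜ v') = 0 := by
  by_contra h0
  obtain ⟨ω₂, Ξ₂, Ξ₂', h1, h2, h3, w, -, hw, w', hwd', hw', hne⟩ := h.exists_eigen_pair hτ hφ
    ⊤ (fun _ _ _ _ => Submodule.mem_top) (OpenPair.defect (P := D'.openPair m hm) π' Ξ'⁻¹)
    (fun g hg x hx => h.isType'.map_mem_defect (D'.grpH_le_grpJ hm hg) hx)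
    (v := v) Submodule.mem_top hv' h0
  have hw0 : w' ≠ 0 := by
    rintro rfl
    rw [TensorProduct.tmul_zero, map_zero] at hne
    exact hne rfl
  have e : Ξ₂'⁻¹ = Ξ'⁻¹ := h3.inv.eq D' h.level.inv hm h.minimal h.smooth_twist.inv h.pure'.inv
    h.smooth' h.irr' (fun hb => hw0 ((Submodule.mem_bot Ω).1 (hb ▸ hw'))) h.ne_bot'
  exact hw0 (eq_zero_of_mem_eigen_of_mem_defect h.smooth' h.isType' (e ▸ hw') hwd')

lemma sub_eigenProj_mem_defect (hπ : IsSmooth π) (hΞ : (D.openPair m hm).IsType Ξ) (v : V) :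
    v - (OpenPair.eigenProj hπ hΞ v : V) ∈ OpenPair.defect (P := D.openPair m hm) π Ξ := by
  refine (OpenPair.eigenProj_eq_zero hπ hΞ).1 ?_
  rw [map_sub]
  exact sub_eq_zero.2 (OpenPair.eigenProj_of_mem hπ hΞ (OpenPair.eigenProj hπ hΞ v)).symm

/-- An equivariant map is determined by its restriction to the eigenspaces. -/
lemma IsTypePair.eq_resEigen_comp (h : IsTypePair ψ hm α π π' ω Ξ Ξ') (hτ : IsTauModel ψ α τ)
    (hφ : IsK1Equivariant π π' τ φ) :
    φ = resEigen φ (eigen hm π Ξ) (eigen hm π' Ξ'⁻¹) ∘ₗ TensorProduct.map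
      (OpenPair.eigenProj h.smooth h.isType) (OpenPair.eigenProj h.smooth' h.isType') := by
  refine TensorProduct.ext' fun v v' => ?_
  rw [LinearMap.comp_apply, TensorProduct.map_tmul, resEigen_tmul]
  have h1 := h.map_defect hτ hφ (sub_eigenProj_mem_defect h.smooth h.isType v) v'
  have h2 := h.map_defect' hτ hφ (OpenPair.eigenProj h.smooth h.isType v : V)
    (sub_eigenProj_mem_defect h.smooth' h.isType' v')
  rw [TensorProduct.sub_tmul, map_sub, sub_eq_zero] at h1
  rw [TensorProduct.tmul_sub, map_sub, sub_eq_zero] at h2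
  exact h1.trans h2

/-- The norms of the two components of an element of `𝒦` differ by a square. -/
lemma exists_nrmUnits_eq (k : grpK D D' m hm) : ∃ v : Fˣ, algebraMap F E v - 1 ∈ pPow E m ∧
    D.nrmUnits k.1.1 = D'.nrmUnits k.1.2 * (v * v) := by
  obtain ⟨e, l, hl, hk⟩ := k.2
  have hf := D.depth_facts m
  have hf' := D'.depth_facts m
  have h1 := InCong.nrm_mem D (a := m) (b := D.bJ m) (by omega) (by omega) hl.1
  have h2 := InCong.nrm_mem D' (a := m) (b := D'.bJ m) (by omega) (by omega) hl.2
  have h3 := mul_sub_one_mem (by omega) h1 (inv_sub_one_mem (by omega) h2)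
  obtain ⟨v, hv, hv'⟩ := exists_sqrt_units (z := D.nrmUnits l.1 * (D'.nrmUnits l.2)⁻¹)
    (i := m) (by omega) (by
      rw [Units.val_mul, map_mul (algebraMap F E), Units.val_inv_eq_inv_val,
        map_inv₀ (algebraMap F E)]
      exact h3)
  refine ⟨v, hv', ?_⟩
  rw [hk]
  change D.nrmUnits (D.jUnits e * l.1) = D'.nrmUnits (D'.jUnits e * l.2) * (v * v)
  rw [← hv, map_mul, map_mul, nrmUnits_jUnits, nrmUnits_jUnits]
  rw [mul_assoc, mul_comm (D'.nrmUnits l.2), inv_mul_cancel_right]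

/-- The restriction of an equivariant map to the twisted eigenspaces is equivariant for the whole
of `𝒦`, because `𝒦` is generated by `𝒦¹` and by scalars that act in the same way on both sides. -/
lemma IsTypePair.resEigen_map (h : IsTypePair ψ hm α π π' ω Ξ Ξ') (hτ : IsTauModel ψ α τ)
    (hφ : IsK1Equivariant π π' τ φ) (k : grpK D D' m hm) (x) :
    resEigen φ _ _ (tensorK h.rep h.rep' k x) = τ k (resEigen φ _ _ x) := by
  set σ := tensorK h.rep h.rep' with hσ
  set f := resEigen φ (eigen hm π Ξ) (eigen hm π' Ξ'⁻¹) with hf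
  have hK1 (k : grpK D D' m hm) (hk : D.nrmUnits k.1.1 = D'.nrmUnits k.1.2) :
      f ∘ₗ σ k = τ k ∘ₗ f := by
    refine TensorProduct.ext' fun w w' => ?_
    rw [LinearMap.comp_apply, LinearMap.comp_apply, hσ, tensorK_apply, TensorProduct.map_tmul]
    have e2 (a b : Ω) (x : eigen hm π Ξ) (y : eigen hm π' Ξ'⁻¹) :
        f ((a • x) ⊗ₜ (b • y)) = (a * b) • f (x ⊗ₜ y) := by
      rw [TensorProduct.smul_tmul_smul, map_smul]
    refine (e2 _ _ _ _).trans ?_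
    have h1 := hφ k hk w w'
    have h2 : ((ω⁻¹ (D.nrmUnits k.1.1) : Ωˣ) : Ω) * ω (D'.nrmUnits k.1.2) = 1 := by
      rw [hk, MonoidHom.inv_apply, Units.inv_mul]
    refine Eq.trans (congrArg₂ _ h2 rfl) ?_
    rw [one_smul]
    exact h1
  have hW (k : grpK D D' m hm) (hk : k ∈ subW D D' m hm) : f ∘ₗ σ k = τ k ∘ₗ f := by
    rw [hσ, tensorK_subW h.actsByPure h.actsByPure' hk, hτ.one_add k hk]
    ext; simp
  -- correct `k` by the scalar `v ∈ 1 + W` of the second group to make the norms equal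
  obtain ⟨v, hv, hk⟩ := exists_nrmUnits_eq k
  have hmem : ((1, scalar v) : Rˣ × R'ˣ) ∈ (D.grpW m hm).prod (D'.grpW m hm) :=
    ⟨Subgroup.one_mem _, D'.inCong_scalar hv _⟩
  set k' : grpK D D' m hm := ⟨(1, scalar v), mem_grpK_of_mem (prod_grpW_le hmem)⟩
  have hk' : k' ∈ subW D D' m hm := hmem
  have h1 := hK1 (k * k') (by
    change D.nrmUnits (k.1.1 * 1) = D'.nrmUnits (k.1.2 * scalar v)
    rw [mul_one, map_mul, D'.nrmUnits_scalar, hk])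
  have h2 := hW k'⁻¹ (Subgroup.inv_mem _ hk')
  have e : k = k * k' * k'⁻¹ := (mul_inv_cancel_right _ _).symm
  have h3 : f ∘ₗ σ k = τ k ∘ₗ f := by
    rw [e, map_mul σ, map_mul τ, Module.End.mul_eq_comp, Module.End.mul_eq_comp,
      ← LinearMap.comp_assoc, h1, LinearMap.comp_assoc, h2, LinearMap.comp_assoc]
  exact LinearMap.congr_fun h3 x

lemma IsTauModel.of_equiv {W₁ W₂ : Type*} [AddCommGroup W₁] [Module Ω W₁] [AddCommGroup W₂]
    [Module Ω W₂] {τ₁ : Representation Ω (grpK D D' m hm) W₁}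
    {τ₂ : Representation Ω (grpK D D' m hm) W₂} (h : IsTauModel ψ α τ₂) (f : W₁ ≃ₗ[Ω] W₂)
    (hf : ∀ k w, f (τ₁ k w) = τ₂ k (f w)) (hirr : τ₁.IsIrreducible) : IsTauModel ψ α τ₁ := by
  have he (k : grpK D D' m hm) : τ₁ k = f.symm.conj (τ₂ k) := by
    ext v
    rw [LinearEquiv.conj_apply_apply, LinearEquiv.symm_symm, ← hf, LinearEquiv.symm_apply_apply]
  have hc (c : Ω) : f.symm.conj (c • (1 : W₂ →ₗ[Ω] W₂)) = c • 1 := by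
    ext v; simp [LinearEquiv.conj_apply_apply]
  refine ⟨hirr, fun e he' => ?_, fun k hk => ?_, fun hr e => ?_, fun hu ζ hζ => ?_⟩
  · rw [he, h.trivial e he', ← one_smul Ω (1 : W₂ →ₗ[Ω] W₂), hc, one_smul]
  · rw [he, h.one_add k hk, hc]
  · rw [he, h.ramified hr, hc]
  · rw [he, LinearMap.trace_conj', h.unramified hu ζ hζ]

/-- If `φ` is a nonzero equivariant map, then the tensor product of the two twisted eigenspaces is
isomorphic to `τ_α`, and every other equivariant map is a multiple of `φ`. -/
lemma IsTypePair.of_ne_zero (h : IsTypePair ψ hm α π π' ω Ξ Ξ') (hτ : IsTauModel ψ α τ)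
    (hφ : IsK1Equivariant π π' τ φ) (h0 : φ ≠ 0) : IsTauModel ψ α (tensorK h.rep h.rep') ∧
    ∀ φ₂, IsK1Equivariant π π' τ φ₂ → ∃ c : Ω, φ₂ = c • φ := by
  have hd := h.finiteDimensional
  have hd' := h.finiteDimensional'
  have hσ := isIrreducible_tensorK h.minimal h.toIsModelPair h.isIrreducible_rep
    h.isIrreducible_rep' h.actsByPure h.actsByPure'
  have hf := h.resEigen_map hτ hφ
  have hbij := bijective_of_equivariant hσ hτ.irreducible _ hf fun h1 => h0 (by
    rw [h.eq_resEigen_comp hτ hφ, h1, LinearMap.zero_comp])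
  let f := LinearEquiv.ofBijective _ hbij
  refine ⟨hτ.of_equiv f hf hσ, fun φ₂ hφ₂ => ?_⟩
  have hf₂ := h.resEigen_map hτ hφ₂
  obtain ⟨c, hc⟩ := exists_eq_smul_of_commute hσ (f.symm.toLinearMap ∘ₗ resEigen φ₂ _ _)
    fun k x => by
      rw [LinearMap.comp_apply, hf₂]
      apply f.injective
      rw [LinearEquiv.coe_coe, LinearEquiv.apply_symm_apply]
      refine Eq.trans ?_ (hf _ _).symm
      exact congrArg _ (f.apply_symm_apply _).symm
  refine ⟨c, ?_⟩
  refine (h.eq_resEigen_comp hτ hφ₂).trans ?_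
  refine Eq.trans ?_ (congrArg (c • ·) (h.eq_resEigen_comp hτ hφ)).symm
  change _ = c • (_ ∘ₗ _)
  rw [← LinearMap.smul_comp]
  congr 1
  refine LinearMap.ext fun x => ?_
  have h1 := congrArg f (hc x)
  rw [LinearMap.comp_apply, LinearEquiv.coe_coe, LinearEquiv.apply_symm_apply, map_smul] at h1
  exact h1

/-- Conversely, if the tensor product of the two twisted eigenspaces satisfies the conditions that
characterise `τ_α`, then there is a nonzero equivariant map. -/
lemma IsTypePair.exists_ne_zero (h : IsTypePair ψ hm α π π' ω Ξ Ξ') (hτ : IsTauModel ψ α τ)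
    (hT : IsTauModel ψ α (tensorK h.rep h.rep')) :
    ∃ φ : V ⊗[Ω] V' →ₗ[Ω] W, φ ≠ 0 ∧ IsK1Equivariant π π' τ φ := by
  obtain ⟨f, hf0, hf⟩ := hT.exists_hom hτ h.level h.minimal h.toIsModelPair
  refine ⟨f ∘ₗ TensorProduct.map (OpenPair.eigenProj h.smooth h.isType)
    (OpenPair.eigenProj h.smooth' h.isType'), fun hz => ?_, fun k hk v v' => ?_⟩
  · refine hf0 (TensorProduct.ext' fun w w' => ?_)
    have h1 := LinearMap.congr_fun hz ((w : V) ⊗ₜ (w' : V'))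
    rw [LinearMap.comp_apply, TensorProduct.map_tmul] at h1
    exact (congrArg f (congrArg₂ (· ⊗ₜ ·)
      (OpenPair.eigenProj_of_mem h.smooth h.isType w)
      (OpenPair.eigenProj_of_mem h.smooth' h.isType' w'))).symm.trans h1
  · rw [LinearMap.comp_apply, LinearMap.comp_apply, TensorProduct.map_tmul, TensorProduct.map_tmul,
      ← hf]
    congr 1
    rw [tensorK_apply, TensorProduct.map_tmul]
    have e3 (a b : Ω) (x : eigen hm π Ξ) (y : eigen hm π' Ξ'⁻¹) :
        (a • x) ⊗ₜ[Ω] (b • y) = (a * b) • (x ⊗ₜ y) := TensorProduct.smul_tmul_smul _ _ _ _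
    refine Eq.trans ?_ (e3 _ _ _ _).symm
    have h2 : ((ω⁻¹ (D.nrmUnits k.1.1) : Ωˣ) : Ω) * ω (D'.nrmUnits k.1.2) = 1 := by
      rw [hk, MonoidHom.inv_apply, Units.inv_mul]
    refine Eq.trans ?_ (congrArg₂ _ h2 rfl).symm
    rw [one_smul]
    exact congrArg₂ (· ⊗ₜ ·) (OpenPair.eigenProj_map h.smooth h.isType (fstK D D' m hm k) v)
      (OpenPair.eigenProj_map h.smooth' h.isType' (sndK D D' m hm k) v')

lemma sgn_inv (e : Eˣ) : (sgn F E Ω e)⁻¹ = sgn F E Ω e := by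
  by_cases hu : Unramified F E
  · rw [sgn_of_unramified hu, inv_one]
  · rw [inv_eq_iff_mul_eq_one]
    refine Units.ext ?_
    rw [Units.val_mul, sgn_of_ramified hu, ← mul_zpow, neg_one_mul, neg_neg, one_zpow,
      Units.val_one]

/-! ### Characters given by minimal elements -/

lemma GivenByOn.anti {n n' : ℕ} {χ : Eˣ →* Ωˣ} (h : GivenByOn ψ β n χ) (hn : n ≤ n') :
    GivenByOn ψ β n' χ := fun u hu => h u (pPow_anti (by exact_mod_cast hn) hu)

lemma GivenByOn.eq_one {χ : Eˣ →* Ωˣ} (h : GivenByOn ψ β m χ) (hψ : IsLevelZero F ψ)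
    (hβ : IsMinimalElt F m β) {u : Eˣ} (hu : (u : E) - 1 ∈ pPow E (m + 1)) : χ u = 1 :=
  Units.ext <| by
    rw [h u (pPow_anti (by omega) hu), QuatModel.psi_eq_one hψ hβ.mem_pPow hu, Units.val_one]

lemma isSmoothChar_of_eq_one {χ : Eˣ →* Ωˣ} {n : ℕ}
    (h : ∀ u : Eˣ, (u : E) - 1 ∈ pPow E n → χ u = 1) : IsSmoothChar χ := by
  rw [QuatModel.isSmoothChar_iff]
  have h1 : Filter.Tendsto (fun u : Eˣ => (u : E) - 1) (𝓝 1) (𝓝 0) := by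
    have : Continuous fun u : Eˣ => (u : E) - 1 := Units.continuous_val.sub continuous_const
    simpa using this.tendsto 1
  filter_upwards [h1 (pPow_mem_nhds E n)] with u hu
  exact h u hu

lemma exists_unit_eq_one_add {n : ℕ} (hn : 1 ≤ n) {y : E} (hy : y ∈ pPow E n) :
    ∃ u : Eˣ, (u : E) = 1 + y := by
  obtain ⟨h0, -⟩ := ne_zero_and_ord_eq_zero (u := 1 + y)
    (by rw [add_sub_cancel_left]; exact pPow_anti (by exact_mod_cast hn) hy)
  exact ⟨Units.mk0 _ h0, rfl⟩

/-- A character which is given on `U_E ^ m` by a minimal element of valuation `-m` is given on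
`U_E ^ (⌊m / 2⌋ + 1)` by another one. -/
lemma GivenByOn.exists_half {χ : Eˣ →* Ωˣ} (h : GivenByOn ψ α m χ)
    (hψ : IsLevelZero F ψ) (hm : 1 ≤ m) (hα : IsMinimalElt F m α) :
    ∃ β : E, IsMinimalElt F m β ∧ GivenByOn ψ β (m / 2 + 1) χ := by
  obtain ⟨β, hβ⟩ := exists_givenByOn (m := m) hψ (n := m / 2 + 1) (by omega) (by omega) χ
    fun u hu => h.eq_one hψ hα hu
  refine ⟨β, hα.congr ?_, hβ⟩
  by_contra hcon
  obtain ⟨y, hy, hne⟩ := exists_char_ne_one hψ hcon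
  obtain ⟨u, hu⟩ := exists_unit_eq_one_add hm hy
  have hu' : (u : E) - 1 = y := by rw [hu]; ring
  have h1 := h u (by rw [hu']; exact hy)
  rw [hβ.anti (show m / 2 + 1 ≤ m by omega) u (by rw [hu']; exact hy), hu'] at h1
  refine hne ?_
  rw [sub_mul, map_sub, AddChar.map_sub_eq_div, h1, div_self]
  exact (AddChar.val_isUnit ψ _).ne_zero

/-- The level of a character of `Eˣ` is determined by its restriction to the elements of norm one:
if `χ (1 + x) = ψ_E (β x)`, then `χ ((1 + x) / (1 + x̄)) = ψ_E ((β - β̄) x)`. -/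
lemma le_of_mul_comp_norm_eq {m₁ m₂ : ℕ} {β₁ β₂ : E} {χ₁ χ₂ : Eˣ →* Ωˣ} {ω₁ ω₂ : Fˣ →* Ωˣ}
    (hψ : IsLevelZero F ψ) (hm₂ : 1 ≤ m₂) (hβ₁ : IsMinimalElt F m₁ β₁)
    (hβ₂ : IsMinimalElt F m₂ β₂) (h₁ : GivenByOn ψ β₁ m₁ χ₁) (h₂ : GivenByOn ψ β₂ m₂ χ₂)
    (h : χ₁ * ω₁.comp (normUnits F E) = χ₂ * ω₂.comp (normUnits F E)) : m₂ ≤ m₁ := by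
  by_contra! hlt
  -- if `m₁ < m₂`, test on `(1 + y) / (1 + σ y)` with `y ∈ 𝔭_E ^ m₂`: there `χ₁` is trivial and `χ₂` is not
  obtain ⟨y, hy, hne⟩ := exists_char_ne_one hψ hβ₂.sub_conj_not_mem
  have hy' := conj_mem_pPow (F := F) hy
  obtain ⟨a, ha⟩ := exists_unit_eq_one_add hm₂ hy
  obtain ⟨b, hb⟩ := exists_unit_eq_one_add hm₂ hy'
  have hab : normUnits F E a = normUnits F E b := by
    refine Units.ext ?_
    change Algebra.norm F (a : E) = Algebra.norm F (b : E)
    rw [← norm_conj, ha, hb, map_add, map_one]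
  have ha' : (a : E) - 1 = y := by rw [ha]; ring
  have hb' : (b : E) - 1 = conj F E y := by rw [hb]; ring
  have hχ (χ : Eˣ →* Ωˣ) (ω : Fˣ →* Ωˣ) : (χ * ω.comp (normUnits F E)) (a / b) = χ a / χ b := by
    rw [MonoidHom.mul_apply, MonoidHom.comp_apply, _root_.map_div, _root_.map_div, hab, div_self', map_one,
      mul_one]
  have e := DFunLike.congr_fun h (a / b)
  rw [hχ, hχ, h₁.eq_one hψ hβ₁ (by rw [ha']; exact pPow_anti (by omega) hy),
    h₁.eq_one hψ hβ₁ (by rw [hb']; exact pPow_anti (by omega) hy'), div_one, eq_comm,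
    div_eq_one] at e
  have e2 := congrArg Units.val e
  rw [h₂ a (by rwa [ha']), h₂ b (by rwa [hb']), ha', hb'] at e2
  refine hne ?_
  have e3 : Algebra.trace F E (conj F E β₂ * y) = Algebra.trace F E (β₂ * conj F E y) := by
    rw [← trace_conj, map_mul, conj_conj]
  rw [sub_mul, map_sub, e3, AddChar.map_sub_eq_div, e2, div_self]
  exact (AddChar.val_isUnit ψ _).ne_zero

variable {M M' : Type*} [AddCommGroup M] [Module Ω M] [AddCommGroup M'] [Module Ω M']
variable {Λ : Representation Ω (D.grpJ m hm) M}

namespace QuatModel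

lemma jUnits_mem_grpH {u : Eˣ} (hu : (u : E) - 1 ∈ pPow E 1) : D.jUnits u ∈ D.grpH m := by
  refine ⟨?_, ?_⟩
  · rw [coe_jUnits, X_j]; exact hu
  · rw [coe_jUnits, Y_j]; exact zero_mem_pPow _

/-! ### Representations of `J` that are given by a minimal element -/

/-- The elements `1 + x` of `J` with `x` in `𝔭_E ^ (⌊m / 2⌋ + 1)` along `E`, and of depth `bH` along
the complement, act by `ψ_E (β x)`. -/
def IsGivenBy (D : QuatModel F E R) (ψ : AddChar F Ω) (β : E)
    (Λ : Representation Ω (D.grpJ m hm) M) : Prop :=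
  ∀ g : D.grpJ m hm, D.InCong (m / 2 + 1 : ℕ) (D.bH m) ((g : Rˣ) : R) →
    Λ g = ψ (Algebra.trace F E (β * (D.X (g : Rˣ) - 1))) • 1

lemma IsLambda.of_eq {χ' : Eˣ →* Ωˣ} (h : D.IsLambda χ Λ) (e : χ = χ') : D.IsLambda χ' Λ := e ▸ h

lemma IsLambda.nontrivial (h : D.IsLambda χ Λ) : Nontrivial M := by
  refine Module.nontrivial_of_finrank_pos (R := Ω) ?_
  rw [h.finrank_eq]
  split_ifs
  · exact one_pos
  · exact Nat.card_pos

lemma IsLambda.actsByPure (h : D.IsLambda χ Λ) (hΛ : D.IsGivenBy ψ β Λ) :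
    D.ActsByPure ψ β Λ := by
  have := h.nontrivial
  have hle : D.grpH m ≤ D.grpJ m hm := D.grpH_le_grpJ hm
  obtain ⟨Θ, hΘ⟩ := exists_char_of_smul (ρ := Λ.comp (Subgroup.inclusion hle)) (by
    rintro ⟨g, hg⟩
    obtain ⟨e, he, hu⟩ := D.exists_jUnits_inv_mul le_rfl hg
    have hm1 : (D.jUnits e)⁻¹ * g ∈ D.grpJ m hm :=
      (D.grpJ m hm).mul_mem ((D.grpJ m hm).inv_mem (D.jUnits_mem_grpJ hm e)) (hle hg)
    refine ⟨(χ e : Ω) *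
      ψ (Algebra.trace F E (β * (D.X ((D.jUnits e)⁻¹ * g : Rˣ) - 1))), ?_⟩
    have e1 : Subgroup.inclusion hle ⟨g, hg⟩ = D.jJ hm e * ⟨_, hm1⟩ :=
      Subtype.ext (mul_inv_cancel_left (D.jUnits e) g).symm
    rw [MonoidHom.comp_apply, e1, map_mul, h.scalar e (.inr (.inr (he ▸ hg.1))),
      hΛ ⟨_, hm1⟩ (hu _),
      smul_mul_smul_comm, one_mul])
  refine ⟨Θ, fun g hg => ?_, fun g hg => hΘ ⟨g, hg⟩⟩
  have h1 := hΘ g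
  have h2 := hΛ (Subgroup.inclusion hle g)
    ⟨pPow_anti (by omega) hg, g.2.2⟩
  obtain ⟨v, hv⟩ := exists_ne (0 : M)
  have h3 := LinearMap.congr_fun (h1.symm.trans h2) v
  exact smul_left_injective Ω hv h3

lemma ActsByPure.givenByOn (hp : D.ActsByPure ψ α Λ) (h : D.IsLambda χ Λ) :
    GivenByOn ψ α m χ := by
  intro u hu
  have := h.nontrivial
  have hu1 : (u : E) - 1 ∈ pPow E 1 := pPow_anti (by omega) hu
  obtain ⟨Θ, hΘ, hs⟩ := hp
  have h1 := hs _ (D.jUnits_mem_grpH (m := m) hu1)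
  obtain ⟨v, hv⟩ := exists_ne (0 : M)
  have h3 := LinearMap.congr_fun ((h.scalar u (.inr (.inr hu1))).symm.trans h1) v
  have h4 := smul_left_injective Ω hv h3
  rw [h4, hΘ _ (by rw [coe_jUnits, X_j]; exact hu), coe_jUnits, X_j]

lemma ActsByPure.isGivenBy (hp : D.ActsByPure ψ α Λ) (hψ : IsLevelZero F ψ)
    (hα : IsMinimalElt F m α) (h : D.IsLambda χ Λ) (hχ : GivenByOn ψ β (m / 2 + 1) χ) :
    D.IsGivenBy ψ β Λ := by
  rintro ⟨g, hgJ⟩ hg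
  have hgH : g ∈ D.grpH m := D.mem_grpH.2 (InCong.anti D hg (by push_cast; omega) le_rfl)
  obtain ⟨Θ, hΘ, hs⟩ := hp
  obtain ⟨h0, -⟩ := ne_zero_and_ord_eq_zero hgH.1
  set e : Eˣ := Units.mk0 _ h0
  have he : D.jUnits e ∈ D.grpH m := D.jUnits_mem_grpH hgH.1
  refine (hs g hgH).trans ?_
  rw [hΘ.eq_of_X_eq D hψ hα (h' := ⟨D.jUnits e, he⟩) (by rw [coe_jUnits, X_j]; rfl), ← hs]
  refine (h.scalar e (.inr (.inr hgH.1))).trans ?_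
  rw [hχ e hg.1]
  rfl

variable {σ : Representation Ω (D.grpJ m hm) M} {ω₁ : Fˣ →* Ωˣ} {Θ : D.grpH m →* Ωˣ}

lemma IsTwistedPure.actsByPure (h : D.IsTwistedPure ψ m α ω Ξ)
    (hσ : OpenPair.LiesOver (P := D.openPair m hm) σ Ξ) :
    D.ActsByPure ψ α (twistJ ω⁻¹ σ) := by
  refine ⟨_, h.isPure, fun g hg => LinearMap.ext fun v => ?_⟩
  rw [twist_apply]
  refine (congrArg _ (LinearMap.congr_fun (hσ g hg) v)).trans ?_
  change (_ : Ω) • ((_ : Ω) • v) = _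
  rw [smul_smul, mul_comm]
  rfl

/-- If `χ₁ (ω₁ ∘ N) = χ₂ (ω ∘ N)`, then twisting by `ω₁` turns the pure character for `χ₁` into the
twist by `ω` of the pure character for `χ₂`. The reason is that `nrm h` differs from `N (X h)` by the
square of an element of `1 + 𝔭_E ^ (m + 1)`, on which `χ₁` and `χ₂` are trivial. -/
lemma IsPure.isTwistedPure (hψ : IsLevelZero F ψ) (hm : 1 ≤ m) (hα : IsMinimalElt F m α)
    (hβ : IsMinimalElt F m β) (hΘ : D.IsPure ψ m β Θ) {χ₁ χ₂ : Eˣ →* Ωˣ}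
    (h₁ : GivenByOn ψ β m χ₁) (h₂ : GivenByOn ψ α m χ₂)
    (h : χ₁ * ω₁.comp (normUnits F E) = χ₂ * ω.comp (normUnits F E)) :
    D.IsTwistedPure ψ m α ω (Θ * (ω₁.comp D.nrmUnits).comp (D.grpH m).subtype) := by
  intro g hg
  have hf := D.depth_facts m
  obtain ⟨h0, h0'⟩ := ne_zero_and_ord_eq_zero g.2.1
  set e : Eˣ := Units.mk0 _ h0 with he
  -- `nrm g / N(X g) = 1 - d N(Y g) / N(X g)`
  have hz : algebraMap F E ((D.nrmUnits g * (normUnits F E e)⁻¹ : Fˣ) : F) - 1 ∈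
      pPow E (m + 1) := by
    have hc0 : conj F E (D.X (g : Rˣ)) ≠ 0 := hom_ne_zero h0
    have e1 : algebraMap F E ((D.nrmUnits g * (normUnits F E e)⁻¹ : Fˣ) : F) - 1 =
        -(algebraMap F E D.d * D.Y (g : Rˣ) * conj F E (D.Y (g : Rˣ)) *
          ((D.X (g : Rˣ))⁻¹ * (conj F E (D.X (g : Rˣ)))⁻¹)) := by
      rw [Units.val_mul, map_mul (algebraMap F E), Units.val_inv_eq_inv_val,
        map_inv₀ (algebraMap F E), coe_nrmUnits, algebraMap_nrm]
      change _ * (algebraMap F E (Algebra.norm F (D.X (g : Rˣ))))⁻¹ - 1 = _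
      rw [algebraMap_norm]
      field_simp
      ring
    rw [e1]
    refine neg_mem_pPow (mem_pPow_of_eq (mul_mem_pPow (pPow_anti (a := m + 1) ?_
      (D.d_mul_mem g.2.2 g.2.2)) (mul_mem_pPow (inv_mem_pPow h0) (inv_mem_pPow hc0))) ?_)
    · omega
    · rw [ord_conj, h0']; ring
  obtain ⟨v, hv, hv'⟩ := exists_sqrt_units (by omega) hz
  set v' : Eˣ := Units.map (algebraMap F E : F →* E) v
  have hN : normUnits F E v' = v * v := by
    refine Units.ext ?_
    change Algebra.norm F (algebraMap F E (v : F)) = v * v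
    rw [Algebra.norm_algebraMap, Algebra.IsQuadraticExtension.finrank_eq_two, pow_two]
  have hnrm : D.nrmUnits g = normUnits F E e * normUnits F E v' := by
    rw [hN, ← hv, mul_comm, inv_mul_cancel_right]
  -- evaluate the relation between the characters at `X g` times the square root `v`
  have e1 := DFunLike.congr_fun h (e * v')
  rw [MonoidHom.mul_apply, MonoidHom.mul_apply, map_mul χ₁, map_mul χ₂,
    h₁.eq_one hψ hβ (u := v') hv', h₂.eq_one hψ hα (u := v') hv', mul_one, mul_one,
    MonoidHom.comp_apply, MonoidHom.comp_apply, map_mul (normUnits F E), ← hnrm] at e1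
  have e2 := congrArg Units.val e1
  rw [Units.val_mul, Units.val_mul, h₁ e hg, h₂ e hg] at e2
  rw [MonoidHom.mul_apply, Units.val_mul, hΘ g hg]
  exact e2

end QuatModel

/-! ### The correspondence for the models -/

/-- `Λ` is the representation `Λ_{χ₀}` of `J` for a decomposition `χ = χ₀ (ω ∘ N)`. The sign
character `ε` is `1` for `GL₂` and `e ↦ (-1) ^ (f v_E(e))` for `Bˣ`. -/
def QuatModel.Presents (D : QuatModel F E R) (ψ : AddChar F Ω) (ε χ : Eˣ →* Ωˣ) {m : ℕ}
    {hm : 1 ≤ m} {d : ℕ} (ω : Fˣ →* Ωˣ) (Λ : Representation Ω (D.grpJ m hm) (Fin d → Ω)) : Prop :=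
  ∃ (β : E) (χ₀ : Eˣ →* Ωˣ), IsPresentation ψ m β χ χ₀ ω ∧ D.IsLambda (χ₀ * ε) Λ ∧
    D.IsGivenBy ψ β Λ

/-- `π ≅ π_χ`, in terms of a model. -/
def QuatModel.IsPi (D : QuatModel F E R) (ψ : AddChar F Ω) (ε χ : Eˣ →* Ωˣ)
    (π : Representation Ω Rˣ V) : Prop :=
  ∃ (m : ℕ) (hm : 1 ≤ m) (d : ℕ) (ω : Fˣ →* Ωˣ)
    (Λ : Representation Ω (D.grpJ m hm) (Fin d → Ω)),
    D.Presents ψ ε χ ω Λ ∧ Nonempty (π.Equiv (twist (ω.comp D.nrmUnits) (ind Λ)))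

/-- `π` is the contragredient of `π_χ`, in terms of a model. -/
def QuatModel.IsPiDual (D : QuatModel F E R) (ψ : AddChar F Ω) (ε χ : Eˣ →* Ωˣ)
    (π : Representation Ω Rˣ V) : Prop :=
  ∃ (m : ℕ) (hm : 1 ≤ m) (d : ℕ) (ω : Fˣ →* Ωˣ)
    (Λ : Representation Ω (D.grpJ m hm) (Fin d → Ω)),
    D.Presents ψ ε χ ω Λ ∧
      Nonempty (π.Equiv (contragredient (twist (ω.comp D.nrmUnits) (ind Λ))))

variable {ε χ₀ χ' : Eˣ →* Ωˣ}

/-- A representation of `J` over a twisted pure character comes from a presentation. -/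
lemma QuatModel.IsTwistedPure.presents {d : ℕ} {σ : Representation Ω (D.grpJ m hm) (Fin d → Ω)}
    (h : D.IsTwistedPure ψ m α ω Ξ) (hσ : OpenPair.LiesOver (P := D.openPair m hm) σ Ξ)
    (hψ : IsLevelZero F ψ) (hα : IsMinimalElt F m α) (hω : IsSmoothChar ω)
    (hε : ∀ u : Eˣ, (u : E) - 1 ∈ pPow E 1 → ε u = 1)
    (hl : D.IsLambda (χ₀ * ε * ω.comp (normUnits F E)) σ) :
    GivenByOn ψ α m χ₀ ∧ IsSmoothChar χ₀ ∧
    D.Presents ψ ε (χ₀ * ω.comp (normUnits F E)) ω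
      (twistJ ω⁻¹ σ) := by
  have hp := h.actsByPure hσ
  have hl' := hl.twist ω⁻¹
  have e : χ₀ * ε * ω.comp (normUnits F E) * ω⁻¹.comp (normUnits F E) = χ₀ * ε :=
    MonoidHom.ext fun x => mul_inv_cancel_right (χ₀ x * ε x) (ω (normUnits F E x))
  rw [e] at hl'
  have hε' {n : ℕ} (hn : 1 ≤ n) {u : Eˣ} (hu : (u : E) - 1 ∈ pPow E n) : (χ₀ * ε) u = χ₀ u := by
    rw [MonoidHom.mul_apply, hε u (pPow_anti (by exact_mod_cast hn) hu), mul_one]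
  have h1 : GivenByOn ψ α m χ₀ := fun u hu => by
    rw [← hε' hm hu]; exact hp.givenByOn hl' u hu
  have h2 : IsSmoothChar χ₀ := isSmoothChar_of_eq_one (n := m + 1) fun u hu =>
    h1.eq_one hψ hα (by exact_mod_cast hu)
  obtain ⟨β, hβ, hβ'⟩ := h1.exists_half hψ hm hα
  refine ⟨h1, h2, β, χ₀, ⟨h2, hω, hβ, hβ', rfl⟩, hl', hp.isGivenBy hψ hα hl' fun u hu => ?_⟩
  rw [hε' (by omega) hu]
  exact hβ' u hu

lemma QuatModel.IsLambda.of_typeRep {hΞ : (D.openPair m hm).IsType Ξ} {c : Fˣ →* Ωˣ}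
    (h : D.IsLambda χ (typeRep π hΞ c)) :
    D.IsLambda (hm := hm) (χ * c⁻¹.comp (normUnits F E))
      (OpenPair.eigenRep π hΞ) :=
  twist_inv_twist ((c.comp D.nrmUnits).comp (D.grpJ m hm).subtype) (OpenPair.eigenRep π hΞ) ▸
    h.twist c⁻¹

/-- A twist of `Ind_J σ` by `ω ∘ nrm` undoes a twist of `σ` by its inverse. -/
lemma nonempty_twist_ind_twistJ_equiv (σ : Representation Ω (D.grpJ m hm) M) (hω : IsSmoothChar ω) :
    Nonempty ((twist (ω.comp D.nrmUnits) (ind (twistJ ω⁻¹ σ))).Equiv (ind σ)) := by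
  have e := nonempty_twist_ind_equiv (twistJ ω⁻¹ σ) (hω.comp D.continuous_nrmUnits)
  rwa [show twist ((ω.comp D.nrmUnits).comp (D.grpJ m hm).subtype) (twistJ ω⁻¹ σ) = σ from
    twist_twist_inv _ σ] at e

/-- If there is a nonzero equivariant map, then `π` and `π'` come from the same `χ ∈ Y_α`. -/
lemma IsSetting.isPi_and_isPiDual_of_ne_zero (S : IsSetting D D' ψ m α π π')
    (hτ : IsTauModel ψ α τ) (hφ : IsK1Equivariant π π' τ φ) (h0 : φ ≠ 0) :
    ∃ χ ∈ charsY ψ m α, D.IsPi ψ 1 χ π ∧ D'.IsPiDual ψ (sgn F E Ω) χ π' := by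
  obtain ⟨ω, Ξ, Ξ', h⟩ := S.exists_isTypePair hτ hφ h0
  have hd := h.finiteDimensional
  have hd' := h.finiteDimensional'
  have : FiniteDimensional Ω (OpenPair.eigen (P := D'.openPair m hm) π' Ξ'⁻¹) := hd'
  obtain ⟨χ₀, hl, hl'⟩ := exists_isLambda h.level h.minimal h.toIsModelPair h.isIrreducible_rep
    h.isIrreducible_rep' h.actsByPure h.actsByPure' (h.of_ne_zero hτ hφ h0).1
  obtain ⟨d, σ, ⟨e⟩⟩ := exists_equiv_fin (V := eigen hm π Ξ) (OpenPair.eigenRep π h.isType)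
  obtain ⟨d', σ', ⟨e'⟩⟩ := exists_equiv_fin (OpenPair.eigenRep π' h.isType').dual
  have hσ : OpenPair.LiesOver (P := D.openPair m hm) σ Ξ :=
    (OpenPair.liesOver_eigenRep h.isType).equiv e
  have hσ' : OpenPair.LiesOver (P := D'.openPair m hm) σ' Ξ' := by
    have h1 := (OpenPair.liesOver_eigenRep (π := π') h.isType').dual.equiv e'
    exact fun x hx => (h1 x hx).trans
      (congrArg (fun c : Ωˣ => (c : Ω) • (1 : Module.End Ω (Fin d' → Ω))) (inv_inv (Ξ' ⟨x, hx⟩)))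
  have hlB' := hl'.of_typeRep.dual.equiv e'
  obtain ⟨h1, h2, hP⟩ := h.pure.presents (ε := 1) (χ₀ := χ₀) hσ h.level h.minimal h.smooth_twist
    (fun _ _ => rfl) ((hl.of_typeRep.equiv e).of_eq <| MonoidHom.ext fun x => by
      simp only [MonoidHom.mul_apply, MonoidHom.inv_apply, MonoidHom.comp_apply, inv_inv,
        MonoidHom.one_apply, mul_one])
  obtain ⟨-, -, hP'⟩ := h.pure'.presents (ε := sgn F E Ω) (χ₀ := χ₀) hσ' h.level h.minimal
    h.smooth_twist (fun u hu => sgn_eq_one (.inr hu)) (hlB'.of_eq <| MonoidHom.ext fun x => by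
      simp only [MonoidHom.mul_apply, MonoidHom.inv_apply, MonoidHom.comp_apply, mul_inv, inv_inv,
        sgn_inv])
  refine ⟨_, ⟨χ₀, ω, h2, h.smooth_twist, h1, rfl⟩, ⟨m, hm, d, ω, _, hP, ?_⟩,
    ⟨m, hm, d', ω, _, hP', ?_⟩⟩
  · -- `π` is induced from its eigenspace
    obtain ⟨e1⟩ := OpenPair.nonempty_equiv_ind h.smooth h.irr h.isType h.ne_bot
    obtain ⟨e2⟩ := nonempty_ind_equiv e
    obtain ⟨e3⟩ := nonempty_twist_ind_twistJ_equiv σ h.smooth_twist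
    exact ⟨(e1.trans e2).trans e3.symm⟩
  · have : Nontrivial (Fin d' → Ω) := hlB'.nontrivial
    obtain ⟨e3⟩ := nonempty_twist_ind_twistJ_equiv σ' h.smooth_twist
    obtain ⟨e6⟩ := nonempty_dual_equiv e'
    obtain ⟨e7⟩ := nonempty_dual_dual_equiv (V := eigen hm π' Ξ'⁻¹)
      (OpenPair.eigenRep π' h.isType')
    obtain ⟨e1⟩ := OpenPair.nonempty_equiv_contragredient_ind (P := D'.openPair m hm) h.smooth'
      h.irr' (h.pure'.isType h.level hm h.minimal h.smooth_twist) hσ' h.ne_bot' (e6.trans e7)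
    obtain ⟨e2⟩ := nonempty_contragredient_equiv e3.symm
    exact ⟨e1.trans e2⟩

/-- The data extracted from an equivalence `π ≅ π_χ`. -/
lemma QuatModel.Presents.exists_isTwistedPure {ω₁ : Fˣ →* Ωˣ} {n : ℕ} {hn : 1 ≤ n} {d : ℕ}
    {Λ : Representation Ω (D.grpJ n hn) (Fin d → Ω)} (hΛ : D.Presents ψ ε χ ω₁ Λ)
    (hψ : IsLevelZero F ψ) (hm : 1 ≤ m) (hα : IsMinimalElt F m α) (h' : GivenByOn ψ α m χ')
    (e : χ = χ' * ω.comp (normUnits F E)) :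
    n = m ∧ ∃ Ξ : D.grpH n →* Ωˣ, D.IsTwistedPure ψ n α ω Ξ ∧ IsSmoothChar ω₁ ∧
      OpenPair.LiesOver (P := D.openPair n hn)
        (twistJ ω₁ Λ) Ξ ∧
      D.IsLambda (χ * ε) (twistJ ω₁ Λ) := by
  obtain ⟨β, χ₀, hp, hl, hg⟩ := hΛ
  have hβ : GivenByOn ψ β n χ₀ := hp.given.anti (by omega)
  have he : χ₀ * ω₁.comp (normUnits F E) = χ' * ω.comp (normUnits F E) := hp.eq.symm.trans e
  have hnm : n = m := le_antisymm
    (le_of_mul_comp_norm_eq hψ hn hα hp.minimal h' hβ he.symm)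
    (le_of_mul_comp_norm_eq hψ hm hp.minimal hα hβ h' he)
  subst hnm
  -- the levels agree, so that `π_χ` is induced from the group `J` of level `m`
  obtain ⟨Θ, hΘ, hs⟩ := hl.actsByPure hg
  refine ⟨rfl, _, hΘ.isTwistedPure hψ hm hα hp.minimal hβ h' he, hp.smooth_twist,
    fun g hg => LinearMap.ext fun v => ?_, (hl.twist ω₁).of_eq ?_⟩
  · refine (congrArg ((ω₁ (D.nrmUnits g) : Ω) • ·) (LinearMap.congr_fun (hs g hg) v)).trans ?_
    change (_ : Ω) • ((_ : Ω) • v) = _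
    rw [smul_smul, mul_comm]
    rfl
  · rw [hp.eq]
    exact MonoidHom.ext fun x => mul_right_comm _ _ _

/-- If `π` and `π'` come from the same `χ ∈ Y_α`, then there is exactly one equivariant map up to scalars. -/
lemma IsSetting.exists_ne_zero_of_isPi (S : IsSetting D D' ψ m α π π') (hτ : IsTauModel ψ α τ)
    (hχ : χ ∈ charsY ψ m α) (h : D.IsPi ψ 1 χ π) (h' : D'.IsPiDual ψ (sgn F E Ω) χ π') :
    ∃ φ : V ⊗[Ω] V' →ₗ[Ω] W, φ ≠ 0 ∧ IsK1Equivariant π π' τ φ ∧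
      ∀ φ₂, IsK1Equivariant π π' τ φ₂ → ∃ c : Ω, φ₂ = c • φ := by
  obtain ⟨χ', ω, -, hω, hg, e⟩ := hχ
  obtain ⟨n, hn, d, ω₁, Λ, hP, ⟨i⟩⟩ := h
  obtain ⟨n', hn', d', ω₂, Λ', hP', ⟨i'⟩⟩ := h'
  obtain ⟨rfl, Ξ, hΞ, hω₁, hs, hl⟩ := hP.exists_isTwistedPure S.level hm S.minimal hg e
  obtain ⟨rfl, Ξ', hΞ', hω₂, hs', hl'⟩ := hP'.exists_isTwistedPure S.level hm S.minimal hg e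
  have hT' := hΞ'.isType S.level hm S.minimal hω
  obtain ⟨k⟩ := nonempty_twist_ind_equiv Λ (hω₁.comp D.continuous_nrmUnits)
  obtain ⟨k'⟩ := nonempty_twist_ind_equiv Λ' (hω₂.comp D'.continuous_nrmUnits)
  obtain ⟨l'⟩ := nonempty_contragredient_equiv k'
  have : Nontrivial (Fin d' → Ω) := hl'.nontrivial
  obtain ⟨h0, ⟨j⟩⟩ := OpenPair.nonempty_equiv_eigenRep (P := D.openPair _ hm) S.smooth S.irr
    (hΞ.isType S.level hm S.minimal hω) hs (i.trans k)
  obtain ⟨h0', ⟨j'⟩⟩ := OpenPair.nonempty_dual_equiv_eigenRep (P := D'.openPair _ hm) S.smooth'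
    S.irr' hT' hs' (i'.trans l')
  have p : IsTypePair ψ hm α π π' ω Ξ Ξ' := ⟨S, hω, hΞ, hΞ', h0, h0'⟩
  have hd := p.finiteDimensional
  have hd' := p.finiteDimensional'
  have hM := isTauModel_tensorK p.minimal p.toIsModelPair p.isIrreducible_rep p.isIrreducible_rep'
    p.actsByPure p.actsByPure' ((hl.equiv j).twist ω⁻¹) ((hl'.dual.equiv j').twist ω)
    (MonoidHom.ext fun x => by
      simp only [MonoidHom.mul_apply, MonoidHom.inv_apply, MonoidHom.comp_apply, mul_inv,
        MonoidHom.one_apply, mul_one, sgn_inv]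
      rw [mul_mul_mul_comm, mul_inv_cancel_left, inv_mul_cancel, mul_one])
  obtain ⟨φ, hφ0, hφ⟩ := p.exists_ne_zero hτ hM
  exact ⟨φ, hφ0, hφ, (p.of_ne_zero hτ hφ hφ0).2⟩

end Equivariant

section Translation

open QuatModel

/-! ### The groups `J` and `𝒦` in coordinates -/

section Groups

variable {R : Type*} [Ring R] [Algebra F R] {D : QuatModel F E R}

lemma QuatModel.range_sup_closure_eq_grpJ (hm : 1 ≤ m) {S : Set R}
    (hS : S = D.lat ((m + 1) / 2 : ℕ) (D.bJ m)) :
    (Units.map (D.j : E →* R)).range ⊔ Subgroup.closure {g : Rˣ | (g : R) - 1 ∈ S} =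
      D.grpJ m hm := by
  subst hS
  have hf := D.depth_facts m
  refine le_antisymm (sup_le ?_ ((Subgroup.closure_le _).2 ?_)) ?_
  · rintro _ ⟨e, rfl⟩
    exact D.jUnits_mem_grpJ hm e
  · intro g hg
    exact ⟨1, g, InCong.anti D ((D.inCong_iff).2 hg) (by omega) le_rfl, by simp⟩
  · rintro _ ⟨e, u, hu, rfl⟩
    obtain ⟨x, -, hx⟩ := D.exists_jUnits_inv_mul le_rfl hu
    rw [show D.jUnits e * u = D.jUnits (e * x) * ((D.jUnits x)⁻¹ * u) by
      rw [map_mul, mul_assoc, mul_inv_cancel_left]]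
    exact Subgroup.mul_mem_sup ⟨_, rfl⟩ (Subgroup.subset_closure ((D.inCong_iff).1 (hx _)))

variable {R' : Type*} [Ring R'] [Algebra F R'] {D' : QuatModel F E R'}

lemma range_sup_closure_eq_grpK (hm : 1 ≤ m) {S : Set R} {S' : Set R'}
    (hS : S = D.lat m (D.bJ m)) (hS' : S' = D'.lat m (D'.bJ m)) :
    ((Units.map (D.j : E →* R)).prod (Units.map (D'.j : E →* R'))).range ⊔
      Subgroup.closure {g : Rˣ × R'ˣ | (g.1 : R) - 1 ∈ S ∧ (g.2 : R') - 1 ∈ S'} =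
        grpK D D' m hm := by
  subst hS hS'
  refine le_antisymm (sup_le ?_ ((Subgroup.closure_le _).2 ?_)) ?_
  · rintro _ ⟨e, rfl⟩
    exact diagUnits_mem_grpK hm e
  · exact fun g hg => mem_grpK_of_mem ⟨(D.inCong_iff).2 hg.1, (D'.inCong_iff).2 hg.2⟩
  · rintro _ ⟨e, l, hl, rfl⟩
    exact Subgroup.mul_mem_sup ⟨e, rfl⟩
      (Subgroup.subset_closure ⟨(D.inCong_iff).1 hl.1, (D'.inCong_iff).1 hl.2⟩)

end Groups

/-! ### The representations `τ_α`, `Λ_χ` and `π_χ` in coordinates -/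

section Representations

variable {R : Type*} [Ring R] [Algebra F R] {D : QuatModel F E R}
variable {hm : 1 ≤ m} {M : Type*} [AddCommGroup M] [Module Ω M] {H : Subgroup Rˣ}

lemma QuatModel.forall_jUnits_iff (hH : H = D.grpJ m hm) (Λ : Representation Ω H M)
    (Q : Eˣ → Module.End Ω M → Prop) :
    (∀ (g : H) (e : Eˣ), ((g : Rˣ) : R) = D.j e → Q e (Λ g)) ↔
      ∀ e, Q e (Λ.comp (Subgroup.inclusion hH.ge) (D.jJ hm e)) := by
  refine ⟨fun h e => h _ e rfl, fun h g e hg => ?_⟩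
  have h1 : g = Subgroup.inclusion hH.ge (D.jJ hm e) :=
    Subtype.ext (Units.ext hg)
  exact h1 ▸ h e

lemma QuatModel.isGivenBy_iff (hH : H = D.grpJ m hm) (Λ : Representation Ω H M) {S : Set R}
    (hS : S = D.lat (m / 2 + 1 : ℕ) (D.bH m)) {T : R → F} (hT : ∀ r, T r = D.tr r) :
    (∀ (g : H) (x : R), x ∈ S → ((g : Rˣ) : R) = 1 + x → Λ g = ψ (T (D.j β * x)) • 1) ↔
      D.IsGivenBy ψ β (Λ.comp (Subgroup.inclusion hH.ge)) := by
  subst hS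
  refine ⟨fun h g hg => ?_, fun h g x hx hgx => ?_⟩
  · have h1 := h (Subgroup.inclusion hH.ge g) _ ((D.inCong_iff).1 hg) (add_sub_cancel _ _).symm
    rw [hT, tr_apply, X_j_mul, map_sub, X_one] at h1
    exact h1
  · have e : x = ((g : Rˣ) : R) - 1 := by rw [hgx, add_sub_cancel_left]
    have h1 := h (Subgroup.inclusion hH.le g) ((D.inCong_iff).2 (e ▸ hx))
    rw [hT, tr_apply, X_j_mul, e, map_sub, X_one]
    exact h1

lemma QuatModel.isLambda_iff {d : ℕ} (hH : H = D.grpJ m hm)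
    (Λ : Representation Ω H (Fin d → Ω)) (χ : Eˣ →* Ωˣ) :
    D.IsLambda χ (Λ.comp (Subgroup.inclusion hH.ge)) ↔
      (D.bH m = D.bJ m → d = 1 ∧
        ∀ (g : H) (e : Eˣ), ((g : Rˣ) : R) = D.j e → Λ g = (χ e : Ω) • 1) ∧
      (D.bH m ≠ D.bJ m → d = Nat.card 𝓀[F] ∧
        (∀ (g : H) (e : Eˣ), ((g : Rˣ) : R) = D.j e →
          ((e : E) ∈ Set.range (algebraMap F E) ∨ (e : E) - 1 ∈ pPow E 1) → Λ g = (χ e : Ω) • 1) ∧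
        ∀ (g : H) (ζ : Eˣ), IsRootOutside F E ζ → ((g : Rˣ) : R) = D.j ζ →
          LinearMap.trace Ω (Fin d → Ω) (Λ g) = -(χ ζ : Ω)) := by
  have hd : Module.finrank Ω (Fin d → Ω) = d := Module.finrank_fin_fun Ω
  have h1 := D.forall_jUnits_iff hH Λ fun e A => A = (χ e : Ω) • 1
  have h2 := D.forall_jUnits_iff hH Λ fun e A =>
    ((e : E) ∈ Set.range (algebraMap F E) ∨ (e : E) - 1 ∈ pPow E 1) → A = (χ e : Ω) • 1
  have h3 := D.forall_jUnits_iff hH Λ fun ζ A =>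
    IsRootOutside F E ζ → LinearMap.trace Ω (Fin d → Ω) A = -(χ ζ : Ω)
  constructor
  · intro h
    refine ⟨fun hb => ⟨?_, h1.2 fun e => h.scalar e (.inl hb)⟩, fun hb => ⟨?_,
      h2.2 fun e he => h.scalar e (.inr he),
      fun g ζ hζ hg => h3.2 (fun ζ => h.trace_eq hb ζ) g ζ hg hζ⟩⟩
    · rw [← hd, h.finrank_eq, if_pos hb]
    · rw [← hd, h.finrank_eq, if_neg hb]
  · rintro ⟨h, h'⟩
    refine ⟨?_, fun e he => ?_, fun hb ζ hζ =>
      h3.1 (fun g ζ hg hζ => (h' hb).2.2 g ζ hζ hg) ζ hζ⟩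
    · rw [hd]
      split_ifs with hb
      exacts [(h hb).1, (h' hb).1]
    · by_cases hb : D.bH m = D.bJ m
      · exact h1.1 (h hb).2 e
      · exact h2.1 (h' hb).2.1 e (he.resolve_left hb)

lemma nonempty_twist_equiv {G V : Type*} [Group G] [AddCommGroup V] [Module Ω V]
    {ρ : Representation Ω G V} {σ : Representation Ω G M} (c : G →* Ωˣ) (e : ρ.Equiv σ) :
    Nonempty ((twist c ρ).Equiv (twist c σ)) :=
  ⟨.mk e.toLinearEquiv fun g => LinearMap.ext fun v =>
    (map_smul e.toLinearEquiv _ _).trans (congrArg ((c g : Ω) • ·) (equiv_map_rep e g v))⟩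

end Representations

/-- The character `χ` of `IsLambdaB` involves the sign `e ↦ (-1) ^ (f v_E(e))`. -/
lemma coe_sgn (e : Eˣ) [Decidable (Unramified F E)] : (sgn F E Ω e : Ω) =
    (-1) ^ ((if Unramified F E then 2 else 1) * ord (e : E)) := by
  split_ifs with h
  · rw [sgn_of_unramified h, zpow_mul]
    simp
  · rw [sgn_of_ramified h, one_mul]

section ModelA

variable {D : QuatModel F E (Matrix (Fin 2) (Fin 2) F)} {hm : 1 ≤ m} {d : ℕ}

lemma groupJA_eq (hκ : D.κ = 0) (hrad : ∀ n : ℕ, radA D.j n = D.lat n n) (hm : 1 ≤ m) :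
    groupJA D.j m = D.grpJ m hm := by
  refine D.range_sup_closure_eq_grpJ hm ((hrad _).trans ?_)
  congr 1
  rw [QuatModel.bJ, hκ]
  omega

lemma isLambdaA_iff (hκ : D.κ = 0) (hrad : ∀ n : ℕ, radA D.j n = D.lat n n)
    (htr : ∀ a, Matrix.trace a = D.tr a) (hJ : groupJA D.j m = D.grpJ m hm)
    (Λ : Representation Ω (groupJA D.j m) (Fin d → Ω)) :
    IsLambdaA D.j ψ m β χ Λ ↔ D.IsLambda χ (Λ.comp (Subgroup.inclusion hJ.ge)) ∧
      D.IsGivenBy ψ β (Λ.comp (Subgroup.inclusion hJ.ge)) := by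
  have hb : D.bH m = D.bJ m ↔ Odd m := by
    rw [Nat.odd_iff, QuatModel.bH, QuatModel.bJ, hκ]
    omega
  have hS : radA D.j (m / 2 + 1) = D.lat (m / 2 + 1 : ℕ) (D.bH m) := by
    rw [hrad, QuatModel.bH, hκ]
    congr 1
    omega
  have hg := D.isGivenBy_iff (ψ := ψ) (β := β) hJ Λ hS htr
  rw [D.isLambda_iff hJ Λ]
  exact ⟨fun h => ⟨⟨fun h1 => h.odd (hb.1 h1),
      fun h1 => h.even (Nat.not_odd_iff_even.1 (mt hb.2 h1))⟩, hg.1 h.one_add⟩,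
    fun ⟨⟨h1, h2⟩, h3⟩ => ⟨hg.2 h3, fun ho => h1 (hb.2 ho),
      fun he => h2 fun h4 => Nat.not_even_iff_odd.2 (hb.1 h4) he⟩⟩

lemma isPi_iff (hκ : D.κ = 0) (hrad : ∀ n : ℕ, radA D.j n = D.lat n n)
    (htr : ∀ a, Matrix.trace a = D.tr a) (hdet : Matrix.GeneralLinearGroup.det = D.nrmUnits)
    {V : Type*} [AddCommGroup V] [Module Ω V] (π : Representation Ω (GL (Fin 2) F) V) :
    IsPi D.j ψ χ π ↔ D.IsPi ψ 1 χ π := by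
  constructor
  · rintro ⟨m, β, χ₀, ω, d, Λ, hm, hp, hΛ, ⟨e⟩⟩
    have hJ := groupJA_eq hκ hrad hm
    obtain ⟨h1, h2⟩ := (isLambdaA_iff hκ hrad htr hJ Λ).1 hΛ
    obtain ⟨i⟩ := nonempty_ind_inclusion hJ Λ
    obtain ⟨k⟩ := nonempty_twist_equiv (ω.comp D.nrmUnits) i
    rw [hdet] at e
    exact ⟨m, hm, d, ω, _, ⟨β, χ₀, hp, (mul_one χ₀).symm ▸ h1, h2⟩, ⟨e.trans k⟩⟩
  · rintro ⟨m, hm, d, ω, Λ, ⟨β, χ₀, hp, h1, h2⟩, ⟨e⟩⟩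
    have hJ := groupJA_eq hκ hrad hm
    obtain ⟨i⟩ := nonempty_ind_inclusion hJ (Λ.comp (Subgroup.inclusion hJ.le))
    obtain ⟨k⟩ := nonempty_twist_equiv (ω.comp D.nrmUnits) i
    refine ⟨m, β, χ₀, ω, d, Λ.comp (Subgroup.inclusion hJ.le), hm, hp,
      (isLambdaA_iff hκ hrad htr hJ _).2 ⟨mul_one χ₀ ▸ h1, h2⟩, ?_⟩
    rw [hdet]
    exact ⟨e.trans k.symm⟩

end ModelA

section ModelB

variable {B : Type*} [DivisionRing B] [Algebra F B] [IsQuaternionDivision F B]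
variable {D : QuatModel F E B} {hm : 1 ≤ m} {d : ℕ}

open Classical in
lemma groupJB_eq (hκ : D.κ = if Unramified F E then 1 else 0)
    (hrad : ∀ n : ℕ, radB F B n = D.lat ((n + D.κ) / (1 + D.κ)) (n / (1 + D.κ))) (hm : 1 ≤ m) :
    groupJB D.j m = D.grpJ m hm := by
  refine D.range_sup_closure_eq_grpJ hm ((hrad _).trans ?_)
  rw [QuatModel.bJ, hκ]
  split_ifs <;> congr 1 <;> push_cast <;> omega

open Classical in
lemma isLambdaB_iff (hκ : D.κ = if Unramified F E then 1 else 0)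
    (hrad : ∀ n : ℕ, radB F B n = D.lat ((n + D.κ) / (1 + D.κ)) (n / (1 + D.κ)))
    (htr : ∀ b, redTrace F b = D.tr b) (hJ : groupJB D.j m = D.grpJ m hm)
    (hβ : IsMinimalElt F m β) (Λ : Representation Ω (groupJB D.j m) (Fin d → Ω)) :
    IsLambdaB D.j ψ m β χ Λ ↔
      D.IsLambda (χ * sgn F E Ω) (Λ.comp (Subgroup.inclusion hJ.ge)) ∧
      D.IsGivenBy ψ β (Λ.comp (Subgroup.inclusion hJ.ge)) := by
  have hb : D.bH m = D.bJ m ↔ ¬ Unramified F E ∨ Even m := by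
    by_cases hu : Unramified F E
    · rw [QuatModel.bH, QuatModel.bJ, hκ, if_pos hu, Nat.even_iff]
      simp only [hu, not_true_eq_false, false_or]
      omega
    · exact iff_of_true (depth_of_ramified hβ hu (by rw [hκ, if_neg hu])) (.inl hu)
  have hS : radB F B (if Unramified F E then m + 1 else (m + 1) / 2) =
      D.lat (m / 2 + 1 : ℕ) (D.bH m) := by
    rw [hrad, QuatModel.bH, hκ]
    split_ifs with hu
    · congr 1 <;> push_cast <;> omega
    · obtain ⟨k, hk⟩ := hβ.odd_of_ramified hu
      congr 1 <;> push_cast <;> omega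
  have hg := D.isGivenBy_iff (ψ := ψ) (β := β) hJ Λ hS htr
  have hsgn (e : Eˣ) : (-1 : Ω) ^ ((if Unramified F E then 2 else 1) * ord (e : E)) * (χ e : Ω) =
      (χ * sgn F E Ω) e := by
    rw [MonoidHom.mul_apply, Units.val_mul, coe_sgn, mul_comm]
  have hsgn' (hu : Unramified F E) (e : Eˣ) : (χ * sgn F E Ω) e = χ e := by
    rw [MonoidHom.mul_apply, sgn_of_unramified hu, mul_one]
  have hne (h1 : ¬ D.bH m = D.bJ m) : Unramified F E ∧ Odd m := by
    rw [hb, not_or, not_not, Nat.not_even_iff_odd] at h1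
    exact h1
  rw [D.isLambda_iff hJ Λ]
  refine ⟨fun h => ⟨⟨fun h1 => ?_, fun h1 => ?_⟩, hg.1 h.one_add⟩,
    fun ⟨⟨h1, h2⟩, h3⟩ => ⟨hg.2 h3, fun ho => ?_, fun hu ho => ?_⟩⟩
  · simpa only [hsgn] using h.character (hb.1 h1)
  · simpa only [hsgn' (hne h1).1] using h.odd (hne h1).1 (hne h1).2
  · simpa only [hsgn] using h1 (hb.2 ho)
  · simpa only [hsgn' hu] using h2 fun h4 =>
      (hb.1 h4).elim (fun h5 => h5 hu) (Nat.not_even_iff_odd.2 ho)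

open Classical in
lemma isPiPrimeDual_iff [TopologicalSpace B] [IsTopologicalRing B]
    (hκ : D.κ = if Unramified F E then 1 else 0)
    (hrad : ∀ n : ℕ, radB F B n = D.lat ((n + D.κ) / (1 + D.κ)) (n / (1 + D.κ)))
    (htr : ∀ b, redTrace F b = D.tr b) (hnrd : Units.map (redNorm F B) = D.nrmUnits)
    {V : Type*} [AddCommGroup V] [Module Ω V] (π : Representation Ω Bˣ V) :
    IsPiPrimeDual D.j ψ χ π ↔ D.IsPiDual ψ (sgn F E Ω) χ π := by
  constructor
  · rintro ⟨m, β, χ₀, ω, d, Λ, hm, hp, hΛ, ⟨e⟩⟩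
    have hJ := groupJB_eq hκ hrad hm
    obtain ⟨h1, h2⟩ := (isLambdaB_iff hκ hrad htr hJ hp.minimal Λ).1 hΛ
    obtain ⟨i⟩ := nonempty_ind_inclusion hJ Λ
    obtain ⟨k⟩ := nonempty_twist_equiv (ω.comp D.nrmUnits) i
    obtain ⟨l⟩ := nonempty_contragredient_equiv k
    rw [hnrd] at e
    exact ⟨m, hm, d, ω, _, ⟨β, χ₀, hp, h1, h2⟩, ⟨e.trans l⟩⟩
  · rintro ⟨m, hm, d, ω, Λ, ⟨β, χ₀, hp, h1, h2⟩, ⟨e⟩⟩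
    have hJ := groupJB_eq hκ hrad hm
    obtain ⟨i⟩ := nonempty_ind_inclusion hJ (Λ.comp (Subgroup.inclusion hJ.le))
    obtain ⟨k⟩ := nonempty_twist_equiv (ω.comp D.nrmUnits) i
    obtain ⟨l⟩ := nonempty_contragredient_equiv k
    refine ⟨m, β, χ₀, ω, d, Λ.comp (Subgroup.inclusion hJ.le), hm, hp,
      (isLambdaB_iff hκ hrad htr hJ hp.minimal _).2 ⟨h1, h2⟩, ?_⟩
    rw [hnrd]
    exact ⟨e.trans l.symm⟩

end ModelB

section ModelK

variable {B : Type*} [DivisionRing B] [Algebra F B] [IsQuaternionDivision F B]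
variable {D : QuatModel F E (Matrix (Fin 2) (Fin 2) F)} {D' : QuatModel F E B}

open Classical in
lemma groupK_eq (hκ : D.κ = 0) (hsA : ∀ a, sA D.j a = D.X a)
    (hrad : ∀ n : ℕ, radA D.j n = D.lat n n)
    (hκ' : D'.κ = if Unramified F E then 1 else 0) (hsB : ∀ b, sB D'.j b = D'.X b)
    (hrad' : ∀ n : ℕ, radB F B n = D'.lat ((n + D'.κ) / (1 + D'.κ)) (n / (1 + D'.κ)))
    (hm : 1 ≤ m) : groupK D.j D'.j m = grpK D D' m hm := by
  refine range_sup_closure_eq_grpK hm (Set.ext fun a => ?_) (Set.ext fun b => ?_)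
  · change sA D.j a ∈ _ ∧ a ∈ radA D.j _ ↔ _
    rw [hsA, hrad, QuatModel.bJ, hκ]
    refine ⟨fun h => ⟨h.1, ?_⟩, fun h => ⟨h.1, pPow_anti (by omega) h.1, ?_⟩⟩
    · exact mem_pPow_of_eq h.2.2 (by omega)
    · exact mem_pPow_of_eq h.2 (by omega)
  · change sB D'.j b ∈ _ ∧ b ∈ radB F B _ ↔ _
    rw [hsB, hrad', QuatModel.bJ, hκ']
    refine ⟨fun h => ⟨h.1, mem_pPow_of_eq h.2.2 ?_⟩,
      fun h => ⟨h.1, pPow_anti ?_ h.1, mem_pPow_of_eq h.2 ?_⟩⟩ <;>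
    split_ifs <;> push_cast <;> omega

open Classical in
lemma IsTau.isTauModel (hκ : D.κ = 0) (hsA : ∀ a, sA D.j a = D.X a)
    (hrad : ∀ n : ℕ, radA D.j n = D.lat n n)
    (hκ' : D'.κ = if Unramified F E then 1 else 0) (hsB : ∀ b, sB D'.j b = D'.X b)
    (hrad' : ∀ n : ℕ, radB F B n = D'.lat ((n + D'.κ) / (1 + D'.κ)) (n / (1 + D'.κ)))
    {hm : 1 ≤ m} (hK : groupK D.j D'.j m = grpK D D' m hm) {W : Type*} [AddCommGroup W] [Module Ω W]
    {τ : Representation Ω (groupK D.j D'.j m) W} (h : IsTau D.j D'.j ψ m α τ) :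
    IsTauModel ψ α (τ.comp (Subgroup.inclusion hK.ge)) := by
  have e (x : Eˣ) : ((Subgroup.inclusion hK.ge (diagK D D' m hm x) : groupK D.j D'.j m) :
    GL (Fin 2) F × Bˣ) = diag D.j D'.j x := rfl
  refine ⟨isIrreducible_of_smul h.irreducible (LinearEquiv.refl Ω W) fun g =>
    ⟨Subgroup.inclusion hK.le g, 1, fun v => (one_smul _ _).symm⟩, fun x hx => ?_, fun k hk => ?_,
    fun hr x => h.ramified hr _ x (e x), fun hu ζ hζ => h.unramified hu _ ζ hζ (e ζ)⟩
  · rcases hx with ⟨a, ha⟩ | hx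
    · have ha0 : a ≠ 0 := by
        rintro rfl
        exact x.ne_zero (by rw [← ha, map_zero])
      refine h.scalar _ (Units.mk0 a ha0) ((e x).trans (congrArg _ (Units.ext ?_)))
      exact ha.symm
    · exact h.oneUnit _ x hx (e x)
  · have h1 := (D.inCong_iff).1 hk.1
    have h2 := (D'.inCong_iff).1 hk.2
    have h3 := h.one_add (Subgroup.inclusion hK.ge k) (a := (k.1.1 : Matrix _ _ F) - 1)
      (b := (k.1.2 : B) - 1) ?_ ?_ (add_sub_cancel _ _).symm (add_sub_cancel _ _).symm
    · rw [hsA, hsB, map_sub, map_sub, X_one, X_one] at h3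
      exact h3
    · refine ⟨by rw [hsA]; exact h1.1, ?_⟩
      rw [hrad]
      have hb := h1.2
      rw [QuatModel.bH, hκ] at hb
      exact ⟨pPow_anti (by omega) h1.1, mem_pPow_of_eq hb (by omega)⟩
    · refine ⟨by rw [hsB]; exact h2.1, ?_⟩
      have hb := h2.2
      rw [QuatModel.bH, hκ'] at hb
      rw [hrad', hκ']
      refine ⟨pPow_anti ?_ h2.1, mem_pPow_of_eq hb ?_⟩ <;> split_ifs <;> push_cast <;> omega

lemma isK1Equivariant_iff (hdet : Matrix.GeneralLinearGroup.det = D.nrmUnits)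
    (hnrd : Units.map (redNorm F B) = D'.nrmUnits) {hm : 1 ≤ m}
    (hK : groupK D.j D'.j m = grpK D D' m hm)
    {V V' W : Type*} [AddCommGroup V] [Module Ω V] [AddCommGroup V'] [Module Ω V']
    [AddCommGroup W] [Module Ω W] {τ : Representation Ω (groupK D.j D'.j m) W}
    {π : Representation Ω (GL (Fin 2) F) V} {π' : Representation Ω Bˣ V'}
    {φ : V ⊗[Ω] V' →ₗ[Ω] W} :
    IsK1Equivariant π π' (τ.comp (Subgroup.inclusion hK.ge)) φ ↔
      ∀ (h : groupK1 D.j D'.j m) x, φ (extTensor π π' h x) = restrictK1 τ h (φ x) := by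
  have hker (g : GL (Fin 2) F × Bˣ) : g ∈ (delta F B).ker ↔ D.nrmUnits g.1 = D'.nrmUnits g.2 := by
    rw [← hdet, ← hnrd]
    exact inv_mul_eq_one
  constructor
  · rintro h ⟨g, hg⟩ x
    have h1 : φ ∘ₗ extTensor π π' g = restrictK1 τ ⟨g, hg⟩ ∘ₗ φ :=
      TensorProduct.ext' fun v v' => h ⟨g, hK.le hg.1⟩ ((hker g).1 hg.2) v v'
    exact LinearMap.congr_fun h1 x
  · intro h k hk v v'
    exact h ⟨k.1, hK.ge k.2, (hker k.1).2 hk⟩ (v ⊗ₜ v')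

end ModelK

end Translation

end

end TameTypes

theorem mainTheorem8
    {F : Type*} [Field F] [ValuativeRel F] [TopologicalSpace F] [IsNonarchimedeanLocalField F]
    [Fact (ringChar 𝓀[F] ≠ 2)]
    {E : Type*} [Field E] [ValuativeRel E] [TopologicalSpace E] [IsNonarchimedeanLocalField E]
    [Algebra F E] [ValuativeExtension F E] [Algebra.IsQuadraticExtension F E]
    {B : Type*} [DivisionRing B] [Algebra F B] [IsQuaternionDivision F B]
    [TopologicalSpace B] [IsTopologicalRing B] [IsModuleTopology F B]
    {Ω : Type*} [Field Ω] [IsAlgClosed Ω] [CharZero Ω]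
    (ψ : AddChar F Ω) (hψ : IsLevelZero F ψ)
    (jA : E →ₐ[F] Matrix (Fin 2) (Fin 2) F) (jB : E →ₐ[F] B)
    (m : ℕ) (hm : 1 ≤ m) (α : E) (hα : IsMinimalElt F m α)
    {W : Type*} [AddCommGroup W] [Module Ω W]
    (τ : Representation Ω (groupK jA jB m) W) (hτ : IsTau jA jB ψ m α τ)
    {V : Type*} [AddCommGroup V] [Module Ω V] (π : Representation Ω (GL (Fin 2) F) V)
    (hπ : IsSmooth π) (hπ_irr : π.IsIrreducible)
    {V' : Type*} [AddCommGroup V'] [Module Ω V'] (π' : Representation Ω Bˣ V')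
    (hπ' : IsSmooth π') (hπ'_irr : π'.IsIrreducible) :
    ((∃ χ ∈ charsY ψ m α, IsPi jA ψ χ π ∧ IsPiPrimeDual jB ψ χ π') →
      Module.rank Ω
        (Representation.IntertwiningMap (extTensor π π') (ind (restrictK1 τ))) = 1) ∧
    ((¬ ∃ χ ∈ charsY ψ m α, IsPi jA ψ χ π ∧ IsPiPrimeDual jB ψ χ π') →
      Module.rank Ω
        (Representation.IntertwiningMap (extTensor π π') (ind (restrictK1 τ))) = 0) := by
  obtain ⟨D, rfl, hκ, hsA, hrad, htr, hdet⟩ := exists_modelA (E := E) jA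
  obtain ⟨D', rfl, hκ', hsB, hrad', htr', hnrd⟩ := exists_modelB (E := E) jB
  have : IsModuleTopology F (Matrix (Fin 2) (Fin 2) F) :=
    inferInstanceAs (IsModuleTopology F (Fin 2 → Fin 2 → F))
  have hdet' : Matrix.GeneralLinearGroup.det = D.nrmUnits :=
    MonoidHom.ext fun g => Units.ext (hdet g)
  have hnrd' : Units.map (redNorm F B) = D'.nrmUnits :=
    MonoidHom.ext fun g => Units.ext (hnrd g)
  have hram (h : ¬ Unramified F E) : D'.κ = 0 := by rw [hκ', if_neg h]
  have hunr (h : Unramified F E) : D'.κ = 1 := by rw [hκ', if_pos h]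
  have hK := groupK_eq hκ hsA hrad hκ' hsB hrad' hm
  have hT := hτ.isTauModel hκ hsA hrad hκ' hsB hrad' hK
  have hiff (χ : Eˣ →* Ωˣ) : (IsPi D.j ψ χ π ∧ IsPiPrimeDual D'.j ψ χ π') ↔
      (D.IsPi ψ 1 χ π ∧ D'.IsPiDual ψ (QuatModel.sgn F E Ω) χ π') :=
    and_congr (isPi_iff hκ hrad htr hdet' π) (isPiPrimeDual_iff hκ' hrad' htr' hnrd' π')
  have S : IsSetting D D' ψ m α π π' := ⟨⟨hκ, hram, hunr⟩, hψ, hα, hπ, hπ', hπ_irr, hπ'_irr⟩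
  refine ⟨?_, fun h => rank_eq_zero_of_frobenius fun φ hφ => ?_⟩
  · rintro ⟨χ, hχ, h⟩
    obtain ⟨h1, h2⟩ := (hiff χ).1 h
    obtain ⟨φ, h0, hφ, huniq⟩ := S.exists_ne_zero_of_isPi hT hχ h1 h2
    exact rank_eq_one_of_frobenius (isSmooth_extTensor hπ hπ') h0
      ((isK1Equivariant_iff hdet' hnrd' hK).1 hφ)
      fun φ₂ hφ₂ => huniq φ₂ ((isK1Equivariant_iff hdet' hnrd' hK).2 hφ₂)
  · by_contra h0
    obtain ⟨χ, hχ, h1, h2⟩ := S.isPi_and_isPiDual_of_ne_zero hT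
      ((isK1Equivariant_iff hdet' hnrd' hK).2 hφ) h0
    exact h ⟨χ, hχ, (hiff χ).2 ⟨h1, h2⟩⟩
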